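/- Theorem. A plumbing tree is a finite connected tree whose vertices carry integer decorations; plumbing trees are considered up to decoration-preserving isomorphism. A plumbing tree $\Gamma$ with $n$ vertices is *symplectic* if there is an embedding $\varphi$ of its vertices into $\mathbb{Z}^n$ with basis $E_1,\dots,E_n$ and the form $Q_n$ with $Q_n(E_i,E_j)=-\delta_{ij}$, such that, for vertices $v\ne v'$, $Q_n(\varphi(v),\varphi(v'))$ is $1$ if $v,v'$ are adjacent and $0$ otherwise, $Q_n(\varphi(v),\varphi(v))$ is the decoration of $v$ for every vertex $v$, and, with $K=E_1+\dots+E_n$, the adjunction equality $Q_n(\varphi(v),K)+Q_n(\varphi(v),\varphi(v))=-2$ holds for every vertex $v$. It is *minimal* if no vertex has decoration $-1$. Let $\mathcal{S}$ be the set of minimal symplectic plumbing trees. Then $$\mathcal{S}=\mathcal{G}\cup\mathcal{W}\cup\mathcal{N}\cup\mathcal{M}\cup\mathcal{A}\cup\mathcal{B}\cup\mathcal{C},$$ where the seven families are as follows. Write $\langle c; L_1, L_2, L_3\rangle$ for the star-shaped tree whose central vertex has decoration $-c$ and which has three legs, the decorations along the $i$-th leg, read from the centre outwards, being the negatives of the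 entries of the list $L_i$; in a list, $2^{k}$ stands for $k$ consecutive entries $2$. - $\mathcal{G}$ consists of the linear trees $\Gamma_{p/q}$ with decorations $-a_1,\dots,-a_k$ in this order, where $p>q>0$ are coprime integers and $p^2/(pq-1)=a_1-\cfrac{1}{a_2-\cfrac{1}{\ddots-\cfrac{1}{a_k}}}$ with all $a_i\ge 2$. - $\mathcal{W}$ consists of the trees $\Gamma_{p,q,r}=\langle 4;\ (2^{q},p+3),\ (2^{r},q+3),\ (2^{p},r+3)\rangle$ with $p,q,r\ge 0$. - $\mathcal{N}$ consists of the trees $\Delta_{p,q,r}$ with $p,q,r\ge 0$, where $\Delta_{p,q,r}=\langle 3;\ (2^{q},3,2^{p-1},r+3),\ (2^{r},q+4),\ (p+2)\rangle$ for $p\ge 1$ and $\Delta_{0,q,r}=\langle 3;\ (2^{q},r+4),\ (2^{r},q+4),\ (2)\rangle$. - $\mathcal{M}$ consists of the trees $\Lambda_{p,q,r}$ with $p,q,r\ge 0$ and $(p,r)\ne(0,0)$, where $\Lambda_{p,q,r}=\langle 2;\ (2^{q},3,2^{r-1},3,2^{p-1},q+4),\ (p+2),\ (r+3)\rangle$ for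 $p,r\ge 1$, $\Lambda_{0,q,r}=\langle 2;\ (2^{q},3,2^{r-1},q+5),\ (2),\ (r+3)\rangle$ for $r\ge 1$, and $\Lambda_{p,q,0}=\langle 2;\ (2^{q},4,2^{p-1},q+4),\ (p+2),\ (3)\rangle$ for $p\ge 1$. - $\mathcal{A}$, $\mathcal{B}$, $\mathcal{C}$ consist of the trees obtained from $\langle 1;(3),(3),(3)\rangle$, $\langle 1;(4),(4),(2)\rangle$, $\langle 1;(2),(6),(3)\rangle$ respectively by finitely many (possibly zero) blow-ups, each of the unique $(-1)$-vertex of the current tree or of an edge emanating from that vertex, and by finally replacing the single decoration $-1$ by $-4$, $-3$, $-2$ respectively. Here blowing up a vertex $v$ adds a new vertex with decoration $-1$ joined to $v$ only and lowers the decoration of $v$ by $1$; blowing up an edge $vw$ subdivides it by a new vertex with decoration $-1$ and lowers the decorations of $v$ and $w$ by $1$. -/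

import Mathlib

universe u w

/-- A plumbing graph: a finite simple graph each of whose vertices carries an integer decoration. -/
structure PlumbingGraph where
  V : Type u
  [fintypeV : Fintype V]
  graph : SimpleGraph V
  dec : V → ℤ

namespace PlumbingGraph

attribute [instance] PlumbingGraph.fintypeV

/-- Two plumbing graphs are isomorphic when some graph isomorphism preserves the decorations. -/
def Isomorphic (Γ : PlumbingGraph.{u}) (Γ' : PlumbingGraph.{w}) : Prop :=
  ∃ e : Γ.graph ≃g Γ'.graph, ∀ v, Γ'.dec (e v) = Γ.dec v

/-! ### Symplectic plumbing trees -/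

/-- The diagonal form `n⟨-1⟩` on `ℤⁿ`: the standard basis satisfies `Q (E i) (E j) = -δ i j`. -/
def Q {n : ℕ} (x y : Fin n → ℤ) : ℤ := -∑ i, x i * y i

/-- The vector `K = E₁ + ⋯ + Eₙ`. -/
def K (n : ℕ) : Fin n → ℤ := fun _ => 1

/-- The graph embeds into `n⟨-1⟩`, with `n` its number of vertices, so that the form realizes the
edges and the decorations, and the adjunction equality holds at every vertex. -/
def IsSymplectic (Γ : PlumbingGraph.{u}) : Prop :=
  ∃ φ : Γ.V ↪ (Fin (Fintype.card Γ.V) → ℤ),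
    (∀ v₁ v₂, Γ.graph.Adj v₁ v₂ → Q (φ v₁) (φ v₂) = 1) ∧
    (∀ v₁ v₂, v₁ ≠ v₂ → ¬ Γ.graph.Adj v₁ v₂ → Q (φ v₁) (φ v₂) = 0) ∧
    (∀ v, Q (φ v) (φ v) = Γ.dec v) ∧
    (∀ v, Q (φ v) (K _) + Q (φ v) (φ v) = -2)

/-- No vertex has decoration `-1`. -/
def IsMinimal (Γ : PlumbingGraph.{u}) : Prop := ∀ v, Γ.dec v ≠ -1

/-- `𝒮`: the minimal, connected symplectic plumbing trees. (`SimpleGraph.IsTree` means connected,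
hence nonempty, and acyclic.) -/
def familyS : Set PlumbingGraph.{u} :=
  {Γ | Γ.graph.IsTree ∧ Γ.IsSymplectic ∧ Γ.IsMinimal}

/-! ### Linear and star-shaped graphs -/

/-- The linear graph with decorations `-a₁, …, -aₖ`, where `l = [a₁, …, aₖ]`. -/
def chain (l : List ℤ) : PlumbingGraph.{0} where
  V := Fin l.length
  graph := SimpleGraph.pathGraph l.length
  dec i := -l.get i

/-- Adjacency in a star with centre `none`, in which `some ⟨i, j⟩` is the `j`-th vertex of the
`i`-th leg, counted from the centre outwards, starting with `j = 0`. -/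
def starAdj (legs : Fin 3 → List ℤ) :
    Option (Σ i : Fin 3, Fin (legs i).length) → Option (Σ i : Fin 3, Fin (legs i).length) → Prop
  | none, none => False
  | none, some x => x.2.val = 0
  | some x, none => x.2.val = 0
  | some x, some y => x.1 = y.1 ∧ (x.2.val + 1 = y.2.val ∨ y.2.val + 1 = x.2.val)

/-- The star-shaped graph with three legs, whose centre has decoration `-c` and whose `i`-th leg
has decorations `-a` for `a` in the list `legs i`, read from the centre outwards. -/
def starGraph (c : ℤ) (legs : Fin 3 → List ℤ) : PlumbingGraph.{0} where
  V := Option (Σ i : Fin 3, Fin (legs i).length)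
  graph :=
    { Adj := starAdj legs
      symm := ⟨by
        rintro (_ | x) (_ | y) h
        · exact h
        · exact h
        · exact h
        · exact ⟨h.1.symm, h.2.symm⟩⟩
      loopless := ⟨by
        rintro (_ | x) h
        · exact h
        · rcases h.2 with h | h <;> omega⟩ }
  dec
    | none => -c
    | some x => -(legs x.1).get x.2

/-- `k` consecutive entries `2`. -/
def twos (k : ℕ) : List ℤ := List.replicate k 2

/-! ### The family `𝒢` -/

/-- The value of the continued fraction `a₁ - 1/(a₂ - 1/(⋯ - 1/aₖ))` (`0` for the empty list). -/
def contFrac : List ℤ → ℚ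
  | [] => 0
  | [a] => a
  | a :: b :: l => a - 1 / contFrac (b :: l)

/-- `𝒢`: the graphs `Γ_{p/q}`, i.e. the linear graphs given by the expansions of `p²/(pq-1)` with
all entries at least `2`, for coprime `p > q > 0`. -/
def familyG : Set PlumbingGraph.{u} :=
  {Γ | ∃ p q : ℕ, 0 < q ∧ q < p ∧ Nat.Coprime p q ∧
    ∃ l : List ℤ, (∀ a ∈ l, 2 ≤ a) ∧
      contFrac l = (p : ℚ) ^ 2 / ((p : ℚ) * q - 1) ∧ Γ.Isomorphic (chain l)}

/-! ### The families `𝒲`, `𝒩`, `ℳ` -/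

/-- `Γ_{p,q,r}`. -/
def Gam (p q r : ℕ) : PlumbingGraph.{0} :=
  starGraph 4 ![twos q ++ [(p : ℤ) + 3], twos r ++ [(q : ℤ) + 3], twos p ++ [(r : ℤ) + 3]]

/-- `𝒲`. -/
def familyW : Set PlumbingGraph.{u} := {Γ | ∃ p q r : ℕ, Γ.Isomorphic (Gam p q r)}

/-- `Δ_{p,q,r}`; the second equation is `Δ_{p'+1,q,r}`. -/
def Del : ℕ → ℕ → ℕ → PlumbingGraph.{0}
  | 0, q, r => starGraph 3 ![twos q ++ [(r : ℤ) + 4], twos r ++ [(q : ℤ) + 4], [2]]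
  | p' + 1, q, r =>
    starGraph 3 ![twos q ++ [3] ++ twos p' ++ [(r : ℤ) + 3], twos r ++ [(q : ℤ) + 4],
      [((p' + 1 : ℕ) : ℤ) + 2]]

/-- `𝒩`. -/
def familyN : Set PlumbingGraph.{u} := {Γ | ∃ p q r : ℕ, Γ.Isomorphic (Del p q r)}

/-- `Λ_{p,q,r}`, with arguments in the order `p q r`. -/
def Lam : ℕ → ℕ → ℕ → PlumbingGraph.{0}
  | 0, q, 0 => starGraph 2 ![twos q ++ [(q : ℤ) + 6], [2], [3]]
  | 0, q, r' + 1 =>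
    starGraph 2 ![twos q ++ [3] ++ twos r' ++ [(q : ℤ) + 5], [2], [((r' + 1 : ℕ) : ℤ) + 3]]
  | p' + 1, q, 0 =>
    starGraph 2 ![twos q ++ [4] ++ twos p' ++ [(q : ℤ) + 4], [((p' + 1 : ℕ) : ℤ) + 2], [3]]
  | p' + 1, q, r' + 1 =>
    starGraph 2 ![twos q ++ [3] ++ twos r' ++ [3] ++ twos p' ++ [(q : ℤ) + 4],
      [((p' + 1 : ℕ) : ℤ) + 2], [((r' + 1 : ℕ) : ℤ) + 3]]

/-- `ℳ`. -/
def familyM : Set PlumbingGraph.{u} :=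
  {Γ | ∃ p q r : ℕ, (p, r) ≠ (0, 0) ∧ Γ.Isomorphic (Lam p q r)}

/-! ### Blow-ups and the families `𝒜`, `ℬ`, `𝒞` -/

open Classical in
/-- Replace the decoration of `v` by `d`. -/
noncomputable def setDec (Γ : PlumbingGraph.{u}) (v : Γ.V) (d : ℤ) : PlumbingGraph.{u} where
  V := Γ.V
  graph := Γ.graph
  dec := Function.update Γ.dec v d

/-- The edges after the blow-up of `v`: the new vertex `none` is joined to `v`. -/
def blowUpVertexAdj (Γ : PlumbingGraph.{u}) (v : Γ.V) : Option Γ.V → Option Γ.V → Prop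
  | none, none => False
  | none, some b => b = v
  | some a, none => a = v
  | some a, some b => Γ.graph.Adj a b

open Classical in
/-- The blow-up of the vertex `v`: a new vertex `none` with decoration `-1` is joined to `v`, and
the decoration of `v` drops by `1`. -/
noncomputable def blowUpVertex (Γ : PlumbingGraph.{u}) (v : Γ.V) : PlumbingGraph.{u} where
  V := Option Γ.V
  graph :=
    { Adj := Γ.blowUpVertexAdj v
      symm := ⟨by
        rintro (_ | a) (_ | b) h
        · exact h
        · exact h
        · exact h
        · exact SimpleGraph.Adj.symm h⟩
      loopless := ⟨by
        rintro (_ | a) h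
        · exact h
        · exact Γ.graph.loopless.irrefl a h⟩ }
  dec
    | none => -1
    | some a => if a = v then Γ.dec a - 1 else Γ.dec a

/-- The edges after the blow-up of the edge `vw`: the edge `vw` is removed, and the new vertex
`none` is joined to `v` and to `w`. -/
def blowUpEdgeAdj (Γ : PlumbingGraph.{u}) (v w : Γ.V) : Option Γ.V → Option Γ.V → Prop
  | none, none => False
  | none, some b => b = v ∨ b = w
  | some a, none => a = v ∨ a = w
  | some a, some b => Γ.graph.Adj a b ∧ s(a, b) ≠ s(v, w)

open Classical in
/-- The blow-up of the edge `vw`: the edge is subdivided by a new vertex `none` with decoration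
`-1`, and the decorations of `v` and `w` drop by `1`. -/
noncomputable def blowUpEdge (Γ : PlumbingGraph.{u}) (v w : Γ.V) : PlumbingGraph.{u} where
  V := Option Γ.V
  graph :=
    { Adj := Γ.blowUpEdgeAdj v w
      symm := ⟨by
        rintro (_ | a) (_ | b) h
        · exact h
        · exact h
        · exact h
        · exact ⟨h.1.symm, fun e => h.2 (Sym2.eq_swap.trans e)⟩⟩
      loopless := ⟨by
        rintro (_ | a) h
        · exact h
        · exact Γ.graph.loopless.irrefl a h.1⟩ }
  dec
    | none => -1
    | some a => if a = v ∨ a = w then Γ.dec a - 1 else Γ.dec a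

/-- `IteratedBlowUp Γ₀ Γ v`: the graph `Γ` arises from `Γ₀` by finitely many (possibly no)
blow-ups, each of the current `(-1)`-vertex or of an edge emanating from it, and `v` is the
`(-1)`-vertex of `Γ`. -/
inductive IteratedBlowUp (Γ₀ : PlumbingGraph.{u}) : (Γ : PlumbingGraph.{u}) → Γ.V → Prop
  | start (v : Γ₀.V) (hv : Γ₀.dec v = -1) : IteratedBlowUp Γ₀ Γ₀ v
  | vertex (Γ : PlumbingGraph.{u}) (v : Γ.V) (h : IteratedBlowUp Γ₀ Γ v) :
      IteratedBlowUp Γ₀ (Γ.blowUpVertex v) (none : Option Γ.V)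
  | edge (Γ : PlumbingGraph.{u}) (v w : Γ.V) (h : IteratedBlowUp Γ₀ Γ v)
      (hvw : Γ.graph.Adj v w) :
      IteratedBlowUp Γ₀ (Γ.blowUpEdge v w) (none : Option Γ.V)

/-- The graphs obtained from `Γ₀` by iterated blow-ups, with the decoration of the final
`(-1)`-vertex replaced by `d`. -/
def blowUpFamily (Γ₀ : PlumbingGraph.{0}) (d : ℤ) : Set PlumbingGraph.{u} :=
  {Γ | ∃ (Γ' : PlumbingGraph.{0}) (v : Γ'.V), IteratedBlowUp Γ₀ Γ' v ∧
    Γ.Isomorphic (Γ'.setDec v d)}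

/-- `𝒜`. -/
def familyA : Set PlumbingGraph.{u} := blowUpFamily (starGraph 1 ![[3], [3], [3]]) (-4)

/-- `ℬ`. -/
def familyB : Set PlumbingGraph.{u} := blowUpFamily (starGraph 1 ![[4], [4], [2]]) (-3)

/-- `𝒞`. -/
def familyC : Set PlumbingGraph.{u} := blowUpFamily (starGraph 1 ![[2], [6], [3]]) (-2)

end PlumbingGraph

set_option linter.unusedSectionVars false
set_option linter.unusedSimpArgs false

/-! Change the sign of the form and write the embedding as an integer matrix with one row per vertex
and one column per basis vector. Adjunction says that the numbers a(a+1), for a running through a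
row, sum to 2; so a row has a single entry 1 or -2, its head, and all its other entries are 0 or -1.
A vertex holds a column if its entry there is -1. Minimality says that all squares are at least 2.

Three facts make the matrix rigid. Adjacent rows add up to a row of the same kind, so the sum over
any connected set of vertices again has exactly one head (`IsConf.sph_sum`). A column contains at
most one entry 1 (`IsConf.pos_unique`). Distinct rows have nonpositive products, so a linear
relation in a connected family can be made positive (`exists_pos_relation`), whereas a minimal tree
has no positive relation (`IsConf.no_pos_relation`).

Let e₀ be the head column of the sum of all rows. Suppose first that it has no entry 1. Then it
consists of two entries -1 or one entry -2, and a suitable vector built from the path between the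
holders is nonpositive on all rows. The positive relation forces this path to be the whole tree and
the vector to vanish (`IsConf.headless_structure`). Peeling off an end of the chain leaves a chain
of the same kind, so the decorations arise from [4] by the moves of `GList`; by the Euclidean
algorithm these lists are the expansions of p²/(pq-1) (`gList_iff`).

Now let r have entry 1 in e₀ and take r as the root. A total of 1 is impossible
(`IsConf.not_single`), and a total of -2 means that exactly three vertices w i hold e₀. When a set
containing the root is grown one vertex at a time, the head of each new vertex lies in a column
whose sum so far is -1 (`ArrowSys.core`). The vertex responsible for this -1 is the arrow parent of
the new one. Arrows lead outwards to columns with no head in the set under consideration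
(`ArrowSys.exists_mark`); for the vertices not below any w i these are the marks. A finite check of
the entries of the w i in their own head columns (`star_bool`) leaves, apart from an impossible case
and the case of a head -2, a cyclic pattern and a pattern with two marks. If one vertex holds all
marks, its row is e - f with f orthogonal to all other rows. Otherwise a flow count along the arrows
(`Tri.flow`, `Tri.spread`) shows that the tree is a star with ends w i, and the positions of the
mark holders are the parameters of 𝒲, 𝒩, ℳ (`Tri.families`).

In the remaining case replace the row e - f by e. This yields a (-1)-vertex, and f is orthogonal to
everything. With at most two neighbours, exactly one of them has square 2, so the vertex can be
blown down and the argument repeated (`FreeAt.exists_two`). With three neighbours the tree is a star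
whose squares satisfy 1/a + 1/b + 1/c = 1. This leaves (3,3,3), (4,4,2), (2,6,3), with 3, 2, 1
nonzero entries in f, and hence the families 𝒜, ℬ, 𝒞.

Conversely, chains and blow-ups are realized by reversing these reductions, and the families 𝒲, 𝒩, ℳ
grow from six explicit matrices by subdividing edges (`StarReal.subdivide`). -/

namespace PlumbingGraph

/-! ### Rooted trees -/

/-- `par` and `dep` present the graph `G` as a tree with root `r`: every other vertex `x` is joined
to its parent `par x`, which has smaller depth, and there are no other edges. -/
structure IsRooted {V : Type*} (G : SimpleGraph V) (r : V) (par : V → V) (dep : V → ℕ) : Prop where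
  par_root : par r = r
  dep_par : ∀ x, x ≠ r → dep (par x) < dep x
  adj_iff : ∀ a b, G.Adj a b ↔ (a ≠ r ∧ par a = b) ∨ (b ≠ r ∧ par b = a)

/-- The parent is the next vertex on a geodesic to the root. In a tree adjacent vertices differ in
distance by exactly one, and two candidate parents would give two paths from the root. -/
theorem exists_isRooted {V : Type*} {G : SimpleGraph V} (hG : G.IsTree) (r : V) :
    ∃ par : V → V, IsRooted G r par (G.dist r) ∧
      ∀ x, x ≠ r → G.dist r (par x) + 1 = G.dist r x := by
  classical
  have key : ∀ x, ∃ y, (x = r → y = r) ∧ (x ≠ r → G.Adj x y ∧ G.dist r y + 1 = G.dist r x) := by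
    intro x
    by_cases hx : x = r
    · exact ⟨r, fun _ => rfl, fun h => absurd hx h⟩
    · obtain ⟨p, hp, hl⟩ := hG.connected.exists_path_of_dist x r
      cases p with
      | nil => exact absurd rfl hx
      | @cons _ y _ hadj q =>
        refine ⟨y, fun h => absurd h hx, fun _ => ⟨hadj, ?_⟩⟩
        have h1 := SimpleGraph.dist_le q.reverse
        simp only [SimpleGraph.Walk.length_cons, SimpleGraph.Walk.length_reverse] at hl h1
        rw [SimpleGraph.dist_comm] at hl
        rcases hG.dist_eq_dist_add_one_of_adj r hadj with h | h <;> omega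
  choose par hpar1 hpar2 using key
  refine ⟨par, ⟨hpar1 r rfl, fun x hx => by have := (hpar2 x hx).2; omega, fun a b => ?_⟩,
    fun x hx => (hpar2 x hx).2⟩
  have uniq : ∀ x y z, G.Adj x y → G.Adj x z → G.dist r y + 1 = G.dist r x →
      G.dist r z + 1 = G.dist r x → y = z := by
    intro x y z hy hz hdy hdz
    obtain ⟨p, hp, hlp⟩ := hG.connected.exists_path_of_dist r y
    obtain ⟨q, hq, hlq⟩ := hG.connected.exists_path_of_dist r z
    have h1 : (p.concat hy.symm).IsPath := by
      apply SimpleGraph.Walk.isPath_of_length_eq_dist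
      simp [hlp, hdy]
    have h2 : (q.concat hz.symm).IsPath := by
      apply SimpleGraph.Walk.isPath_of_length_eq_dist
      simp [hlq, hdz]
    have h3 := (hG.existsUnique_path r x).unique h1 h2
    have h4 := congrArg SimpleGraph.Walk.penultimate h3
    simpa using h4
  constructor
  · intro h
    rcases hG.dist_eq_dist_add_one_of_adj r h with h' | h'
    · have ha : a ≠ r := by rintro rfl; simp at h'
      exact Or.inl ⟨ha, uniq a _ _ (hpar2 a ha).1 h (hpar2 a ha).2 h'.symm⟩
    · have hb : b ≠ r := by rintro rfl; simp at h'
      exact Or.inr ⟨hb, uniq b _ _ (hpar2 b hb).1 h.symm (hpar2 b hb).2 h'.symm⟩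
  · rintro (⟨ha, rfl⟩ | ⟨hb, rfl⟩)
    · exact (hpar2 a ha).1
    · exact (hpar2 b hb).1.symm

/-- Descent along parents gives connectedness, and sending a non-root vertex to the edge towards its
parent counts the edges. -/
theorem IsRooted.isTree {V : Type*} [Finite V] {G : SimpleGraph V} {r : V} {par : V → V}
    {dep : V → ℕ} (h : IsRooted G r par dep) : G.IsTree := by
  classical
  have := Fintype.ofFinite V
  rw [SimpleGraph.isTree_iff_connected_and_card]
  have hreach : ∀ n x, dep x = n → G.Reachable x r := by
    intro n
    induction n using Nat.strong_induction_on with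
    | _ n ih =>
      intro x hx
      by_cases hxr : x = r
      · rw [hxr]
      · have h1 : G.Adj x (par x) := (h.adj_iff _ _).2 (Or.inl ⟨hxr, rfl⟩)
        exact h1.reachable.trans (ih _ (hx ▸ h.dep_par x hxr) _ rfl)
  have : Nonempty V := ⟨r⟩
  refine ⟨⟨fun a b => (hreach _ a rfl).trans (hreach _ b rfl).symm⟩, ?_⟩
  have e : {x : V // x ≠ r} ≃ G.edgeSet := by
    refine Equiv.ofBijective (fun x => ⟨s(x.1, par x.1), (h.adj_iff _ _).2 (Or.inl ⟨x.2, rfl⟩)⟩)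
      ⟨?_, ?_⟩
    · rintro ⟨x, hx⟩ ⟨y, hy⟩ hxy
      rcases Sym2.eq_iff.1 (congrArg Subtype.val hxy) with hxy | ⟨h1, h2⟩
      · exact Subtype.ext hxy.1
      · have a1 := h.dep_par x hx
        have a2 := h.dep_par y hy
        dsimp only at h1 h2
        rw [h2] at a1; rw [← h1] at a2; omega
    · rintro ⟨e, he⟩
      induction e using Sym2.ind with
      | _ a b =>
        rcases (h.adj_iff a b).1 he with ⟨ha, rfl⟩ | ⟨hb, rfl⟩
        · exact ⟨⟨a, ha⟩, rfl⟩
        · exact ⟨⟨b, hb⟩, Subtype.ext Sym2.eq_swap⟩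
  rw [← Nat.card_congr e, Nat.card_eq_fintype_card, Nat.card_eq_fintype_card,
    Fintype.card_subtype_compl, Fintype.card_subtype_eq]
  have : 0 < Fintype.card V := Fintype.card_pos_iff.2 ⟨r⟩
  omega

/-- `a` is an ancestor of `x` (possibly `x` itself). -/
def Anc {V : Type*} (par : V → V) (a x : V) : Prop := ∃ n : ℕ, par^[n] x = a

section Anc
variable {V : Type*} {G : SimpleGraph V} {r : V} {par : V → V} {dep : V → ℕ}

theorem Anc.refl (x : V) : Anc par x x := ⟨0, rfl⟩

theorem Anc.trans {a b x : V} (h1 : Anc par a b) (h2 : Anc par b x) : Anc par a x := by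
  obtain ⟨m, rfl⟩ := h1
  obtain ⟨n, rfl⟩ := h2
  exact ⟨m + n, Function.iterate_add_apply _ _ _ _⟩

theorem anc_par (x : V) : Anc par (par x) x := ⟨1, rfl⟩

theorem Anc.eq_or {a x : V} (h : Anc par a x) : a = x ∨ Anc par a (par x) := by
  obtain ⟨n, rfl⟩ := h
  cases n with
  | zero => exact Or.inl rfl
  | succ n => exact Or.inr ⟨n, (Function.iterate_succ_apply _ _ _).symm⟩

theorem IsRooted.dep_par_le (h : IsRooted G r par dep) (x : V) : dep (par x) ≤ dep x := by
  by_cases hx : x = r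
  · rw [hx, h.par_root]
  · exact (h.dep_par x hx).le

theorem IsRooted.anc_dep_le (h : IsRooted G r par dep) {a x : V} (hx : Anc par a x) :
    dep a ≤ dep x := by
  obtain ⟨n, rfl⟩ := hx
  induction n with
  | zero => exact le_rfl
  | succ n ih => rw [Function.iterate_succ_apply']; exact (h.dep_par_le _).trans ih

theorem IsRooted.anc_dep_lt (h : IsRooted G r par dep) {a x : V} (hx : Anc par a x) (hne : a ≠ x) :
    dep a < dep x := by
  rcases hx.eq_or with h1 | h1
  · exact absurd h1 hne
  · by_cases hxr : x = r
    · subst hxr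
      rw [h.par_root] at h1
      obtain ⟨n, rfl⟩ := hx
      exact absurd (Function.iterate_fixed h.par_root n) hne
    · exact (h.anc_dep_le h1).trans_lt (h.dep_par x hxr)

theorem IsRooted.anc_antisymm (h : IsRooted G r par dep) {a x : V} (h1 : Anc par a x)
    (h2 : Anc par x a) : a = x := by
  by_contra hne
  have := h.anc_dep_lt h1 hne
  have := h.anc_dep_le h2
  omega

theorem IsRooted.root_anc (h : IsRooted G r par dep) (x : V) : Anc par r x := by
  have : ∀ n x, dep x = n → Anc par r x := by
    intro n
    induction n using Nat.strong_induction_on with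
    | _ n ih =>
      intro x hx
      by_cases hxr : x = r
      · exact hxr ▸ Anc.refl _
      · exact (ih _ (hx ▸ h.dep_par x hxr) _ rfl).trans (anc_par x)
  exact this _ x rfl

theorem IsRooted.anc_root (h : IsRooted G r par dep) {a : V} (ha : Anc par a r) : a = r :=
  h.anc_antisymm ha (h.root_anc a)

/-- Two ancestors of a vertex are comparable. -/
theorem Anc.total {a b x : V} (h1 : Anc par a x) (h2 : Anc par b x) :
    Anc par a b ∨ Anc par b a := by
  obtain ⟨m, rfl⟩ := h1
  obtain ⟨n, rfl⟩ := h2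
  rcases le_total m n with h | h
  · right; exact ⟨n - m, by rw [← Function.iterate_add_apply]; congr 2; omega⟩
  · left; exact ⟨m - n, by rw [← Function.iterate_add_apply]; congr 2; omega⟩

theorem IsRooted.dep_root_lt (h : IsRooted G r par dep) {x : V} (hx : x ≠ r) : dep r < dep x :=
  h.anc_dep_lt (h.root_anc x) (Ne.symm hx)

theorem IsRooted.par_ne (h : IsRooted G r par dep) {x : V} (hx : x ≠ r) : par x ≠ x := by
  intro he
  have := h.dep_par x hx
  rw [he] at this
  omega

theorem IsRooted.adj_par (h : IsRooted G r par dep) {x : V} (hx : x ≠ r) : G.Adj x (par x) :=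
  (h.adj_iff _ _).2 (Or.inl ⟨hx, rfl⟩)

/-- A set of vertices containing the root and closed under parents. -/
def Lower (r : V) (par : V → V) (L : Finset V) : Prop := r ∈ L ∧ ∀ x ∈ L, par x ∈ L

/-- A set of vertices with top `t`, i.e. a connected set. -/
def ConnTop (r : V) (par : V → V) (S : Finset V) (t : V) : Prop :=
  t ∈ S ∧ ∀ x ∈ S, x ≠ t → x ≠ r ∧ par x ∈ S

theorem Lower.connTop {L : Finset V} (h : Lower r par L) : ConnTop r par L r :=
  ⟨h.1, fun x hx hne => ⟨hne, h.2 x hx⟩⟩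

theorem Lower.anc {L : Finset V} (h : Lower r par L) {a x : V} (ha : Anc par a x) (hx : x ∈ L) :
    a ∈ L := by
  obtain ⟨n, rfl⟩ := ha
  induction n with
  | zero => exact hx
  | succ n ih => rw [Function.iterate_succ_apply']; exact h.2 _ ih

theorem Lower.union [DecidableEq V] {L L' : Finset V} (h : Lower r par L) (h' : Lower r par L') :
    Lower r par (L ∪ L') := by
  refine ⟨Finset.mem_union_left _ h.1, fun x hx => ?_⟩
  rcases Finset.mem_union.1 hx with hx | hx
  · exact Finset.mem_union_left _ (h.2 x hx)
  · exact Finset.mem_union_right _ (h'.2 x hx)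

theorem Lower.univ [Fintype V] : Lower r par Finset.univ := ⟨Finset.mem_univ _, by simp⟩

open Classical in
/-- The set of ancestors of `x`, including `x`. -/
noncomputable def ancs [Fintype V] (par : V → V) (x : V) : Finset V :=
  Finset.univ.filter fun a => Anc par a x

open Classical in
/-- The set of descendants of `x`, including `x`. -/
noncomputable def descs [Fintype V] (par : V → V) (x : V) : Finset V :=
  Finset.univ.filter fun a => Anc par x a

@[simp] theorem mem_ancs [Fintype V] {a x : V} : a ∈ ancs par x ↔ Anc par a x := by simp [ancs]

@[simp] theorem mem_descs [Fintype V] {a x : V} : a ∈ descs par x ↔ Anc par x a := by simp [descs]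

theorem IsRooted.lower_ancs [Fintype V] (h : IsRooted G r par dep) (x : V) :
    Lower r par (ancs par x) :=
  ⟨by simpa using h.root_anc x, fun a ha => by
    rw [mem_ancs] at ha ⊢; exact (anc_par a).trans ha⟩

theorem IsRooted.lower_singleton (h : IsRooted G r par dep) : Lower r par {r} :=
  ⟨by simp, by simp [h.par_root]⟩

theorem connTop_descs [Fintype V] (h : IsRooted G r par dep) (x : V) :
    ConnTop r par (descs par x) x := by
  refine ⟨by simpa using Anc.refl x, fun y hy hne => ?_⟩
  rw [mem_descs] at hy ⊢
  refine ⟨?_, (hy.eq_or).resolve_left (Ne.symm hne)⟩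
  rintro rfl
  exact hne (h.anc_root hy).symm

end Anc

end PlumbingGraph

namespace PlumbingGraph

open Matrix

/-! ### Sphere vectors -/

section Sphere
variable {ι : Type*} [Fintype ι]

/-- The adjunction equality for a vector. -/
def Sph (x : ι → ℤ) : Prop := ∑ i, x i * (x i + 1) = 2

/-- The entry at `h` is `1` or `-2`, all others are `0` or `-1`. -/
def IsHead (x : ι → ℤ) (h : ι) : Prop :=
  (x h = 1 ∨ x h = -2) ∧ ∀ k, k ≠ h → x k = 0 ∨ x k = -1

theorem mul_succ_nonneg (a : ℤ) : 0 ≤ a * (a + 1) := by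
  rcases le_or_gt 0 a with h | h
  · positivity
  · nlinarith

theorem sum_eq_add_of_forall {f : ι → ℤ} (k : ι) (h : ∀ j, j ≠ k → f j = 0) : ∑ j, f j = f k :=
  Finset.sum_eq_single k (fun j _ hj => h j hj) (by simp)

theorem le_sum_of_forall {f : ι → ℤ} (k : ι) (h : ∀ j, j ≠ k → 0 ≤ f j) : f k ≤ ∑ j, f j := by
  classical
  rw [← Finset.add_sum_erase _ _ (Finset.mem_univ k)]
  have : 0 ≤ ∑ x ∈ Finset.univ.erase k, f x :=
    Finset.sum_nonneg fun j hj => h j (Finset.ne_of_mem_erase hj)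
  omega

theorem add_le_sum_of_forall {f : ι → ℤ} (k l : ι) (hkl : k ≠ l)
    (h : ∀ j, j ≠ k → j ≠ l → 0 ≤ f j) : f k + f l ≤ ∑ j, f j := by
  classical
  rw [← Finset.add_sum_erase _ _ (Finset.mem_univ k),
    ← Finset.add_sum_erase _ _ (Finset.mem_erase.2 ⟨hkl.symm, Finset.mem_univ l⟩)]
  have : 0 ≤ ∑ x ∈ (Finset.univ.erase k).erase l, f x :=
    Finset.sum_nonneg fun j hj => h j (Finset.ne_of_mem_erase (Finset.mem_of_mem_erase hj))
      (Finset.ne_of_mem_erase hj)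
  omega

/-- The numbers a(a+1) are 0 for a = 0, -1, they are 2 for a = 1, -2, and larger otherwise. So the
total 2 is spent at one coordinate. -/
theorem Sph.exists_head {x : ι → ℤ} (hx : Sph x) : ∃ h, IsHead x h := by
  have h1 : ∃ h, x h * (x h + 1) ≠ 0 := by
    by_contra hcon
    push Not at hcon
    unfold Sph at hx
    simp [hcon] at hx
  obtain ⟨h, hh⟩ := h1
  have small : ∀ a : ℤ, a * (a + 1) < 2 → a = 0 ∨ a = -1 := by
    intro a ha
    have h1 : a < 1 := by by_contra hc; push Not at hc; nlinarith
    have h2 : -2 < a := by by_contra hc; push Not at hc; nlinarith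
    omega
  have big : 2 ≤ x h * (x h + 1) := by
    by_contra hc
    rcases small (x h) (by omega) with h0 | h0 <;> simp [h0] at hh
  refine ⟨h, ?_, fun k hk => small _ ?_⟩
  · have h2 := le_sum_of_forall (f := fun i => x i * (x i + 1)) h (fun j _ => mul_succ_nonneg _)
    rw [hx] at h2
    have h3 : x h < 2 := by by_contra hc; push Not at hc; nlinarith
    have h4 : -3 < x h := by by_contra hc; push Not at hc; nlinarith
    have : x h = -2 ∨ x h = -1 ∨ x h = 0 ∨ x h = 1 := by omega
    rcases this with h0 | h0 | h0 | h0 <;> simp [h0] at hh ⊢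
  · have h2 := add_le_sum_of_forall (f := fun i => x i * (x i + 1)) h k hk.symm
      (fun j _ _ => mul_succ_nonneg _)
    rw [hx] at h2
    have := mul_succ_nonneg (x k)
    by_contra hc
    have : x k * (x k + 1) ≠ 0 := by omega
    omega

theorem IsHead.sph {x : ι → ℤ} {h : ι} (hx : IsHead x h) : Sph x := by
  unfold Sph
  rw [sum_eq_add_of_forall h]
  · rcases hx.1 with h0 | h0 <;> simp [h0]
  · intro j hj
    rcases hx.2 j hj with h0 | h0 <;> simp [h0]

theorem IsHead.eq {x : ι → ℤ} {h k : ι} (hx : IsHead x h) (hk : x k = 1 ∨ x k = -2) : k = h := by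
  by_contra hne
  rcases hx.2 k hne with h0 | h0 <;> rcases hk with h1 | h1 <;> omega

/-- Smoothing one intersection point: the cross term is twice the product, that is -2, and cancels
the surplus 2. -/
theorem sph_add {x y : ι → ℤ} (hx : Sph x) (hy : Sph y) (h : x ⬝ᵥ y = -1) : Sph (x + y) := by
  unfold Sph at *
  unfold dotProduct at h
  have : ∑ i, (x + y) i * ((x + y) i + 1) =
      ∑ i, x i * (x i + 1) + ∑ i, y i * (y i + 1) + 2 * ∑ i, x i * y i := by
    rw [Finset.mul_sum, ← Finset.sum_add_distrib, ← Finset.sum_add_distrib]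
    refine Finset.sum_congr rfl fun i _ => ?_
    simp only [Pi.add_apply]
    ring
  rw [this, hx, hy, h]
  norm_num

/-- The square of a sphere vector determines the sum of its entries. -/
theorem Sph.sum_eq {x : ι → ℤ} (hx : Sph x) : ∑ i, x i = 2 - x ⬝ᵥ x := by
  unfold Sph at hx
  unfold dotProduct
  rw [← hx, ← Finset.sum_sub_distrib]
  refine Finset.sum_congr rfl fun i _ => ?_
  ring

theorem IsHead.eq_zero_or {x : ι → ℤ} {h : ι} (hx : IsHead x h) (k : ι) :
    x k = 1 ∨ x k = 0 ∨ x k = -1 ∨ x k = -2 := by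
  by_cases hk : k = h
  · subst hk; rcases hx.1 with h | h <;> simp [h]
  · rcases hx.2 k hk with h | h <;> simp [h]

end Sphere

/-! ### Configurations -/

/-- The vectors `c v` realize the graph `G`, and each satisfies the adjunction equality. -/
structure IsConf {V ι : Type*} [Fintype ι] (G : SimpleGraph V) (c : V → ι → ℤ) : Prop where
  sph : ∀ v, Sph (c v)
  adj : ∀ a b, G.Adj a b → c a ⬝ᵥ c b = -1
  nadj : ∀ a b, a ≠ b → ¬ G.Adj a b → c a ⬝ᵥ c b = 0

section Conf
variable {V ι : Type*} [Fintype ι] {G : SimpleGraph V} {c : V → ι → ℤ}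

theorem IsConf.exists_heads (hC : IsConf G c) : ∃ h : V → ι, ∀ v, IsHead (c v) (h v) := by
  choose h hh using fun v => (hC.sph v).exists_head
  exact ⟨h, hh⟩

theorem IsConf.dot_nonpos (hC : IsConf G c) {a b : V} (hab : a ≠ b) : c a ⬝ᵥ c b ≤ 0 := by
  by_cases h : G.Adj a b
  · rw [hC.adj a b h]; norm_num
  · rw [hC.nadj a b hab h]

variable {h : V → ι}

/-- An entry 1 is the head of its row, so two rows with 1 in the same column have only nonnegative
terms elsewhere and would have positive product. -/
theorem IsConf.pos_unique (hC : IsConf G c) (hh : ∀ v, IsHead (c v) (h v)) {a b : V} {k : ι}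
    (ha : c a k = 1) (hb : c b k = 1) : a = b := by
  by_contra hab
  have h0 := hC.dot_nonpos hab
  have hka := (hh a).eq (Or.inl ha)
  have hkb := (hh b).eq (Or.inl hb)
  have := le_sum_of_forall (f := fun j => c a j * c b j) k (by
    intro j hj
    rcases (hh a).2 j (hka ▸ hj) with h1 | h1 <;> rcases (hh b).2 j (hkb ▸ hj) with h2 | h2 <;>
      simp [h1, h2])
  unfold dotProduct at h0
  simp only [ha, hb] at this
  omega

/-- A column with an entry `-2` has no other negative entries. -/
theorem IsConf.neg_two (hC : IsConf G c) (hh : ∀ v, IsHead (c v) (h v)) {a b : V} {k : ι}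
    (ha : c a k = -2) (hab : a ≠ b) : 0 ≤ c b k := by
  have h0 := hC.dot_nonpos hab
  have hka := (hh a).eq (Or.inr ha)
  by_contra hb
  have hneg : ∀ j, j ≠ k → c a j = 0 ∨ c a j = -1 := fun j hj => (hh a).2 j (hka ▸ hj)
  unfold dotProduct at h0
  by_cases hkb : k = h b
  · have := le_sum_of_forall (f := fun j => c a j * c b j) k (by
      intro j hj
      rcases hneg j hj with h1 | h1 <;> rcases (hh b).2 j (hkb ▸ hj) with h2 | h2 <;>
        simp [h1, h2])
    simp only [ha] at this
    omega
  -- Column k contributes 2, and the only possible negative term is a -1 at the head of b.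
  · have := add_le_sum_of_forall (f := fun j => c a j * c b j) k (h b) hkb (by
      intro j hj hj'
      rcases hneg j hj with h1 | h1 <;> rcases (hh b).2 j hj' with h2 | h2 <;>
        simp [h1, h2])
    simp only [ha] at this
    rcases hneg _ (Ne.symm hkb) with h1 | h1 <;> rcases (hh b).1 with h2 | h2 <;>
      rw [h1, h2] at this <;> omega

end Conf

/-! ### Sums over connected sets of vertices -/

section RConf
variable {V ι : Type*} [Fintype ι] {G : SimpleGraph V} {c : V → ι → ℤ}
  {r : V} {par : V → V} {dep : V → ℕ} {h : V → ι}

theorem ConnTop.anc (hR : IsRooted G r par dep) {S : Finset V} {t : V} (hS : ConnTop r par S t) :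
    ∀ x ∈ S, Anc par t x := by
  have : ∀ n, ∀ x ∈ S, dep x = n → Anc par t x := by
    intro n
    induction n using Nat.strong_induction_on with
    | _ n ih =>
      intro x hx hn
      by_cases hxt : x = t
      · exact hxt ▸ Anc.refl _
      · obtain ⟨h1, h2⟩ := hS.2 x hx hxt
        exact (ih _ (hn ▸ hR.dep_par x h1) _ h2 rfl).trans (anc_par x)
  exact fun x hx => this _ x hx rfl

/-- If exactly one vertex of `S` is adjacent to `x` then the sum over `S` has product `-1`
with `c x`. -/
theorem IsConf.sum_dot_eq (hC : IsConf G c) {S : Finset V} {x p : V} (hx : x ∉ S) (hp : p ∈ S)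
    (hpx : G.Adj p x) (huniq : ∀ y ∈ S, G.Adj y x → y = p) : (∑ y ∈ S, c y) ⬝ᵥ c x = -1 := by
  rw [sum_dotProduct, Finset.sum_eq_single p, hC.adj _ _ hpx]
  · intro y hy hne
    exact hC.nadj _ _ (fun e => hx (e ▸ hy)) fun hadj => hne (huniq y hy hadj)
  · exact fun hcon => absurd hp hcon

/-- A lower set is closed under parents, so a vertex outside can be adjacent to it only through its
own parent. -/
theorem IsConf.lower_dot (hC : IsConf G c) (hR : IsRooted G r par dep) {L : Finset V}
    (hL : Lower r par L) {x : V} (hx : x ∉ L) (hp : par x ∈ L) :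
    (∑ y ∈ L, c y) ⬝ᵥ c x = -1 := by
  have hxr : x ≠ r := fun e => hx (e ▸ hL.1)
  refine hC.sum_dot_eq hx hp (hR.adj_par hxr).symm fun y hy hadj => ?_
  rcases (hR.adj_iff _ _).1 hadj with ⟨h1, h2⟩ | ⟨h1, h2⟩
  · exact absurd (h2 ▸ hL.2 y hy) hx
  · exact h2.symm

/-- Peel off a deepest vertex: within S it is adjacent to its parent only, so `sph_add` applies. -/
theorem IsConf.sph_sum (hC : IsConf G c) (hR : IsRooted G r par dep) {S : Finset V} {t : V}
    (hS : ConnTop r par S t) : Sph (∑ x ∈ S, c x) := by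
  classical
  have : ∀ n, ∀ S : Finset V, S.card = n → ConnTop r par S t → Sph (∑ x ∈ S, c x) := by
    intro n
    induction n with
    | zero =>
      intro S hn hS
      rw [Finset.card_eq_zero] at hn
      exact absurd hS.1 (by simp [hn])
    | succ n ih =>
      intro S hn hS
      by_cases hne : (S.erase t).Nonempty
      · obtain ⟨x, hx, hmax⟩ := Finset.exists_max_image _ dep hne
        have hxS := Finset.mem_of_mem_erase hx
        have hxt := Finset.ne_of_mem_erase hx
        obtain ⟨hxr, hpx⟩ := hS.2 x hxS hxt
        have hnopar : ∀ y ∈ S, y ≠ r → par y ≠ x := by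
          intro y hy hyr he
          have h1 := hR.dep_par y hyr
          rw [he] at h1
          by_cases hyt : y = t
          · have := hR.anc_dep_le (hS.anc hR x hxS)
            rw [hyt] at h1
            omega
          · have := hmax y (Finset.mem_erase.2 ⟨hyt, hy⟩)
            omega
        have hS' : ConnTop r par (S.erase x) t := by
          refine ⟨Finset.mem_erase.2 ⟨hxt.symm, hS.1⟩, fun y hy hyt => ?_⟩
          have hyS := Finset.mem_of_mem_erase hy
          obtain ⟨h1, h2⟩ := hS.2 y hyS hyt
          exact ⟨h1, Finset.mem_erase.2 ⟨hnopar y hyS h1, h2⟩⟩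
        have h1 := ih (S.erase x) (by rw [Finset.card_erase_of_mem hxS, hn]; rfl) hS'
        rw [← Finset.sum_erase_add _ _ hxS]
        refine sph_add h1 (hC.sph x) (hC.sum_dot_eq (p := par x) (by simp)
          (Finset.mem_erase.2 ⟨hR.par_ne hxr, hpx⟩) (hR.adj_par hxr).symm ?_)
        intro y hy hadj
        rcases (hR.adj_iff _ _).1 hadj with ⟨h2, h3⟩ | ⟨h2, h3⟩
        · exact absurd h3 (hnopar y (Finset.mem_of_mem_erase hy) h2)
        · exact h3.symm
      · have : S = {t} := by
          ext x
          simp only [Finset.mem_singleton]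
          constructor
          · intro hx
            by_contra hxt
            exact hne ⟨x, Finset.mem_erase.2 ⟨hxt, hx⟩⟩
          · rintro rfl; exact hS.1
        rw [this, Finset.sum_singleton]
        exact hC.sph t
  exact this _ S rfl hS

end RConf

end PlumbingGraph

namespace PlumbingGraph

open Matrix

/-! ### Positive relations -/

section Null
variable {A ι : Type*} [Fintype A] [Fintype ι]

/-- Every property closed under non-orthogonality holds for all or for no vectors of the family. -/
def DotConn (u : A → ι → ℤ) : Prop :=
  ∀ P : A → Prop, (∃ a, P a) → (∀ a b, P a → u a ⬝ᵥ u b < 0 → P b) → ∀ a, P a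

/-- The Perron–Frobenius argument for nonpositive off-diagonal products: replacing the coefficients
by their absolute values does not increase the square of the combination, so it remains zero. A zero
coefficient spreads to all vectors not orthogonal to its own, hence to all. -/
theorem exists_pos_relation {u : A → ι → ℤ} (hdot : ∀ a b, a ≠ b → u a ⬝ᵥ u b ≤ 0)
    (hconn : DotConn u) {g : A → ℤ} (hg : ∑ a, g a • u a = 0) (hne : ∃ a, g a ≠ 0) :
    ∃ m : A → ℤ, (∀ a, 0 < m a) ∧ ∑ a, m a • u a = 0 := by
  classical
  have hexp : ∀ m : A → ℤ, (∑ a, m a • u a) ⬝ᵥ (∑ a, m a • u a) =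
      ∑ a, ∑ b, m a * m b * (u a ⬝ᵥ u b) := by
    intro m
    rw [sum_dotProduct]
    refine Finset.sum_congr rfl fun a _ => ?_
    rw [dotProduct_sum]
    refine Finset.sum_congr rfl fun b _ => ?_
    rw [smul_dotProduct, dotProduct_smul, smul_eq_mul, smul_eq_mul]
    ring
  have hz : ∑ a, |g a| • u a = 0 := by
    rw [← dotProduct_self_eq_zero]
    apply le_antisymm
    · rw [hexp]
      calc ∑ a, ∑ b, |g a| * |g b| * (u a ⬝ᵥ u b) ≤ ∑ a, ∑ b, g a * g b * (u a ⬝ᵥ u b) := by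
            refine Finset.sum_le_sum fun a _ => Finset.sum_le_sum fun b _ => ?_
            by_cases hab : a = b
            · subst hab; rw [abs_mul_abs_self]
            · rw [← abs_mul]
              exact mul_le_mul_of_nonpos_right (le_abs_self _) (hdot a b hab)
        _ = 0 := by rw [← hexp, hg]; simp
    · exact Finset.sum_nonneg fun i _ => mul_self_nonneg _
  refine ⟨fun a => |g a|, ?_, hz⟩
  by_contra hcon
  push Not at hcon
  obtain ⟨a, ha⟩ := hcon
  have hall := hconn (fun a => |g a| = 0) ⟨a, le_antisymm ha (abs_nonneg _)⟩ (by
    intro a b ha hab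
    have h1 : (∑ x, |g x| • u x) ⬝ᵥ u a = 0 := by rw [hz]; simp
    rw [sum_dotProduct] at h1
    have h2 : ∀ x ∈ Finset.univ, (|g x| • u x) ⬝ᵥ u a ≤ 0 := by
      intro x _
      rw [smul_dotProduct, smul_eq_mul]
      by_cases hx : x = a
      · subst hx; rw [ha]; simp
      · exact mul_nonpos_of_nonneg_of_nonpos (abs_nonneg _) (hdot x a hx)
    have h3 := (Finset.sum_eq_zero_iff_of_nonpos h2).1 h1 b (Finset.mem_univ _)
    rw [smul_dotProduct, smul_eq_mul, dotProduct_comm] at h3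
    rcases mul_eq_zero.1 h3 with h4 | h4
    · exact h4
    · omega)
  obtain ⟨b, hb⟩ := hne
  exact hb (abs_eq_zero.1 (hall b))

theorem exists_pos_relation_of_card {u : A → ι → ℤ} (hdot : ∀ a b, a ≠ b → u a ⬝ᵥ u b ≤ 0)
    (hconn : DotConn u) (hcard : Fintype.card ι < Fintype.card A) :
    ∃ m : A → ℤ, (∀ a, 0 < m a) ∧ ∑ a, m a • u a = 0 := by
  have hli : ¬ LinearIndependent ℤ u := by
    intro hl
    have := hl.fintype_card_le_finrank
    rw [Module.finrank_fintype_fun_eq_card] at this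
    omega
  rw [Fintype.not_linearIndependent_iff] at hli
  obtain ⟨g, hg, i, hi⟩ := hli
  exact exists_pos_relation hdot hconn hg ⟨i, hi⟩

/-- Together with f there is one vector too many. Pairing the resulting relation with f kills the
coefficient of f. -/
theorem exists_pos_relation_of_orth {u : A → ι → ℤ} (hdot : ∀ a b, a ≠ b → u a ⬝ᵥ u b ≤ 0)
    (hconn : DotConn u) (hcard : Fintype.card ι = Fintype.card A) {f : ι → ℤ} (hf : f ≠ 0)
    (hort : ∀ a, f ⬝ᵥ u a = 0) :
    ∃ m : A → ℤ, (∀ a, 0 < m a) ∧ ∑ a, m a • u a = 0 := by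
  let u' : Option A → ι → ℤ := fun o => o.elim f u
  have hli : ¬ LinearIndependent ℤ u' := by
    intro hl
    have := hl.fintype_card_le_finrank
    rw [Module.finrank_fintype_fun_eq_card, Fintype.card_option] at this
    omega
  rw [Fintype.not_linearIndependent_iff] at hli
  obtain ⟨g, hg, i, hi⟩ := hli
  rw [Fintype.sum_option] at hg
  change g none • f + ∑ a, g (some a) • u a = 0 at hg
  have h0 : g none = 0 := by
    have h1 : f ⬝ᵥ (g none • f + ∑ a, g (some a) • u a) = 0 := by rw [hg]; simp
    rw [dotProduct_add, dotProduct_sum, dotProduct_smul] at h1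
    rw [Finset.sum_eq_zero fun a _ => by rw [dotProduct_smul, hort, smul_zero], add_zero,
      smul_eq_mul] at h1
    rcases mul_eq_zero.1 h1 with h2 | h2
    · exact h2
    · exact absurd (dotProduct_self_eq_zero.1 h2) hf
  rw [h0, zero_smul, zero_add] at hg
  refine exists_pos_relation hdot hconn hg ?_
  cases i with
  | none => exact absurd h0 hi
  | some a => exact ⟨a, hi⟩

/-- In a positive relation, a functional that is nonnegative on all vectors vanishes on them. -/
theorem eq_zero_of_pos_relation {u : A → ι → ℤ} {m : A → ℤ} (hm : ∀ a, 0 < m a)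
    (hz : ∑ a, m a • u a = 0) {f : ι → ℤ} (hf : ∀ a, 0 ≤ f ⬝ᵥ u a) (a : A) : f ⬝ᵥ u a = 0 := by
  have h1 : f ⬝ᵥ (∑ a, m a • u a) = 0 := by rw [hz]; simp
  rw [dotProduct_sum] at h1
  have h2 : ∀ x ∈ Finset.univ, 0 ≤ f ⬝ᵥ (m x • u x) := by
    intro x _
    rw [dotProduct_smul, smul_eq_mul]
    exact mul_nonneg (hm x).le (hf x)
  have h3 := (Finset.sum_eq_zero_iff_of_nonneg h2).1 h1 a (Finset.mem_univ _)
  rw [dotProduct_smul, smul_eq_mul] at h3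
  rcases mul_eq_zero.1 h3 with h4 | h4
  · have := hm a; omega
  · exact h4

theorem dot_relation {u : A → ι → ℤ} {m : A → ℤ} (hz : ∑ a, m a • u a = 0) (f : ι → ℤ) :
    ∑ a, m a * (f ⬝ᵥ u a) = 0 := by
  have h1 : f ⬝ᵥ (∑ a, m a • u a) = 0 := by rw [hz]; simp
  rw [dotProduct_sum] at h1
  rw [← h1]
  refine Finset.sum_congr rfl fun a _ => ?_
  rw [dotProduct_smul, smul_eq_mul]

end Null

theorem IsConf.dotConn {V ι : Type*} [Fintype ι] {G : SimpleGraph V} {c : V → ι → ℤ}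
    (hC : IsConf G c) (hG : G.Connected) : DotConn c := by
  rintro P ⟨a, ha⟩ hP b
  obtain ⟨p⟩ := hG a b
  induction p with
  | nil => exact ha
  | cons h _ ih => exact ih (hP _ _ ha (by rw [hC.adj _ _ h]; norm_num))

theorem one_dotProduct_of_sph {ι : Type*} [Fintype ι] {x : ι → ℤ} (hx : Sph x) :
    (1 : ι → ℤ) ⬝ᵥ x = 2 - x ⬝ᵥ x := by
  rw [one_dotProduct]
  exact hx.sum_eq

/-- A tree of spheres of square at most `-2` admits no positive relation. -/
theorem IsConf.no_pos_relation {V ι : Type*} [Fintype V] [Fintype ι] {G : SimpleGraph V}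
    {c : V → ι → ℤ} (hC : IsConf G c) {r : V} {par : V → V} {dep : V → ℕ}
    (hR : IsRooted G r par dep) (hmin : ∀ v, 2 ≤ c v ⬝ᵥ c v) {m : V → ℤ} (hm : ∀ a, 0 < m a)
    (hz : ∑ a, m a • c a = 0) : False := by
  classical
  obtain ⟨h, hh⟩ := hC.exists_heads
  -- The functional -1 takes the value d - 2 on a sphere of square d, which is nonnegative by
  -- minimality; a positive relation makes it vanish.
  have hd2 : ∀ v, c v ⬝ᵥ c v = 2 := by
    intro v
    have := eq_zero_of_pos_relation hm hz (f := -1) (fun a => by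
      rw [neg_dotProduct, one_dotProduct_of_sph (hC.sph a)]
      have := hmin a; omega) v
    rw [neg_dotProduct, one_dotProduct_of_sph (hC.sph v)] at this
    omega
  have hpos : ∀ v, c v (h v) = 1 := by
    intro v
    rcases (hh v).1 with h1 | h1
    · exact h1
    · exfalso
      have := le_sum_of_forall (f := fun j => c v j * c v j) (h v) (fun j _ => mul_self_nonneg _)
      have h2 := hd2 v
      unfold dotProduct at h2
      rw [h2, h1] at this
      norm_num at this
  -- all vertices have the form `e i - e j`
  have hform : ∀ v, ∃ k, k ≠ h v ∧ c v k = -1 ∧ ∀ j, j ≠ h v → j ≠ k → c v j = 0 := by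
    intro v
    have h2 := hd2 v
    unfold dotProduct at h2
    have hex : ∃ k, k ≠ h v ∧ c v k = -1 := by
      by_contra hcon
      push Not at hcon
      rw [sum_eq_add_of_forall (h v), hpos v] at h2
      · norm_num at h2
      · intro j hj
        rcases (hh v).2 j hj with h3 | h3
        · simp [h3]
        · exact absurd h3 (hcon j hj)
    obtain ⟨k, hk, hck⟩ := hex
    refine ⟨k, hk, hck, fun j hj hjk => ?_⟩
    rcases (hh v).2 j hj with h3 | h3
    · exact h3
    · exfalso
      have h4 := add_le_sum_of_forall (f := fun j => c v j * c v j - (if j = h v then 1 else 0))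
        k j (Ne.symm hjk) (fun i _ _ => by
          split_ifs with hi
          · rw [hi, hpos v]; norm_num
          · simpa using mul_self_nonneg _)
      rw [Finset.sum_sub_distrib, h2] at h4
      simp only [hck, h3, hk, hj, if_false, Finset.sum_ite_eq', Finset.mem_univ, if_true] at h4
      norm_num at h4
  choose k hk hck hzero using hform
  have hdot : ∀ u v, c u ⬝ᵥ c v = c v (h u) - c v (k u) := by
    intro u v
    unfold dotProduct
    rw [← Finset.add_sum_erase _ _ (Finset.mem_univ (h u)), Finset.sum_eq_single (k u), hpos, hck]
    · ring
    · intro j hj hne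
      rw [hzero u j (Finset.ne_of_mem_erase hj) hne]
      ring
    · intro hcon
      exact absurd (Finset.mem_erase.2 ⟨hk u, Finset.mem_univ _⟩) hcon
  -- a vertex has at most one neighbour without the head condition
  have hnbr : ∀ u s s', G.Adj u s → G.Adj u s' → h s ≠ k u → h s' ≠ k u → s = s' := by
    intro u s s' hs hs' hks hks'
    by_contra hne
    have key : ∀ s, G.Adj u s → h s ≠ k u → c s (h u) = -1 := by
      intro s hs hks
      have h1 := hC.adj _ _ hs
      rw [hdot] at h1
      have h2 : h s ≠ h u := fun e => hs.ne (hC.pos_unique hh (hpos u) (e ▸ hpos s))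
      rcases (hh s).2 _ h2.symm with h3 | h3 <;> rcases (hh s).2 _ hks.symm with h4 | h4 <;> omega
    have h1 := key s hs hks
    have h2 := key s' hs' hks'
    have h3 := hC.dot_nonpos hne
    have hku : k s = h u := by
      by_contra hcon
      have e1 : h u ≠ h s := fun e => hs.ne (hC.pos_unique hh (hpos u) (e ▸ hpos s))
      have := hzero s (h u) e1 (Ne.symm hcon)
      omega
    rw [hdot s s', hku, h2] at h3
    have e2 : h s ≠ h s' := fun e => hne (hC.pos_unique hh (hpos s) (e ▸ hpos s'))
    rcases (hh s').2 _ e2 with h7 | h7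
    · omega
    · have h8 := hzero s' (h s) e2 (fun e => by
        have : c s' (k s') = -1 := hck s'
        have e3 : k s' = h u := by
          by_contra hcon
          have e1 : h u ≠ h s' := fun e => hs'.ne (hC.pos_unique hh (hpos u) (e ▸ hpos s'))
          have := hzero s' (h u) e1 (Ne.symm hcon)
          omega
        exact hs.ne (hC.pos_unique hh (hpos u) (by rw [← e3, ← e]; exact hpos s)))
      omega
  -- Paired with c v, the relation says that 2 m v is the sum of m over the neighbours of v, of
  -- which there are at most two. So the maximum of m spreads over the whole tree, but at a deepest
  -- vertex only the parent is a neighbour.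
  obtain ⟨M, -, hM⟩ := Finset.exists_max_image Finset.univ m ⟨r, Finset.mem_univ _⟩
  have hrel : ∀ v, 2 * m v = ∑ s ∈ Finset.univ.filter (G.Adj v), m s := by
    intro v
    have h1 := dot_relation hz (c v)
    rw [← Finset.add_sum_erase _ _ (Finset.mem_univ v), hd2] at h1
    have h2 : ∑ x ∈ Finset.univ.erase v, m x * (c v ⬝ᵥ c x) =
        - ∑ s ∈ Finset.univ.filter (G.Adj v), m s := by
      rw [← Finset.sum_neg_distrib, Finset.sum_filter, ← Finset.add_sum_erase _ _
        (Finset.mem_univ v), if_neg (G.loopless.irrefl v), zero_add]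
      refine Finset.sum_congr rfl fun x hx => ?_
      split_ifs with hadj
      · rw [hC.adj _ _ hadj]; ring
      · rw [hC.nadj _ _ (Finset.ne_of_mem_erase hx).symm hadj]; ring
    rw [h2] at h1
    omega
  have hcard : ∀ v, (Finset.univ.filter (G.Adj v)).card ≤ 2 := by
    intro v
    rw [← Finset.card_filter_add_card_filter_not (fun s => h s = k v)]
    have h1 : ((Finset.univ.filter (G.Adj v)).filter (fun s => h s = k v)).card ≤ 1 :=
      Finset.card_le_one.2 fun a ha b hb => by
        simp only [Finset.mem_filter] at ha hb
        exact hC.pos_unique hh (ha.2 ▸ hpos a) (hb.2 ▸ hpos b)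
    have h2 : ((Finset.univ.filter (G.Adj v)).filter (fun s => ¬ h s = k v)).card ≤ 1 :=
      Finset.card_le_one.2 fun a ha b hb => by
        simp only [Finset.mem_filter] at ha hb
        exact hnbr v a b ha.1.2 hb.1.2 ha.2 hb.2
    omega
  have hall := hC.dotConn hR.isTree.connected (fun v => m v = m M) ⟨M, rfl⟩ (by
    intro a b ha hab
    have hadj : G.Adj a b := by
      by_contra hcon
      by_cases hne : a = b
      · subst hne; have := hd2 a; omega
      · rw [hC.nadj _ _ hne hcon] at hab; omega
    have hb : b ∈ Finset.univ.filter (G.Adj a) := by simpa using hadj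
    have h1 := hrel a
    rw [← Finset.add_sum_erase _ _ hb] at h1
    have h2 : ∑ x ∈ (Finset.univ.filter (G.Adj a)).erase b, m x ≤ 1 * m M := by
      refine (Finset.sum_le_card_nsmul _ _ (m M) fun x _ => hM x (Finset.mem_univ _)).trans ?_
      rw [nsmul_eq_mul]
      refine mul_le_mul_of_nonneg_right ?_ (hm M).le
      have := hcard a
      have h3 := Finset.card_erase_of_mem hb
      have : ((Finset.univ.filter (G.Adj a)).erase b).card ≤ 1 := by omega
      exact_mod_cast this
    have := hM b (Finset.mem_univ _)
    omega)
  obtain ⟨x, -, hx⟩ := Finset.exists_max_image Finset.univ dep ⟨r, Finset.mem_univ _⟩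
  have h1 := hrel x
  have h2 : ∑ s ∈ Finset.univ.filter (G.Adj x), m s ≤ ∑ s ∈ {par x}, m s := by
    refine Finset.sum_le_sum_of_subset_of_nonneg ?_ fun i _ _ => (hm i).le
    intro s hs
    simp only [Finset.mem_filter, Finset.mem_univ, true_and] at hs
    rcases (hR.adj_iff _ _).1 hs with ⟨_, h3⟩ | ⟨h3, h4⟩
    · simp [h3]
    · have := hR.dep_par s h3
      have := hx s (Finset.mem_univ _)
      rw [h4] at *
      omega
  rw [Finset.sum_singleton, hall (par x), hall x] at *
  have := hm M
  omega

end PlumbingGraph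

namespace PlumbingGraph

open Matrix

/-! ### Configurations with a headless exceptional column -/

theorem IsRooted.exists_child {V : Type*} {G : SimpleGraph V} {r : V} {par : V → V} {dep : V → ℕ}
    (hR : IsRooted G r par dep) {a x : V} (ha : Anc par a x) (hne : a ≠ x) :
    ∃ y, y ≠ r ∧ Anc par y x ∧ par y = a := by
  obtain ⟨n, hn⟩ := ha
  induction n generalizing x with
  | zero => exact absurd hn.symm hne
  | succ n ih =>
    rw [Function.iterate_succ_apply] at hn
    by_cases hx : par x = a
    · refine ⟨x, ?_, Anc.refl x, hx⟩
      rintro rfl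
      exact hne (hx.symm.trans hR.par_root)
    · obtain ⟨y, h1, h2, h3⟩ := ih (x := par x) (Ne.symm hx) hn
      exact ⟨y, h1, h2.trans (anc_par x), h3⟩

section Headless
variable {V ι : Type*} [Fintype V] [Fintype ι] {G : SimpleGraph V} {c : V → ι → ℤ}

/-- The case `w = w'` stands for a single entry -2. -/
theorem exists_ends {f : V → ℤ} [DecidableEq V] (hneg : ∀ v, f v ≤ 0) (hsum : ∑ v, f v = -2) :
    ∃ w w', ∀ v, f v = -(if v = w then 1 else 0) - (if v = w' then 1 else 0) := by
  have hex : ∃ w, f w < 0 := by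
    by_contra hcon
    push Not at hcon
    have : ∑ v, f v = 0 := Finset.sum_eq_zero fun v _ => le_antisymm (hneg v) (hcon v)
    omega
  obtain ⟨w, hw⟩ := hex
  have hsum1 : ∑ v, (f v + if v = w then 1 else 0) = -1 := by
    rw [Finset.sum_add_distrib, hsum]; simp
  have hneg1 : ∀ v, f v + (if v = w then 1 else 0) ≤ 0 := by
    intro v
    split_ifs with h
    · subst h; omega
    · have := hneg v; omega
  have hex : ∃ w', f w' + (if w' = w then 1 else 0) < 0 := by
    by_contra hcon
    push Not at hcon
    have : ∑ v, (f v + if v = w then 1 else 0) = 0 :=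
      Finset.sum_eq_zero fun v _ => le_antisymm (hneg1 v) (hcon v)
    omega
  obtain ⟨w', hw'⟩ := hex
  refine ⟨w, w', fun v => ?_⟩
  have hsum2 : ∑ v, -(f v + (if v = w then 1 else 0) + if v = w' then 1 else 0) = 0 := by
    rw [Finset.sum_neg_distrib, Finset.sum_add_distrib, hsum1]; simp
  have hneg2 : ∀ v ∈ Finset.univ,
      0 ≤ -(f v + (if v = w then 1 else 0) + if v = w' then 1 else 0) := by
    intro v _
    have := hneg1 v
    by_cases h : v = w'
    · subst h; simp only [if_true]; omega
    · simp only [h, if_false]; omega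
  have := (Finset.sum_eq_zero_iff_of_nonneg hneg2).1 hsum2 v (Finset.mem_univ v)
  omega

/-- Let P be the path from w to w' and f the sum of the all-ones vector, the rows on P and the basis
vector of e₀. Then f is nonpositive on all rows and zero on the basis vector, and these are one
vector more than the dimension, so a positive relation makes f vanish on all of them. A row adjacent
to P from outside would have negative value, so P is everything; and f itself is zero because
otherwise the rows alone would satisfy a positive relation. -/
theorem IsConf.headless_structure [DecidableEq V] (hC : IsConf G c) (hG : G.IsTree)
    (hmin : ∀ v, 2 ≤ c v ⬝ᵥ c v) (hcard : Fintype.card ι = Fintype.card V) {e₀ : ι}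
    {w w' : V} (hend : ∀ v, c v e₀ = -(if v = w then 1 else 0) - (if v = w' then 1 else 0)) :
    (∀ k, k ≠ e₀ → ∑ v, c v k = -1) ∧ (w = w' → ∀ v, v = w) ∧
      (w ≠ w' → (∃ p, ∀ y, G.Adj w y ↔ y = p) ∧ (∃ p, ∀ y, G.Adj w' y ↔ y = p)) := by
  classical
  obtain ⟨par, hR, -⟩ := exists_isRooted hG w
  set dep := G.dist w
  set P := ancs par w' with hP
  have hPl : Lower w par P := hR.lower_ancs w'
  let δ : ι → ℤ := Pi.single e₀ 1
  let f : ι → ℤ := 1 + ∑ y ∈ P, c y + δ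
  have hδ : ∀ x : ι → ℤ, δ ⬝ᵥ x = x e₀ := fun x => by simp [δ]
  have hchild : ∀ a, ∃ y, Anc par a w' → a ≠ w' → y ≠ w ∧ Anc par y w' ∧ par y = a := by
    intro a
    by_cases h1 : Anc par a w' ∧ a ≠ w'
    · obtain ⟨y, hy⟩ := hR.exists_child h1.1 h1.2
      exact ⟨y, fun _ _ => hy⟩
    · exact ⟨a, fun h2 h3 => absurd ⟨h2, h3⟩ h1⟩
  choose ch hch using hchild
  have hXle : ∀ a, (∑ y ∈ P, c y) ⬝ᵥ c a ≤
      (if a ∈ P then c a ⬝ᵥ c a else 0) - (if a ≠ w ∧ par a ∈ P then 1 else 0)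
        - (if a ∈ P ∧ a ≠ w' then 1 else 0) := by
    intro a
    rw [sum_dotProduct]
    have hpt : ∀ y ∈ P, c y ⬝ᵥ c a ≤ (if y = a then c a ⬝ᵥ c a else 0)
        - (if y = par a then (if a ≠ w then 1 else 0) else 0)
        - (if y = ch a then (if a ∈ P ∧ a ≠ w' then 1 else 0) else 0) := by
      intro y hy
      by_cases hya : y = a
      · subst hya
        have h1 : (if y = par y then (if y ≠ w then (1 : ℤ) else 0) else 0) = 0 := by
          split_ifs with h1 h2
          · exact absurd h1.symm (hR.par_ne h2)
          · rfl
          · rfl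
        have h2 : (if y = ch y then (if y ∈ P ∧ y ≠ w' then (1 : ℤ) else 0) else 0) = 0 := by
          split_ifs with h1 h2
          · obtain ⟨h3, h4, h5⟩ := hch y (by simpa [hP] using h2.1) h2.2
            rw [← h1] at h5 h3
            exact absurd h5 (hR.par_ne h3)
          · rfl
          · rfl
        rw [h1, h2]; simp
      · have h0 := hC.dot_nonpos hya
        rw [if_neg hya]
        by_cases h1 : y = par a ∧ a ≠ w
        · have hadj : G.Adj y a := (hR.adj_iff _ _).2 (Or.inr ⟨h1.2, h1.1.symm⟩)
          rw [hC.adj _ _ hadj, if_pos h1.1, if_pos h1.2]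
          split_ifs with h2 h3
          · obtain ⟨h4, h5, h6⟩ := hch a (by simpa [hP] using h3.1) h3.2
            have e1 := hR.dep_par _ h4
            have e2 := hR.dep_par _ h1.2
            rw [h6, ← h2, h1.1] at e1
            omega
          · norm_num
          · norm_num
        · have h1' : (if y = par a then (if a ≠ w then (1 : ℤ) else 0) else 0) = 0 := by
            split_ifs with h2 h3
            · exact absurd ⟨h2, h3⟩ h1
            · rfl
            · rfl
          rw [h1']
          split_ifs with h2 h3
          · obtain ⟨h4, h5, h6⟩ := hch a (by simpa [hP] using h3.1) h3.2
            rw [← h2] at h4 h6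
            have hadj : G.Adj y a := (hR.adj_iff _ _).2 (Or.inl ⟨h4, h6⟩)
            rw [hC.adj _ _ hadj]
            norm_num
          · omega
          · omega
    refine (Finset.sum_le_sum hpt).trans ?_
    rw [Finset.sum_sub_distrib, Finset.sum_sub_distrib, Finset.sum_ite_eq', Finset.sum_ite_eq',
      Finset.sum_ite_eq']
    have h1 : (if ch a ∈ P then (if a ∈ P ∧ a ≠ w' then (1 : ℤ) else 0) else 0) =
        (if a ∈ P ∧ a ≠ w' then (1 : ℤ) else 0) := by
      by_cases h2 : a ∈ P ∧ a ≠ w'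
      · have := (hch a (by simpa [hP] using h2.1) h2.2).2.1
        rw [if_pos (by simpa [hP] using this)]
      · simp [h2]
    have h2 : (if par a ∈ P then (if a ≠ w then (1 : ℤ) else 0) else 0) =
        (if a ≠ w ∧ par a ∈ P then (1 : ℤ) else 0) := by
      by_cases h3 : par a ∈ P <;> by_cases h4 : a ≠ w <;> simp [h3, h4]
    rw [h1, h2]
  have hw'P : w' ∈ P := by simpa [hP] using Anc.refl w'
  -- On the path the contributions are 2 - d, then d minus the number of path neighbours, then minus
  -- the number of times a is an end; they cancel. Off the path 2 - d ≤ 0 remains, lowered by 1 if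
  -- the parent is on the path.
  have hfle : ∀ a, f ⬝ᵥ c a ≤ -(if a ∉ P ∧ par a ∈ P then 1 else 0) := by
    intro a
    have h1 := hXle a
    have h2 := hmin a
    simp only [f, add_dotProduct, hδ, one_dotProduct_of_sph (hC.sph a), hend a]
    by_cases ha : a ∈ P
    · have hpa := hPl.2 a ha
      simp only [ha, hpa, if_true, not_true, if_false, true_and, and_true] at h1 ⊢
      split_ifs at h1 ⊢ <;> omega
    · have h3 : a ≠ w := fun e => ha (e ▸ hPl.1)
      have h4 : a ≠ w' := fun e => ha (e ▸ hw'P)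
      by_cases h5 : par a ∈ P <;> simp only [ha, h3, h4, h5, ne_eq, not_true, not_false_iff,
        if_true, if_false, true_and, and_true, false_and] at h1 ⊢ <;> omega
  have hXe₀ : (∑ y ∈ P, c y) e₀ = -2 := by
    rw [Finset.sum_apply, Finset.sum_congr rfl fun y _ => hend y, Finset.sum_sub_distrib,
      Finset.sum_neg_distrib, Finset.sum_ite_eq', Finset.sum_ite_eq', if_pos hPl.1, if_pos hw'P]
    norm_num
  -- the family obtained by adding the exceptional basis vector
  let u' : Option V → ι → ℤ := fun o => o.elim δ c
  have hneg : ∀ v, c v e₀ ≤ 0 := by intro v; rw [hend]; split_ifs <;> norm_num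
  have hrel : ∃ m : Option V → ℤ, (∀ a, 0 < m a) ∧ ∑ a, m a • u' a = 0 := by
    apply exists_pos_relation_of_card
    · rintro (_ | a) (_ | b) hab
      · exact absurd rfl hab
      · change δ ⬝ᵥ c b ≤ 0
        rw [hδ]; exact hneg b
      · change c a ⬝ᵥ δ ≤ 0
        rw [dotProduct_comm, hδ]; exact hneg a
      · exact hC.dot_nonpos fun e => hab (by rw [e])
    · intro Q hQ hcl
      have h1 : ∀ b, Q (some b) → ∀ a, Q (some a) := fun b hb =>
        hC.dotConn hG.connected (fun a => Q (some a)) ⟨b, hb⟩ fun a b ha hab =>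
          hcl (some a) (some b) ha hab
      have h2 : δ ⬝ᵥ c w < 0 := by rw [hδ, hend, if_pos rfl]; split_ifs <;> norm_num
      have h3 : ∀ a, Q (some a) := by
        obtain ⟨a | a, ha⟩ := hQ
        · exact h1 w (hcl none (some w) ha h2)
        · exact h1 _ ha
      rintro (_ | a)
      · exact hcl (some w) none (h3 w) (by
          change c w ⬝ᵥ δ < 0
          rw [dotProduct_comm]; exact h2)
      · exact h3 a
    · rw [Fintype.card_option, hcard]; exact Nat.lt_succ_self _
  obtain ⟨m, hm, hz⟩ := hrel
  have hfz : ∀ a, f ⬝ᵥ c a = 0 := by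
    intro a
    have := eq_zero_of_pos_relation hm hz (f := -f) (fun o => by
      rw [neg_dotProduct]
      cases o with
      | none =>
        change 0 ≤ -(f ⬝ᵥ δ)
        rw [dotProduct_comm, hδ]
        simp only [f, Pi.add_apply, hXe₀, Pi.one_apply]
        simp [δ]
      | some a =>
        change 0 ≤ -(f ⬝ᵥ c a)
        have := hfle a
        split_ifs at this <;> omega) (some a)
    rw [neg_dotProduct] at this
    change -(f ⬝ᵥ c a) = 0 at this
    omega
  have hPuniv : ∀ a, a ∈ P := by
    have : ∀ n a, dep a = n → a ∈ P := by
      intro n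
      induction n using Nat.strong_induction_on with
      | _ n ih =>
        intro a hn
        by_cases haw : a = w
        · exact haw ▸ hPl.1
        · have h1 := ih _ (hn ▸ hR.dep_par a haw) _ rfl
          by_contra hcon
          have h2 := hfle a
          rw [hfz a, if_pos ⟨hcon, h1⟩] at h2
          omega
    exact fun a => this _ a rfl
  have hPeq : P = Finset.univ := Finset.eq_univ_of_forall hPuniv
  have hanc : ∀ a, Anc par a w' := fun a => by simpa [hP] using hPuniv a
  have hf0 : f = 0 := by
    by_contra hne
    obtain ⟨m, hm, hz⟩ := exists_pos_relation_of_orth (fun a b hab => hC.dot_nonpos hab)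
      (hC.dotConn hG.connected) hcard hne hfz
    exact hC.no_pos_relation hR hmin hm hz
  refine ⟨fun k hk => ?_, fun hww v => ?_, fun hww => ⟨?_, par w', fun y => ?_⟩⟩
  · have h1 := congrFun hf0 k
    simp only [f, hPeq, Pi.add_apply, Pi.one_apply, Finset.sum_apply, Pi.zero_apply, δ,
      Pi.single_eq_of_ne hk] at h1
    omega
  · exact hR.anc_root (hww ▸ hanc v)
  · obtain ⟨y, hy, hyw, hpy⟩ := hR.exists_child (hanc w) hww
    refine ⟨y, fun z => ?_⟩
    rw [hR.adj_iff]
    constructor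
    · rintro (⟨h1, -⟩ | ⟨h1, h2⟩)
      · exact absurd rfl h1
      · have key : ∀ y z, y ≠ w → z ≠ w → par y = w → Anc par z y → z = y := by
          intro y z hy hz hpy hzy
          rcases hzy.eq_or with h3 | h3
          · exact h3
          · rw [hpy] at h3
            exact absurd (hR.anc_root h3) hz
        rcases (hanc z).total hyw with h3 | h3
        · exact key y z hy h1 hpy h3
        · exact (key z y h1 hy h2 h3).symm
    · rintro rfl
      exact Or.inr ⟨hy, hpy⟩
  · rw [hR.adj_iff]
    constructor
    · rintro (⟨-, h1⟩ | ⟨h1, h2⟩)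
      · exact h1.symm
      · have e1 := hR.dep_par y h1
        have e2 := hR.anc_dep_le (hanc y)
        rw [h2] at e1
        omega
    · rintro rfl
      exact Or.inl ⟨Ne.symm hww, rfl⟩

end Headless

end PlumbingGraph

namespace PlumbingGraph

open Matrix

/-! ### Deleting a vertex and a column -/

theorem dot_subtype_ne {ι : Type*} [Fintype ι] [DecidableEq ι] (e : ι) (x y : ι → ℤ) :
    (fun k : {k // k ≠ e} => x k) ⬝ᵥ (fun k : {k // k ≠ e} => y k) = x ⬝ᵥ y - x e * y e := by
  have := Fintype.sum_eq_add_sum_subtype_ne (fun k => x k * y k) e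
  unfold dotProduct
  rw [this]
  ring

theorem sph_subtype_ne {ι : Type*} [Fintype ι] [DecidableEq ι] {e : ι} {x : ι → ℤ} (hx : Sph x)
    (he : x e = 0 ∨ x e = -1) : Sph (fun k : {k // k ≠ e} => x k) := by
  have := Fintype.sum_eq_add_sum_subtype_ne (fun k => x k * (x k + 1)) e
  unfold Sph at *
  rw [hx] at this
  rcases he with he | he <;> simp only [he] at this <;> simpa using this.symm

theorem isTree_delete_leaf {V : Type*} [Finite V] {G : SimpleGraph V} (hG : G.IsTree) {x : V}
    {p : V} (hp : ∀ y, G.Adj x y ↔ y = p) :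
    (G.comap (Subtype.val : {v // v ≠ x} → V)).IsTree := by
  obtain ⟨par, hR, -⟩ := exists_isRooted hG p
  have hpx : p ≠ x := ((hp p).2 rfl).ne'
  have hpar : ∀ v, v ≠ x → par v ≠ x := by
    intro v hv he
    by_cases hvp : v = p
    · rw [hvp, hR.par_root] at he; exact hpx he
    · have := hR.adj_par hvp
      rw [he] at this
      exact hvp ((hp v).1 this.symm)
  refine IsRooted.isTree (r := ⟨p, hpx⟩) (par := fun v => ⟨par v, hpar v v.2⟩)
    (dep := fun v => G.dist p v) ⟨?_, ?_, ?_⟩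
  · exact Subtype.ext hR.par_root
  · rintro ⟨v, hv⟩ hne
    exact hR.dep_par v fun e => hne (Subtype.ext e)
  · rintro ⟨a, ha⟩ ⟨b, hb⟩
    rw [SimpleGraph.comap_adj, hR.adj_iff]
    simp [Subtype.ext_iff]

/-! ### Chains -/

/-- The lists generated from `[4]` by putting a `2` in front and raising the last entry by `1`,
and by reversing. -/
inductive GList : List ℤ → Prop
  | base : GList [4]
  | step (l : List ℤ) (a : ℤ) : GList (l ++ [a]) → GList (2 :: (l ++ [a + 1]))
  | rev (l : List ℤ) : GList l → GList l.reverse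

/-- The vertices in the list `vs` are all vertices, once each, and consecutive ones are adjacent. -/
def ChainOf {V : Type*} (G : SimpleGraph V) (vs : List V) : Prop :=
  vs.Nodup ∧ (∀ v, v ∈ vs) ∧
    ∀ i j (hi : i < vs.length) (hj : j < vs.length), G.Adj vs[i] vs[j] ↔ i + 1 = j ∨ j + 1 = i

theorem ChainOf.reverse {V : Type*} {G : SimpleGraph V} {vs : List V} (h : ChainOf G vs) :
    ChainOf G vs.reverse := by
  refine ⟨List.nodup_reverse.2 h.1, fun v => List.mem_reverse.2 (h.2.1 v), fun i j hi hj => ?_⟩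
  rw [List.length_reverse] at hi hj
  rw [List.getElem_reverse, List.getElem_reverse, h.2.2]
  omega

theorem ChainOf.isomorphic {Γ : PlumbingGraph.{u}} {vs : List Γ.V} (h : ChainOf Γ.graph vs)
    {d : Γ.V → ℤ} (hd : ∀ v, Γ.dec v = -d v) : Γ.Isomorphic (chain (vs.map d)) := by
  classical
  let e₁ : Fin (vs.map d).length ≃ Γ.V :=
    (finCongr (List.length_map d)).trans (h.1.getEquivOfForallMemList vs h.2.1)
  refine ⟨⟨e₁.symm, ?_⟩, fun v => ?_⟩
  · intro a b
    obtain ⟨i, rfl⟩ := e₁.surjective a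
    obtain ⟨j, rfl⟩ := e₁.surjective b
    change (SimpleGraph.pathGraph _).Adj (e₁.symm (e₁ i)) (e₁.symm (e₁ j)) ↔
      Γ.graph.Adj (vs[i.1]'(by simpa using i.2)) (vs[j.1]'(by simpa using j.2))
    rw [Equiv.symm_apply_apply, Equiv.symm_apply_apply, h.2.2, SimpleGraph.pathGraph_adj]
  · obtain ⟨i, rfl⟩ := e₁.surjective v
    change (chain (vs.map d)).dec (e₁.symm (e₁ i)) = _
    rw [Equiv.symm_apply_apply, hd]
    change -(vs.map d).get i = - d (vs[i.1]'(by simpa using i.2))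
    simp

theorem GList.ne_nil {l : List ℤ} (h : GList l) : l ≠ [] := by
  induction h with
  | base => simp
  | step => simp
  | rev l _ ih => simpa using ih

theorem ChainOf.cons {V : Type*} {G : SimpleGraph V} {x : V} {vs : List {v // v ≠ x}}
    (hvs : ChainOf (G.comap (Subtype.val : {v // v ≠ x} → V)) vs)
    (hadj : ∀ v : {v // v ≠ x}, G.Adj x v ↔ vs.head? = some v) :
    ChainOf G (x :: vs.map Subtype.val) := by
  refine ⟨?_, ?_, ?_⟩
  · rw [List.nodup_cons]
    refine ⟨?_, hvs.1.map Subtype.val_injective⟩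
    intro hx
    obtain ⟨v, -, hv⟩ := List.mem_map.1 hx
    exact v.2 hv
  · intro v
    by_cases hv : v = x
    · simp [hv]
    · exact List.mem_cons_of_mem _ (List.mem_map.2 ⟨⟨v, hv⟩, hvs.2.1 _, rfl⟩)
  · have key : ∀ j (hj : j < vs.length), G.Adj x (vs[j] : V) ↔ j = 0 := by
      intro j hj
      rw [hadj, List.head?_eq_getElem?, List.getElem?_eq_getElem (by omega), Option.some_inj,
        hvs.1.getElem_inj_iff]
      exact eq_comm
    intro i j hi hj
    rcases i with _ | i <;> rcases j with _ | j
    · simp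
    · simp only [List.getElem_cons_zero, List.getElem_cons_succ, List.getElem_map]
      rw [key j (by simpa using hj)]
      omega
    · simp only [List.getElem_cons_zero, List.getElem_cons_succ, List.getElem_map]
      rw [SimpleGraph.adj_comm, key i (by simpa using hi)]
      omega
    · simp only [List.getElem_cons_succ, List.getElem_map]
      have := hvs.2.2 i j (by simpa using hi) (by simpa using hj)
      rw [SimpleGraph.comap_adj] at this
      rw [this]
      omega

/-- Delete an end x of the chain whose head is 1, together with the column e₀. In the head column of
x the remaining entries are nonpositive with sum -2, so the smaller chain is of the same kind.
Comparing column sums shows that x is a difference of two basis vectors; it is adjacent to the end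
of the smaller chain opposite to y, and the square of y dropped by 1. -/
theorem IsConf.headless_chain (n : ℕ) : ∀ {V : Type u} {ι : Type w} [Fintype V] [Fintype ι]
    [DecidableEq V] {G : SimpleGraph V} {c : V → ι → ℤ} (_ : IsConf G c) (_ : G.IsTree)
    (_ : ∀ v, 2 ≤ c v ⬝ᵥ c v) (_ : Fintype.card ι = Fintype.card V) (_ : Fintype.card V = n)
    {e₀ : ι} (_ : ∀ v, c v e₀ ≤ 0) (_ : ∑ v, c v e₀ = -2),
    ∃ vs : List V, ChainOf G vs ∧ GList (vs.map fun v => c v ⬝ᵥ c v) ∧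
      ∀ v, c v e₀ = -(if vs.head? = some v then 1 else 0)
        - (if vs.getLast? = some v then 1 else 0) := by
  induction n with
  | zero =>
    intro V ι _ _ _ G c hC hG hmin hcard hn e₀ hneg hsum
    rw [Fintype.card_eq_zero_iff] at hn
    simp at hsum
  | succ n ih =>
    intro V ι _ _ _ G c hC hG hmin hcard hn e₀ hneg hsum
    classical
    obtain ⟨w, w', hend⟩ := exists_ends hneg hsum
    obtain ⟨hfull, hsame, hleaf⟩ := hC.headless_structure hG hmin hcard hend
    obtain ⟨h, hh⟩ := hC.exists_heads
    by_cases hww : w = w'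
    · subst hww
      have hall := hsame rfl
      have hV1 : Fintype.card V = 1 := Fintype.card_eq_one_iff.2 ⟨w, hall⟩
      obtain ⟨k, hk⟩ := Fintype.card_eq_one_iff.1 (hcard.trans hV1)
      have hdd : c w ⬝ᵥ c w = 4 := by
        unfold dotProduct
        rw [sum_eq_add_of_forall e₀ fun j hj => absurd ((hk j).trans (hk e₀).symm) hj, hend]
        simp
      refine ⟨[w], ⟨by simp, fun v => by simp [hall v], fun i j hi hj => ?_⟩, ?_, fun v => ?_⟩
      · simp at hi hj; subst hi; subst hj; simp
      · simp only [List.map_cons, List.map_nil, hdd]; exact GList.base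
      · rw [hend v, hall v]; simp
    · -- choose the end to be deleted
      have hdec : ∃ x y, x ≠ y ∧ (∀ v, c v e₀ = -(if v = x then 1 else 0) -
          (if v = y then 1 else 0)) ∧ (∃ p, ∀ z, G.Adj x z ↔ z = p) ∧ c x (h x) = 1 ∧
          3 ≤ c y ⬝ᵥ c y := by
        have hwe : c w e₀ = -1 := by rw [hend]; simp [hww]
        have hwe' : c w' e₀ = -1 := by rw [hend]; simp [Ne.symm hww]
        obtain ⟨hl, hl'⟩ := hleaf hww
        have hend2 : ∀ v, c v e₀ = -(if v = w' then 1 else 0) - (if v = w then 1 else 0) := by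
          intro v; rw [hend]; ring
        have hne : ∀ x, c x e₀ = -1 → h x ≠ e₀ := fun x hx e => by
          rcases (hh x).1 with h1 | h1 <;> rw [e] at h1 <;> omega
        have hD : ∀ x, c x e₀ = -1 → c x ⬝ᵥ c x = 2 →
            c x (h x) = 1 ∧ ∀ k, k ≠ h x → k ≠ e₀ → c x k = 0 := by
          intro x hx hd
          have h0 := add_le_sum_of_forall (f := fun j => c x j * c x j) (h x) e₀ (hne x hx)
            fun j _ _ => mul_self_nonneg _
          unfold dotProduct at hd
          rw [hd] at h0
          simp only [hx] at h0
          have h1 : c x (h x) = 1 := by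
            rcases (hh x).1 with h1 | h1
            · exact h1
            · rw [h1] at h0; norm_num at h0
          refine ⟨h1, fun k hk hke => ?_⟩
          by_contra hk0
          have h2 := (hh x).2 k hk
          have h3 : ∑ j, c x j * c x j ≥ 1 + 1 + 1 := by
            rw [← Finset.add_sum_erase _ _ (Finset.mem_univ (h x)),
              ← Finset.add_sum_erase _ _ (Finset.mem_erase.2 ⟨(hne x hx).symm, Finset.mem_univ e₀⟩),
              ← Finset.add_sum_erase _ _ (Finset.mem_erase.2 ⟨hke, Finset.mem_erase.2
                ⟨hk, Finset.mem_univ k⟩⟩)]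
            have h4 : 0 ≤ ∑ j ∈ ((Finset.univ.erase (h x)).erase e₀).erase k, c x j * c x j :=
              Finset.sum_nonneg fun j _ => mul_self_nonneg _
            have h5 : c x k = -1 := by omega
            rw [h1, hx, h5]
            omega
          omega
        -- Both would be a basis vector minus that of e₀, with distinct heads, and have positive
        -- product. So one end can be deleted while the other keeps square at least 2.
        have hboth : ¬ (c w ⬝ᵥ c w = 2 ∧ c w' ⬝ᵥ c w' = 2) := by
          rintro ⟨h1, h2⟩
          obtain ⟨h3, h4⟩ := hD w hwe h1
          obtain ⟨h5, h6⟩ := hD w' hwe' h2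
          have h7 := hC.dot_nonpos hww
          have hhne : h w ≠ h w' := fun e => hww (hC.pos_unique hh h3 (e ▸ h5))
          have h8 := le_sum_of_forall (f := fun j => c w j * c w' j) e₀ (by
            intro j hj
            by_cases hjw : j = h w
            · rw [hjw, h6 _ hhne (hne w hwe)]; simp
            · rw [h4 j hjw hj]; simp)
          unfold dotProduct at h7
          simp only [hwe, hwe'] at h8
          omega
        have hDD : ¬ (c w (h w) = -2 ∧ c w' (h w') = -2) := by
          rintro ⟨h1, h2⟩
          have hnp : ∀ x, c x (h x) = -2 → ∀ k, c x k ≤ 0 := by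
            intro x hx k
            by_cases hk : k = h x
            · rw [hk, hx]; norm_num
            · have := (hh x).2 k hk; omega
          have h8 := le_sum_of_forall (f := fun j => c w j * c w' j) e₀ fun j _ =>
            mul_nonneg_of_nonpos_of_nonpos (hnp w h1 j) (hnp w' h2 j)
          have h7 := hC.dot_nonpos hww
          unfold dotProduct at h7
          simp only [hwe, hwe'] at h8
          omega
        have m1 := hmin w
        have m2 := hmin w'
        by_cases h1 : c w ⬝ᵥ c w = 2
        · exact ⟨w, w', hww, hend, hl, (hD w hwe h1).1, by omega⟩
        · by_cases h2 : c w' ⬝ᵥ c w' = 2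
          · exact ⟨w', w, Ne.symm hww, hend2, hl', (hD w' hwe' h2).1, by omega⟩
          · rcases (hh w).1 with h3 | h3
            · exact ⟨w, w', hww, hend, hl, h3, by omega⟩
            · exact ⟨w', w, Ne.symm hww, hend2, hl',
                (hh w').1.resolve_right fun h4 => hDD ⟨h3, h4⟩, by omega⟩
      obtain ⟨x, y, hxy, hend', ⟨p, hp⟩, hx1, hy3⟩ := hdec
      have hxe : c x e₀ = -1 := by rw [hend']; simp [hxy]
      have hye : c y e₀ = -1 := by rw [hend']; simp [Ne.symm hxy]
      have hhx : h x ≠ e₀ := fun e => by rw [e] at hx1; omega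
      let c' : {v // v ≠ x} → {k // k ≠ e₀} → ℤ := fun v k => c v k
      have hdot' : ∀ a b, c' a ⬝ᵥ c' b = c a ⬝ᵥ c b - c a e₀ * c b e₀ := fun a b =>
        dot_subtype_ne e₀ (c a) (c b)
      have he0' : ∀ v : {v // v ≠ x}, c v e₀ = -(if (v : V) = y then 1 else 0) := by
        intro v; rw [hend', if_neg v.2]; ring
      have hC' : IsConf (G.comap (Subtype.val : {v // v ≠ x} → V)) c' := by
        have hprod : ∀ a b : {v // v ≠ x}, a ≠ b → c a e₀ * c b e₀ = 0 := by
          intro a b hab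
          rw [he0', he0']
          split_ifs with h1 h2
          · exact absurd (Subtype.ext (h1.trans h2.symm)) hab
          all_goals ring
        refine ⟨fun v => sph_subtype_ne (hC.sph v) ?_, fun a b hab => ?_, fun a b hab hadj => ?_⟩
        · rw [he0']; split_ifs <;> simp
        · rw [hdot', hprod a b hab.ne, hC.adj _ _ hab]; ring
        · rw [hdot', hprod a b hab, hC.nadj _ _ (fun e => hab (Subtype.ext e)) hadj]; ring
      have hG' := isTree_delete_leaf hG hp
      have hmin' : ∀ v, 2 ≤ c' v ⬝ᵥ c' v := by
        intro v
        rw [hdot', he0']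
        split_ifs with h1
        · rw [h1]; omega
        · have := hmin v; omega
      have hcV : Fintype.card {v // v ≠ x} = n := by
        rw [Fintype.card_subtype_compl, Fintype.card_subtype_eq, hn]; rfl
      have hcι : Fintype.card {k // k ≠ e₀} = n := by
        rw [Fintype.card_subtype_compl, Fintype.card_subtype_eq, hcard, hn]; rfl
      have hsum' : ∀ k : {k // k ≠ e₀}, ∑ v, c' v k = -1 - c x k := by
        intro k
        have h1 := Fintype.sum_eq_add_sum_subtype_ne (fun v => c v k) x
        rw [hfull k k.2] at h1
        change ∑ v : {v // v ≠ x}, c v k = _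
        omega
      have hneg' : ∀ v, c' v ⟨h x, hhx⟩ ≤ 0 := by
        intro v
        change c v (h x) ≤ 0
        rcases (hh v).eq_zero_or (h x) with h1 | h1 | h1 | h1
        · exact absurd (hC.pos_unique hh h1 hx1) v.2
        all_goals omega
      have hs2 : ∑ v, c' v ⟨h x, hhx⟩ = -2 := by rw [hsum', hx1]; norm_num
      obtain ⟨vs, hvs, hgl, hvend⟩ := ih hC' hG' hmin' (hcι.trans hcV.symm) hcV hneg' hs2
      obtain ⟨z, z', hend2⟩ := exists_ends hneg' hs2
      obtain ⟨hfull', -, -⟩ := hC'.headless_structure hG' hmin' (hcι.trans hcV.symm) hend2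
      -- Such a column sums to -1 both with and without x, by `headless_structure` for the large and
      -- for the small chain.
      have hcx : ∀ k, k ≠ h x → k ≠ e₀ → c x k = 0 := by
        intro k hk hke
        have h1 := hfull' ⟨k, hke⟩ (fun e => hk (congrArg Subtype.val e))
        rw [hsum'] at h1
        simp only at h1
        omega
      have hdotx : ∀ v, c x ⬝ᵥ c v = c v (h x) - c v e₀ := by
        intro v
        unfold dotProduct
        rw [← Finset.add_sum_erase _ _ (Finset.mem_univ (h x)), Finset.sum_eq_single e₀, hx1, hxe]
        · ring
        · intro j hj hne
          rw [hcx j (Finset.ne_of_mem_erase hj) hne]; ring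
        · intro hcon
          exact absurd (Finset.mem_erase.2 ⟨hhx.symm, Finset.mem_univ _⟩) hcon
      have hdx2 : c x ⬝ᵥ c x = 2 := by rw [hdotx, hx1, hxe]; norm_num
      -- orient the chain so that `y` is its last vertex
      have horient : ∃ vs : List {v // v ≠ x}, ChainOf (G.comap Subtype.val) vs ∧
          GList (vs.map fun v => c' v ⬝ᵥ c' v) ∧ (∀ v, c' v ⟨h x, hhx⟩ =
            -(if vs.head? = some v then 1 else 0) - (if vs.getLast? = some v then 1 else 0)) ∧
          vs.getLast? = some ⟨y, hxy.symm⟩ := by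
        by_cases h1 : vs.getLast? = some ⟨y, hxy.symm⟩
        · exact ⟨vs, hvs, hgl, hvend, h1⟩
        · refine ⟨vs.reverse, hvs.reverse, ?_, ?_, ?_⟩
          · rw [List.map_reverse]; exact hgl.rev
          · intro v
            rw [hvend v, List.head?_reverse, List.getLast?_reverse]; ring
          · rw [List.getLast?_reverse]
            by_contra h2
            have h3 := hvend ⟨y, hxy.symm⟩
            rw [if_neg h1, if_neg h2] at h3
            change c y (h x) = _ at h3
            have h4 := hC.dot_nonpos hxy
            rw [hdotx, h3, hye] at h4
            norm_num at h4
      obtain ⟨vs, hvs, hgl, hvend, hlast⟩ := horient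
      have hne : vs ≠ [] := by rintro rfl; simp at hlast
      obtain ⟨us, u, rfl⟩ : ∃ us u, vs = us ++ [u] :=
        ⟨vs.dropLast, vs.getLast hne, (List.dropLast_append_getLast hne).symm⟩
      have hu : u = ⟨y, hxy.symm⟩ := by simpa using hlast
      refine ⟨x :: (us ++ [u]).map Subtype.val, hvs.cons ?_, ?_, ?_⟩
      · intro v
        have h1 : c x ⬝ᵥ c v = -(if (us ++ [u]).head? = some v then 1 else 0) := by
          have h2 := hvend v
          change c v (h x) = _ at h2
          rw [hdotx, h2, he0', hlast]
          have h3 : (some (⟨y, hxy.symm⟩ : {v // v ≠ x}) = some v) ↔ (v : V) = y := by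
            rw [Option.some_inj, eq_comm, Subtype.ext_iff]
          simp only [h3]
          ring
        constructor
        · intro hadj
          rw [hC.adj _ _ hadj] at h1
          by_contra h2
          rw [if_neg h2] at h1
          norm_num at h1
        · intro h2
          rw [if_pos h2] at h1
          by_contra hadj
          rw [hC.nadj _ _ (Ne.symm v.2) hadj] at h1
          norm_num at h1
      · have h1 : (x :: (us ++ [u]).map Subtype.val).map (fun v => c v ⬝ᵥ c v) =
            2 :: ((us.map fun v => c' v ⬝ᵥ c' v) ++ [c' u ⬝ᵥ c' u + 1]) := by
          simp only [List.map_cons, List.map_append, List.map_map, List.map_nil, hdx2]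
          congr 2
          · refine List.map_congr_left fun v hv => ?_
            simp only [Function.comp_apply]
            rw [hdot', he0', if_neg]
            · ring
            · intro e
              have h3 := hvs.1
              rw [List.nodup_append] at h3
              exact h3.2.2 v hv u (by simp) (hu ▸ Subtype.ext e)
          · rw [hdot', he0', if_pos (congrArg Subtype.val hu)]
            simp
        rw [h1]
        refine GList.step _ _ ?_
        simpa using hgl
      · intro v
        have h2 : (x :: (us ++ [u]).map Subtype.val).getLast? = some y := by
          rw [List.map_append, ← List.cons_append, List.getLast?_append]
          simp [hu]
        rw [h2, hend', List.head?_cons]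
        simp only [Option.some_inj]
        simp only [eq_comm]

end PlumbingGraph

namespace PlumbingGraph

open Matrix

/-! ### Columns -/

section Columns
variable {V : Type*}

theorem exists_unique_holder {f : V → ℤ} {S : Finset V} (hsum : ∑ y ∈ S, f y = -1)
    (hpos : ∀ y ∈ S, f y ≤ 0) : ∃ y ∈ S, f y = -1 ∧ ∀ z ∈ S, z ≠ y → f z = 0 := by
  classical
  have hex : ∃ y ∈ S, f y < 0 := by
    by_contra hcon
    push Not at hcon
    have := Finset.sum_nonneg hcon
    omega
  obtain ⟨y, hy, hneg⟩ := hex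
  have h1 := Finset.add_sum_erase S f hy
  have h2 : ∑ z ∈ S.erase y, f z ≤ 0 :=
    Finset.sum_nonpos fun z hz => hpos z (Finset.mem_of_mem_erase hz)
  have h3 : ∑ z ∈ S.erase y, f z = 0 := by omega
  refine ⟨y, hy, by omega, fun z hz hne => ?_⟩
  exact (Finset.sum_eq_zero_iff_of_nonpos fun z hz => hpos z (Finset.mem_of_mem_erase hz)).1 h3 z
    (Finset.mem_erase.2 ⟨hne, hz⟩)

theorem forall_eq_zero_of_sum {f : V → ℤ} {S : Finset V} (hsum : ∑ y ∈ S, f y = 0)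
    (hpos : ∀ y ∈ S, f y ≤ 0) : ∀ y ∈ S, f y = 0 :=
  (Finset.sum_eq_zero_iff_of_nonpos hpos).1 hsum

end Columns

section Conf
variable {V ι : Type*} [Fintype ι] {G : SimpleGraph V} {c : V → ι → ℤ} {h : V → ι}

theorem nonpos_of_ne_one (hh : ∀ v, IsHead (c v) (h v)) {y : V} {k : ι} (hy : c y k ≠ 1) :
    c y k ≤ 0 := by
  rcases (hh y).eq_zero_or k with h1 | h1 | h1 | h1 <;> omega

theorem IsConf.nonpos_of_pos (hC : IsConf G c) (hh : ∀ v, IsHead (c v) (h v)) {x y : V} {k : ι}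
    (hx : c x k = 1) (hy : y ≠ x) : c y k ≤ 0 :=
  nonpos_of_ne_one hh fun e => hy (hC.pos_unique hh e hx)

/-- In a column whose sum over `S` vanishes and whose positive entry lies in `S` there is exactly
one negative entry in `S`. -/
theorem IsConf.exists_holder (hC : IsConf G c) (hh : ∀ v, IsHead (c v) (h v)) {S : Finset V}
    {x : V} {k : ι} (hx : c x k = 1) (hxS : x ∈ S) (hsum : ∑ y ∈ S, c y k = 0) :
    ∃ y ∈ S, c y k = -1 ∧ ∀ z ∈ S, z ≠ x → z ≠ y → c z k = 0 := by
  classical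
  have h1 := Finset.add_sum_erase S (fun y => c y k) hxS
  obtain ⟨y, hy, h2, h3⟩ := exists_unique_holder (f := fun y => c y k) (S := S.erase x)
    (by omega)
    (fun y hy => hC.nonpos_of_pos hh hx (Finset.ne_of_mem_erase hy))
  exact ⟨y, Finset.mem_of_mem_erase hy, h2, fun z hz h4 h5 =>
    h3 z (Finset.mem_erase.2 ⟨h4, hz⟩) h5⟩

theorem exists_neg_one {x : ι → ℤ} {k : ι} (hx : IsHead x k) (h1 : x k = 1) (hd : 2 ≤ x ⬝ᵥ x) :
    ∃ j, x j = -1 := by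
  by_contra hcon
  push Not at hcon
  have : x ⬝ᵥ x = 1 := by
    unfold dotProduct
    rw [sum_eq_add_of_forall k, h1]
    · norm_num
    · intro j hj
      rcases hx.2 j hj with h2 | h2
      · rw [h2]; ring
      · exact absurd h2 (hcon j)
  omega

end Conf

/-! ### Arrow systems -/

/-- A pair `R ⊆ U` of lower sets such that every lower set between them has all column sums outside
`e₀` equal to `0` or `-1`, and the vertices outside `R` do not involve `e₀`. -/
structure ArrowSys {V ι : Type*} (c : V → ι → ℤ) (r : V) (par : V → V) (U R : Finset V) (e₀ : ι) :
    Prop where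
  lowU : Lower r par U
  lowR : Lower r par R
  sub : R ⊆ U
  off : ∀ L, Lower r par L → R ⊆ L → L ⊆ U → ∀ k, k ≠ e₀ →
    ∑ y ∈ L, c y k = 0 ∨ ∑ y ∈ L, c y k = -1
  zero : ∀ x ∈ U, x ∉ R → c x e₀ = 0

open Classical in
/-- The vertices of `R` and the proper ancestors of `x`. -/
noncomputable def pre {V : Type*} [Fintype V] (par : V → V) (R : Finset V) (x : V) : Finset V :=
  R ∪ (ancs par x).erase x

section Pre
variable {V : Type*} [Fintype V] {G : SimpleGraph V} {r : V} {par : V → V} {dep : V → ℕ}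
  {R U : Finset V}

theorem mem_pre {x a : V} : a ∈ pre par R x ↔ a ∈ R ∨ (a ≠ x ∧ Anc par a x) := by
  simp [pre]

theorem subset_pre (x : V) : R ⊆ pre par R x := fun _ ha => mem_pre.2 (Or.inl ha)

theorem not_mem_pre {x : V} (hx : x ∉ R) : x ∉ pre par R x := by
  rw [mem_pre]; tauto

theorem IsRooted.par_mem_pre (hR : IsRooted G r par dep) {x : V} (hx : x ≠ r) :
    par x ∈ pre par R x :=
  mem_pre.2 (Or.inr ⟨hR.par_ne hx, anc_par x⟩)

theorem IsRooted.lower_pre (hR : IsRooted G r par dep) (hL : Lower r par R) (x : V) :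
    Lower r par (pre par R x) := by
  refine ⟨subset_pre x hL.1, fun a ha => ?_⟩
  rcases mem_pre.1 ha with h1 | ⟨h1, h2⟩
  · exact subset_pre x (hL.2 a h1)
  · refine mem_pre.2 (Or.inr ⟨?_, (anc_par a).trans h2⟩)
    intro e
    have h3 := hR.dep_par_le a
    have h4 := hR.anc_dep_lt h2 h1
    rw [e] at h3
    omega

theorem pre_subset (hU : Lower r par U) (hs : R ⊆ U) {x : V} (hx : x ∈ U) : pre par R x ⊆ U := by
  intro a ha
  rcases mem_pre.1 ha with h1 | ⟨_, h2⟩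
  · exact hs h1
  · exact hU.anc h2 hx

theorem pre_mono {x x' : V} (hR : IsRooted G r par dep) (h1 : Anc par x' x) :
    pre par R x' ⊆ pre par R x := by
  intro a ha
  rcases mem_pre.1 ha with h2 | ⟨h2, h3⟩
  · exact subset_pre x h2
  · refine mem_pre.2 (Or.inr ⟨?_, h3.trans h1⟩)
    rintro rfl
    exact h2 (hR.anc_antisymm h3 h1)

end Pre

/-- `y` assigns to every vertex of `U` outside `R` the unique vertex of `pre x` with a negative
entry in the head column of `x`; it is the identity on the other vertices. -/
def IsArrow {V ι : Type*} [Fintype V] (c : V → ι → ℤ) (h : V → ι) (par : V → V) (U R : Finset V)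
    (y : V → V) : Prop :=
  (∀ x, x ∈ U → x ∉ R → y x ∈ pre par R x ∧ c (y x) (h x) = -1 ∧
    ∀ z ∈ pre par R x, z ≠ y x → c z (h x) = 0) ∧
  ∀ x, ¬ (x ∈ U ∧ x ∉ R) → y x = x

section Arrow
variable {V ι : Type*} [Fintype V] [Fintype ι] {G : SimpleGraph V} {c : V → ι → ℤ}
  {h : V → ι} {r : V} {par : V → V} {dep : V → ℕ} {U R : Finset V} {e₀ : ι} {y : V → V}

/-- The product of c x with the sum over L is -1. All columns except the head of x contribute
nonnegatively, so the head is 1, meets a column sum -1, and all other terms vanish. -/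
theorem ArrowSys.core (hA : ArrowSys c r par U R e₀) (hC : IsConf G c)
    (hh : ∀ v, IsHead (c v) (h v)) (hR : IsRooted G r par dep) {x : V} (hxU : x ∈ U)
    (hxR : x ∉ R) {L : Finset V} (hL : Lower r par L) (hRL : R ⊆ L) (hLU : L ⊆ U) (hxL : x ∉ L)
    (hp : par x ∈ L) :
    c x (h x) = 1 ∧ ∑ z ∈ L, c z (h x) = -1 ∧ ∀ k, c x k = -1 → ∑ z ∈ L, c z k = 0 := by
  classical
  have hd := hC.lower_dot hR hL hxL hp
  have h0 := hA.zero x hxU hxR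
  have hoff := hA.off L hL hRL hLU
  have hhe : h x ≠ e₀ := by
    intro e
    rcases (hh x).1 with h1 | h1 <;> rw [e] at h1 <;> omega
  unfold dotProduct at hd
  simp only [Finset.sum_apply] at hd
  have hnn : ∀ k, k ≠ h x → 0 ≤ (∑ z ∈ L, c z k) * c x k := by
    intro k hk
    by_cases hke : k = e₀
    · rw [hke, h0]; simp
    · rcases hoff k hke with h1 | h1 <;> rcases (hh x).2 k hk with h2 | h2 <;> rw [h1, h2] <;>
        norm_num
  rw [← Finset.add_sum_erase _ _ (Finset.mem_univ (h x))] at hd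
  have hnn' : ∀ k ∈ Finset.univ.erase (h x), 0 ≤ (∑ z ∈ L, c z k) * c x k :=
    fun k hk => hnn k (Finset.ne_of_mem_erase hk)
  have h3 := Finset.sum_nonneg hnn'
  have h4 : c x (h x) = 1 := by
    rcases (hh x).1 with h4 | h4
    · exact h4
    · rw [h4] at hd
      rcases hoff (h x) hhe with h5 | h5 <;> rw [h5] at hd <;> omega
  rw [h4] at hd
  have h5 : ∑ z ∈ L, c z (h x) = -1 := by
    rcases hoff (h x) hhe with h5 | h5
    · rw [h5] at hd; omega
    · exact h5
  rw [h5] at hd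
  refine ⟨h4, h5, fun k hk => ?_⟩
  have hkh : k ≠ h x := fun e => by rw [e] at hk; omega
  have h6 := (Finset.sum_eq_zero_iff_of_nonneg hnn').1 (by omega) k
    (Finset.mem_erase.2 ⟨hkh, Finset.mem_univ _⟩)
  rw [hk] at h6
  omega

theorem ArrowSys.core_pre (hA : ArrowSys c r par U R e₀) (hC : IsConf G c)
    (hh : ∀ v, IsHead (c v) (h v)) (hR : IsRooted G r par dep) {x : V} (hxU : x ∈ U)
    (hxR : x ∉ R) : c x (h x) = 1 ∧ ∑ z ∈ pre par R x, c z (h x) = -1 ∧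
      ∀ k, c x k = -1 → ∑ z ∈ pre par R x, c z k = 0 :=
  hA.core hC hh hR hxU hxR (hR.lower_pre hA.lowR x) (subset_pre x)
    (pre_subset hA.lowU hA.sub hxU) (not_mem_pre hxR)
    (hR.par_mem_pre fun e => hxR (e ▸ hA.lowR.1))

/-- The head column of x sums to -1 over `pre x`, and its only positive entry belongs to x, which
lies outside. -/
theorem ArrowSys.exists_arrow (hA : ArrowSys c r par U R e₀) (hC : IsConf G c)
    (hh : ∀ v, IsHead (c v) (h v)) (hR : IsRooted G r par dep) : ∃ y, IsArrow c h par U R y := by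
  classical
  have key : ∀ x, ∃ z, (x ∈ U ∧ x ∉ R → z ∈ pre par R x ∧ c z (h x) = -1 ∧
      ∀ z' ∈ pre par R x, z' ≠ z → c z' (h x) = 0) ∧ (¬ (x ∈ U ∧ x ∉ R) → z = x) := by
    intro x
    by_cases hx : x ∈ U ∧ x ∉ R
    · obtain ⟨h1, h2, -⟩ := hA.core_pre hC hh hR hx.1 hx.2
      obtain ⟨z, hz, h3, h4⟩ := exists_unique_holder h2 fun z hz =>
        hC.nonpos_of_pos hh h1 fun e => not_mem_pre hx.2 (e ▸ hz)
      exact ⟨z, fun _ => ⟨hz, h3, h4⟩, fun hn => absurd hx hn⟩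
    · exact ⟨x, fun hx' => absurd hx' hx, fun _ => rfl⟩
  choose y hy1 hy2 using key
  exact ⟨y, fun x h1 h2 => hy1 x ⟨h1, h2⟩, hy2⟩

theorem IsArrow.eq_of_holder (hy : IsArrow c h par U R y) {x z : V} (hxU : x ∈ U) (hxR : x ∉ R)
    (hz : z ∈ pre par R x) (hc : c z (h x) = -1) : y x = z := by
  by_contra hne
  have := (hy.1 x hxU hxR).2.2 z hz (Ne.symm hne)
  omega

/-- A column held by `x` whose head is not in `pre x` belongs to an arrow child of `x`. -/
theorem ArrowSys.primary (hA : ArrowSys c r par U R e₀) (hC : IsConf G c)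
    (hh : ∀ v, IsHead (c v) (h v)) (hR : IsRooted G r par dep) (hy : IsArrow c h par U R y)
    {x x' : V} {k : ι} (hxU : x ∈ U) (hxR : x ∉ R) (hk : c x k = -1) (hx'U : x' ∈ U)
    (hk' : c x' k = 1) (hpre : x' ∉ pre par R x) : x' ∉ R ∧ y x' = x := by
  classical
  have hx'R : x' ∉ R := fun e => hpre (subset_pre x e)
  have hkx : h x' = k := ((hh x').eq (Or.inl hk')).symm
  refine ⟨hx'R, ?_⟩
  by_cases hxx : x ∈ pre par R x'
  · exact hy.eq_of_holder hx'U hx'R hxx (hkx ▸ hk)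
  · exfalso
    obtain ⟨h1, h2, -⟩ := hy.1 x' hx'U hx'R
    rw [hkx] at h2
    -- This lower set contains the parent of x but not x, so column k sums to 0 over it. It has no
    -- positive entry there, since the head x' is outside, but the arrow parent of x' has a negative
    -- one.
    have hL : Lower r par (pre par R x ∪ pre par R x') :=
      (hR.lower_pre hA.lowR x).union (hR.lower_pre hA.lowR x')
    obtain ⟨-, -, h5⟩ := hA.core hC hh hR hxU hxR hL
      ((subset_pre x).trans Finset.subset_union_left)
      (Finset.union_subset (pre_subset hA.lowU hA.sub hxU) (pre_subset hA.lowU hA.sub hx'U))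
      (by rw [Finset.mem_union]; exact fun e => e.elim (not_mem_pre hxR) hxx)
      (Finset.mem_union_left _ (hR.par_mem_pre fun e => hxR (e ▸ hA.lowR.1)))
    have h6 := forall_eq_zero_of_sum (h5 k hk) (fun z hz => hC.nonpos_of_pos hh hk' (by
      rintro rfl
      rcases Finset.mem_union.1 hz with h7 | h7
      · exact hpre h7
      · exact not_mem_pre hx'R h7)) _ (Finset.mem_union_right _ h1)
    omega

/-- Column k sums to 0 over `pre x`, so the -1 at z must be balanced by the unique 1 of the column,
and no further entry is left. -/
theorem ArrowSys.head_mem_pre (hA : ArrowSys c r par U R e₀) (hC : IsConf G c)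
    (hh : ∀ v, IsHead (c v) (h v)) (hR : IsRooted G r par dep)
    {x z : V} {k : ι} (hxU : x ∈ U) (hxR : x ∉ R) (hk : c x k = -1) (hz : z ∈ pre par R x)
    (hkz : c z k = -1) : ∃ x' ∈ pre par R x, c x' k = 1 ∧
      ∀ a ∈ pre par R x, a ≠ x' → a ≠ z → c a k = 0 := by
  obtain ⟨-, -, h3⟩ := hA.core_pre hC hh hR hxU hxR
  have h4 := h3 k hk
  by_cases hex : ∃ x' ∈ pre par R x, c x' k = 1
  · obtain ⟨x', hx', h1⟩ := hex
    obtain ⟨b, hb, h5, h6⟩ := hC.exists_holder hh h1 hx' h4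
    have hbz : b = z := by
      by_contra hne
      have := h6 z hz (fun e => by rw [e] at hkz; omega) (Ne.symm hne)
      omega
    subst hbz
    exact ⟨x', hx', h1, h6⟩
  · push Not at hex
    have := forall_eq_zero_of_sum h4 (fun a ha => nonpos_of_ne_one hh (hex a ha)) z hz
    omega

/-- The heads of `R` that are used up inside `R` have their holder closer to the root. -/
def RootHolders (c : V → ι → ℤ) (h : V → ι) (dep : V → ℕ) (R : Finset V) : Prop :=
  ∀ x ∈ R, c x (h x) = 1 → ∑ z ∈ R, c z (h x) = 0 → ∃ z ∈ R, dep z < dep x ∧ c z (h x) = -1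

/-- A column that is balanced before x was balanced either by the arrow of its head or already
inside R. In both cases z precedes x' in the order given by `rnk`, which drives the descent in
`exists_common`. -/
theorem ArrowSys.holder_cases (hA : ArrowSys c r par U R e₀) (hC : IsConf G c)
    (hh : ∀ v, IsHead (c v) (h v)) (hR : IsRooted G r par dep) (hy : IsArrow c h par U R y)
    (hRH : RootHolders c h dep R) {x z x' : V} {k : ι} (hxU : x ∈ U) (hxR : x ∉ R)
    (hk : c x k = -1) (hz : z ∈ pre par R x) (hkz : c z k = -1) (hx' : x' ∈ pre par R x)
    (hkx' : c x' k = 1) :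
    (x' ∉ R ∧ x' ∈ U ∧ Anc par x' x ∧ x' ≠ x ∧ y x' = z) ∨
      (x' ∈ R ∧ z ∈ R ∧ dep z < dep x' ∧ ∑ b ∈ R, c b k = 0) := by
  classical
  obtain ⟨x'', hx'', h1, h2⟩ := hA.head_mem_pre hC hh hR hxU hxR hk hz hkz
  obtain rfl := hC.pos_unique hh h1 hkx'
  have hkx : h x'' = k := ((hh x'').eq (Or.inl hkx')).symm
  have hzx : z ≠ x'' := fun e => by rw [e] at hkz; omega
  by_cases hR' : x'' ∈ R
  · right
    have hke : k ≠ e₀ := fun e => by rw [e, hA.zero x hxU hxR] at hk; omega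
    have hsum : ∑ b ∈ R, c b k = 0 := by
      have h3 : ∑ b ∈ R, c b k = 1 + ∑ b ∈ R.erase x'', c b k := by
        rw [← Finset.add_sum_erase _ _ hR', h1]
      have h4 : ∑ b ∈ R.erase x'', c b k ≥ -1 := by
        by_cases hzR : z ∈ R.erase x''
        · rw [Finset.sum_eq_single z, hkz]
          · intro b hb hbz
            exact h2 b (subset_pre x (Finset.mem_of_mem_erase hb)) (Finset.ne_of_mem_erase hb) hbz
          · exact fun e => absurd hzR e
        · rw [Finset.sum_eq_zero]
          · norm_num
          · intro b hb
            exact h2 b (subset_pre x (Finset.mem_of_mem_erase hb)) (Finset.ne_of_mem_erase hb)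
              fun e => hzR (e ▸ hb)
      rcases hA.off R hA.lowR subset_rfl hA.sub k hke with h5 | h5 <;> omega
    obtain ⟨b, hb, h3, h4⟩ := hRH x'' hR' (by rw [hkx]; exact h1) (by rw [hkx]; exact hsum)
    rw [hkx] at h4
    have : b = z := by
      by_contra hne
      have := h2 b (subset_pre x hb) (fun e => by rw [e] at h4; omega) hne
      omega
    subst this
    exact ⟨hR', hb, h3, hsum⟩
  · left
    rcases mem_pre.1 hx'' with h3 | ⟨h3, h4⟩
    · exact absurd h3 hR'
    · have hU' : x'' ∈ U := hA.lowU.anc h4 hxU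
      refine ⟨hR', hU', h4, h3, ?_⟩
      obtain ⟨h5, h6, -⟩ := hy.1 x'' hU' hR'
      rw [hkx] at h6
      by_contra hne
      have := h2 _ (pre_mono hR h4 h5) (fun e => by rw [e] at h6; omega) hne
      omega

open Classical in
/-- An order in which the vertices of `R` come first, then those outside, by depth. -/
noncomputable def rnk (dep : V → ℕ) (R : Finset V) (x : V) : ℕ :=
  if x ∈ R then dep x else R.sup dep + 1 + dep x

theorem rnk_lt_of_mem_pre (hR : IsRooted G r par dep) {x z : V} (hx : x ∉ R)
    (hz : z ∈ pre par R x) : rnk dep R z < rnk dep R x := by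
  unfold rnk
  rw [if_neg hx]
  split_ifs with h1
  · have := Finset.le_sup (f := dep) h1
    omega
  · rcases mem_pre.1 hz with h2 | ⟨h2, h3⟩
    · exact absurd h2 h1
    · have := hR.anc_dep_lt h3 h2
      omega

/-- If `x` holds a column used before, then it holds one also held by its arrow parent. -/
theorem ArrowSys.exists_common (hA : ArrowSys c r par U R e₀) (hC : IsConf G c)
    (hh : ∀ v, IsHead (c v) (h v)) (hR : IsRooted G r par dep) (hy : IsArrow c h par U R y)
    (hRH : RootHolders c h dep R) {x : V} (hxU : x ∈ U) (hxR : x ∉ R) :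
    ∀ {x' : V} {k : ι}, c x k = -1 → x' ∈ pre par R x → c x' k = 1 →
      ∃ k, c x k = -1 ∧ c (y x) k = -1 := by
  classical
  have key : ∀ n, ∀ x' k, rnk dep R x' = n → c x k = -1 → x' ∈ pre par R x → c x' k = 1 →
      ∃ k, c x k = -1 ∧ c (y x) k = -1 := by
    intro n
    induction n using Nat.strong_induction_on with
    | _ n ih =>
      intro x' k hn hk hx' hkx'
      obtain ⟨hx1, -, hsum⟩ := hA.core_pre hC hh hR hxU hxR
      obtain ⟨z, hz, hkz, -⟩ := hC.exists_holder hh hkx' hx' (hsum k hk)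
      by_cases hzy : z = y x
      · exact ⟨k, hk, hzy ▸ hkz⟩
      have hzx : z ≠ x := fun e => not_mem_pre hxR (e ▸ hz)
      have hhx0 : c z (h x) = 0 := (hy.1 x hxU hxR).2.2 z hz hzy
      have hrnk : rnk dep R z < n := by
        rw [← hn]
        rcases hA.holder_cases hC hh hR hy hRH hxU hxR hk hz hkz hx' hkx' with
          ⟨h1, h2, h3, h4, h5⟩ | ⟨h1, h2, h3, -⟩
        · rw [← h5]
          exact rnk_lt_of_mem_pre hR h1 (hy.1 x' h2 h1).1
        · unfold rnk; rw [if_pos h1, if_pos h2]; exact h3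
      have hd := hC.dot_nonpos hzx.symm
      -- The shared column k contributes 1 to the nonpositive product of x and z, and the head of x
      -- meets a zero of z. The compensation must come from the head of z, which x therefore holds;
      -- now z takes the place of x'.
      have hneg : c x (h z) = -1 ∧ c z (h z) = 1 := by
        by_contra hcon
        have hkx : k ≠ h x := fun e => by rw [e] at hk; omega
        have := le_sum_of_forall (f := fun j => c x j * c z j) k (by
          intro j hj
          by_cases h1 : j = h x
          · rw [h1, hhx0]; simp
          · rcases (hh x).2 j h1 with h2 | h2
            · rw [h2]; simp
            · by_cases h3 : j = h z
              · rcases (hh z).1 with h4 | h4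
                · exact absurd ⟨h3 ▸ h2, h4⟩ hcon
                · rw [h2, h3, h4]; norm_num
              · rcases (hh z).2 j h3 with h4 | h4 <;> rw [h2, h4] <;> norm_num)
        unfold dotProduct at hd
        simp only [hk, hkz] at this
        omega
      exact ih _ hrnk z (h z) rfl hneg.1 hz hneg.2
  exact fun {x' k} h1 h2 h3 => key _ x' k rfl h1 h2 h3

theorem IsArrow.not_mem_of_anc (hy : IsArrow c h par U R y) {a z : V} (hz : Anc y a z)
    (hne : z ≠ a) : z ∈ U ∧ z ∉ R := by
  by_contra hcon
  obtain ⟨n, rfl⟩ := hz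
  exact hne (Function.iterate_fixed (hy.2 z hcon) n).symm

/-- A column shared with the arrow parent a would have as its head an earlier arrow child of a. With
no shared column, `exists_common` also rules out all heads occurring before x, so everything x holds
is new. -/
theorem ArrowSys.least_child (hA : ArrowSys c r par U R e₀) (hC : IsConf G c)
    (hh : ∀ v, IsHead (c v) (h v)) (hR : IsRooted G r par dep) (hy : IsArrow c h par U R y)
    (hRH : RootHolders c h dep R) {a x : V}
    (ha : a ∈ R → ∀ b ∈ R, ∑ z ∈ R, c z (h b) = 0 → c a (h b) ≠ -1)
    (hxU : x ∈ U) (hxR : x ∉ R) (hyx : y x = a)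
    (hmin : ∀ z ∈ U, z ∉ R → y z = a → dep x ≤ dep z) (k : ι) (hk : c x k = -1) :
    c a k ≠ -1 ∧ ∀ x' ∈ pre par R x, c x' k ≠ 1 := by
  have key : ∀ k, c x k = -1 → c a k ≠ -1 := by
    intro k hk hka
    have hapre : a ∈ pre par R x := hyx ▸ (hy.1 x hxU hxR).1
    obtain ⟨x', hx', hkx', -⟩ := hA.head_mem_pre hC hh hR hxU hxR hk hapre hka
    rcases hA.holder_cases hC hh hR hy hRH hxU hxR hk hapre hka hx' hkx' with
      ⟨h1, h2, h3, h4, h5⟩ | ⟨h1, h2, h3, h4⟩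
    · have h6 := hmin x' h2 h1 h5
      have h7 := hR.anc_dep_lt h3 h4
      omega
    · have hkx : h x' = k := ((hh x').eq (Or.inl hkx')).symm
      exact ha h2 x' h1 (hkx ▸ h4) (hkx ▸ hka)
  refine ⟨key k hk, fun x' hx' h1 => ?_⟩
  obtain ⟨k', h2, h3⟩ := hA.exists_common hC hh hR hy hRH hxU hxR hk hx' h1
  exact key k' h2 (hyx ▸ h3)

/-- If `a` has an arrow child, then some strict arrow descendant of `a` holds a column whose head
is not in `U`. -/
theorem ArrowSys.exists_mark (hA : ArrowSys c r par U R e₀) (hC : IsConf G c)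
    (hh : ∀ v, IsHead (c v) (h v)) (hR : IsRooted G r par dep) (hy : IsArrow c h par U R y)
    (hRH : RootHolders c h dep R) (hd : ∀ x ∈ U, x ∉ R → 2 ≤ c x ⬝ᵥ c x) {a x₀ : V}
    (ha : a ∈ R → ∀ b ∈ R, ∑ z ∈ R, c z (h b) = 0 → c a (h b) ≠ -1)
    (hx₀U : x₀ ∈ U) (hx₀R : x₀ ∉ R) (hx₀ : y x₀ = a) :
    ∃ z, Anc y a z ∧ z ≠ a ∧ ∃ k, c z k = -1 ∧ ∀ x ∈ U, c x k ≠ 1 := by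
  classical
  -- Among the arrow descendants having children take the last one, b, and its least child x. Then x
  -- has no arrow children and holds only new columns; a head of such a column in U would be an
  -- arrow child of x by `primary`.
  let S : Finset V := Finset.univ.filter fun b => Anc y a b ∧ ∃ x ∈ U, x ∉ R ∧ y x = b
  have hS : S.Nonempty := ⟨a, by simp only [S, Finset.mem_filter, Finset.mem_univ, true_and]
                                 exact ⟨Anc.refl a, x₀, hx₀U, hx₀R, hx₀⟩⟩
  obtain ⟨b, hbS, hbmax⟩ := S.exists_max_image (rnk dep R) hS
  simp only [S, Finset.mem_filter, Finset.mem_univ, true_and] at hbS hbmax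
  obtain ⟨hab, x₁, hx₁U, hx₁R, hx₁⟩ := hbS
  let T : Finset V := Finset.univ.filter fun x => x ∈ U ∧ x ∉ R ∧ y x = b
  have hT : T.Nonempty := ⟨x₁, by simp [T, hx₁U, hx₁R, hx₁]⟩
  obtain ⟨x, hxT, hxmin⟩ := T.exists_min_image dep hT
  simp only [T, Finset.mem_filter, Finset.mem_univ, true_and] at hxT hxmin
  obtain ⟨hxU, hxR, hyx⟩ := hxT
  have hrx : rnk dep R b < rnk dep R x :=
    rnk_lt_of_mem_pre hR hxR (hyx ▸ (hy.1 x hxU hxR).1)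
  have hax : Anc y a x := hab.trans (hyx ▸ anc_par x)
  have hxa : x ≠ a := by
    rintro rfl
    have := hbmax x ⟨Anc.refl x, x₀, hx₀U, hx₀R, hx₀⟩
    omega
  have hb : b ∈ R → ∀ d ∈ R, ∑ z ∈ R, c z (h d) = 0 → c b (h d) ≠ -1 := by
    intro hbR
    have : b = a := by
      by_contra hne
      exact (hy.not_mem_of_anc hab hne).2 hbR
    subst this
    exact ha hbR
  have hlc := hA.least_child hC hh hR hy hRH hb hxU hxR hyx
    (fun z h1 h2 h3 => hxmin z ⟨h1, h2, h3⟩)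
  obtain ⟨k, hk⟩ := exists_neg_one (hh x) (hA.core_pre hC hh hR hxU hxR).1 (hd x hxU hxR)
  refine ⟨x, hax, hxa, k, hk, fun x' hx'U hx' => ?_⟩
  by_cases hpre : x' ∈ pre par R x
  · exact (hlc k hk).2 x' hpre hx'
  · obtain ⟨h1, h2⟩ := hA.primary hC hh hR hy hxU hxR hk hx'U hx' hpre
    have := hbmax x ⟨hax, x', hx'U, h1, h2⟩
    omega

end Arrow

end PlumbingGraph

/-! ### Heads of sums and shared columns -/

namespace PlumbingGraph

open Matrix

section Prelim
variable {V ι : Type*} [Fintype V] [Fintype ι] {G : SimpleGraph V} {c : V → ι → ℤ}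
  {h : V → ι} {r : V} {par : V → V} {dep : V → ℕ}

/-- The sum over a connected set is a sphere, so an entry 1 or -2 is its head and leaves only 0 and
-1 elsewhere. -/
theorem IsConf.off_of_head (hC : IsConf G c) (hR : IsRooted G r par dep) {S : Finset V} {t : V}
    (hS : ConnTop r par S t) {e₀ : ι} (he : ∑ x ∈ S, c x e₀ = 1 ∨ ∑ x ∈ S, c x e₀ = -2) (k : ι)
    (hk : k ≠ e₀) : ∑ x ∈ S, c x k = 0 ∨ ∑ x ∈ S, c x k = -1 := by
  obtain ⟨j, hj⟩ := (hC.sph_sum hR hS).exists_head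
  have h1 : e₀ = j := hj.eq (by simpa [Finset.sum_apply] using he)
  subst h1
  simpa [Finset.sum_apply] using hj.2 k hk

theorem IsConf.sum_mem (hC : IsConf G c) (hR : IsRooted G r par dep) {S : Finset V} {t : V}
    (hS : ConnTop r par S t) (k : ι) : -2 ≤ ∑ x ∈ S, c x k ∧ ∑ x ∈ S, c x k ≤ 1 := by
  obtain ⟨j, hj⟩ := (hC.sph_sum hR hS).exists_head
  have := hj.eq_zero_or k
  simp only [Finset.sum_apply] at this
  omega

theorem IsConf.dot_sum_nonpos (hC : IsConf G c) {S S' : Finset V} (hd : Disjoint S S') :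
    (∑ x ∈ S, c x) ⬝ᵥ (∑ x ∈ S', c x) ≤ 0 := by
  rw [sum_dotProduct]
  refine Finset.sum_nonpos fun x hx => ?_
  rw [dotProduct_sum]
  refine Finset.sum_nonpos fun z hz => hC.dot_nonpos ?_
  rintro rfl
  exact Finset.disjoint_left.1 hd hx hz

theorem exists_pos_of_sum {f : ι → ℤ} {k : ι} (hs : 0 ≤ ∑ j, f j) (hk : f k < 0) :
    ∃ j, 0 < f j := by
  by_contra hcon
  push Not at hcon
  have := Finset.sum_lt_sum (s := Finset.univ) (f := f) (g := fun _ => 0) (fun j _ => hcon j)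
    ⟨k, Finset.mem_univ k, hk⟩
  simp at this
  omega

/-- Two vertices with positive heads and nonnegative product share a column once one of them holds
the head of the other. -/
theorem IsConf.exists_common_of_dot (hC : IsConf G c) (hh : ∀ v, IsHead (c v) (h v)) {a b : V}
    (hab : a ≠ b) (ha : c a (h a) = 1) (hb : c b (h b) = 1) (hdot : 0 ≤ c a ⬝ᵥ c b) {k : ι}
    (hk : c a k * c b k < 0) : ∃ j, c a j = -1 ∧ c b j = -1 := by
  obtain ⟨j, hj⟩ := exists_pos_of_sum hdot hk
  refine ⟨j, ?_⟩
  have hn : ∀ v, c v (h v) = 1 → c v j ≠ -2 := by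
    intro v hv e
    have := (hh v).eq (Or.inr e)
    rw [this] at e
    omega
  have h1 := hn a ha
  have h2 := hn b hb
  rcases (hh a).eq_zero_or j with h3 | h3 | h3 | h3 <;>
    rcases (hh b).eq_zero_or j with h4 | h4 | h4 | h4 <;>
    first
    | exact ⟨h3, h4⟩
    | exact absurd h3 h1
    | exact absurd h4 h2
    | exact absurd (hC.pos_unique hh h3 h4) hab
    | (rw [h3, h4] at hj; norm_num at hj)

/-- Positive heads are distinct, so as many of them as there are columns exhaust the columns. -/
theorem IsConf.forall_exists_head (hC : IsConf G c) (hh : ∀ v, IsHead (c v) (h v))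
    (hcard : Fintype.card ι = Fintype.card V) (hpos : ∀ v, c v (h v) = 1) (k : ι) :
    ∃ v, c v k = 1 := by
  have hinj : Function.Injective h := fun a b hab => hC.pos_unique hh (hpos a) (hab ▸ hpos b)
  have hbij := (Fintype.bijective_iff_injective_and_card h).2 ⟨hinj, hcard.symm⟩
  obtain ⟨v, rfl⟩ := hbij.2 k
  exact ⟨v, hpos v⟩

theorem rnk_le_of_anc {U R : Finset V} {y : V → V} (hR : IsRooted G r par dep)
    (hy : IsArrow c h par U R y) {a x : V} (ha : Anc y a x) : rnk dep R a ≤ rnk dep R x := by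
  obtain ⟨n, rfl⟩ := ha
  induction n with
  | zero => exact le_rfl
  | succ n ih =>
    rw [Function.iterate_succ_apply']
    refine le_trans ?_ ih
    set z := y^[n] x
    by_cases hz : z ∈ U ∧ z ∉ R
    · exact (rnk_lt_of_mem_pre hR hz.2 (hy.1 z hz.1 hz.2).1).le
    · rw [hy.2 z hz]

end Prelim

/-! ### Three vertices holding the head of the root -/

/-- The column `e₀` has entry `1` at the root, `-1` at the three vertices `w i`, and `0` elsewhere. -/
structure Tri {V ι : Type*} [Fintype V] [Fintype ι] (G : SimpleGraph V) (c : V → ι → ℤ)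
    (h : V → ι) (r : V) (par : V → V) (dep : V → ℕ) (e₀ : ι) (w : Fin 3 → V) : Prop where
  conf : IsConf G c
  heads : ∀ v, IsHead (c v) (h v)
  rooted : IsRooted G r par dep
  two_le : ∀ v, 2 ≤ c v ⬝ᵥ c v
  card : Fintype.card ι = Fintype.card V
  root : c r e₀ = 1
  hold : ∀ i, c (w i) e₀ = -1
  other : ∀ v, v ≠ r → (∀ i, v ≠ w i) → c v e₀ = 0
  inj : Function.Injective w

open Classical in
/-- The vertices that are not descendants of the `w i`. -/
noncomputable def core {V : Type*} [Fintype V] (par : V → V) (w : Fin 3 → V) : Finset V :=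
  Finset.univ.filter fun x => ∀ i, ¬ Anc par (w i) x

open Classical in
/-- The core together with the `w i`. -/
noncomputable def coreW {V : Type*} [Fintype V] (par : V → V) (w : Fin 3 → V) : Finset V :=
  core par w ∪ Finset.univ.image w

namespace Tri

section
variable {V ι : Type*} [Fintype V] [Fintype ι] {G : SimpleGraph V} {c : V → ι → ℤ}
  {h : V → ι} {r : V} {par : V → V} {dep : V → ℕ} {e₀ : ι} {w : Fin 3 → V}

theorem ne_root (t : Tri G c h r par dep e₀ w) (i : Fin 3) : w i ≠ r := by
  intro e
  have h1 := t.hold i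
  rw [e, t.root] at h1
  omega

theorem head_root (t : Tri G c h r par dep e₀ w) : h r = e₀ :=
  ((t.heads r).eq (Or.inl t.root)).symm

theorem sum_e₀ [DecidableEq V] (t : Tri G c h r par dep e₀ w) (S : Finset V) :
    ∑ v ∈ S, c v e₀ = (if r ∈ S then 1 else 0) - ∑ i, if w i ∈ S then 1 else 0 := by
  have h1 : ∀ v, c v e₀ = (if v = r then 1 else 0) - ∑ i, if v = w i then 1 else 0 := by
    intro v
    by_cases hv : v = r
    · rw [hv, t.root, if_pos rfl, Finset.sum_eq_zero fun i _ => if_neg (t.ne_root i).symm]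
      ring
    · by_cases hw : ∃ i, v = w i
      · obtain ⟨i, rfl⟩ := hw
        rw [t.hold, if_neg hv, Finset.sum_eq_single i]
        · simp
        · intro j _ hj
          rw [if_neg fun e => hj (t.inj e).symm]
        · simp
      · push Not at hw
        rw [t.other v hv hw, if_neg hv, Finset.sum_eq_zero fun i _ => if_neg (hw i)]
        ring
  rw [Finset.sum_congr rfl fun v _ => h1 v, Finset.sum_sub_distrib, Finset.sum_comm]
  congr 1
  · simp
  · exact Finset.sum_congr rfl fun i _ => by simp

/-- If w j lies below w i, the subtree at w i has sum -2 in column e₀, since a sphere allows no less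
and so the third w l stays outside. The subtree at w l is then disjoint from it and has sum -1
there. The two sums have product at least 2 - 1, as in `IsConf.neg_two`, but disjoint sets have
nonpositive product. -/
theorem incomparable (t : Tri G c h r par dep e₀ w) {i j : Fin 3} (hij : i ≠ j) :
    ¬ Anc par (w i) (w j) := by
  classical
  intro hanc
  have hroot : ∀ a, r ∉ descs par (w a) := by
    intro a ha
    rw [mem_descs] at ha
    exact t.ne_root a (t.rooted.anc_root ha)
  have hself : ∀ a, w a ∈ descs par (w a) := fun a => by simpa using Anc.refl _
  obtain ⟨l, hli, hlj⟩ : ∃ l, l ≠ i ∧ l ≠ j := by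
    clear hanc; revert i j; decide
  have huniv : (Finset.univ : Finset (Fin 3)) = {i, j, l} := by
    clear hanc; revert i j l; decide
  have hsum : ∀ a, ∑ v ∈ descs par (w a), c v e₀ = -((if w i ∈ descs par (w a) then 1 else 0) +
      (if w j ∈ descs par (w a) then 1 else 0) + if w l ∈ descs par (w a) then 1 else 0) := by
    intro a
    rw [t.sum_e₀, if_neg (hroot a), huniv, Finset.sum_insert, Finset.sum_insert,
      Finset.sum_singleton]
    · ring
    · simpa using hlj.symm
    · simp [hij, hli.symm]
  have hb : ∀ a, -2 ≤ ∑ v ∈ descs par (w a), c v e₀ := fun a =>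
    (t.conf.sum_mem t.rooted (connTop_descs t.rooted (w a)) e₀).1
  have hwj : w j ∈ descs par (w i) := by simpa using hanc
  have hwl : w l ∉ descs par (w i) := by
    intro e
    have h1 := hb i
    rw [hsum, if_pos (hself i), if_pos hwj, if_pos e] at h1
    norm_num at h1
  have hwi : w i ∉ descs par (w l) := by
    intro e
    have e' : w j ∈ descs par (w l) := by
      rw [mem_descs] at e ⊢; exact e.trans hanc
    have h1 := hb l
    rw [hsum, if_pos (hself l), if_pos e, if_pos e'] at h1
    norm_num at h1
  have hwj' : w j ∉ descs par (w l) := by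
    intro e
    rw [mem_descs] at e
    rcases Anc.total e hanc with h1 | h1
    · exact hwi (by simpa using h1)
    · exact hwl (by simpa using h1)
  have hdisj : Disjoint (descs par (w i)) (descs par (w l)) := by
    rw [Finset.disjoint_left]
    intro a ha hb
    rw [mem_descs] at ha hb
    rcases Anc.total ha hb with h1 | h1
    · exact hwl (by simpa using h1)
    · exact hwi (by simpa using h1)
  have hS : ∑ v ∈ descs par (w i), c v e₀ = -2 := by
    rw [hsum, if_pos (hself i), if_pos hwj, if_neg hwl]; norm_num
  have hS' : ∑ v ∈ descs par (w l), c v e₀ = -1 := by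
    rw [hsum, if_pos (hself l), if_neg hwi, if_neg hwj']; norm_num
  have hdot := t.conf.dot_sum_nonpos hdisj
  obtain ⟨g, hg⟩ := (t.conf.sph_sum t.rooted (connTop_descs t.rooted (w l))).exists_head
  have hoff := t.conf.off_of_head t.rooted (connTop_descs t.rooted (w i)) (Or.inr hS)
  have hge : e₀ ≠ g := by
    rintro rfl
    have := hg.1
    simp only [Finset.sum_apply, hS'] at this
    omega
  unfold dotProduct at hdot
  simp only [Finset.sum_apply] at hdot
  have h1 := add_le_sum_of_forall (f := fun k => (∑ v ∈ descs par (w i), c v k) *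
    ∑ v ∈ descs par (w l), c v k) e₀ g hge (by
      intro k hk hkg
      have h2 := hg.2 k hkg
      simp only [Finset.sum_apply] at h2
      rcases hoff k hk with h3 | h3 <;> rcases h2 with h4 | h4 <;> simp [h3, h4])
  simp only [hS, hS'] at h1
  have h2 := hg.1
  simp only [Finset.sum_apply] at h2
  rcases hoff g hge.symm with h3 | h3 <;> rcases h2 with h4 | h4 <;> simp only [h3, h4] at h1 <;>
    omega

theorem mem_core {x : V} : x ∈ core par w ↔ ∀ i, ¬ Anc par (w i) x := by simp [core]

theorem mem_coreW {x : V} : x ∈ coreW par w ↔ x ∈ core par w ∨ ∃ i, w i = x := by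
  simp [coreW]

theorem root_mem (t : Tri G c h r par dep e₀ w) : r ∈ core par w :=
  mem_core.2 fun i hi => t.ne_root i (t.rooted.anc_root hi)

theorem lower_core (t : Tri G c h r par dep e₀ w) : Lower r par (core par w) :=
  ⟨t.root_mem, fun x hx => mem_core.2 fun i hi => mem_core.1 hx i (hi.trans (anc_par x))⟩

theorem w_not_mem (i : Fin 3) : w i ∉ core par w := fun hi => mem_core.1 hi i (Anc.refl _)

theorem par_w (t : Tri G c h r par dep e₀ w) (i : Fin 3) : par (w i) ∈ core par w := by
  refine mem_core.2 fun j hj => ?_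
  have h1 : Anc par (w j) (w i) := hj.trans (anc_par _)
  by_cases hij : j = i
  · subst hij
    have h2 := t.rooted.anc_antisymm (anc_par (w j)) hj
    exact t.rooted.par_ne (t.ne_root j) h2
  · exact t.incomparable hij h1

theorem core_subset : core par w ⊆ coreW par w := fun _ hx => mem_coreW.2 (Or.inl hx)

theorem w_mem (i : Fin 3) : w i ∈ coreW par w := mem_coreW.2 (Or.inr ⟨i, rfl⟩)

theorem lower_coreW (t : Tri G c h r par dep e₀ w) : Lower r par (coreW par w) := by
  refine ⟨core_subset t.root_mem, fun x hx => ?_⟩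
  rcases mem_coreW.1 hx with h1 | ⟨i, rfl⟩
  · exact core_subset (t.lower_core.2 x h1)
  · exact core_subset (t.par_w i)

/-- No w i lies in the core, so a lower set inside it sums to 1 in column e₀ and has its head there.
-/
theorem sys_core (t : Tri G c h r par dep e₀ w) : ArrowSys c r par (core par w) {r} e₀ := by
  classical
  refine ⟨t.lower_core, t.rooted.lower_singleton, by simpa using t.root_mem, ?_, ?_⟩
  · intro L hL _ hLU
    refine t.conf.off_of_head t.rooted hL.connTop (Or.inl ?_)
    rw [t.sum_e₀, if_pos hL.1, Finset.sum_eq_zero fun i _ => if_neg fun hi => w_not_mem i (hLU hi)]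
    norm_num
  · intro x hx hxr
    refine t.other x (by simpa using hxr) ?_
    rintro i rfl
    exact w_not_mem i hx

theorem sum_coreW_e₀ (t : Tri G c h r par dep e₀ w) : ∑ v ∈ coreW par w, c v e₀ = -2 := by
  classical
  rw [t.sum_e₀, if_pos t.lower_coreW.1, Finset.sum_congr rfl fun i _ => if_pos (w_mem i)]
  simp

/-- Once all three w i are included, the sum in column e₀ is 1 - 3 = -2, so the head stays at e₀. -/
theorem sys_coreW (t : Tri G c h r par dep e₀ w) :
    ArrowSys c r par Finset.univ (coreW par w) e₀ := by
  classical
  refine ⟨Lower.univ, t.lower_coreW, Finset.subset_univ _, ?_, ?_⟩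
  · intro L hL hRL _
    refine t.conf.off_of_head t.rooted hL.connTop (Or.inr ?_)
    rw [t.sum_e₀, if_pos hL.1, Finset.sum_congr rfl fun i _ => if_pos (hRL (w_mem i))]
    simp
  · intro x _ hx
    refine t.other x ?_ ?_
    · rintro rfl; exact hx (core_subset t.root_mem)
    · rintro i rfl; exact hx (w_mem i)

theorem core_pos (t : Tri G c h r par dep e₀ w) {x : V} (hx : x ∈ core par w) : c x (h x) = 1 := by
  by_cases hxr : x = r
  · rw [hxr, t.head_root, t.root]
  · exact (t.sys_core.core_pre t.conf t.heads t.rooted hx (by simpa using hxr)).1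

theorem out_pos (t : Tri G c h r par dep e₀ w) {x : V} (hx : x ∉ coreW par w) : c x (h x) = 1 :=
  (t.sys_coreW.core_pre t.conf t.heads t.rooted (Finset.mem_univ _) hx).1

theorem sum_core_e₀ (t : Tri G c h r par dep e₀ w) : ∑ v ∈ core par w, c v e₀ = 1 := by
  classical
  rw [t.sum_e₀, if_pos t.root_mem, Finset.sum_eq_zero fun i _ => if_neg (w_not_mem i)]
  simp

theorem off_core (t : Tri G c h r par dep e₀ w) {k : ι} (hk : k ≠ e₀) :
    ∑ v ∈ core par w, c v k = 0 ∨ ∑ v ∈ core par w, c v k = -1 :=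
  t.sys_core.off _ t.lower_core (by simpa using t.root_mem) subset_rfl k hk

theorem off_coreW (t : Tri G c h r par dep e₀ w) {k : ι} (hk : k ≠ e₀) :
    ∑ v ∈ coreW par w, c v k = 0 ∨ ∑ v ∈ coreW par w, c v k = -1 :=
  t.sys_coreW.off _ t.lower_coreW subset_rfl (Finset.subset_univ _) k hk

theorem sum_coreW (t : Tri G c h r par dep e₀ w) (k : ι) :
    ∑ v ∈ coreW par w, c v k = ∑ v ∈ core par w, c v k + ∑ i, c (w i) k := by
  classical
  unfold coreW
  rw [Finset.sum_union, Finset.sum_image fun i _ j _ e => t.inj e]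
  rw [Finset.disjoint_left]
  intro a ha hb
  obtain ⟨i, -, rfl⟩ := Finset.mem_image.1 hb
  exact w_not_mem i ha

theorem root_holders_core (t : Tri G c h r par dep e₀ w) : RootHolders c h dep {r} := by
  intro x hx _ hs
  rw [Finset.mem_singleton] at hx
  rw [hx, t.head_root, Finset.sum_singleton, t.root] at hs
  omega

theorem out_not_adj (t : Tri G c h r par dep e₀ w) {u x : V} (hu : u ∉ coreW par w)
    (hx : x ∈ core par w) : ¬ G.Adj u x := by
  intro hadj
  rcases (t.rooted.adj_iff _ _).1 hadj with ⟨h1, h2⟩ | ⟨h1, h2⟩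
  · have h3 : u ∉ core par w := fun e => hu (core_subset e)
    rw [mem_core] at h3
    push Not at h3
    obtain ⟨i, hi⟩ := h3
    rcases hi.eq_or with h4 | h4
    · exact hu (h4 ▸ w_mem i)
    · rw [h2] at h4
      exact mem_core.1 hx i h4
  · exact hu (core_subset (h2 ▸ t.lower_core.2 x hx))

/-- No column held in the core has its head outside of `coreW`, and no head column of the core is
held outside of `coreW`. -/
theorem out_aux (t : Tri G c h r par dep e₀ w)
    (hstar : ∀ i, c (w i) (h (w i)) = 1 → ∑ v ∈ core par w, c v (h (w i)) = 0 ∨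
      ∑ v ∈ coreW par w, c v (h (w i)) = -1) :
    ∀ n u, dep u = n → u ∉ coreW par w →
      (∀ x ∈ core par w, c u (h x) ≠ -1) ∧ ∀ z ∈ core par w, c z (h u) = 0 := by
  classical
  obtain ⟨y, hy⟩ := t.sys_core.exists_arrow t.conf t.heads t.rooted
  intro n
  induction n using Nat.strong_induction_on with
  | _ n ih =>
    intro u hn hu
    have hupos := t.out_pos hu
    have hue : c u e₀ = 0 := t.sys_coreW.zero u (Finset.mem_univ _) hu
    have hnad : ∀ x ∈ core par w, c u ⬝ᵥ c x = 0 := fun x hx =>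
      t.conf.nadj _ _ (fun e => hu (core_subset (e ▸ hx))) (t.out_not_adj hu hx)
    -- The head of a column shared by u and x comes before u. In the core it has x as its arrow
    -- parent and is therefore deeper. At a w i the assumption on column sums excludes it, and
    -- outside `coreW` the induction hypothesis does.
    have hcom : ∀ x ∈ core par w, ∀ j, c u j = -1 → c x j = -1 →
        ∃ x' ∈ core par w, c u (h x') = -1 ∧ dep x < dep x' := by
      intro x hx j huj hxj
      have hxpre : x ∈ pre par (coreW par w) u := subset_pre u (core_subset hx)
      obtain ⟨x', hx', h1, h2⟩ := t.sys_coreW.head_mem_pre t.conf t.heads t.rooted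
        (Finset.mem_univ u) hu huj hxpre hxj
      have hjx : h x' = j := ((t.heads x').eq (Or.inl h1)).symm
      have hxx' : x ≠ x' := fun e => by rw [e] at hxj; omega
      by_cases hc : x' ∈ core par w
      · refine ⟨x', hc, hjx ▸ huj, ?_⟩
        have hx'r : x' ∉ ({r} : Finset V) := by
          rw [Finset.mem_singleton]
          rintro rfl
          rw [t.head_root] at hjx
          rw [← hjx] at huj
          omega
        obtain ⟨h3, h4, -⟩ := hy.1 x' hc hx'r
        rw [hjx] at h4
        have h5 : y x' ∈ core par w := pre_subset t.lower_core (by simpa using t.root_mem) hc h3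
        have h6 : y x' = x := by
          by_contra hne
          have := h2 _ (subset_pre u (core_subset h5)) (fun e => by rw [e] at h4; omega) hne
          omega
        rw [h6] at h3
        rcases mem_pre.1 h3 with h7 | ⟨h7, h8⟩
        · rw [Finset.mem_singleton] at h7 hx'r
          rw [h7]
          exact t.rooted.dep_root_lt hx'r
        · exact t.rooted.anc_dep_lt h8 h7
      · exfalso
        by_cases hcw : x' ∈ coreW par w
        · obtain ⟨i, hi⟩ := (mem_coreW.1 hcw).resolve_left hc
          rcases hstar i (by rw [hi, hjx, h1]) with h3 | h3
          · rw [hi, hjx] at h3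
            have := forall_eq_zero_of_sum h3 (fun v hv => t.conf.nonpos_of_pos t.heads h1
              fun e => hc (e ▸ hv)) x hx
            omega
          · rw [hi, hjx, ← Finset.add_sum_erase _ _ hcw, Finset.sum_eq_single x] at h3
            · omega
            · intro b hb hbx
              exact h2 b (subset_pre u (Finset.mem_of_mem_erase hb)) (Finset.ne_of_mem_erase hb) hbx
            · exact fun e => absurd (Finset.mem_erase.2 ⟨hxx', core_subset hx⟩) e
        · rcases mem_pre.1 hx' with h3 | ⟨h3, h4⟩
          · exact hcw h3
          · have h5 := (ih _ (hn ▸ t.rooted.anc_dep_lt h4 h3) x' rfl hcw).2 x hx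
            rw [hjx] at h5
            omega
    -- For a deepest such x the product with u is zero although u holds the head of x. So the two
    -- share a column, and `hcom` produces a deeper one.
    have claim1 : ∀ x ∈ core par w, c u (h x) ≠ -1 := by
      by_contra hcon
      push Not at hcon
      let S : Finset V := (core par w).filter fun x => c u (h x) = -1
      have hS : S.Nonempty := by
        obtain ⟨x, hx, h1⟩ := hcon
        exact ⟨x, by simp [S, hx, h1]⟩
      obtain ⟨x, hxS, hmax⟩ := S.exists_max_image dep hS
      simp only [S, Finset.mem_filter] at hxS hmax
      obtain ⟨hx, hux⟩ := hxS
      have hxpos := t.core_pos hx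
      obtain ⟨j, h1, h2⟩ := t.conf.exists_common_of_dot t.heads
        (fun e : u = x => hu (core_subset (e ▸ hx))) hupos hxpos (hnad x hx).ge (k := h x)
        (by rw [hux, hxpos]; norm_num)
      obtain ⟨x', hx', h3, h4⟩ := hcom x hx j h1 h2
      have := hmax x' ⟨hx', h3⟩
      omega
    refine ⟨claim1, fun z hz => ?_⟩
    by_contra hne
    have hzu : z ≠ u := fun e => hu (core_subset (e ▸ hz))
    have h0 := t.conf.nonpos_of_pos t.heads hupos hzu
    obtain ⟨j, h1, h2⟩ := t.conf.exists_common_of_dot t.heads hzu.symm hupos (t.core_pos hz)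
      (hnad z hz).ge (k := h u) (by rw [hupos]; omega)
    obtain ⟨x', hx', h3, -⟩ := hcom z hz j h1 h2
    exact claim1 x' hx' h3

/-- A column is a mark if it has no head in the core. -/
def IsMark (c : V → ι → ℤ) (par : V → V) (w : Fin 3 → V) (k : ι) : Prop :=
  ∀ x ∈ core par w, c x k ≠ 1

theorem ha_root (t : Tri G c h r par dep e₀ w) (a : V) : a ∈ ({r} : Finset V) → ∀ b ∈ ({r} : Finset V),
    ∑ z ∈ ({r} : Finset V), c z (h b) = 0 → c a (h b) ≠ -1 := by
  intro _ b hb hs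
  rw [Finset.mem_singleton] at hb
  rw [hb, t.head_root, Finset.sum_singleton, t.root] at hs
  omega

theorem mark_of_child (t : Tri G c h r par dep e₀ w) {y : V → V}
    (hy : IsArrow c h par (core par w) {r} y) {x : V} (hx : x ∈ core par w) (hxr : x ≠ r) :
    ∃ z, Anc y (y x) z ∧ z ≠ y x ∧ ∃ k, c z k = -1 ∧ IsMark c par w k :=
  t.sys_core.exists_mark t.conf t.heads t.rooted hy t.root_holders_core
    (fun x _ _ => t.two_le x) (t.ha_root _) hx (by simpa using hxr) rfl

/-- Either the root holds a mark, or the head of a column held by the root is an arrow child, below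
which there is one. -/
theorem exists_mark_core (t : Tri G c h r par dep e₀ w) :
    ∃ z ∈ core par w, ∃ k, c z k = -1 ∧ IsMark c par w k := by
  obtain ⟨y, hy⟩ := t.sys_core.exists_arrow t.conf t.heads t.rooted
  obtain ⟨k, hk⟩ := exists_neg_one (t.heads r) (t.core_pos t.root_mem) (t.two_le r)
  by_cases hm : IsMark c par w k
  · exact ⟨r, t.root_mem, k, hk, hm⟩
  · unfold IsMark at hm
    push Not at hm
    obtain ⟨x, hx, h1⟩ := hm
    have hxr : x ≠ r := by rintro rfl; omega
    obtain ⟨z, h2, h3, h4⟩ := t.mark_of_child hy hx hxr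
    exact ⟨z, (hy.not_mem_of_anc h2 h3).1, h4⟩

/-- If all marks are held by `v`, then `v` holds nothing but marks. -/
theorem mark_of_single (t : Tri G c h r par dep e₀ w) {v : V} (hv : v ∈ core par w)
    (hall : ∀ x ∈ core par w, ∀ k, c x k = -1 → IsMark c par w k → x = v) (k : ι)
    (hk : c v k = -1) : IsMark c par w k := by
  classical
  obtain ⟨y, hy⟩ := t.sys_core.exists_arrow t.conf t.heads t.rooted
  intro x' hx' hkx'
  have hkx : h x' = k := ((t.heads x').eq (Or.inl hkx')).symm
  have hx'v : x' ≠ v := by rintro rfl; omega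
  have nochild : ∀ x ∈ core par w, x ≠ r → y x ≠ v := by
    intro x hx hxr hyx
    obtain ⟨z, h1, h2, k', h3, h4⟩ := t.mark_of_child hy hx hxr
    rw [hyx] at h2
    exact h2 (hall z (hy.not_mem_of_anc h1 (hyx ▸ h2)).1 k' h3 h4)
  by_cases hvr : v = r
  · subst hvr
    have hx'r : x' ∉ ({v} : Finset V) := by simpa using hx'v
    exact nochild x' hx' hx'v (hy.eq_of_holder hx' hx'r (subset_pre _ (by simp)) (hkx ▸ hk))
  · have hvR : v ∉ ({r} : Finset V) := by simpa using hvr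
    by_cases hpre : x' ∈ pre par {r} v
    · let S : Finset V := (core par w).filter fun x => x ∉ ({r} : Finset V) ∧ y x = y v
      have hS : S.Nonempty := ⟨v, by simp [S, hv, hvr]⟩
      obtain ⟨x, hxS, hmin⟩ := S.exists_min_image dep hS
      simp only [S, Finset.mem_filter] at hxS hmin
      obtain ⟨hx, hxR, hyx⟩ := hxS
      have hlc := t.sys_core.least_child t.conf t.heads t.rooted hy t.root_holders_core
        (t.ha_root _) hx hxR hyx (fun z h1 h2 h3 => hmin z ⟨h1, h2, h3⟩)
      have hxv : x ≠ v := by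
        rintro rfl
        exact (hlc k hk).2 x' hpre hkx'
      obtain ⟨k₂, hk₂⟩ := exists_neg_one (t.heads x) (t.core_pos hx) (t.two_le x)
      have hnm : ¬ IsMark c par w k₂ := fun hm => hxv (hall x hx k₂ hk₂ hm)
      unfold IsMark at hnm
      push Not at hnm
      obtain ⟨x₂, hx₂, h3⟩ := hnm
      obtain ⟨h4, h5⟩ := t.sys_core.primary t.conf t.heads t.rooted hy hx hxR hk₂ hx₂ h3
        fun e => (hlc k₂ hk₂).2 x₂ e h3
      obtain ⟨z, h6, h7, k₃, h8, h9⟩ := t.mark_of_child hy hx₂ (by simpa using h4)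
      rw [h5] at h6 h7
      obtain rfl := hall z (hy.not_mem_of_anc h6 h7).1 k₃ h8 h9
      have h10 := (h6.eq_or).resolve_left (Ne.symm h7)
      have h11 := rnk_le_of_anc t.rooted hy h10
      rw [← hyx] at h11
      have h12 := rnk_lt_of_mem_pre t.rooted hxR (hy.1 x hx hxR).1
      omega
    · obtain ⟨h4, h5⟩ := t.sys_core.primary t.conf t.heads t.rooted hy hv hvR hk hx' hkx' hpre
      exact nochild x' hx' (by simpa using h4) h5

/-- All vertices are in the core or among the `w i`. -/
theorem mem_coreW_of (t : Tri G c h r par dep e₀ w)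
    (hstar : ∀ i, ∑ v ∈ coreW par w, c v (h (w i)) = -1)
    (hfree : ∀ z, z ∉ coreW par w → ∀ k, c z k = -1 → ∃ x, c x k = 1) (u : V) :
    u ∈ coreW par w := by
  classical
  by_contra hu
  have hout : ∀ u, u ∉ coreW par w → (∀ x ∈ core par w, c u (h x) ≠ -1) ∧
      ∀ z ∈ core par w, c z (h u) = 0 := fun u hu =>
    t.out_aux (fun i _ => Or.inr (hstar i)) _ u rfl hu
  obtain ⟨y, hy⟩ := t.sys_coreW.exists_arrow t.conf t.heads t.rooted
  obtain ⟨y₁, hy₁⟩ := t.sys_core.exists_arrow t.conf t.heads t.rooted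
  -- A highest vertex outside has its arrow parent in `coreW`, and by `out_aux` not in the core, so
  -- it is some w i. The existence of marks below w i then yields a headless column, contrary to
  -- `hfree`.
  let S : Finset V := Finset.univ.filter fun u => u ∉ coreW par w
  have hS : S.Nonempty := ⟨u, by simp [S, hu]⟩
  obtain ⟨x, hxS, hmin⟩ := S.exists_min_image dep hS
  simp only [S, Finset.mem_filter, Finset.mem_univ, true_and] at hxS hmin
  obtain ⟨h1, h2, -⟩ := hy.1 x (Finset.mem_univ _) hxS
  have hyR : y x ∈ coreW par w := by
    by_contra hcon
    rcases mem_pre.1 h1 with h3 | ⟨h3, h4⟩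
    · exact hcon h3
    · have h5 := t.rooted.anc_dep_lt h4 h3
      have h6 := hmin _ hcon
      omega
  obtain ⟨i, hi⟩ := (mem_coreW.1 hyR).resolve_left fun hc => by
    have := (hout x hxS).2 _ hc
    omega
  have harr : ∀ b ∈ core par w, b ≠ r → y₁ b ∈ core par w ∧ dep (y₁ b) < dep b ∧
      c (y₁ b) (h b) = -1 := by
    intro b hb hbr
    obtain ⟨h3, h4, -⟩ := hy₁.1 b hb (by simpa using hbr)
    refine ⟨pre_subset t.lower_core (by simpa using t.root_mem) hb h3, ?_, h4⟩
    rcases mem_pre.1 h3 with h7 | ⟨h7, h8⟩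
    · rw [Finset.mem_singleton] at h7
      rw [h7]
      exact t.rooted.dep_root_lt hbr
    · exact t.rooted.anc_dep_lt h8 h7
  have hbr : ∀ b ∈ coreW par w, ∑ z ∈ coreW par w, c z (h b) = 0 → b ∈ core par w ∧ b ≠ r := by
    intro b hb hs
    refine ⟨(mem_coreW.1 hb).resolve_right ?_, ?_⟩
    · rintro ⟨j, rfl⟩
      rw [hstar j] at hs
      omega
    · rintro rfl
      rw [t.head_root, t.sum_coreW_e₀] at hs
      omega
  have hRH : RootHolders c h dep (coreW par w) := by
    intro b hb _ hs
    obtain ⟨h3, h4⟩ := hbr b hb hs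
    obtain ⟨h5, h6, h7⟩ := harr b h3 h4
    exact ⟨y₁ b, core_subset h5, h6, h7⟩
  obtain ⟨z, h3, h4, k, h5, h6⟩ := t.sys_coreW.exists_mark t.conf t.heads t.rooted hy hRH
    -- A column balanced inside `coreW` belongs to the head of a core vertex, and its only holder
    -- there is the arrow parent in the core, not w i.
    (fun x _ _ => t.two_le x) (a := w i) (x₀ := x) (by
      intro _ b hb hs hcon
      obtain ⟨h3, h4⟩ := hbr b hb hs
      obtain ⟨h5, h6, h7⟩ := harr b h3 h4
      obtain ⟨a, ha, h8, h9⟩ := t.conf.exists_holder t.heads (t.core_pos h3) hb hs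
      have e1 : w i = a := by
        by_contra hne
        have := h9 (w i) (w_mem i) (fun e => w_not_mem (par := par) i (e ▸ h3)) hne
        omega
      have e2 : y₁ b = a := by
        by_contra hne
        have := h9 (y₁ b) (core_subset h5) (fun e => by rw [e] at h6; omega) hne
        omega
      exact w_not_mem (par := par) i (e1.trans e2.symm ▸ h5)) (Finset.mem_univ _) hxS hi.symm
  obtain ⟨h7, h8⟩ := hy.not_mem_of_anc h3 h4
  obtain ⟨x', hx'⟩ := hfree z h8 k h5
  exact h6 x' (Finset.mem_univ _) hx'

end

end Tri

end PlumbingGraph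

/-! ### The entries of the three holders in their head columns -/

namespace PlumbingGraph

open Matrix

/-- A vertex `v = e - f` with `f` orthogonal to all other vertices. -/
def HasFreeVertex {V ι : Type*} [Fintype ι] (c : V → ι → ℤ) : Prop :=
  ∃ (v : V) (e : ι) (f : ι → ℤ), c v e = 1 ∧ (∀ k, k ≠ e → c v k = -f k) ∧ f e = 0 ∧
    (∀ k, f k = 0 ∨ f k = 1) ∧ f ≠ 0 ∧ ∀ x, x ≠ v → f ⬝ᵥ c x = 0

theorem sum_eq_add_sum_range {ι : Type*} [Fintype ι] {F : ι → ℤ} {e₀ : ι} {g : Fin 3 → ι}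
    (hg : Function.Injective g) (hge : ∀ i, g i ≠ e₀)
    (h0 : ∀ k, k ≠ e₀ → (∀ i, k ≠ g i) → F k = 0) : ∑ k, F k = F e₀ + ∑ i, F (g i) := by
  classical
  rw [← Finset.sum_image (s := Finset.univ) (g := g) (f := F) fun a _ b _ e => hg e,
    ← Finset.sum_insert (a := e₀)]
  · refine (Finset.sum_subset (Finset.subset_univ _) fun k _ hk => h0 k ?_ ?_).symm
    · rintro rfl; simp at hk
    · rintro i rfl; simp at hk
  · simp [hge]

/-- The entry `-1` or `0` given by a Boolean. -/
def bz (b : Bool) : ℤ := if b then -1 else 0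

theorem exists_bz {x : ℤ} (hx : x = 0 ∨ x = -1) : ∃ b, x = bz b := by
  rcases hx with h | h
  · exact ⟨false, h⟩
  · exact ⟨true, h⟩

theorem mul_eq_zero_of_le {x y : ℤ} (hx : x = 0 ∨ x = -1) (hy : y = 0 ∨ y = -1)
    (hxy : -1 ≤ x + y) : x * y = 0 := by
  rcases hx with h | h <;> rcases hy with h' | h' <;> subst h <;> subst h' <;> simp at hxy ⊢

set_option synthInstance.maxSize 100000 in
set_option synthInstance.maxHeartbeats 400000 in
set_option maxRecDepth 100000 in
-- Here `a j` encodes the core sum and `b i j` the entry of w i in the head column of w j. The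
-- equations are the products of the w i with the core sum and with each other after column e₀ has
-- been accounted for; the inequalities are the lower bound -1 for column sums. Up to relabelling
-- the solutions are: no core sums, the cyclic pattern, and the pattern with two marks.
theorem star_bool : ∀ a0 a1 a2 b01 b02 b10 b12 b20 b21 : Bool,
    (bz a0 + bz a1 * bz b01 + bz a2 * bz b02 = 0) → (bz a1 + bz a0 * bz b10 + bz a2 * bz b12 = 0) →
    (bz a2 + bz a0 * bz b20 + bz a1 * bz b21 = 0) →
    (1 + bz b10 + bz b01 + bz b02 * bz b12 = 0) → (1 + bz b20 + bz b02 + bz b01 * bz b21 = 0) →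
    (1 + bz b21 + bz b12 + bz b10 * bz b20 = 0) →
    (-1 ≤ bz a0 + 1 + bz b10 + bz b20) → (-1 ≤ bz a1 + 1 + bz b01 + bz b21) →
    (-1 ≤ bz a2 + 1 + bz b02 + bz b12) →
    (a0 = false ∧ a1 = false ∧ a2 = false) ∨
    (a0 = true ∧ a1 = true ∧ a2 = true ∧ b02 = true ∧ b01 = false ∧ b10 = true ∧ b12 = false ∧
      b21 = true ∧ b20 = false) ∨
    (a0 = true ∧ a1 = true ∧ a2 = true ∧ b02 = false ∧ b01 = true ∧ b10 = false ∧ b12 = true ∧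
      b21 = false ∧ b20 = true) ∨
    (a0 = false ∧ a1 = true ∧ a2 = true ∧ b01 = false ∧ b02 = false ∧ b10 = true ∧ b12 = true ∧
      b20 = true ∧ b21 = true) ∨
    (a0 = true ∧ a1 = false ∧ a2 = true ∧ b10 = false ∧ b12 = false ∧ b01 = true ∧ b02 = true ∧
      b21 = true ∧ b20 = true) ∨
    (a0 = true ∧ a1 = true ∧ a2 = false ∧ b21 = false ∧ b20 = false ∧ b10 = true ∧ b12 = true ∧
      b01 = true ∧ b02 = true) := by
  decide

namespace Tri

section
variable {V ι : Type*} [Fintype V] [Fintype ι] {G : SimpleGraph V} {c : V → ι → ℤ}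
  {h : V → ι} {r : V} {par : V → V} {dep : V → ℕ} {e₀ : ι} {w : Fin 3 → V}

theorem core_comp (σ : Equiv.Perm (Fin 3)) : core par (w ∘ σ) = core par w := by
  ext x
  simp only [mem_core, Function.comp_apply]
  exact ⟨fun h i => by simpa using h (σ.symm i), fun h i => h (σ i)⟩

theorem comp (t : Tri G c h r par dep e₀ w) (σ : Equiv.Perm (Fin 3)) :
    Tri G c h r par dep e₀ (w ∘ σ) where
  conf := t.conf
  heads := t.heads
  rooted := t.rooted
  two_le := t.two_le
  card := t.card
  root := t.root
  hold i := t.hold (σ i)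
  other v h1 h2 := t.other v h1 fun i => by simpa using h2 (σ.symm i)
  inj := t.inj.comp σ.injective

/-- The three vertices hold each other's heads cyclically, the core holds all their heads. -/
def StarA (c : V → ι → ℤ) (h : V → ι) (par : V → V) (w : Fin 3 → V) : Prop :=
  ∀ i, ∑ v ∈ core par w, c v (h (w i)) = -1 ∧ c (w i) (h (w (i + 2))) = -1 ∧
    c (w i) (h (w (i + 1))) = 0

/-- `w 1` and `w 2` hold each other's heads and that of `w 0`, the core holds the heads of `w 1`
and `w 2`. -/
def StarB (c : V → ι → ℤ) (h : V → ι) (par : V → V) (w : Fin 3 → V) : Prop :=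
  ∑ v ∈ core par w, c v (h (w 0)) = 0 ∧ ∑ v ∈ core par w, c v (h (w 1)) = -1 ∧
    ∑ v ∈ core par w, c v (h (w 2)) = -1 ∧ c (w 0) (h (w 1)) = 0 ∧ c (w 0) (h (w 2)) = 0 ∧
    c (w 1) (h (w 0)) = -1 ∧ c (w 1) (h (w 2)) = -1 ∧ c (w 2) (h (w 0)) = -1 ∧
    c (w 2) (h (w 1)) = -1

theorem head_ne (t : Tri G c h r par dep e₀ w) (i : Fin 3) : h (w i) ≠ e₀ := by
  intro e
  have h1 := (t.heads (w i)).1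
  rw [e, t.hold] at h1
  omega

theorem dot_core_w (t : Tri G c h r par dep e₀ w) (i : Fin 3) :
    ∑ k, (∑ v ∈ core par w, c v k) * c (w i) k = -1 := by
  have := t.conf.lower_dot t.rooted t.lower_core (w_not_mem i) (t.par_w i)
  unfold dotProduct at this
  simpa only [Finset.sum_apply] using this

theorem dot_w_w (t : Tri G c h r par dep e₀ w) {i j : Fin 3} (hij : i ≠ j) :
    c (w i) ⬝ᵥ c (w j) = 0 := by
  refine t.conf.nadj _ _ (fun e => hij (t.inj e)) fun hadj => ?_
  rcases (t.rooted.adj_iff _ _).1 hadj with ⟨-, h2⟩ | ⟨-, h2⟩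
  · exact w_not_mem (par := par) j (h2 ▸ t.par_w i)
  · exact w_not_mem (par := par) i (h2 ▸ t.par_w j)

theorem bound (t : Tri G c h r par dep e₀ w) {k : ι} (hk : k ≠ e₀) :
    -1 ≤ ∑ v ∈ core par w, c v k + c (w 0) k + c (w 1) k + c (w 2) k := by
  have h1 := t.off_coreW hk
  rw [t.sum_coreW, Fin.sum_univ_three] at h1
  omega

/-- Only column e₀ and the three head columns contribute to the products, so these reduce to the
finite problem `star_bool`. -/
theorem star_types (t : Tri G c h r par dep e₀ w) (hpos : ∀ i, c (w i) (h (w i)) = 1) :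
    (∀ i, ∑ v ∈ core par w, c v (h (w i)) = 0) ∨
      ∃ σ : Equiv.Perm (Fin 3), StarA c h par (w ∘ σ) ∨ StarB c h par (w ∘ σ) := by
  have hginj : Function.Injective fun i => h (w i) := fun i j e =>
    t.inj (t.conf.pos_unique t.heads (hpos i) (by rw [show h (w i) = h (w j) from e]; exact hpos j))
  have hX : ∀ k, k ≠ e₀ → ∃ b : Bool, ∑ v ∈ core par w, c v k = bz b := fun k hk =>
    exists_bz (t.off_core hk)
  have hW : ∀ i k, k ≠ h (w i) → ∃ b : Bool, c (w i) k = bz b := fun i k hk =>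
    exists_bz ((t.heads (w i)).2 k hk)
  -- In such a column the core sum and the three entries are all 0 or -1 with total at least -1, so
  -- at most one of them is nonzero.
  have hz : ∀ k, k ≠ e₀ → (∀ i, k ≠ h (w i)) → (∀ i, (∑ v ∈ core par w, c v k) * c (w i) k = 0) ∧
      ∀ i j, i ≠ j → c (w i) k * c (w j) k = 0 := by
    intro k hk hkg
    have hb := t.off_coreW hk
    rw [t.sum_coreW] at hb
    have h0 := t.off_core hk
    have hn : ∀ i, c (w i) k = 0 ∨ c (w i) k = -1 := fun i => (t.heads (w i)).2 k (hkg i)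
    have hn' : ∀ i, c (w i) k ≤ 0 := fun i => by have := hn i; omega
    refine ⟨fun i => mul_eq_zero_of_le h0 (hn i) ?_, fun i j hij =>
      mul_eq_zero_of_le (hn i) (hn j) ?_⟩
    · rw [← Finset.add_sum_erase _ _ (Finset.mem_univ i)] at hb
      have := Finset.sum_nonpos fun j (_ : j ∈ Finset.univ.erase i) => hn' j
      omega
    · rw [← Finset.add_sum_erase _ _ (Finset.mem_univ i),
        ← Finset.add_sum_erase _ _ (Finset.mem_erase.2 ⟨Ne.symm hij, Finset.mem_univ j⟩)] at hb
      have := Finset.sum_nonpos fun l (_ : l ∈ (Finset.univ.erase i).erase j) => hn' l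
      omega
  have eq1 : ∀ i, ∑ j, (∑ v ∈ core par w, c v (h (w j))) * c (w i) (h (w j)) = 0 := by
    intro i
    have h1 := t.dot_core_w i
    rw [sum_eq_add_sum_range hginj t.head_ne fun k hk hkg => (hz k hk hkg).1 i, t.hold,
      t.sum_core_e₀] at h1
    simpa using h1
  have eq2 : ∀ i j, i ≠ j → 1 + ∑ l, c (w i) (h (w l)) * c (w j) (h (w l)) = 0 := by
    intro i j hij
    have h1 := t.dot_w_w hij
    unfold dotProduct at h1
    rw [sum_eq_add_sum_range hginj t.head_ne fun k hk hkg => (hz k hk hkg).2 i j hij, t.hold,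
      t.hold] at h1
    simpa using h1
  have hne : ∀ i j, i ≠ j → h (w i) ≠ h (w j) := fun i j hij e => hij (hginj e)
  obtain ⟨a0, ha0⟩ := hX _ (t.head_ne 0)
  obtain ⟨a1, ha1⟩ := hX _ (t.head_ne 1)
  obtain ⟨a2, ha2⟩ := hX _ (t.head_ne 2)
  obtain ⟨b01, hb01⟩ := hW 0 _ (hne 1 0 (by decide))
  obtain ⟨b02, hb02⟩ := hW 0 _ (hne 2 0 (by decide))
  obtain ⟨b10, hb10⟩ := hW 1 _ (hne 0 1 (by decide))
  obtain ⟨b12, hb12⟩ := hW 1 _ (hne 2 1 (by decide))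
  obtain ⟨b20, hb20⟩ := hW 2 _ (hne 0 2 (by decide))
  obtain ⟨b21, hb21⟩ := hW 2 _ (hne 1 2 (by decide))
  have c0 := eq1 0
  have c1 := eq1 1
  have c2 := eq1 2
  have c3 := eq2 0 1 (by decide)
  have c4 := eq2 0 2 (by decide)
  have c5 := eq2 1 2 (by decide)
  have c6 := t.bound (t.head_ne 0)
  have c7 := t.bound (t.head_ne 1)
  have c8 := t.bound (t.head_ne 2)
  simp only [Fin.sum_univ_three, hpos, ha0, ha1, ha2, hb01, hb02, hb10, hb12, hb20, hb21,
    mul_one, one_mul] at c0 c1 c2 c3 c4 c5 c6 c7 c8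
  rcases star_bool a0 a1 a2 b01 b02 b10 b12 b20 b21 (by linarith) (by linarith)
    (by linarith) (by linarith) (by linarith) (by linarith)
    (by linarith) (by linarith) (by linarith) with
    ⟨h0, h1, h2⟩ | ⟨h0, h1, h2, h3, h4, h5, h6, h7, h8⟩ | ⟨h0, h1, h2, h3, h4, h5, h6, h7, h8⟩ |
    ⟨h0, h1, h2, h3, h4, h5, h6, h7, h8⟩ | ⟨h0, h1, h2, h3, h4, h5, h6, h7, h8⟩ |
    ⟨h0, h1, h2, h3, h4, h5, h6, h7, h8⟩ <;> subst_vars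
  · left
    intro i
    fin_cases i <;> simp [ha0, ha1, ha2, bz]
  · right
    refine ⟨1, Or.inl fun i => ?_⟩
    fin_cases i <;> simp [core_comp, ha0, ha1, ha2, hb01, hb02, hb10, hb12, hb20, hb21, bz]
  · right
    refine ⟨Equiv.swap 0 1, Or.inl fun i => ?_⟩
    rw [core_comp]
    fin_cases i <;> simp [ha0, ha1, ha2, hb01, hb02, hb10, hb12, hb20, hb21, bz,
      Equiv.swap_apply_of_ne_of_ne]
  · right
    refine ⟨1, Or.inr ?_⟩
    simp [StarB, core_comp, ha0, ha1, ha2, hb01, hb02, hb10, hb12, hb20, hb21, bz]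
  · right
    refine ⟨Equiv.swap 0 1, Or.inr ?_⟩
    simp [StarB, core_comp, ha0, ha1, ha2, hb01, hb02, hb10, hb12, hb20, hb21, bz,
      Equiv.swap_apply_of_ne_of_ne]
  · right
    refine ⟨Equiv.swap 0 2, Or.inr ?_⟩
    simp [StarB, core_comp, ha0, ha1, ha2, hb01, hb02, hb10, hb12, hb20, hb21, bz,
      Equiv.swap_apply_of_ne_of_ne]

theorem mul_eq_zero_of_sum {F : ι → ℤ} {a : ι} (hsum : ∑ k, F k = F a)
    (hnn : ∀ k, k ≠ a → 0 ≤ F k) (k : ι) (hk : k ≠ a) : F k = 0 := by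
  classical
  rw [← Finset.add_sum_erase _ _ (Finset.mem_univ a)] at hsum
  exact (Finset.sum_eq_zero_iff_of_nonneg fun j hj => hnn j (Finset.ne_of_mem_erase hj)).1
    (by omega) k (Finset.mem_erase.2 ⟨hk, Finset.mem_univ _⟩)

/-- Column e₀ already accounts for the product -1 with the core sum, and all other terms are
nonnegative. -/
theorem disjoint_of_head (t : Tri G c h r par dep e₀ w) {i : Fin 3}
    (h0 : ∑ v ∈ core par w, c v (h (w i)) = 0) (k : ι) (hk : k ≠ e₀) :
    (∑ v ∈ core par w, c v k) * c (w i) k = 0 := by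
  refine mul_eq_zero_of_sum (F := fun k => (∑ v ∈ core par w, c v k) * c (w i) k) (a := e₀) ?_ ?_
    k hk
  · rw [t.dot_core_w, t.sum_core_e₀, t.hold]; rfl
  · intro k hk
    by_cases h1 : k = h (w i)
    · rw [h1, h0]; simp
    · rcases t.off_core hk with h2 | h2 <;> rcases (t.heads (w i)).2 k h1 with h3 | h3 <;>
        simp [h2, h3]

/-- The case that `w 2` has a negative head. -/
theorem neg_type (t : Tri G c h r par dep e₀ w) (hneg : c (w 2) (h (w 2)) = -2) :
    (∀ i, ∑ v ∈ core par w, c v (h (w i)) = 0) ∧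
    (∀ i, ∑ v ∈ coreW par w, c v (h (w i)) = -1) ∧ ∀ v, v ≠ w 2 → c v (h v) = 1 := by
  have hnp : ∀ k, c (w 2) k ≤ 0 := by
    intro k
    by_cases hk : k = h (w 2)
    · rw [hk, hneg]; norm_num
    · have := (t.heads (w 2)).2 k hk; omega
  have hX2 : ∑ v ∈ core par w, c v (h (w 2)) = 0 := by
    have := mul_eq_zero_of_sum (F := fun k => (∑ v ∈ core par w, c v k) * c (w 2) k) (a := e₀)
      (by rw [t.dot_core_w, t.sum_core_e₀, t.hold]; rfl) (fun k hk => by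
        have h1 := hnp k
        rcases t.off_core hk with h2 | h2 <;> simp only [h2] <;> omega) _ (t.head_ne 2)
    simp only [hneg] at this
    omega
  have hpos' : ∀ i, i ≠ 2 → c (w i) (h (w i)) = 1 := by
    intro i hi
    refine (t.heads (w i)).1.resolve_right fun hcon => ?_
    have h1 := t.dot_w_w hi
    have h2 : ∀ k, c (w i) k ≤ 0 := by
      intro k
      by_cases hk : k = h (w i)
      · rw [hk, hcon]; norm_num
      · have := (t.heads (w i)).2 k hk; omega
    have h3 := le_sum_of_forall (f := fun k => c (w i) k * c (w 2) k) e₀ fun k _ =>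
      mul_nonneg_of_nonpos_of_nonpos (h2 k) (hnp k)
    unfold dotProduct at h1
    simp only [t.hold] at h3
    omega
  have key : ∀ i j : Fin 3, i ≠ 2 → j ≠ 2 → i ≠ j → c (w i) (h (w 2)) = 1 →
      (∑ v ∈ core par w, c v (h (w j)) = 0 ∧ ∑ v ∈ coreW par w, c v (h (w j)) = -1) ∧
      h (w i) = h (w 2) ∧ ∑ v ∈ coreW par w, c v (h (w 2)) = -1 := by
    intro i j hi hj hij hc
    have hih : h (w i) = h (w 2) := ((t.heads (w i)).eq (Or.inl hc)).symm
    have hcj : c (w j) (h (w 2)) = 0 := by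
      have h1 := t.conf.neg_two t.heads hneg (fun e => hj (t.inj e.symm))
      have h2 := t.conf.nonpos_of_pos t.heads hc (fun e => hij (t.inj e.symm))
      omega
    have huniv : ∀ F : Fin 3 → ℤ, ∑ a, F a = F i + F j + F 2 := by
      intro F
      rw [Fin.sum_univ_three]
      fin_cases i <;> fin_cases j <;> simp at hi hj hij ⊢; ring
    -- In the zero product column e₀ contributes 1 and the common head column -2, so a shared column
    -- supplies the missing 1. There the lower bound for column sums forces the third vertex w j to
    -- have entry 1.
    have hcom : ∃ k, k ≠ e₀ ∧ c (w i) k = -1 ∧ c (w 2) k = -1 := by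
      have h1 := t.dot_w_w hi
      unfold dotProduct at h1
      by_contra hcon
      push Not at hcon
      have h2 : ∑ k, c (w i) k * c (w 2) k = c (w i) e₀ * c (w 2) e₀ +
          c (w i) (h (w 2)) * c (w 2) (h (w 2)) := by
        classical
        rw [← Finset.add_sum_erase _ _ (Finset.mem_univ e₀), Finset.sum_eq_single (h (w 2))]
        · intro k hk hk2
          have hke := Finset.ne_of_mem_erase hk
          have h3 := (t.heads (w 2)).2 k hk2
          have h4 := (t.heads (w i)).2 k (by rw [hih]; exact hk2)
          rcases h4 with h4 | h4
          · rw [h4]; ring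
          · have h5 := hcon k hke h4
            have h6 : c (w 2) k = 0 := by omega
            rw [h6]; ring
        · exact fun e => absurd (Finset.mem_erase.2 ⟨t.head_ne 2, Finset.mem_univ _⟩) e
      rw [h2, t.hold, t.hold, hc, hneg] at h1
      norm_num at h1
    obtain ⟨k, hke, hk1, hk2⟩ := hcom
    have hb := t.off_coreW hke
    rw [t.sum_coreW, huniv] at hb
    have hXk := t.off_core hke
    have hle : c (w j) k ≤ 1 := by
      rcases (t.heads (w j)).eq_zero_or k with h1 | h1 | h1 | h1 <;> omega
    have hj1 : c (w j) k = 1 := by omega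
    have hkj : h (w j) = k := ((t.heads (w j)).eq (Or.inl hj1)).symm
    refine ⟨⟨by rw [hkj]; omega, by rw [hkj, t.sum_coreW, huniv]; omega⟩, hih, ?_⟩
    rw [t.sum_coreW, huniv, hX2, hc, hcj, hneg]
    norm_num
  -- The entry -2 is below the least admissible column sum, so one of the other two vertices has its
  -- head in the same column.
  have hb := t.off_coreW (t.head_ne 2)
  rw [t.sum_coreW, hX2, Fin.sum_univ_three, hneg] at hb
  have hle : ∀ j, c (w j) (h (w 2)) ≤ 1 := by
    intro j
    rcases (t.heads (w j)).eq_zero_or (h (w 2)) with h1 | h1 | h1 | h1 <;> omega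
  have hl0 := hle 0
  have hl1 := hle 1
  have hex : c (w 0) (h (w 2)) = 1 ∨ c (w 1) (h (w 2)) = 1 := by omega
  have hfin : (∀ i, ∑ v ∈ core par w, c v (h (w i)) = 0) ∧
      (∀ i, ∑ v ∈ coreW par w, c v (h (w i)) = -1) := by
    rcases hex with h1 | h1
    · obtain ⟨⟨k1, k2⟩, k3, k4⟩ := key 0 1 (by decide) (by decide) (by decide) h1
      refine ⟨fun i => ?_, fun i => ?_⟩ <;> fin_cases i <;>
        simp only [Fin.zero_eta, Fin.mk_one, Fin.reduceFinMk] <;> first | assumption | (rw [k3]; assumption)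
    · obtain ⟨⟨k1, k2⟩, k3, k4⟩ := key 1 0 (by decide) (by decide) (by decide) h1
      refine ⟨fun i => ?_, fun i => ?_⟩ <;> fin_cases i <;>
        simp only [Fin.zero_eta, Fin.mk_one, Fin.reduceFinMk] <;> first | assumption | (rw [k3]; assumption)
  refine ⟨hfin.1, hfin.2, fun v hv => ?_⟩
  by_cases h1 : v ∈ coreW par w
  · rcases mem_coreW.1 h1 with h2 | ⟨i, rfl⟩
    · exact t.core_pos h2
    · exact hpos' i fun e => hv (by rw [e])
  · exact t.out_pos h1

/-- A mark of the core is headless if the core holds no head of the `w i`. -/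
theorem headless_of_mark (t : Tri G c h r par dep e₀ w)
    (h0 : ∀ i, ∑ v ∈ core par w, c v (h (w i)) = 0) {z : V} {k : ι} (hz : z ∈ core par w)
    (hk : c z k = -1) (hm : IsMark c par w k) (x : V) : c x k ≠ 1 := by
  intro hx
  have hkx : h x = k := ((t.heads x).eq (Or.inl hx)).symm
  by_cases h1 : x ∈ coreW par w
  · rcases mem_coreW.1 h1 with h2 | ⟨i, rfl⟩
    · exact hm x h2 hx
    · have h3 := h0 i
      rw [hkx] at h3
      have := forall_eq_zero_of_sum h3 (fun v hv => nonpos_of_ne_one t.heads (hm v hv)) z hz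
      omega
  · have := (t.out_aux (fun i _ => Or.inl (h0 i)) _ x rfl h1).2 z hz
    rw [hkx] at this
    omega

/-- A mark of the core would be headless, but with all heads positive every column has a head. -/
theorem not_all_zero (t : Tri G c h r par dep e₀ w) (hpos : ∀ i, c (w i) (h (w i)) = 1)
    (h0 : ∀ i, ∑ v ∈ core par w, c v (h (w i)) = 0) : False := by
  obtain ⟨z, hz, k, hk, hm⟩ := t.exists_mark_core
  obtain ⟨x, hx⟩ := t.conf.forall_exists_head t.heads t.card (fun v => by
    by_cases h1 : v ∈ coreW par w
    · rcases mem_coreW.1 h1 with h2 | ⟨i, rfl⟩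
      · exact t.core_pos h2
      · exact hpos i
    · exact t.out_pos h1) k
  exact t.headless_of_mark h0 hz hk hm x hx

/-- A mark is held by exactly one vertex of the core. -/
theorem mark_unique (t : Tri G c h r par dep e₀ w) {x z : V} {k : ι} (hx : x ∈ core par w)
    (hz : z ∈ core par w) (hkx : c x k = -1) (hkz : c z k = -1) (hm : IsMark c par w k) : x = z := by
  have hke : k ≠ e₀ := by
    rintro rfl
    exact hm r t.root_mem t.root
  have hnp : ∀ v ∈ core par w, c v k ≤ 0 := fun v hv => nonpos_of_ne_one t.heads (hm v hv)
  rcases t.off_core hke with h1 | h1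
  · have := forall_eq_zero_of_sum h1 hnp x hx
    omega
  · obtain ⟨y, -, -, h2⟩ := exists_unique_holder h1 hnp
    have e1 : x = y := by
      by_contra hne
      have := h2 x hx hne
      omega
    have e2 : z = y := by
      by_contra hne
      have := h2 z hz hne
      omega
    exact e1.trans e2.symm

/-- All vertices but w 2 have distinct positive heads, so only one column can be headless. This is
the only mark; its holder v in the core has no other negative entry, and f is the basis vector of
that column. -/
theorem free_of_neg (t : Tri G c h r par dep e₀ w) (hneg : c (w 2) (h (w 2)) = -2) :
    HasFreeVertex c := by
  classical
  obtain ⟨h0, hR, hpos⟩ := t.neg_type hneg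
  obtain ⟨v, hv, k₀, hk₀, hm₀⟩ := t.exists_mark_core
  have hhl := t.headless_of_mark h0 hv hk₀ hm₀
  have huniq : ∀ k, (∀ x, c x k ≠ 1) → k = k₀ := by
    intro k hk
    by_contra hne
    -- The n - 1 positive heads would have to avoid two of the n columns.
    have hinj : Set.InjOn h (Finset.univ.erase (w 2) : Finset V) := by
      intro a ha b hb hab
      rw [Finset.coe_erase] at ha hb
      exact t.conf.pos_unique t.heads (hpos a ha.2) (hab ▸ hpos b hb.2)
    have h1 := Finset.card_image_of_injOn hinj
    have h2 : ((Finset.univ.erase (w 2)).image h) ⊆ (Finset.univ.erase k).erase k₀ := by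
      intro j hj
      obtain ⟨a, ha, rfl⟩ := Finset.mem_image.1 hj
      have h3 := hpos a (Finset.ne_of_mem_erase ha)
      rw [Finset.mem_erase, Finset.mem_erase]
      refine ⟨?_, ?_, Finset.mem_univ _⟩
      · intro e; exact hhl a (e ▸ h3)
      · intro e; exact hk a (e ▸ h3)
    have h3 := Finset.card_le_card h2
    rw [h1, Finset.card_erase_of_mem (Finset.mem_univ _), Finset.card_erase_of_mem
      (Finset.mem_erase.2 ⟨Ne.symm hne, Finset.mem_univ _⟩), Finset.card_erase_of_mem
      (Finset.mem_univ _), Finset.card_univ, Finset.card_univ, t.card] at h3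
    have h4 : 1 < Fintype.card ι := Fintype.one_lt_card_iff.2 ⟨k, k₀, hne⟩
    rw [t.card] at h4
    omega
  have hall : ∀ x ∈ core par w, ∀ k, c x k = -1 → IsMark c par w k → x = v := by
    intro x hx k hk hm
    obtain rfl := huniq k (t.headless_of_mark h0 hx hk hm)
    exact t.mark_unique hx hv hk hk₀ hm₀
  have hfull : ∀ u, u ∈ coreW par w := by
    refine t.mem_coreW_of hR fun z hz k hk => ?_
    by_contra hcon
    push Not at hcon
    obtain rfl := huniq k hcon
    obtain ⟨x', -, h2, -⟩ := t.sys_coreW.head_mem_pre t.conf t.heads t.rooted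
      (Finset.mem_univ z) hz hk (subset_pre z (core_subset hv)) hk₀
    exact hhl x' h2
  have hke : k₀ ≠ e₀ := by
    rintro rfl
    exact hhl r t.root
  have hv1 := t.core_pos hv
  have hvk : h v ≠ k₀ := fun e => by rw [e] at hv1; omega
  refine ⟨v, h v, fun k => if k = k₀ then 1 else 0, hv1, fun k hk => ?_, if_neg hvk, fun k => ?_, ?_,
    fun x hx => ?_⟩
  · by_cases h1 : k = k₀
    · simp [h1, hk₀]
    · simp only [if_neg h1]
      rcases (t.heads v).2 k hk with h2 | h2
      · simpa using h2
      · have h3 := t.mark_of_single hv hall k h2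
        exact absurd (huniq k (t.headless_of_mark h0 hv h2 h3)) h1
  · by_cases h1 : k = k₀ <;> simp [h1]
  · intro e
    have := congrFun e k₀
    simp at this
  · have h1 : (fun k => if k = k₀ then (1 : ℤ) else 0) ⬝ᵥ c x = c x k₀ := by
      simp [dotProduct]
    rw [h1]
    rcases mem_coreW.1 (hfull x) with h2 | ⟨i, rfl⟩
    · rcases (t.heads x).eq_zero_or k₀ with h3 | h3 | h3 | h3
      · exact absurd h3 (hhl x)
      · exact h3
      · exact absurd (t.mark_unique h2 hv h3 hk₀ hm₀) hx
      · have := t.conf.neg_two t.heads h3 hx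
        omega
    · have h2 := t.disjoint_of_head (h0 i) k₀ hke
      have h3 : ∑ v ∈ core par w, c v k₀ = -1 := by
        refine (t.off_core hke).resolve_left fun h3 => ?_
        have := forall_eq_zero_of_sum h3 (fun v hv => nonpos_of_ne_one t.heads (hm₀ v hv)) v hv
        omega
      rw [h3] at h2
      omega

end

end Tri

end PlumbingGraph

/-! ### Mark holders and the flow along arrows -/

namespace PlumbingGraph

open Matrix

/-- Stopping at the first visit to a matters, since a may be a fixed point of y. -/
theorem Anc.exists_child {V : Type*} {y : V → V} {a z : V} (h : Anc y a z) (hne : a ≠ z) :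
    ∃ b, y b = a ∧ b ≠ a ∧ Anc y b z := by
  classical
  have hex : ∃ n, y^[n] z = a := h
  have h1 := Nat.find_spec hex
  have h2 : Nat.find hex ≠ 0 := by
    intro e
    rw [e] at h1
    exact hne h1.symm
  obtain ⟨n, hn⟩ := Nat.exists_eq_succ_of_ne_zero h2
  have h3 : y^[n] z ≠ a := Nat.find_min hex (by omega)
  rw [hn, Function.iterate_succ_apply'] at h1
  exact ⟨y^[n] z, h1, h3, n, rfl⟩

namespace Tri

section
variable {V ι : Type*} [Fintype V] [Fintype ι] {G : SimpleGraph V} {c : V → ι → ℤ}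
  {h : V → ι} {r : V} {par : V → V} {dep : V → ℕ} {e₀ : ι} {w : Fin 3 → V}

/-- The `w i` have positive heads, the core holds exactly the heads of those with index in `M`, and
the matrix of the entries of the `w i` in their head columns is connected on `M` with vanishing
row and column sums. -/
structure Marked (c : V → ι → ℤ) (h : V → ι) (par : V → V) (w : Fin 3 → V)
    (M : Finset (Fin 3)) : Prop where
  pos : ∀ i, c (w i) (h (w i)) = 1
  sum : ∀ j, ∑ v ∈ core par w, c v (h (w j)) = if j ∈ M then -1 else 0
  sumW : ∀ j, ∑ v ∈ coreW par w, c v (h (w j)) = -1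
  nonempty : M.Nonempty
  row : ∀ i, ∑ j ∈ M, c (w i) (h (w j)) = 0
  col : ∀ j ∈ M, ∑ i, c (w i) (h (w j)) = 0
  conn : ∀ P : Fin 3 → ℤ, (∀ i, ∑ j ∈ M, c (w i) (h (w j)) * P j = 0) →
    ∀ i ∈ M, ∀ j ∈ M, P i = P j

theorem StarA.entries (hA : StarA c h par w) : c (w 0) (h (w 2)) = -1 ∧ c (w 0) (h (w 1)) = 0 ∧
    c (w 1) (h (w 0)) = -1 ∧ c (w 1) (h (w 2)) = 0 ∧ c (w 2) (h (w 1)) = -1 ∧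
    c (w 2) (h (w 0)) = 0 :=
  ⟨(hA 0).2.1, (hA 0).2.2, (hA 1).2.1, (hA 1).2.2, (hA 2).2.1, (hA 2).2.2⟩

/-- In the cyclic pattern each row and each column of the 3×3 matrix has one 1 and one -1, so its
kernel consists of the constants. -/
theorem marked_of_starA (t : Tri G c h r par dep e₀ w) (hpos : ∀ i, c (w i) (h (w i)) = 1)
    (hA : StarA c h par w) : Marked c h par w Finset.univ := by
  obtain ⟨h1, h2, h3, h4, h5, h6⟩ := hA.entries
  refine ⟨hpos, fun j => by simpa using (hA j).1, fun j => ?_, ⟨0, by simp⟩, fun i => ?_,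
    fun j _ => ?_, fun P hP => ?_⟩
  · rw [t.sum_coreW, (hA j).1, Fin.sum_univ_three]
    fin_cases j <;> simp [hpos, h1, h2, h3, h4, h5, h6]
  · rw [Fin.sum_univ_three]
    fin_cases i <;> simp [hpos, h1, h2, h3, h4, h5, h6]
  · rw [Fin.sum_univ_three]
    fin_cases j <;> simp [hpos, h1, h2, h3, h4, h5, h6]
  · have p0 := hP 0
    have p1 := hP 1
    rw [Fin.sum_univ_three, hpos, h1, h2] at p0
    rw [Fin.sum_univ_three, hpos, h3, h4] at p1
    intro i _ j _
    fin_cases i <;> fin_cases j <;> simp <;> linarith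

theorem marked_of_starB (t : Tri G c h r par dep e₀ w) (hpos : ∀ i, c (w i) (h (w i)) = 1)
    (hB : StarB c h par w) : Marked c h par w {1, 2} := by
  obtain ⟨k0, k1, k2, h1, h2, h3, h4, h5, h6⟩ := hB
  refine ⟨hpos, fun j => ?_, fun j => ?_, ⟨1, by simp⟩, fun i => ?_, fun j hj => ?_,
    fun P hP => ?_⟩
  · fin_cases j <;> simp [k0, k1, k2]
  · rw [t.sum_coreW, Fin.sum_univ_three]
    fin_cases j <;> simp [hpos, h1, h2, h3, h4, h5, h6, k0, k1, k2]
  · rw [Finset.sum_pair (by decide)]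
    fin_cases i <;> simp [hpos, h1, h2, h3, h4, h5, h6]
  · rw [Fin.sum_univ_three]
    fin_cases j
    · simp at hj
    · simp [hpos, h1, h2, h3, h4, h5, h6]
    · simp [hpos, h1, h2, h3, h4, h5, h6]
  · have p1 := hP 1
    rw [Finset.sum_pair (by decide), hpos, h4] at p1
    intro i hi j hj
    fin_cases i <;> fin_cases j <;> simp at hi hj ⊢ <;> linarith

variable {M : Finset (Fin 3)} {yy : Fin 3 → V} {y : V → V}

theorem all_pos (t : Tri G c h r par dep e₀ w) (m : Marked c h par w M) (v : V) :
    c v (h v) = 1 := by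
  by_cases h1 : v ∈ coreW par w
  · rcases mem_coreW.1 h1 with h2 | ⟨i, rfl⟩
    · exact t.core_pos h2
    · exact m.pos i
  · exact t.out_pos h1

theorem full (t : Tri G c h r par dep e₀ w) (m : Marked c h par w M) (v : V) :
    v ∈ coreW par w :=
  t.mem_coreW_of m.sumW (fun _ _ k _ => t.conf.forall_exists_head t.heads t.card (t.all_pos m) k) v

theorem entry_cases (t : Tri G c h r par dep e₀ w) (m : Marked c h par w M) {v x : V}
    (hv : v ≠ x) : c v (h x) = 0 ∨ c v (h x) = -1 := by
  have h1 := t.conf.nonpos_of_pos t.heads (t.all_pos m x) hv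
  rcases (t.heads v).eq_zero_or (h x) with h2 | h2 | h2 | h2
  · omega
  · exact Or.inl h2
  · exact Or.inr h2
  · have h3 := (t.heads v).eq (Or.inr h2)
    have h4 := t.all_pos m v
    rw [← h3] at h4
    omega

theorem sum_univ_eq (t : Tri G c h r par dep e₀ w) (m : Marked c h par w M) (F : V → ℤ) :
    ∑ v, F v = ∑ v ∈ core par w, F v + ∑ i, F (w i) := by
  classical
  have h1 : (Finset.univ : Finset V) = coreW par w := by
    ext v; simpa using t.full m v
  rw [h1]
  unfold coreW
  rw [Finset.sum_union, Finset.sum_image fun i _ j _ e => t.inj e]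
  rw [Finset.disjoint_left]
  intro a ha hb
  obtain ⟨i, -, rfl⟩ := Finset.mem_image.1 hb
  exact w_not_mem i ha

/-- Heads are a bijection between vertices and columns, so columns can be summed over the core and
the w i. -/
theorem sum_col_eq (t : Tri G c h r par dep e₀ w) (m : Marked c h par w M) (F : ι → ℤ) :
    ∑ k, F k = ∑ v ∈ core par w, F (h v) + ∑ i, F (h (w i)) := by
  have hinj : Function.Injective h := fun a b hab =>
    t.conf.pos_unique t.heads (t.all_pos m a) (hab ▸ t.all_pos m b)
  have hbij := (Fintype.bijective_iff_injective_and_card h).2 ⟨hinj, t.card.symm⟩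
  rw [← t.sum_univ_eq m fun v => F (h v)]
  exact (hbij.sum_comp F).symm

theorem isMark_w (t : Tri G c h r par dep e₀ w) (m : Marked c h par w M) (j : Fin 3) :
    IsMark c par w (h (w j)) := fun _ hx h1 =>
  w_not_mem (par := par) j (t.conf.pos_unique t.heads h1 (m.pos j) ▸ hx)

theorem exists_mark_holders (t : Tri G c h r par dep e₀ w) (m : Marked c h par w M) :
    ∃ yy : Fin 3 → V, ∀ j ∈ M, yy j ∈ core par w ∧ c (yy j) (h (w j)) = -1 := by
  have key : ∀ j, ∃ v, j ∈ M → v ∈ core par w ∧ c v (h (w j)) = -1 := by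
    intro j
    by_cases hj : j ∈ M
    · have h1 := m.sum j
      rw [if_pos hj] at h1
      obtain ⟨v, hv, h2, -⟩ := exists_unique_holder h1 fun v hv =>
        nonpos_of_ne_one t.heads (t.isMark_w m j v hv)
      exact ⟨v, fun _ => ⟨hv, h2⟩⟩
    · exact ⟨r, fun h => absurd h hj⟩
  choose yy hyy using key
  exact ⟨yy, hyy⟩

/-- The head of a mark exists and is outside the core, so it belongs to some w j; the index is in M
because the core sum of that column is not zero. -/
theorem mark_cases (t : Tri G c h r par dep e₀ w) (m : Marked c h par w M)
    (hyy : ∀ j ∈ M, yy j ∈ core par w ∧ c (yy j) (h (w j)) = -1) {x : V} {k : ι}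
    (hx : x ∈ core par w) (hk : c x k = -1) (hm : IsMark c par w k) :
    ∃ j ∈ M, k = h (w j) ∧ x = yy j := by
  obtain ⟨v, hv⟩ := t.conf.forall_exists_head t.heads t.card (t.all_pos m) k
  have hkv : h v = k := ((t.heads v).eq (Or.inl hv)).symm
  rcases mem_coreW.1 (t.full m v) with h1 | ⟨j, rfl⟩
  · exact absurd hv (hm v h1)
  · have hj : j ∈ M := by
      by_contra hj
      have h1 := m.sum j
      rw [if_neg hj, hkv] at h1
      have := forall_eq_zero_of_sum h1 (fun v hv => nonpos_of_ne_one t.heads (hm v hv)) x hx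
      omega
    refine ⟨j, hj, hkv.symm, t.mark_unique hx (hyy j hj).1 hk ?_ hm⟩
    rw [← hkv]
    exact (hyy j hj).2

theorem mark_entry (t : Tri G c h r par dep e₀ w) (m : Marked c h par w M) [DecidableEq V]
    (hyy : ∀ j ∈ M, yy j ∈ core par w ∧ c (yy j) (h (w j)) = -1) {x : V}
    (hx : x ∈ core par w) (j : Fin 3) :
    c x (h (w j)) = -(if j ∈ M ∧ yy j = x then 1 else 0) := by
  have hxw : x ≠ w j := fun e => w_not_mem (par := par) j (e ▸ hx)
  split_ifs with h1
  · rw [← h1.2, (hyy j h1.1).2]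
  · rcases t.entry_cases m hxw with h2 | h2
    · rw [h2]; rfl
    · obtain ⟨j', hj', h3, h4⟩ := t.mark_cases m hyy hx h2 (t.isMark_w m j)
      have h5 : j = j' := t.inj (t.conf.pos_unique t.heads (m.pos j) (h3 ▸ m.pos j'))
      exact absurd ⟨h5 ▸ hj', h5 ▸ h4.symm⟩ h1

/-- The vector f is the sum of the basis vectors of the marks. The common holder has no other
negative entries by `mark_of_single`, the rest of the core has no marks, and f is orthogonal to the
w i because the row sums over M vanish. -/
theorem free_of_marked (t : Tri G c h r par dep e₀ w) (m : Marked c h par w M)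
    (hyy : ∀ j ∈ M, yy j ∈ core par w ∧ c (yy j) (h (w j)) = -1)
    (hsame : ∀ i ∈ M, ∀ j ∈ M, yy i = yy j) : HasFreeVertex c := by
  classical
  obtain ⟨j₀, hj₀⟩ := m.nonempty
  have hall : ∀ x ∈ core par w, ∀ k, c x k = -1 → IsMark c par w k → x = yy j₀ := by
    intro x hx k hk hm
    obtain ⟨j, hj, -, h2⟩ := t.mark_cases m hyy hx hk hm
    rw [h2, hsame j hj j₀ hj₀]
  have hv := (hyy j₀ hj₀).1
  have hginj : ∀ i j, h (w i) = h (w j) → i = j := fun i j e =>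
    t.inj (t.conf.pos_unique t.heads (m.pos i) (e ▸ m.pos j))
  let f : ι → ℤ := fun k => ∑ j ∈ M, if k = h (w j) then 1 else 0
  have hf1 : ∀ j ∈ M, f (h (w j)) = 1 := by
    intro j hj
    simp only [f]
    rw [Finset.sum_eq_single j]
    · simp
    · intro i _ hi
      rw [if_neg fun e => hi (hginj _ _ e).symm]
    · exact fun e => absurd hj e
  have hf0 : ∀ k, (∀ j ∈ M, k ≠ h (w j)) → f k = 0 := fun k hk =>
    Finset.sum_eq_zero fun j hj => if_neg (hk j hj)
  have hfdot : ∀ x, f ⬝ᵥ c x = ∑ j ∈ M, c x (h (w j)) := by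
    intro x
    simp only [dotProduct, f, Finset.sum_mul]
    rw [Finset.sum_comm]
    refine Finset.sum_congr rfl fun j _ => ?_
    simp
  refine ⟨yy j₀, h (yy j₀), f, t.core_pos hv, fun k hk => ?_, ?_, fun k => ?_, ?_, fun x hx => ?_⟩
  · by_cases h1 : ∃ j ∈ M, k = h (w j)
    · obtain ⟨j, hj, rfl⟩ := h1
      rw [hf1 j hj, hsame j₀ hj₀ j hj, (hyy j hj).2]
    · push Not at h1
      rw [hf0 k h1]
      rcases (t.heads (yy j₀)).2 k hk with h2 | h2
      · simpa using h2
      · obtain ⟨j, hj, h3, -⟩ := t.mark_cases m hyy hv h2 (t.mark_of_single hv hall k h2)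
        exact absurd h3 (h1 j hj)
  · refine hf0 _ fun j hj e => ?_
    have h1 := t.core_pos hv
    rw [e] at h1
    exact t.isMark_w m j _ hv h1
  · by_cases h1 : ∃ j ∈ M, k = h (w j)
    · obtain ⟨j, hj, rfl⟩ := h1
      exact Or.inr (hf1 j hj)
    · push Not at h1
      exact Or.inl (hf0 k h1)
  · intro e
    have h1 := hf1 j₀ hj₀
    rw [e] at h1
    simp at h1
  · rw [hfdot]
    rcases mem_coreW.1 (t.full m x) with h2 | ⟨i, rfl⟩
    · refine Finset.sum_eq_zero fun j hj => ?_
      rw [t.mark_entry m hyy h2, if_neg]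
      · rfl
      · rintro ⟨-, h3⟩
        exact hx (by rw [← h3, hsame j hj j₀ hj₀])
    · exact m.row i

theorem arrow_facts (t : Tri G c h r par dep e₀ w) (hy : IsArrow c h par (core par w) {r} y)
    {x : V} (hx : x ∈ core par w) (hxr : x ≠ r) :
    y x ∈ core par w ∧ Anc par (y x) x ∧ dep (y x) < dep x ∧ c (y x) (h x) = -1 := by
  obtain ⟨h3, h4, -⟩ := hy.1 x hx (by simpa using hxr)
  have h5 : Anc par (y x) x ∧ y x ≠ x := by
    rcases mem_pre.1 h3 with h7 | ⟨h7, h8⟩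
    · rw [Finset.mem_singleton] at h7
      rw [h7]
      exact ⟨t.rooted.root_anc x, Ne.symm hxr⟩
    · exact ⟨h8, h7⟩
  exact ⟨t.lower_core.anc h5.1 hx, h5.1, t.rooted.anc_dep_lt h5.1 h5.2, h4⟩

/-- A head column of the core is held by at most one vertex besides the arrow parent. -/
theorem second_holder (t : Tri G c h r par dep e₀ w) (m : Marked c h par w M)
    (hy : IsArrow c h par (core par w) {r} y) {x v : V} (hx : x ∈ core par w) (hxr : x ≠ r)
    (hv : v ≠ y x) (hc : c v (h x) = -1) {z : V} (hzx : z ≠ x) (hzy : z ≠ y x) (hzv : z ≠ v) :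
    c z (h x) = 0 := by
  classical
  have hke : h x ≠ e₀ := by
    intro e
    have h1 := t.core_pos hx
    rw [e, t.other x hxr (fun i e => w_not_mem (par := par) i (e ▸ hx))] at h1
    omega
  have h1 := t.off_coreW hke
  have h2 : coreW par w = Finset.univ := by ext a; simpa using t.full m a
  have hvx : v ≠ x := fun e => by rw [e, t.core_pos hx] at hc; omega
  obtain ⟨-, -, h3, h4⟩ := t.arrow_facts hy hx hxr
  have hyx : y x ≠ x := fun e => by rw [e] at h3; omega
  -- The head, its arrow parent and v add up to 1 - 1 - 1 = -1, the least possible column sum.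
  rw [h2, ← Finset.add_sum_erase _ _ (Finset.mem_univ x),
    ← Finset.add_sum_erase _ _ (Finset.mem_erase.2 ⟨hyx, Finset.mem_univ _⟩),
    ← Finset.add_sum_erase _ _ (Finset.mem_erase.2 ⟨hv, Finset.mem_erase.2
      ⟨hvx, Finset.mem_univ _⟩⟩),
    ← Finset.add_sum_erase _ _ (Finset.mem_erase.2 ⟨hzv, Finset.mem_erase.2 ⟨hzy,
      Finset.mem_erase.2 ⟨hzx, Finset.mem_univ _⟩⟩⟩), t.core_pos hx, h4, hc] at h1
  have h5 := Finset.sum_nonpos fun a (ha : a ∈ (((Finset.univ.erase x).erase (y x)).erase v).erase z)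
    => t.conf.nonpos_of_pos t.heads (t.core_pos hx) (y := a) (by
      rintro rfl; simp at ha)
  have h6 := t.entry_cases m hzx
  omega

theorem descs_subset (_ : Tri G c h r par dep e₀ w) (hy : IsArrow c h par (core par w) {r} y)
    {x : V} (hx : x ∈ core par w) (hxr : x ≠ r) {z : V} (hz : Anc y x z) :
    z ∈ core par w ∧ z ≠ r := by
  by_cases h1 : z = x
  · rw [h1]; exact ⟨hx, hxr⟩
  · have := hy.not_mem_of_anc hz h1
    simpa using this

/-- The flow of a head column through its arrow descendants. -/
theorem flow (t : Tri G c h r par dep e₀ w) (m : Marked c h par w M) [DecidableEq V]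
    (hyy : ∀ j ∈ M, yy j ∈ core par w ∧ c (yy j) (h (w j)) = -1)
    (hy : IsArrow c h par (core par w) {r} y) {x : V} (hx : x ∈ core par w) (hxr : x ≠ r)
    (i : Fin 3) : -c (w i) (h x) = (if par (w i) ∈ descs y x then 1 else 0) -
      ∑ j ∈ M, c (w i) (h (w j)) * if yy j ∈ descs y x then 1 else 0 := by
  set A := descs y x with hA
  have hAcore : ∀ z ∈ A, z ∈ core par w ∧ z ≠ r := fun z hz =>
    t.descs_subset hy hx hxr (by simpa [hA] using hz)
  -- The product of w i with the sum over the arrow subtree A is computed twice: from the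
  -- adjacencies here, and column by column below.
  have h1 : ∑ z ∈ A, c (w i) ⬝ᵥ c z = -(if par (w i) ∈ A then 1 else 0) := by
    have h2 : ∀ z ∈ A, c (w i) ⬝ᵥ c z = -(if z = par (w i) then 1 else 0) := by
      intro z hz
      have hzw : w i ≠ z := fun e => w_not_mem (par := par) i (e ▸ (hAcore z hz).1)
      split_ifs with h3
      · exact t.conf.adj _ _ (h3 ▸ t.rooted.adj_par (t.ne_root i))
      · refine t.conf.nadj _ _ hzw fun hadj => ?_
        rcases (t.rooted.adj_iff _ _).1 hadj with ⟨-, h4⟩ | ⟨-, h4⟩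
        · exact h3 h4.symm
        · exact w_not_mem (par := par) i (h4 ▸ t.lower_core.2 z (hAcore z hz).1)
    rw [Finset.sum_congr rfl h2, Finset.sum_neg_distrib, Finset.sum_ite_eq']
  have h2 : ∑ z ∈ A, c (w i) ⬝ᵥ c z = ∑ k, c (w i) k * ∑ z ∈ A, c z k := by
    simp only [dotProduct, Finset.mul_sum]
    exact Finset.sum_comm
  rw [h2, t.sum_col_eq m] at h1
  have h3 : ∑ j, c (w i) (h (w j)) * ∑ z ∈ A, c z (h (w j)) =
      -∑ j ∈ M, c (w i) (h (w j)) * if yy j ∈ A then 1 else 0 := by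
    rw [← Finset.sum_neg_distrib, ← Finset.sum_subset (Finset.subset_univ M)]
    · refine Finset.sum_congr rfl fun j hj => ?_
      rw [Finset.sum_congr rfl fun z hz => t.mark_entry m hyy (hAcore z hz).1 j]
      simp [hj]
    · intro j _ hj
      rw [Finset.sum_congr rfl fun z hz => t.mark_entry m hyy (hAcore z hz).1 j]
      simp [hj]
  -- If w i holds the head column of s, then inside the core that column has only the entries 1 at s
  -- and -1 at its arrow parent. For s ≠ x both or neither of these lie in A, so they cancel; for s
  -- = x only the 1 does.
  have h4 : ∑ s ∈ core par w, c (w i) (h s) * ∑ z ∈ A, c z (h s) = c (w i) (h x) := by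
    rw [Finset.sum_eq_single x]
    · have h5 : ∑ z ∈ A, c z (h x) = 1 ∨ c (w i) (h x) = 0 := by
        rcases t.entry_cases m (v := w i) (x := x)
          (fun e => w_not_mem (par := par) i (e ▸ hx)) with h6 | h6
        · exact Or.inr h6
        · left
          rw [Finset.sum_eq_single x, t.core_pos hx]
          · intro z hz hzx
            obtain ⟨h7, -, h8, -⟩ := t.arrow_facts hy hx hxr
            refine t.second_holder m hy hx hxr (fun e => w_not_mem (par := par) i (e ▸ h7)) h6 hzx
              ?_ fun e => w_not_mem (par := par) i (e ▸ (hAcore z hz).1)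
            rintro rfl
            have h9 := rnk_le_of_anc t.rooted hy (by simpa [hA] using hz)
            have h10 := rnk_lt_of_mem_pre t.rooted (by simpa using hxr)
              (hy.1 x hx (by simpa using hxr)).1
            omega
          · exact fun e => absurd (by simpa [hA] using Anc.refl x) e
      rcases h5 with h5 | h5 <;> rw [h5] <;> ring
    · intro s hs hsx
      by_cases hsr : s = r
      · rw [hsr, t.head_root, Finset.sum_eq_zero]
        · ring
        · intro z hz
          exact t.other z (hAcore z hz).2
            fun i e => w_not_mem (par := par) i (e ▸ (hAcore z hz).1)
      · rcases t.entry_cases m (v := w i) (x := s)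
          (fun e => w_not_mem (par := par) i (e ▸ hs)) with h6 | h6
        · rw [h6]; ring
        · obtain ⟨h7, -, h8, h9⟩ := t.arrow_facts hy hs hsr
          have hys : y s ≠ s := fun e => by rw [e] at h8; omega
          have hz0 : ∀ z ∈ A, z ≠ s → z ≠ y s → c z (h s) = 0 := fun z hz h10 h11 =>
            t.second_holder m hy hs hsr (fun e => w_not_mem (par := par) i (e ▸ h7)) h6 h10 h11
              fun e => w_not_mem (par := par) i (e ▸ (hAcore z hz).1)
          have hiff : s ∈ A ↔ y s ∈ A := by
            simp only [hA, mem_descs]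
            exact ⟨fun h10 => (h10.eq_or).resolve_left (Ne.symm hsx), fun h10 =>
              h10.trans (anc_par s)⟩
          by_cases hsA : s ∈ A
          · rw [← Finset.add_sum_erase _ _ hsA, Finset.sum_eq_single (y s), t.core_pos hs, h9]
            · ring
            · intro z hz hzy
              exact hz0 z (Finset.mem_of_mem_erase hz) (Finset.ne_of_mem_erase hz) hzy
            · exact fun e => absurd (Finset.mem_erase.2 ⟨hys, hiff.1 hsA⟩) e
          · rw [Finset.sum_eq_zero]
            · ring
            · intro z hz
              exact hz0 z hz (fun e => hsA (e ▸ hz)) fun e => hsA (hiff.2 (e ▸ hz))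
    · exact fun e => absurd hx e
  rw [h3, h4] at h1
  linarith

/-- If not all marks are held by the same vertex, then all arrow subtrees contain a mark and exactly
one neighbour of the `w i`, and no head column of the core is held twice in the core. -/
theorem spread (t : Tri G c h r par dep e₀ w) (m : Marked c h par w M) [DecidableEq V]
    (hyy : ∀ j ∈ M, yy j ∈ core par w ∧ c (yy j) (h (w j)) = -1)
    (hy : IsArrow c h par (core par w) {r} y) (hne : ¬ ∀ i ∈ M, ∀ j ∈ M, yy i = yy j) {x : V}
    (hx : x ∈ core par w) (hxr : x ≠ r) :
    (∃ j ∈ M, yy j ∈ descs y x) ∧ ∑ i, (if par (w i) ∈ descs y x then 1 else 0 : ℤ) = 1 ∧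
      ∀ z ∈ core par w, z ≠ x → z ≠ y x → c z (h x) = 0 := by
  have hu : ∀ x ∈ core par w, ∀ i, c (w i) (h x) = 0 ∨ c (w i) (h x) = -1 := fun x hx i =>
    t.entry_cases m fun e => w_not_mem (par := par) i (e ▸ hx)
  -- Summing the flow over i removes the mark terms, because the column sums of the matrix vanish.
  have hN : ∀ x ∈ core par w, x ≠ r → -∑ i, c (w i) (h x) =
      ∑ i, (if par (w i) ∈ descs y x then 1 else 0 : ℤ) := by
    intro x hx hxr
    rw [← Finset.sum_neg_distrib, Finset.sum_congr rfl fun i _ => t.flow m hyy hy hx hxr i,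
      Finset.sum_sub_distrib, Finset.sum_comm]
    rw [Finset.sum_eq_zero (s := M), sub_zero]
    intro j hj
    rw [← Finset.sum_mul, m.col j hj, zero_mul]
  have hnon : ∀ x, ∀ i, (0 : ℤ) ≤ if par (w i) ∈ descs y x then 1 else 0 := by
    intro x i; split_ifs <;> norm_num
  -- With no neighbour of a w i in the subtree, the indicator of the marks inside it lies in the
  -- kernel of the matrix, hence is constant on M.
  have hzero : ∀ x ∈ core par w, x ≠ r →
      ∑ i, (if par (w i) ∈ descs y x then 1 else 0 : ℤ) = 0 →
      ∀ i ∈ M, ∀ j ∈ M, yy i ∈ descs y x → yy j ∈ descs y x := by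
    intro x hx hxr h0 i hi j hj hin
    have h1 : ∀ i, (if par (w i) ∈ descs y x then 1 else 0 : ℤ) = 0 := fun i =>
      (Finset.sum_eq_zero_iff_of_nonneg fun i _ => hnon x i).1 h0 i (Finset.mem_univ i)
    have h2 : ∀ i, c (w i) (h x) = 0 := by
      have h3 := hN x hx hxr
      rw [h0, neg_eq_zero] at h3
      have h4 := forall_eq_zero_of_sum h3 fun i _ => by have := hu x hx i; omega
      exact fun i => h4 i (Finset.mem_univ i)
    have h3 := m.conn (fun j => if yy j ∈ descs y x then 1 else 0) (fun i => by
      have h4 := t.flow m hyy hy hx hxr i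
      rw [h1 i, h2 i] at h4
      linarith) i hi j hj
    simp only [if_pos hin] at h3
    by_contra hcon
    rw [if_neg hcon] at h3
    norm_num at h3
  -- Otherwise a deepest subtree with a mark contains all marks, and then its top vertex holds all
  -- of them, which is excluded.
  have hpos : ∀ x ∈ core par w, x ≠ r → (∃ j ∈ M, yy j ∈ descs y x) →
      ∑ i, (if par (w i) ∈ descs y x then 1 else 0 : ℤ) ≠ 0 := by
    intro x hx hxr hj h0
    let S : Finset V := (descs y x).filter fun z => ∃ j ∈ M, yy j ∈ descs y z
    have hS : S.Nonempty := ⟨x, by simp only [S, Finset.mem_filter, mem_descs]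
                                   exact ⟨Anc.refl x, by simpa using hj⟩⟩
    obtain ⟨z, hzS, hmax⟩ := S.exists_max_image dep hS
    simp only [S, Finset.mem_filter, mem_descs] at hzS hmax
    obtain ⟨hxz, j, hj, hjz⟩ := hzS
    obtain ⟨hz, hzr⟩ := t.descs_subset hy hx hxr hxz
    have hz0 : ∑ i, (if par (w i) ∈ descs y z then 1 else 0 : ℤ) = 0 := by
      refine Finset.sum_eq_zero fun i _ => if_neg fun h1 => ?_
      have h2 := (Finset.sum_eq_zero_iff_of_nonneg fun i _ => hnon x i).1 h0 i (Finset.mem_univ i)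
      rw [if_pos (by rw [mem_descs] at h1 ⊢; exact hxz.trans h1)] at h2
      norm_num at h2
    have hallz : ∀ i ∈ M, Anc y z (yy i) := fun i hi => by
      simpa using hzero z hz hzr hz0 j hj i hi (by simpa using hjz)
    have hat : ∀ i ∈ M, yy i = z := by
      intro i hi
      by_contra hiz
      obtain ⟨b, h1, h2, h3⟩ := (hallz i hi).exists_child (Ne.symm hiz)
      have hzb : Anc y z b := h1 ▸ anc_par b
      obtain ⟨hb, hbr⟩ := t.descs_subset hy hz hzr hzb
      have h4 := hmax b ⟨hxz.trans hzb, i, hi, h3⟩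
      have h5 := (t.arrow_facts hy hb hbr).2.2.1
      rw [h1] at h5
      omega
    exact hne fun i hi j hj => (hat i hi).trans (hat j hj).symm
  -- Some w i holds the head column of x; by `second_holder` it is the only holder besides the arrow
  -- parent, so the count is exactly 1.
  have hone : ∀ x ∈ core par w, x ≠ r → (∃ j ∈ M, yy j ∈ descs y x) →
      ∑ i, (if par (w i) ∈ descs y x then 1 else 0 : ℤ) = 1 ∧
        ∀ z ∈ core par w, z ≠ x → z ≠ y x → c z (h x) = 0 := by
    intro x hx hxr hj
    have h1 := hpos x hx hxr hj
    have h2 := Finset.sum_nonneg fun i (_ : i ∈ Finset.univ) => hnon x i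
    obtain ⟨i, hi⟩ : ∃ i, c (w i) (h x) = -1 := by
      by_contra hcon
      push Not at hcon
      have h3 : ∀ i, c (w i) (h x) = 0 := fun i => (hu x hx i).resolve_right (hcon i)
      have h4 := hN x hx hxr
      simp only [h3, Finset.sum_const_zero, neg_zero] at h4
      exact h1 h4.symm
    obtain ⟨hyc, -, -, -⟩ := t.arrow_facts hy hx hxr
    have hwy : w i ≠ y x := fun e => w_not_mem (par := par) i (e ▸ hyc)
    have hsec := fun z => t.second_holder m hy hx hxr hwy hi (z := z)
    refine ⟨?_, fun z hz h3 h4 => hsec z h3 h4 fun e => w_not_mem (par := par) i (e ▸ hz)⟩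
    rw [← hN x hx hxr, Finset.sum_eq_single i, hi]
    · norm_num
    · intro j _ hji
      exact hsec (w j) (fun e => w_not_mem (par := par) j (e ▸ hx))
        (fun e => w_not_mem (par := par) j (e ▸ hyc)) fun e => hji (t.inj e)
    · simp
  -- If the subtree of x had no mark, x would have no arrow child and would hold a column with head
  -- s in the core. Either s is an ancestor whose column would be held twice in the core, or s is an
  -- arrow child of x.
  have hall : ∀ n, ∀ x ∈ core par w, x ≠ r → dep x = n → ∃ j ∈ M, yy j ∈ descs y x := by
    intro n
    induction n using Nat.strong_induction_on with
    | _ n ih =>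
      intro x hx hxr hn
      by_contra hcon
      push Not at hcon
      have hxR : x ∉ ({r} : Finset V) := by simpa using hxr
      have hnochild : ∀ s ∈ core par w, s ≠ r → y s ≠ x := by
        intro s hs hsr e
        obtain ⟨z, h1, h2, k, h3, h4⟩ := t.mark_of_child hy hs hsr
        rw [e] at h1 h2
        obtain ⟨j, hj, -, h5⟩ := t.mark_cases m hyy (t.descs_subset hy hx hxr h1).1 h3 h4
        exact hcon j hj (by rw [mem_descs, ← h5]; exact h1)
      obtain ⟨k, hk⟩ := exists_neg_one (t.heads x) (t.core_pos hx) (t.two_le x)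
      have hnm : ¬ IsMark c par w k := by
        intro hm
        obtain ⟨j, hj, -, h5⟩ := t.mark_cases m hyy hx hk hm
        exact hcon j hj (by rw [mem_descs, ← h5]; exact Anc.refl x)
      unfold IsMark at hnm
      push Not at hnm
      obtain ⟨s, hs, hsk⟩ := hnm
      have hks : h s = k := ((t.heads s).eq (Or.inl hsk)).symm
      have hsr : s ≠ r := by
        rintro rfl
        rw [t.head_root] at hks
        rw [← hks, t.sys_core.zero x hx hxR] at hk
        omega
      by_cases hpre : s ∈ pre par {r} x
      · rcases mem_pre.1 hpre with h1 | ⟨h1, h2⟩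
        · exact hsr (by simpa using h1)
        · have h3 := ih _ (hn ▸ t.rooted.anc_dep_lt h2 h1) s hs hsr rfl
          have h4 := (hone s hs hsr h3).2 x hx (Ne.symm h1) (Ne.symm (hnochild s hs hsr))
          rw [hks] at h4
          omega
      · exact hnochild s hs hsr
          (t.sys_core.primary t.conf t.heads t.rooted hy hx hxR hk hs hsk hpre).2
  have h1 := hall _ x hx hxr rfl
  exact ⟨h1, hone x hx hxr h1⟩

/-- If not all marks are held by the same vertex, then the graph is a star with the `w i` at the
ends of its legs. -/
theorem star_facts (t : Tri G c h r par dep e₀ w) (m : Marked c h par w M) [DecidableEq V]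
    (hyy : ∀ j ∈ M, yy j ∈ core par w ∧ c (yy j) (h (w j)) = -1)
    (hne : ¬ ∀ i ∈ M, ∀ j ∈ M, yy i = yy j) :
    (∀ x, x ≠ r → ∃! i, Anc par x (w i)) ∧
    (∀ x ∈ core par w, ∀ s ∈ core par w, s ≠ r →
      c x (h s) = (if x = s then 1 else 0) - if x = par s then 1 else 0) ∧
    (∀ x ∈ core par w, x ≠ r → ∀ i, -c (w i) (h x) = (if w i ∈ descs par x then 1 else 0) -
      ∑ j ∈ M, c (w i) (h (w j)) * if yy j ∈ descs par x then 1 else 0) ∧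
    ∀ x ∈ core par w, x ≠ r → ∃ j ∈ M, Anc par x (yy j) := by
  classical
  obtain ⟨y, hy⟩ := t.sys_core.exists_arrow t.conf t.heads t.rooted
  have hsp := fun x hx hxr => t.spread m hyy hy hne (x := x) hx hxr
  -- If x and its arrow parent were not adjacent, they would have to share a column to balance the
  -- head of x; but neither a mark nor a head column is held twice in the core.
  have hypar : ∀ x, x ∈ core par w → y x = par x := by
    intro x hx
    by_cases hxr : x = r
    · rw [hxr, hy.2 r (by simp), t.rooted.par_root]
    obtain ⟨h1, h2, h3, h4⟩ := t.arrow_facts hy hx hxr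
    have hyx : y x ≠ x := fun e => by rw [e] at h3; omega
    by_contra hcon
    have hnadj : ¬ G.Adj x (y x) := by
      intro hadj
      rcases (t.rooted.adj_iff _ _).1 hadj with ⟨-, h5⟩ | ⟨-, h5⟩
      · exact hcon h5.symm
      · have := t.rooted.dep_par_le (y x)
        rw [h5] at this
        omega
    obtain ⟨j, h5, h6⟩ := t.conf.exists_common_of_dot t.heads (Ne.symm hyx) (t.core_pos hx)
      (t.core_pos h1) (t.conf.nadj _ _ (Ne.symm hyx) hnadj).ge (k := h x)
      (by rw [t.core_pos hx, h4]; norm_num)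
    by_cases hm : IsMark c par w j
    · exact hyx (t.mark_unique h1 hx h6 h5 hm)
    · unfold IsMark at hm
      push Not at hm
      obtain ⟨s, hs, hsk⟩ := hm
      have hks : h s = j := ((t.heads s).eq (Or.inl hsk)).symm
      have hsr : s ≠ r := by
        rintro rfl
        rw [t.head_root] at hks
        rw [← hks, t.sys_core.zero x hx (by simpa using hxr)] at h5
        omega
      have hh := (hsp s hs hsr).2.2
      rw [hks] at hh
      have e1 : x = y s := by
        by_contra e
        have := hh x hx (fun e' => by rw [e', hsk] at h5; omega) e
        omega
      have e2 : y x = y s := by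
        by_contra e
        have := hh (y x) h1 (fun e' => by rw [e', hsk] at h6; omega) e
        omega
      exact hyx (e2.trans e1.symm)
  have hanc : ∀ x z, z ∈ core par w → (Anc y x z ↔ Anc par x z) := by
    intro x z hz
    have hit : ∀ n, y^[n] z = par^[n] z ∧ par^[n] z ∈ core par w := by
      intro n
      induction n with
      | zero => exact ⟨rfl, hz⟩
      | succ n ih =>
        rw [Function.iterate_succ_apply', Function.iterate_succ_apply', ih.1, hypar _ ih.2]
        exact ⟨rfl, t.lower_core.2 _ ih.2⟩
    exact ⟨fun ⟨n, hn⟩ => ⟨n, (hit n).1 ▸ hn⟩, fun ⟨n, hn⟩ => ⟨n, (hit n).1.trans hn⟩⟩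
  have hwd : ∀ x ∈ core par w, ∀ i, par (w i) ∈ descs y x ↔ Anc par x (w i) := by
    intro x hx i
    rw [mem_descs, hanc x _ (t.par_w i)]
    refine ⟨fun h1 => h1.trans (anc_par _), fun h1 => (h1.eq_or).resolve_left fun e =>
      w_not_mem (par := par) i (e ▸ hx)⟩
  refine ⟨fun x hxr => ?_, fun x hx s hs hsr => ?_, fun x hx hxr i => ?_, fun x hx hxr => ?_⟩
  · rcases mem_coreW.1 (t.full m x) with hx | ⟨i, rfl⟩
    · have h1 := (hsp x hx hxr).2.1
      rw [Finset.sum_congr rfl fun i _ => if_congr (hwd x hx i) rfl rfl] at h1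
      have h2 : ((Finset.univ.filter fun i => Anc par x (w i)).card : ℤ) = 1 := by
        rw [← h1, Finset.sum_boole]
      have h3 := Finset.card_eq_one.1 (by exact_mod_cast h2)
      obtain ⟨i, hi⟩ := h3
      refine ⟨i, by simpa using (Finset.ext_iff.1 hi i).2 (by simp), fun j hj => ?_⟩
      simpa using (Finset.ext_iff.1 hi j).1 (by simpa using hj)
    · refine ⟨i, Anc.refl _, fun j hj => ?_⟩
      by_contra hne
      exact t.incomparable (Ne.symm hne) hj
  · obtain ⟨h1, -, h3, h4⟩ := t.arrow_facts hy hs hsr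
    rw [hypar s hs] at h1 h3 h4
    have hps : par s ≠ s := t.rooted.par_ne hsr
    by_cases e1 : x = s
    · rw [e1, if_pos rfl, if_neg hps.symm, t.core_pos hs]; norm_num
    · by_cases e2 : x = par s
      · rw [e2, if_neg hps, if_pos rfl, h4]; norm_num
      · rw [if_neg e1, if_neg e2, (hsp s hs hsr).2.2 x hx e1 (by rw [hypar s hs]; exact e2)]
        norm_num
  · rw [t.flow m hyy hy hx hxr i]
    congr 1
    · exact if_congr ((hwd x hx i).trans mem_descs.symm) rfl rfl
    · refine Finset.sum_congr rfl fun j hj => ?_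
      congr 1
      exact if_congr (mem_descs.trans ((hanc x _ (hyy j hj).1).trans mem_descs.symm)) rfl rfl
  · obtain ⟨j, hj, h1⟩ := (hsp x hx hxr).1
    exact ⟨j, hj, (hanc x _ (hyy j hj).1).1 (by simpa using h1)⟩

end

end Tri

end PlumbingGraph

/-! ### Recognizing star-shaped graphs -/

namespace PlumbingGraph

open Matrix

section Depth
variable {V : Type*} {G : SimpleGraph V} {r : V} {par : V → V} {dep : V → ℕ}

theorem IsRooted.dep_eq_zero (hR : IsRooted G r par dep) (h0 : dep r = 0) {x : V} :
    dep x = 0 ↔ x = r := by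
  refine ⟨fun h => ?_, fun h => h ▸ h0⟩
  by_contra hne
  have := hR.dep_root_lt hne
  omega

theorem IsRooted.dep_iterate (hR : IsRooted G r par dep) (h0 : dep r = 0)
    (hs : ∀ x, x ≠ r → dep (par x) + 1 = dep x) (n : ℕ) (x : V) :
    dep (par^[n] x) = dep x - n := by
  induction n with
  | zero => simp
  | succ n ih =>
    rw [Function.iterate_succ_apply']
    by_cases h1 : par^[n] x = r
    · rw [h1, hR.par_root, h0]
      rw [h1, h0] at ih
      omega
    · have := hs _ h1
      omega

theorem IsRooted.anc_eq_iterate (hR : IsRooted G r par dep) (h0 : dep r = 0)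
    (hs : ∀ x, x ≠ r → dep (par x) + 1 = dep x) {a x : V} (h : Anc par a x) :
    par^[dep x - dep a] x = a := by
  obtain ⟨n, hn⟩ := h
  have h1 := hR.dep_iterate h0 hs n x
  rw [hn] at h1
  rcases le_or_gt n (dep x) with h2 | h2
  · rw [h1, Nat.sub_sub_self h2, hn]
  · have h3 : a = r := (hR.dep_eq_zero h0).1 (by omega)
    rw [h3, h0]
    exact (hR.dep_eq_zero h0).1 (by rw [hR.dep_iterate h0 hs]; omega)

theorem IsRooted.anc_inj (hR : IsRooted G r par dep) (h0 : dep r = 0)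
    (hs : ∀ x, x ≠ r → dep (par x) + 1 = dep x) {a b x : V} (ha : Anc par a x)
    (hb : Anc par b x) : a = b ↔ dep a = dep b := by
  refine ⟨fun h => h ▸ rfl, fun h => ?_⟩
  rw [← hR.anc_eq_iterate h0 hs ha, ← hR.anc_eq_iterate h0 hs hb, h]

theorem IsRooted.card_ancs (hR : IsRooted G r par dep) [Fintype V] [DecidableEq V] (h0 : dep r = 0)
    (hs : ∀ x, x ≠ r → dep (par x) + 1 = dep x) (z : V) : ((ancs par z).erase r).card = dep z := by
  have key : ∀ n z, dep z = n → ((ancs par z).erase r).card = dep z := by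
    intro n
    induction n with
    | zero =>
      intro z hz
      have hzr := (hR.dep_eq_zero h0).1 hz
      rw [hz, Finset.card_eq_zero, Finset.eq_empty_iff_forall_notMem]
      intro a ha
      rw [Finset.mem_erase, mem_ancs, hzr] at ha
      exact ha.1 (hR.anc_root ha.2)
    | succ n ih =>
      intro z hz
      have hzr : z ≠ r := fun e => by rw [e, h0] at hz; omega
      have h1 := hs z hzr
      have h2 := ih (par z) (by omega)
      have h3 : (ancs par z).erase r = insert z ((ancs par (par z)).erase r) := by
        ext a
        simp only [Finset.mem_erase, mem_ancs, Finset.mem_insert]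
        constructor
        · rintro ⟨h4, h5⟩
          rcases h5.eq_or with h6 | h6
          · exact Or.inl h6
          · exact Or.inr ⟨h4, h6⟩
        · rintro (h4 | ⟨h4, h5⟩)
          · rw [h4]; exact ⟨hzr, Anc.refl z⟩
          · exact ⟨h4, h5.trans (anc_par z)⟩
      rw [h3, Finset.card_insert_of_notMem, h2]
      · exact h1
      · rw [Finset.mem_erase, mem_ancs]
        rintro ⟨-, h4⟩
        have := hR.anc_dep_le h4
        omega
  exact key _ z rfl

end Depth

/-- Position s on the i-th leg is the ancestor of w i at depth s + 1, since lists start at 0 and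
legs at depth 1. -/
theorem isomorphic_starGraph {Γ : PlumbingGraph.{u}} {r : Γ.V} {par : Γ.V → Γ.V} {dep : Γ.V → ℕ}
    (hR : IsRooted Γ.graph r par dep) (h0 : dep r = 0)
    (hs : ∀ x, x ≠ r → dep (par x) + 1 = dep x) {w : Fin 3 → Γ.V}
    (huniq : ∀ x, x ≠ r → ∃! i, Anc par x (w i)) {cc : ℤ} {L : Fin 3 → List ℤ}
    (hlen : ∀ i, (L i).length = dep (w i)) (hc : Γ.dec r = -cc)
    (hdec : ∀ i x, x ≠ r → Anc par x (w i) → (L i)[dep x - 1]? = some (-Γ.dec x)) :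
    Γ.Isomorphic (starGraph cc L) := by
  classical
  let F : (starGraph cc L).V → Γ.V := fun o =>
    Option.elim o r fun x => par^[dep (w x.1) - 1 - x.2.val] (w x.1)
  have hF : ∀ (i) (s : Fin (L i).length), F (some ⟨i, s⟩) = par^[dep (w i) - 1 - s.val] (w i) :=
    fun _ _ => rfl
  have hanc : ∀ (i) (s : Fin (L i).length), Anc par (F (some ⟨i, s⟩)) (w i) := fun i s => ⟨_, rfl⟩
  have hdep : ∀ (i) (s : Fin (L i).length), dep (F (some ⟨i, s⟩)) = s.val + 1 := by
    intro i s
    have := s.2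
    have := hlen i
    rw [hF, hR.dep_iterate h0 hs]
    omega
  have hne : ∀ (i) (s : Fin (L i).length), F (some ⟨i, s⟩) ≠ r := by
    intro i s e
    have := hdep i s
    rw [e, h0] at this
    omega
  have hext : ∀ (i j) (s : Fin (L i).length) (s' : Fin (L j).length), i = j → s.val = s'.val →
      (some ⟨i, s⟩ : Option (Σ i : Fin 3, Fin (L i).length)) = some ⟨j, s'⟩ := by
    rintro i j s s' rfl e
    obtain rfl := Fin.ext e
    rfl
  have hinj : Function.Injective F := by
    rintro (_ | ⟨i, s⟩) (_ | ⟨j, s'⟩) e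
    · rfl
    · exact absurd e.symm (hne j s')
    · exact absurd e (hne i s)
    · have hij : i = j := (huniq _ (hne i s)).unique (hanc i s) (e ▸ hanc j s')
      have h1 := hdep i s
      rw [e, hdep] at h1
      exact hext _ _ _ _ hij (by omega)
  have hsurj : Function.Surjective F := by
    intro x
    by_cases hx : x = r
    · exact ⟨none, hx.symm⟩
    · obtain ⟨i, hi, -⟩ := huniq x hx
      have h1 := hR.anc_dep_le hi
      have h2 : dep x ≠ 0 := fun e => hx ((hR.dep_eq_zero h0).1 e)
      refine ⟨some ⟨i, ⟨dep x - 1, by rw [hlen]; omega⟩⟩, ?_⟩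
      rw [hF]
      have h3 : dep (w i) - 1 - (dep x - 1) = dep (w i) - dep x := by omega
      simp only [h3]
      exact hR.anc_eq_iterate h0 hs hi
  have hpar : ∀ (i) (s s' : Fin (L i).length), s.val + 1 = s'.val →
      par (F (some ⟨i, s'⟩)) = F (some ⟨i, s⟩) := by
    intro i s s' e
    have := s'.2
    have := hlen i
    rw [hF, hF, ← Function.iterate_succ_apply' par]
    congr 2
    omega
  have hadj : ∀ a b, Γ.graph.Adj (F a) (F b) ↔ (starGraph cc L).graph.Adj a b := by
    have hroot : ∀ (i) (s : Fin (L i).length), par (F (some ⟨i, s⟩)) = r ↔ s.val = 0 := by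
      intro i s
      rw [← hR.dep_eq_zero h0]
      have := hs _ (hne i s)
      rw [hdep] at this
      omega
    have hstep : ∀ (i j) (s : Fin (L i).length) (s' : Fin (L j).length),
        par (F (some ⟨i, s⟩)) = F (some ⟨j, s'⟩) ↔ i = j ∧ s'.val + 1 = s.val := by
      intro i j s s'
      constructor
      · intro e
        have h1 : Anc par (F (some ⟨j, s'⟩)) (w i) := e ▸ (anc_par _).trans (hanc i s)
        have h2 := hs _ (hne i s)
        rw [e, hdep, hdep] at h2
        exact ⟨(huniq _ (hne j s')).unique h1 (hanc j s'), by omega⟩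
      · rintro ⟨rfl, e⟩
        exact hpar i s' s e
    rintro (_ | ⟨i, s⟩) (_ | ⟨j, s'⟩)
    · exact ⟨fun h => absurd h (SimpleGraph.irrefl _), fun h => h.elim⟩
    · rw [hR.adj_iff]
      change _ ↔ s'.val = 0
      rw [← hroot j s']
      exact ⟨fun h => h.elim (fun h => absurd rfl h.1) fun h => h.2, fun h => Or.inr ⟨hne j s', h⟩⟩
    · rw [hR.adj_iff]
      change _ ↔ s.val = 0
      rw [← hroot i s]
      exact ⟨fun h => h.elim (fun h => h.2) fun h => absurd rfl h.1, fun h => Or.inl ⟨hne i s, h⟩⟩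
    · rw [hR.adj_iff, hstep, hstep]
      change _ ↔ i = j ∧ (s.val + 1 = s'.val ∨ s'.val + 1 = s.val)
      have e1 := hne i s
      have e2 := hne j s'
      constructor
      · rintro (⟨-, h1, h2⟩ | ⟨-, h1, h2⟩)
        · exact ⟨h1, Or.inr h2⟩
        · exact ⟨h1.symm, Or.inl h2⟩
      · rintro ⟨h1, h2 | h2⟩
        · exact Or.inr ⟨e2, h1.symm, h2⟩
        · exact Or.inl ⟨e1, h1, h2⟩
  let E := Equiv.ofBijective F ⟨hinj, hsurj⟩
  refine ⟨⟨E.symm, ?_⟩, fun v => ?_⟩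
  · intro a b
    rw [← hadj]
    change Γ.graph.Adj (E (E.symm a)) (E (E.symm b)) ↔ _
    rw [E.apply_symm_apply, E.apply_symm_apply]
  · change (starGraph cc L).dec (E.symm v) = Γ.dec v
    obtain ⟨o, rfl⟩ := E.surjective v
    rw [E.symm_apply_apply]
    rcases o with _ | ⟨i, s⟩
    · exact hc.symm
    · change -(L i).get s = Γ.dec (F (some ⟨i, s⟩))
      have h1 := hdec i _ (hne i s) (hanc i s)
      rw [hdep] at h1
      simp only [Nat.add_sub_cancel, Fin.is_lt, List.getElem?_eq_getElem, Option.some_inj] at h1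
      rw [List.get_eq_getElem, h1]
      ring

/-! ### Entries of the lists describing the legs -/

theorem getElem?_leg₁ {q n : ℕ} {e : ℤ} (hn : n ≤ q) :
    (twos q ++ [e])[n]? = some (if n = q then e else 2) := by
  rcases hn.lt_or_eq with h | h
  · rw [List.getElem?_append_left (by simpa [twos] using h), if_neg h.ne]
    simp [twos, List.getElem?_replicate, h]
  · subst h
    rw [List.getElem?_append_right (by simp [twos])]
    simp [twos]

theorem getElem?_leg₂ {q p n : ℕ} {x e : ℤ} (hn : n ≤ q + 1 + p) :
    (twos q ++ [x] ++ twos p ++ [e])[n]? =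
      some (if n = q then x else if n = q + 1 + p then e else 2) := by
  rw [List.append_assoc]
  rcases le_or_gt n q with h | h
  · rw [List.getElem?_append_left (by simpa [twos] using by omega), getElem?_leg₁ h,
      if_neg (show ¬ n = q + 1 + p by omega)]
  · rw [List.getElem?_append_right (by simpa [twos] using by omega)]
    have h1 : (twos q ++ [x]).length = q + 1 := by simp [twos]
    rw [h1, getElem?_leg₁ (by omega), if_neg (show ¬ n = q by omega)]
    congr 1
    exact if_congr (by omega) rfl rfl

theorem getElem?_leg₃ {q s p n : ℕ} {x y e : ℤ} (hn : n ≤ q + 1 + s + 1 + p) :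
    (twos q ++ [x] ++ twos s ++ [y] ++ twos p ++ [e])[n]? =
      some (if n = q then x else if n = q + 1 + s then y else
        if n = q + 1 + s + 1 + p then e else 2) := by
  rw [List.append_assoc]
  rcases le_or_gt n (q + 1 + s) with h | h
  · rw [List.getElem?_append_left (by simpa [twos] using by omega), getElem?_leg₂ h,
      if_neg (show ¬ n = q + 1 + s + 1 + p by omega)]
  · rw [List.getElem?_append_right (by simpa [twos] using by omega)]
    have h1 : (twos q ++ [x] ++ twos s ++ [y]).length = q + 1 + s + 1 := by simp [twos]; omega
    rw [h1, getElem?_leg₁ (by omega), if_neg (show ¬ n = q by omega),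
      if_neg (show ¬ n = q + 1 + s by omega)]
    congr 1
    exact if_congr (by omega) rfl rfl

end PlumbingGraph

/-! ### Squares of the vertices on the legs -/

namespace PlumbingGraph

open Matrix

namespace Tri

section
variable {V ι : Type*} [Fintype V] [Fintype ι] {G : SimpleGraph V} {c : V → ι → ℤ}
  {h : V → ι} {r : V} {par : V → V} {dep : V → ℕ} {e₀ : ι} {w : Fin 3 → V}
  {M : Finset (Fin 3)} {yy : Fin 3 → V}

theorem core_or (t : Tri G c h r par dep e₀ w) (m : Marked c h par w M) (x : V) :
    x ∈ core par w ∨ ∃ i, x = w i := by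
  rcases mem_coreW.1 (t.full m x) with h1 | ⟨i, rfl⟩
  · exact Or.inl h1
  · exact Or.inr ⟨i, rfl⟩

-- A core vertex has entry 1 at its head and -1 exactly at the heads of its children in the core and
-- at its marks. The condition on depths excludes the child w i, which is not in the core.
open Classical in
theorem core_dot (t : Tri G c h r par dep e₀ w) (m : Marked c h par w M)
    (hyy : ∀ j ∈ M, yy j ∈ core par w ∧ c (yy j) (h (w j)) = -1)
    (hne : ¬ ∀ i ∈ M, ∀ j ∈ M, yy i = yy j) (h0 : dep r = 0)
    (hs : ∀ x, x ≠ r → dep (par x) + 1 = dep x) {x : V} (hx : x ∈ core par w) :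
    c x ⬝ᵥ c x = 1 + ∑ i, (if Anc par x (w i) ∧ dep x + 1 < dep (w i) then 1 else 0) +
      ∑ j ∈ M, if yy j = x then 1 else 0 := by
  obtain ⟨F1, F2, -, -⟩ := t.star_facts m hyy hne
  have h1 : ∑ j, c x (h (w j)) * c x (h (w j)) = ∑ j ∈ M, if yy j = x then 1 else 0 := by
    rw [← Finset.sum_subset (Finset.subset_univ M)]
    · refine Finset.sum_congr rfl fun j hj => ?_
      rw [t.mark_entry m hyy hx]
      by_cases h2 : yy j = x <;> simp [hj, h2]
    · intro j _ hj
      rw [t.mark_entry m hyy hx]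
      simp [hj]
  have h2 : ∀ s ∈ core par w, c x (h s) * c x (h s) =
      (if x = s then 1 else 0) + if s ≠ r ∧ x = par s then 1 else 0 := by
    intro s hs'
    by_cases hsr : s = r
    · subst hsr
      rw [t.head_root]
      by_cases hxs : x = s
      · rw [hxs, t.root]; simp
      · rw [t.other x hxs fun i e => w_not_mem (par := par) i (e ▸ hx)]; simp [hxs]
    · rw [F2 x hx s hs' hsr]
      have hps := t.rooted.par_ne hsr
      by_cases h3 : x = s
      · simp [h3, hps.symm]
      · by_cases h4 : x = par s <;> simp [h3, h4, hsr, hps]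
  have h3 : ∑ s ∈ core par w, (if s ≠ r ∧ x = par s then 1 else 0 : ℤ) =
      ∑ i, if Anc par x (w i) ∧ dep x + 1 < dep (w i) then 1 else 0 := by
    have h4 : ∀ s, (if s ≠ r ∧ x = par s then 1 else 0 : ℤ) =
        ∑ i, if (s ≠ r ∧ x = par s) ∧ Anc par s (w i) then 1 else 0 := by
      intro s
      by_cases h5 : s ≠ r ∧ x = par s
      · obtain ⟨i, hi, hu⟩ := F1 s h5.1
        rw [if_pos h5, Finset.sum_eq_single i]
        · rw [if_pos ⟨h5, hi⟩]
        · intro j _ hj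
          rw [if_neg fun h6 => hj (hu j h6.2)]
        · simp
      · rw [if_neg h5, Finset.sum_eq_zero fun i _ => if_neg fun h6 => h5 h6.1]
    rw [Finset.sum_congr rfl fun s _ => h4 s, Finset.sum_comm]
    refine Finset.sum_congr rfl fun i _ => ?_
    by_cases h5 : Anc par x (w i) ∧ dep x + 1 < dep (w i)
    · rw [if_pos h5]
      set s₀ := par^[dep (w i) - dep x - 1] (w i) with hs₀
      have hanc : Anc par s₀ (w i) := ⟨_, rfl⟩
      have hd : dep s₀ = dep x + 1 := by
        rw [hs₀, t.rooted.dep_iterate h0 hs]; omega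
      have hsr : s₀ ≠ r := fun e => by rw [e, h0] at hd; omega
      have hpx : x = par s₀ := by
        have h6 := hs s₀ hsr
        exact (t.rooted.anc_inj h0 hs h5.1 ((anc_par s₀).trans hanc)).2 (by omega)
      have hcore : s₀ ∈ core par w := by
        refine mem_core.2 fun j hj => ?_
        have h6 := t.rooted.anc_dep_le hj
        by_cases hij : j = i
        · rw [hij] at h6; omega
        · exact t.incomparable hij (hj.trans hanc)
      rw [Finset.sum_eq_single s₀]
      · rw [if_pos ⟨⟨hsr, hpx⟩, hanc⟩]
      · intro s _ hss
        rw [if_neg]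
        rintro ⟨⟨h6, h7⟩, h8⟩
        have h9 := hs s h6
        rw [← h7] at h9
        exact hss ((t.rooted.anc_inj h0 hs h8 hanc).2 (by omega))
      · exact fun e => absurd hcore e
    · rw [if_neg h5]
      refine Finset.sum_eq_zero fun s hs' => if_neg ?_
      rintro ⟨⟨h6, h7⟩, h8⟩
      refine h5 ⟨h7 ▸ (anc_par s).trans h8, ?_⟩
      have h9 := hs s h6
      have h10 := t.rooted.anc_dep_lt h8 fun e => w_not_mem (par := par) i (e ▸ hs')
      rw [← h7] at h9
      omega
  unfold dotProduct
  rw [t.sum_col_eq m, h1, Finset.sum_congr rfl h2, Finset.sum_add_distrib, h3]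
  simp [hx]

/-- Off the three head columns and e₀ the entries are 0 or -1, so their squares are the flows.
Summed over the core without the root, an indicator of descendants becomes a depth: dep(yy j) for a
mark holder, and dep(w i) - 1 for w i itself, to which e₀ adds 1. -/
theorem w_dot (t : Tri G c h r par dep e₀ w) (m : Marked c h par w M)
    (hyy : ∀ j ∈ M, yy j ∈ core par w ∧ c (yy j) (h (w j)) = -1)
    (hne : ¬ ∀ i ∈ M, ∀ j ∈ M, yy i = yy j) (h0 : dep r = 0)
    (hs : ∀ x, x ≠ r → dep (par x) + 1 = dep x) (i : Fin 3) :
    c (w i) ⬝ᵥ c (w i) = ∑ j, c (w i) (h (w j)) * c (w i) (h (w j)) + dep (w i) -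
      ∑ j ∈ M, c (w i) (h (w j)) * dep (yy j) := by
  classical
  obtain ⟨F1, F2, F3, -⟩ := t.star_facts m hyy hne
  have hcount : ∀ z ∈ core par w, ∑ s ∈ (core par w).erase r, (if z ∈ descs par s then 1 else 0 : ℤ)
      = dep z := by
    intro z hz
    rw [← t.rooted.card_ancs h0 hs z, Finset.sum_boole]
    congr 2
    ext s
    simp only [Finset.mem_filter, Finset.mem_erase, mem_descs, mem_ancs]
    exact ⟨fun h1 => ⟨h1.1.1, h1.2⟩, fun h1 => ⟨⟨h1.1, t.lower_core.anc h1.2 hz⟩, h1.2⟩⟩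
  have hcountw : ∑ s ∈ (core par w).erase r, (if w i ∈ descs par s then 1 else 0 : ℤ)
      = dep (w i) - 1 := by
    have h1 := hs (w i) (t.ne_root i)
    have h2 := hcount _ (t.par_w i)
    have h3 : ∀ s ∈ (core par w).erase r, (if w i ∈ descs par s then 1 else 0 : ℤ) =
        if par (w i) ∈ descs par s then 1 else 0 := by
      intro s hs'
      refine if_congr ?_ rfl rfl
      simp only [mem_descs]
      exact ⟨fun h4 => (h4.eq_or).resolve_left fun e =>
        w_not_mem (par := par) i (e ▸ Finset.mem_of_mem_erase hs'), fun h4 => h4.trans (anc_par _)⟩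
    rw [Finset.sum_congr rfl h3, h2]
    omega
  unfold dotProduct
  rw [t.sum_col_eq m, ← Finset.add_sum_erase _ _ t.root_mem, t.head_root, t.hold]
  have h1 : ∀ s ∈ (core par w).erase r, c (w i) (h s) * c (w i) (h s) =
      (if w i ∈ descs par s then 1 else 0) -
      ∑ j ∈ M, c (w i) (h (w j)) * if yy j ∈ descs par s then 1 else 0 := by
    intro s hs'
    have hsc := Finset.mem_of_mem_erase hs'
    rw [← F3 s hsc (Finset.ne_of_mem_erase hs') i]
    rcases t.entry_cases m (v := w i) (x := s)
      (fun e => w_not_mem (par := par) i (e ▸ hsc)) with h6 | h6 <;> rw [h6] <;> norm_num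
  rw [Finset.sum_congr rfl h1, Finset.sum_sub_distrib, hcountw, Finset.sum_comm]
  have h2 : ∑ j ∈ M, ∑ s ∈ (core par w).erase r, (c (w i) (h (w j)) *
      if yy j ∈ descs par s then 1 else 0) = ∑ j ∈ M, c (w i) (h (w j)) * dep (yy j) := by
    refine Finset.sum_congr rfl fun j hj => ?_
    rw [← Finset.mul_sum, hcount _ (hyy j hj).1]
  rw [h2]
  ring

/-- The arms of the star: all marks lie on the leg of one of the `w i`. -/
theorem leg_dot (t : Tri G c h r par dep e₀ w) (m : Marked c h par w M)
    (hyy : ∀ j ∈ M, yy j ∈ core par w ∧ c (yy j) (h (w j)) = -1)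
    (hne : ¬ ∀ i ∈ M, ∀ j ∈ M, yy i = yy j) (h0 : dep r = 0)
    (hs : ∀ x, x ≠ r → dep (par x) + 1 = dep x) {x : V} (hx : x ∈ core par w) (hxr : x ≠ r)
    {a : Fin 3} (ha : Anc par x (w a)) {N : Finset (Fin 3)}
    (hN : ∀ j, j ∈ N ↔ j ∈ M ∧ yy j ≠ r ∧ Anc par (yy j) (w a)) :
    c x ⬝ᵥ c x = 1 + (if dep x + 1 < dep (w a) then 1 else 0) +
      ∑ j ∈ N, if dep (yy j) = dep x then 1 else 0 := by
  classical
  obtain ⟨F1, -, -, -⟩ := t.star_facts m hyy hne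
  rw [t.core_dot m hyy hne h0 hs hx]
  congr 1
  · congr 1
    rw [Finset.sum_eq_single a]
    · simp [ha]
    · intro j _ hj
      rw [if_neg fun e => hj ((F1 x hxr).unique e.1 ha)]
    · simp
  · rw [← Finset.sum_subset (s₁ := N) (fun j hj => ((hN j).1 hj).1)]
    · refine Finset.sum_congr rfl fun j hj => ?_
      exact if_congr (t.rooted.anc_inj h0 hs ((hN j).1 hj).2.2 ha) rfl rfl
    · intro j hj hjN
      rw [if_neg]
      intro e
      exact hjN ((hN j).2 ⟨hj, e ▸ hxr, e ▸ ha⟩)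

theorem root_dot (t : Tri G c h r par dep e₀ w) (m : Marked c h par w M)
    (hyy : ∀ j ∈ M, yy j ∈ core par w ∧ c (yy j) (h (w j)) = -1)
    (hne : ¬ ∀ i ∈ M, ∀ j ∈ M, yy i = yy j) (h0 : dep r = 0)
    (hs : ∀ x, x ≠ r → dep (par x) + 1 = dep x) :
    c r ⬝ᵥ c r = 1 + ∑ i, (if 1 < dep (w i) then 1 else 0) +
      ∑ j ∈ M, if dep (yy j) = 0 then 1 else 0 := by
  classical
  rw [t.core_dot m hyy hne h0 hs t.root_mem]
  congr 1
  · congr 1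
    refine Finset.sum_congr rfl fun i _ => if_congr ?_ rfl rfl
    simp [t.rooted.root_anc (w i), h0]
  · exact Finset.sum_congr rfl fun j _ => if_congr (t.rooted.dep_eq_zero h0).symm rfl rfl

end

theorem to_star {Γ : PlumbingGraph.{u}} {ι : Type w} [Fintype ι] {c : Γ.V → ι → ℤ} {h : Γ.V → ι}
    {r : Γ.V} {par : Γ.V → Γ.V} {dep : Γ.V → ℕ} {e₀ : ι} {w : Fin 3 → Γ.V}
    {M : Finset (Fin 3)} {yy : Fin 3 → Γ.V}
    (t : Tri Γ.graph c h r par dep e₀ w) (m : Marked c h par w M)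
    (hyy : ∀ j ∈ M, yy j ∈ core par w ∧ c (yy j) (h (w j)) = -1)
    (hne : ¬ ∀ i ∈ M, ∀ j ∈ M, yy i = yy j) (h0 : dep r = 0)
    (hs : ∀ x, x ≠ r → dep (par x) + 1 = dep x) (hd : ∀ v, Γ.dec v = -(c v ⬝ᵥ c v))
    (σ : Fin 3 → Fin 3) (hσ : Function.Bijective σ) {cc : ℤ} {L : Fin 3 → List ℤ}
    (hlen : ∀ i, (L i).length = dep (w (σ i))) (hc : c r ⬝ᵥ c r = cc)
    (hcore : ∀ i, ∀ x ∈ core par w, x ≠ r → Anc par x (w (σ i)) →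
      (L i)[dep x - 1]? = some (c x ⬝ᵥ c x))
    (hend : ∀ i, (L i)[dep (w (σ i)) - 1]? = some (c (w (σ i)) ⬝ᵥ c (w (σ i)))) :
    Γ.Isomorphic (starGraph cc L) := by
  classical
  obtain ⟨F1, -, -, -⟩ := t.star_facts m hyy hne
  refine isomorphic_starGraph t.rooted h0 hs (w := w ∘ σ) (fun x hx => ?_) hlen (by rw [hd, hc])
    fun i x hx ha => ?_
  · obtain ⟨i, hi, hu⟩ := F1 x hx
    obtain ⟨j, rfl⟩ := hσ.2 i
    exact ⟨j, hi, fun j' hj' => hσ.1 (hu (σ j') hj')⟩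
  · rw [hd, neg_neg]
    rcases t.core_or m x with h1 | ⟨j, rfl⟩
    · exact hcore i x h1 hx ha
    · have : j = σ i := by
        by_contra hji
        exact t.incomparable hji ha
      subst this
      exact hend i

end Tri

end PlumbingGraph

/-! ### The cyclic pattern -/

namespace PlumbingGraph

open Matrix

namespace Tri

section
variable {V ι : Type*} [Fintype V] [Fintype ι] {G : SimpleGraph V} {c : V → ι → ℤ}
  {h : V → ι} {r : V} {par : V → V} {dep : V → ℕ} {e₀ : ι} {w : Fin 3 → V}
  {M : Finset (Fin 3)} {yy : Fin 3 → V}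

/-- A mark holder at the root lies above every leg, so `b j` is then arbitrary; its depth 0 never
equals that of x. -/
theorem leg_dot_of_legs (t : Tri G c h r par dep e₀ w) (m : Marked c h par w M)
    (hyy : ∀ j ∈ M, yy j ∈ core par w ∧ c (yy j) (h (w j)) = -1)
    (hne : ¬ ∀ i ∈ M, ∀ j ∈ M, yy i = yy j) (h0 : dep r = 0)
    (hs : ∀ x, x ≠ r → dep (par x) + 1 = dep x) {b : Fin 3 → Fin 3}
    (hb : ∀ j ∈ M, Anc par (yy j) (w (b j))) {x : V} (hx : x ∈ core par w) (hxr : x ≠ r)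
    {a : Fin 3} (ha : Anc par x (w a)) :
    c x ⬝ᵥ c x = 1 + (if dep x + 1 < dep (w a) then 1 else 0) +
      ∑ j ∈ M, if b j = a ∧ dep (yy j) = dep x then 1 else 0 := by
  classical
  obtain ⟨F1, -, -, -⟩ := t.star_facts m hyy hne
  rw [t.leg_dot m hyy hne h0 hs hx hxr ha (N := M.filter fun j => yy j ≠ r ∧ Anc par (yy j) (w a))
    (fun j => by simp)]
  congr 1
  rw [Finset.sum_filter]
  refine Finset.sum_congr rfl fun j hj => ?_
  have hx0 : dep x ≠ 0 := fun e => hxr ((t.rooted.dep_eq_zero h0).1 e)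
  by_cases h1 : dep (yy j) = dep x
  · have h2 : yy j ≠ r := fun e => hx0 (by rw [← h1, e, h0])
    by_cases h3 : b j = a
    · have h4 := hb j hj
      rw [h3] at h4
      simp [h1, h2, h3, h4]
    · have h4 : ¬ Anc par (yy j) (w a) := fun h4 => h3 ((F1 _ h2).unique (hb j hj) h4)
      simp [h3, h4]
  · simp [h1]

/-- The end of every leg with index in `M` carries the corresponding mark, unless the leg is
trivial. -/
theorem own_dep (t : Tri G c h r par dep e₀ w)
    (hyy : ∀ j ∈ M, yy j ∈ core par w ∧ c (yy j) (h (w j)) = -1) (h0 : dep r = 0)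
    (hs : ∀ x, x ≠ r → dep (par x) + 1 = dep x)
    (hP : ∀ a ∈ M, ∀ x ∈ core par w, x ≠ r → Anc par x (w a) → Anc par x (yy a)) {a : Fin 3}
    (ha : a ∈ M) (hown : Anc par (yy a) (w a)) : dep (yy a) + 1 = dep (w a) := by
  have h1 := t.rooted.anc_dep_lt hown fun e => w_not_mem (par := par) a (e ▸ (hyy a ha).1)
  have h2 := hs (w a) (t.ne_root a)
  by_cases h3 : par (w a) = r
  · rw [h3, h0] at h2
    omega
  · have h4 := t.rooted.anc_dep_le (hP a ha _ (t.par_w a) h3 (anc_par _))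
    omega

/-- If leg a had a core vertex, that vertex would lie above yy a, and so would force yy a onto leg
a. For the leg b containing yy a, the vertex yy a itself lies above yy b, so yy b is on leg b too.
-/
theorem not_own (t : Tri G c h r par dep e₀ w) (m : Marked c h par w M)
    (hyy : ∀ j ∈ M, yy j ∈ core par w ∧ c (yy j) (h (w j)) = -1)
    (hne : ¬ ∀ i ∈ M, ∀ j ∈ M, yy i = yy j) (h0 : dep r = 0)
    (hs : ∀ x, x ≠ r → dep (par x) + 1 = dep x)
    (hP : ∀ a ∈ M, ∀ x ∈ core par w, x ≠ r → Anc par x (w a) → Anc par x (yy a))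
    (hM : ∀ a, a ∉ M → dep (w a) = 1) {a : Fin 3} (ha : a ∈ M) (hown : ¬ Anc par (yy a) (w a)) :
    dep (w a) = 1 ∧ yy a ≠ r ∧ ∃ b ∈ M, b ≠ a ∧ Anc par (yy a) (w b) ∧ Anc par (yy b) (w b) ∧
      Anc par (yy a) (yy b) := by
  classical
  obtain ⟨F1, -, -, -⟩ := t.star_facts m hyy hne
  have hr : yy a ≠ r := fun e => hown (e ▸ t.rooted.root_anc _)
  obtain ⟨b, hb, -⟩ := F1 _ hr
  have hba : b ≠ a := fun e => hown (e ▸ hb)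
  refine ⟨?_, hr, b, ?_, hba, hb, ?_⟩
  · by_contra hcon
    have h2 := hs (w a) (t.ne_root a)
    have h3 : par (w a) ≠ r := fun e => by rw [e, h0] at h2; omega
    have h4 := hP a ha _ (t.par_w a) h3 (anc_par _)
    exact hba ((F1 _ h3).unique (h4.trans hb) (anc_par _))
  · by_contra hbM
    have h1 := hM b hbM
    have h2 := t.rooted.anc_dep_lt hb fun e => w_not_mem (par := par) b (e ▸ (hyy a ha).1)
    exact hr ((t.rooted.dep_eq_zero h0).1 (by omega))
  · have hbM : b ∈ M := by
      by_contra hbM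
      have h1 := hM b hbM
      have h2 := t.rooted.anc_dep_lt hb fun e => w_not_mem (par := par) b (e ▸ (hyy a ha).1)
      exact hr ((t.rooted.dep_eq_zero h0).1 (by omega))
    have h5 := hP b hbM _ (hyy a ha).1 hr hb
    refine ⟨?_, h5⟩
    have h6 : yy b ≠ r := fun e => by
      rw [e] at h5
      exact hr (t.rooted.anc_root h5)
    obtain ⟨b', hb', -⟩ := F1 _ h6
    obtain rfl := (F1 _ hr).unique hb (h5.trans hb')
    exact hb'

/-- Let J be the indices of the marks below x. Since the flow of w i is 0 or 1, for i ≠ a membership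
of i in J implies that of i + 2. As J is nonempty, it is {a}, {a, a+1} or everything. -/
theorem starA_anc (t : Tri G c h r par dep e₀ w) (m : Marked c h par w Finset.univ)
    (hA : StarA c h par w)
    (hyy : ∀ j ∈ Finset.univ, yy j ∈ core par w ∧ c (yy j) (h (w j)) = -1)
    (hne : ¬ ∀ i ∈ Finset.univ, ∀ j ∈ Finset.univ, yy i = yy j) (a : Fin 3) {x : V}
    (hx : x ∈ core par w) (hxr : x ≠ r) (ha : Anc par x (w a)) :
    Anc par x (yy a) ∧ (Anc par x (yy (a + 2)) → Anc par x (yy (a + 1))) := by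
  classical
  obtain ⟨F1, -, F3, F4⟩ := t.star_facts m hyy hne
  obtain ⟨h1, h2, h3, h4, h5, h6⟩ := hA.entries
  obtain ⟨j, -, hj⟩ := F4 x hx hxr
  have hu : ∀ i, c (w i) (h x) = 0 ∨ c (w i) (h x) = -1 := fun i =>
    t.entry_cases m fun e => w_not_mem (par := par) i (e ▸ hx)
  have k0 := F3 x hx hxr 0
  have k1 := F3 x hx hxr 1
  have k2 := F3 x hx hxr 2
  have hw : ∀ i, w i ∈ descs par x ↔ i = a := by
    intro i
    rw [mem_descs]
    exact ⟨fun h7 => (F1 x hxr).unique h7 ha, fun e => e ▸ ha⟩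
  have u0 := hu 0
  have u1 := hu 1
  have u2 := hu 2
  simp only [hw, Fin.sum_univ_three, m.pos, h1, h2, h3, h4, h5, h6, mem_descs] at k0 k1 k2
  fin_cases a <;> fin_cases j <;> simp at k0 k1 k2 hj ⊢ <;>
    by_cases p0 : Anc par x (yy 0) <;> by_cases p1 : Anc par x (yy 1) <;>
    by_cases p2 : Anc par x (yy 2) <;> simp only [p0, p1, p2, if_true, if_false] at k0 k1 k2 hj ⊢ <;>
    first | omega | simp

theorem starA_w_dot (t : Tri G c h r par dep e₀ w) (m : Marked c h par w Finset.univ)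
    (hA : StarA c h par w)
    (hyy : ∀ j ∈ Finset.univ, yy j ∈ core par w ∧ c (yy j) (h (w j)) = -1)
    (hne : ¬ ∀ i ∈ Finset.univ, ∀ j ∈ Finset.univ, yy i = yy j) (h0 : dep r = 0)
    (hs : ∀ x, x ≠ r → dep (par x) + 1 = dep x) :
    c (w 0) ⬝ᵥ c (w 0) = 2 + dep (w 0) - dep (yy 0) + dep (yy 2) ∧
    c (w 1) ⬝ᵥ c (w 1) = 2 + dep (w 1) - dep (yy 1) + dep (yy 0) ∧
    c (w 2) ⬝ᵥ c (w 2) = 2 + dep (w 2) - dep (yy 2) + dep (yy 1) := by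
  obtain ⟨h1, h2, h3, h4, h5, h6⟩ := hA.entries
  refine ⟨?_, ?_, ?_⟩ <;> rw [t.w_dot m hyy hne h0 hs] <;>
    simp only [Fin.sum_univ_three, m.pos, h1, h2, h3, h4, h5, h6] <;> ring

end

section
variable {Γ : PlumbingGraph.{u}} {ι : Type w} [Fintype ι] {c : Γ.V → ι → ℤ} {h : Γ.V → ι}
    {r : Γ.V} {par : Γ.V → Γ.V} {dep : Γ.V → ℕ} {e₀ : ι} {w : Fin 3 → Γ.V} {yy : Fin 3 → Γ.V}

/-- Each mark sits at the last core vertex of its own leg, so it raises that vertex from 1 to 2; on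
a trivial leg it raises the root instead, which always ends up with square 4. -/
theorem starA_own (t : Tri Γ.graph c h r par dep e₀ w) (m : Marked c h par w Finset.univ)
    (hA : StarA c h par w)
    (hyy : ∀ j ∈ Finset.univ, yy j ∈ core par w ∧ c (yy j) (h (w j)) = -1)
    (hne : ¬ ∀ i ∈ Finset.univ, ∀ j ∈ Finset.univ, yy i = yy j) (h0 : dep r = 0)
    (hs : ∀ x, x ≠ r → dep (par x) + 1 = dep x) (hd : ∀ v, Γ.dec v = -(c v ⬝ᵥ c v))
    (hown : ∀ a, Anc par (yy a) (w a)) : Γ ∈ familyW := by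
  have hdep : ∀ a, dep (yy a) + 1 = dep (w a) := fun a =>
    t.own_dep hyy h0 hs (fun a _ x hx hxr ha => (t.starA_anc m hA hyy hne a hx hxr ha).1)
      (Finset.mem_univ a) (hown a)
  obtain ⟨w0, w1, w2⟩ := t.starA_w_dot m hA hyy hne h0 hs
  have d0 := hdep 0
  have d1 := hdep 1
  have d2 := hdep 2
  have hleg : ∀ a, ∀ x ∈ core par w, x ≠ r → Anc par x (w a) → c x ⬝ᵥ c x = 2 ∧
      1 ≤ dep x ∧ dep x ≤ dep (yy a) := by
    intro a x hx hxr ha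
    have e1 : dep x ≠ 0 := fun e => hxr ((t.rooted.dep_eq_zero h0).1 e)
    have e2 := t.rooted.anc_dep_lt ha fun e => w_not_mem (par := par) a (e ▸ hx)
    have e3 := hdep a
    refine ⟨?_, by omega, by omega⟩
    rw [t.leg_dot_of_legs m hyy hne h0 hs (b := id) (fun j _ => hown j) hx hxr ha]
    simp only [id, Fin.sum_univ_three]
    fin_cases a <;> simp at e2 e3 ⊢ <;> split_ifs <;> omega
  refine ⟨dep (yy 2), dep (yy 0), dep (yy 1), ?_⟩
  refine t.to_star m hyy hne h0 hs hd id Function.bijective_id ?_ ?_ ?_ ?_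
  · intro i
    fin_cases i <;> simp [twos] <;> omega
  · rw [t.root_dot m hyy hne h0 hs]
    simp only [Fin.sum_univ_three]
    split_ifs <;> omega
  · intro i x hx hxr ha
    obtain ⟨e1, e2, e3⟩ := hleg i x hx hxr ha
    rw [e1]
    fin_cases i <;> simp at e3 ⊢ <;> rw [getElem?_leg₁ (by omega), if_neg (by omega)]
  · intro i
    fin_cases i
    · simp
      rw [getElem?_leg₁ (by omega), if_pos (by omega), w0]
      congr 1; omega
    · simp
      rw [getElem?_leg₁ (by omega), if_pos (by omega), w1]
      congr 1; omega
    · simp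
      rw [getElem?_leg₁ (by omega), if_pos (by omega), w2]
      congr 1; omega

/-- The stray mark 1 lies on leg 0, not on leg 2, because there it would drag mark 0 along. It
produces the entry 3 on that leg, while leg 1 is trivial. -/
theorem starA_one (t : Tri Γ.graph c h r par dep e₀ w) (m : Marked c h par w Finset.univ)
    (hA : StarA c h par w)
    (hyy : ∀ j ∈ Finset.univ, yy j ∈ core par w ∧ c (yy j) (h (w j)) = -1)
    (hne : ¬ ∀ i ∈ Finset.univ, ∀ j ∈ Finset.univ, yy i = yy j) (h0 : dep r = 0)
    (hs : ∀ x, x ≠ r → dep (par x) + 1 = dep x) (hd : ∀ v, Γ.dec v = -(c v ⬝ᵥ c v))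
    (own0 : Anc par (yy 0) (w 0)) (own1 : ¬ Anc par (yy 1) (w 1)) (own2 : Anc par (yy 2) (w 2)) :
    Γ ∈ familyN := by
  classical
  obtain ⟨F1, -, -, -⟩ := t.star_facts m hyy hne
  have hP := fun a (_ : a ∈ Finset.univ) x hx hxr ha => (t.starA_anc m hA hyy hne a (x := x) hx hxr ha).1
  obtain ⟨w0, w1, w2⟩ := t.starA_w_dot m hA hyy hne h0 hs
  have d0 := t.own_dep hyy h0 hs hP (Finset.mem_univ 0) own0
  have d2 := t.own_dep hyy h0 hs hP (Finset.mem_univ 2) own2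
  obtain ⟨d1, h1r, b, -, hb1, h1b, hbb, h1yb⟩ := t.not_own m hyy hne h0 hs hP (by simp)
    (Finset.mem_univ 1) own1
  have hleg1 : Anc par (yy 1) (w 0) ∧ Anc par (yy 1) (yy 0) := by
    fin_cases b
    · exact ⟨h1b, h1yb⟩
    · exact absurd rfl hb1
    · exfalso
      have h1 := (t.starA_anc m hA hyy hne 2 (hyy 1 (by simp)).1 h1r h1b).2 (Anc.refl _)
      exact absurd ((F1 _ h1r).unique (h1.trans own0) h1b) (by decide)
  have e1 := t.rooted.anc_dep_le hleg1.2
  have e2 : dep (yy 1) ≠ 0 := fun e => h1r ((t.rooted.dep_eq_zero h0).1 e)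
  have hb : ∀ j ∈ Finset.univ, Anc par (yy j) (w ((![0, 0, 2] : Fin 3 → Fin 3) j)) := by
    intro j _
    fin_cases j
    · exact own0
    · exact hleg1.1
    · exact own2
  have hleg := fun x hx hxr a ha => t.leg_dot_of_legs m hyy hne h0 hs hb (x := x) hx hxr (a := a) ha
  have hx1 : ∀ x ∈ core par w, ∀ a, x ≠ r → Anc par x (w a) → 1 ≤ dep x ∧ dep x < dep (w a) := by
    intro x hx a hxr ha
    have e1 : dep x ≠ 0 := fun e => hxr ((t.rooted.dep_eq_zero h0).1 e)
    have e2 := t.rooted.anc_dep_lt ha fun e => w_not_mem (par := par) a (e ▸ hx)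
    omega
  -- The entry 3 is at depth dep(yy 1), hence at index dep(yy 1) - 1. The first parameter is written
  -- as a successor so that the second equation of `Del` applies.
  refine ⟨dep (yy 0) - dep (yy 1) + 1, dep (yy 1) - 1, dep (yy 2), ?_⟩
  refine t.to_star m hyy hne h0 hs hd ![0, 2, 1] (by decide) ?_ ?_ ?_ ?_
  · intro i
    fin_cases i <;> simp [twos] <;> omega
  · rw [t.root_dot m hyy hne h0 hs]
    simp only [Fin.sum_univ_three]
    split_ifs <;> omega
  · intro i x hx hxr ha
    fin_cases i
    · replace ha : Anc par x (w 0) := ha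
      have e3 := hx1 x hx 0 hxr ha
      rw [hleg x hx hxr 0 ha]
      simp only [Fin.sum_univ_three]
      change (twos _ ++ [3] ++ twos _ ++ [_])[_]? = _
      rw [getElem?_leg₂ (by omega)]
      congr 1
      simp
      split_ifs <;> omega
    · replace ha : Anc par x (w 2) := ha
      have e3 := hx1 x hx 2 hxr ha
      rw [hleg x hx hxr 2 ha]
      simp only [Fin.sum_univ_three]
      simp
      rw [getElem?_leg₁ (by omega)]
      congr 1
      split_ifs <;> omega
    · replace ha : Anc par x (w 1) := ha
      have e3 := hx1 x hx 1 hxr ha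
      omega
  · intro i
    fin_cases i
    · change (twos _ ++ [3] ++ twos _ ++ [_])[dep (w 0) - 1]? = some (c (w 0) ⬝ᵥ c (w 0))
      rw [getElem?_leg₂ (by omega), if_neg (by omega),
        if_pos (by omega), w0]
      congr 1; omega
    · simp
      rw [getElem?_leg₁ (by omega), if_pos (by omega), w2]
      congr 1; omega
    · simp
      rw [d1, w1]
      simp
      omega

/-- Both stray marks lie on leg 0, with yy 2 above or equal to yy 1. Distinct positions give two
entries 3; equal positions give one entry 4. -/
theorem starA_two (t : Tri Γ.graph c h r par dep e₀ w) (m : Marked c h par w Finset.univ)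
    (hA : StarA c h par w)
    (hyy : ∀ j ∈ Finset.univ, yy j ∈ core par w ∧ c (yy j) (h (w j)) = -1)
    (hne : ¬ ∀ i ∈ Finset.univ, ∀ j ∈ Finset.univ, yy i = yy j) (h0 : dep r = 0)
    (hs : ∀ x, x ≠ r → dep (par x) + 1 = dep x) (hd : ∀ v, Γ.dec v = -(c v ⬝ᵥ c v))
    (own1 : ¬ Anc par (yy 1) (w 1)) (own2 : ¬ Anc par (yy 2) (w 2)) :
    Γ ∈ familyM := by
  classical
  obtain ⟨F1, -, -, -⟩ := t.star_facts m hyy hne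
  have hP := fun a (_ : a ∈ Finset.univ) x hx hxr ha => (t.starA_anc m hA hyy hne a (x := x) hx hxr ha).1
  obtain ⟨w0, w1, w2⟩ := t.starA_w_dot m hA hyy hne h0 hs
  obtain ⟨d1, h1r, b, -, hb1, h1b, hbb, h1yb⟩ := t.not_own m hyy hne h0 hs hP (by simp)
    (Finset.mem_univ 1) own1
  obtain ⟨d2, h2r, b', -, hb2, h2b, hbb', h2yb⟩ := t.not_own m hyy hne h0 hs hP (by simp)
    (Finset.mem_univ 2) own2
  have hb0 : b = 0 := by
    fin_cases b
    · rfl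
    · exact absurd rfl hb1
    · exact absurd hbb own2
  have hb0' : b' = 0 := by
    fin_cases b'
    · rfl
    · exact absurd hbb' own1
    · exact absurd rfl hb2
  subst hb0
  subst hb0'
  have h21 := (t.starA_anc m hA hyy hne 0 (hyy 2 (by simp)).1 h2r h2b).2 (Anc.refl _)
  have d0 := t.own_dep hyy h0 hs hP (Finset.mem_univ 0) hbb
  have e1 := t.rooted.anc_dep_le h1yb
  have e2 := t.rooted.anc_dep_le h21
  have e3 : dep (yy 2) ≠ 0 := fun e => h2r ((t.rooted.dep_eq_zero h0).1 e)
  replace e2 : dep (yy 2) ≤ dep (yy 1) := e2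
  have hb : ∀ j ∈ Finset.univ, Anc par (yy j) (w ((![0, 0, 0] : Fin 3 → Fin 3) j)) := by
    intro j _
    fin_cases j
    · exact hbb
    · exact h1b
    · exact h2b
  have hleg := fun x hx hxr a ha => t.leg_dot_of_legs m hyy hne h0 hs hb (x := x) hx hxr (a := a) ha
  have hx1 : ∀ x ∈ core par w, ∀ a, x ≠ r → Anc par x (w a) → 1 ≤ dep x ∧ dep x < dep (w a) := by
    intro x hx a hxr ha
    have e1 : dep x ≠ 0 := fun e => hxr ((t.rooted.dep_eq_zero h0).1 e)
    have e2 := t.rooted.anc_dep_lt ha fun e => w_not_mem (par := par) a (e ▸ hx)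
    omega
  have hroot : c r ⬝ᵥ c r = 2 := by
    rw [t.root_dot m hyy hne h0 hs]
    simp only [Fin.sum_univ_three]
    split_ifs <;> omega
  by_cases hlt : dep (yy 2) < dep (yy 1)
  · refine ⟨dep (yy 0) - dep (yy 1) + 1, dep (yy 2) - 1, dep (yy 1) - dep (yy 2) - 1 + 1, by simp, ?_⟩
    refine t.to_star m hyy hne h0 hs hd id Function.bijective_id ?_ hroot ?_ ?_
    · intro i
      fin_cases i <;> simp [twos] <;> omega
    · intro i x hx hxr ha
      fin_cases i
      · replace ha : Anc par x (w 0) := ha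
        have e3 := hx1 x hx 0 hxr ha
        rw [hleg x hx hxr 0 ha]
        simp only [Fin.sum_univ_three]
        change (twos _ ++ [3] ++ twos _ ++ [3] ++ twos _ ++ [_])[_]? = _
        rw [getElem?_leg₃ (by omega)]
        congr 1
        simp
        split_ifs <;> omega
      · replace ha : Anc par x (w 1) := ha
        have e3 := hx1 x hx 1 hxr ha
        omega
      · replace ha : Anc par x (w 2) := ha
        have e3 := hx1 x hx 2 hxr ha
        omega
    · intro i
      fin_cases i
      · change (twos _ ++ [3] ++ twos _ ++ [3] ++ twos _ ++ [_])[dep (w 0) - 1]? = some (c (w 0) ⬝ᵥ c (w 0))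
        rw [getElem?_leg₃ (by omega), if_neg (by omega), if_neg (by omega), if_pos (by omega), w0]
        congr 1; omega
      · simp
        rw [d1, w1]
        simp
        omega
      · simp
        rw [d2, w2]
        simp
        omega
  · refine ⟨dep (yy 0) - dep (yy 1) + 1, dep (yy 2) - 1, 0, by simp, ?_⟩
    refine t.to_star m hyy hne h0 hs hd id Function.bijective_id ?_ hroot ?_ ?_
    · intro i
      fin_cases i <;> simp [twos] <;> omega
    · intro i x hx hxr ha
      fin_cases i
      · replace ha : Anc par x (w 0) := ha
        have e3 := hx1 x hx 0 hxr ha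
        rw [hleg x hx hxr 0 ha]
        simp only [Fin.sum_univ_three]
        change (twos _ ++ [4] ++ twos _ ++ [_])[_]? = _
        rw [getElem?_leg₂ (by omega)]
        congr 1
        simp
        split_ifs <;> omega
      · replace ha : Anc par x (w 1) := ha
        have e3 := hx1 x hx 1 hxr ha
        omega
      · replace ha : Anc par x (w 2) := ha
        have e3 := hx1 x hx 2 hxr ha
        omega
    · intro i
      fin_cases i
      · change (twos _ ++ [4] ++ twos _ ++ [_])[dep (w 0) - 1]? = some (c (w 0) ⬝ᵥ c (w 0))
        rw [getElem?_leg₂ (by omega), if_neg (by omega), if_pos (by omega), w0]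
        congr 1; omega
      · simp
        rw [d1, w1]
        simp
        omega
      · simp
        rw [d2, w2]
        simp
        omega

end

end Tri

end PlumbingGraph

/-! ### The pattern with two marks -/

namespace PlumbingGraph

open Matrix

namespace Tri

section
variable {V ι : Type*} [Fintype V] [Fintype ι] {G : SimpleGraph V} {c : V → ι → ℤ}
  {h : V → ι} {r : V} {par : V → V} {dep : V → ℕ} {e₀ : ι} {w : Fin 3 → V} {yy : Fin 3 → V}

/-- The rows of w 1 and w 2 contribute opposite differences of the two mark indicators. A core
vertex on leg 0 therefore has both marks below it, and one on another leg has its own mark below it.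
-/
theorem starB_anc (t : Tri G c h r par dep e₀ w) (m : Marked c h par w {1, 2})
    (hB : StarB c h par w)
    (hyy : ∀ j ∈ ({1, 2} : Finset (Fin 3)), yy j ∈ core par w ∧ c (yy j) (h (w j)) = -1)
    (hne : ¬ ∀ i ∈ ({1, 2} : Finset (Fin 3)), ∀ j ∈ ({1, 2} : Finset (Fin 3)), yy i = yy j)
    (a : Fin 3) {x : V} (hx : x ∈ core par w) (hxr : x ≠ r) (ha : Anc par x (w a)) :
    (a = 0 → Anc par x (yy 1) ∧ Anc par x (yy 2)) ∧ (a ≠ 0 → Anc par x (yy a)) := by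
  classical
  obtain ⟨F1, -, F3, F4⟩ := t.star_facts m hyy hne
  obtain ⟨-, -, -, h1, h2, h3, h4, h5, h6⟩ := hB
  obtain ⟨j, hjM, hj⟩ := F4 x hx hxr
  have hu : ∀ i, c (w i) (h x) = 0 ∨ c (w i) (h x) = -1 := fun i =>
    t.entry_cases m fun e => w_not_mem (par := par) i (e ▸ hx)
  have k1 := F3 x hx hxr 1
  have k2 := F3 x hx hxr 2
  have hw : ∀ i, w i ∈ descs par x ↔ i = a := by
    intro i
    rw [mem_descs]
    exact ⟨fun h7 => (F1 x hxr).unique h7 ha, fun e => e ▸ ha⟩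
  have u1 := hu 1
  have u2 := hu 2
  rw [Finset.sum_pair (by decide)] at k1 k2
  simp only [hw, m.pos, h1, h2, h3, h4, h5, h6, mem_descs] at k1 k2
  have hj' : Anc par x (yy 1) ∨ Anc par x (yy 2) := by
    rcases Finset.mem_insert.1 hjM with e | e
    · exact Or.inl (e ▸ hj)
    · exact Or.inr ((Finset.mem_singleton.1 e) ▸ hj)
  have a3 : a = 0 ∨ a = 1 ∨ a = 2 := by omega
  rcases a3 with rfl | rfl | rfl <;> simp at k1 k2 ⊢ <;>
    by_cases p1 : Anc par x (yy 1) <;>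
    by_cases p2 : Anc par x (yy 2) <;> simp only [p1, p2, if_true, if_false] at k1 k2 hj' ⊢ <;>
    first | omega | (simp; done) | exact absurd hj' (by simp)

theorem starB_w_dot (t : Tri G c h r par dep e₀ w) (m : Marked c h par w {1, 2})
    (hB : StarB c h par w)
    (hyy : ∀ j ∈ ({1, 2} : Finset (Fin 3)), yy j ∈ core par w ∧ c (yy j) (h (w j)) = -1)
    (hne : ¬ ∀ i ∈ ({1, 2} : Finset (Fin 3)), ∀ j ∈ ({1, 2} : Finset (Fin 3)), yy i = yy j)
    (h0 : dep r = 0) (hs : ∀ x, x ≠ r → dep (par x) + 1 = dep x) :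
    dep (w 0) = 1 ∧ c (w 0) ⬝ᵥ c (w 0) = 2 ∧
    c (w 1) ⬝ᵥ c (w 1) = 3 + dep (w 1) - dep (yy 1) + dep (yy 2) ∧
    c (w 2) ⬝ᵥ c (w 2) = 3 + dep (w 2) - dep (yy 2) + dep (yy 1) := by
  classical
  have hanc := fun a x => t.starB_anc m hB hyy hne a (x := x)
  obtain ⟨F1, -, -, -⟩ := t.star_facts m hyy hne
  obtain ⟨-, -, -, h1, h2, h3, h4, h5, h6⟩ := hB
  -- The last core vertex of leg 0 would have both marks below it, and then it would hold both of
  -- them.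
  have hw0 : dep (w 0) = 1 := by
    by_contra hcon
    have h7 := hs (w 0) (t.ne_root 0)
    have hpr : par (w 0) ≠ r := fun e => by rw [e, h0] at h7; omega
    have h8 := (hanc 0 _ (t.par_w 0) hpr (anc_par _)).1 rfl
    have key : ∀ j ∈ ({1, 2} : Finset (Fin 3)), Anc par (par (w 0)) (yy j) → yy j = par (w 0) := by
      intro j hj hja
      have hjr : yy j ≠ r := fun e => by rw [e] at hja; exact hpr (t.rooted.anc_root hja)
      obtain ⟨b, hb, -⟩ := F1 _ hjr
      obtain rfl := (F1 _ hpr).unique (hja.trans hb) (anc_par _)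
      have h9 := t.rooted.anc_dep_lt hb fun e => w_not_mem (par := par) 0 (e ▸ (hyy j hj).1)
      have h10 := t.rooted.anc_dep_le hja
      exact (t.rooted.anc_inj h0 hs hb (anc_par _)).2 (by omega)
    have e1 := key 1 (by decide) h8.1
    have e2 := key 2 (by decide) h8.2
    refine hne fun i hi j hj => ?_
    have : ∀ i ∈ ({1, 2} : Finset (Fin 3)), yy i = par (w 0) := by
      intro i hi
      rcases Finset.mem_insert.1 hi with e | e
      · rw [e, e1]
      · rw [Finset.mem_singleton.1 e, e2]
    rw [this i hi, this j hj]
  refine ⟨hw0, ?_, ?_, ?_⟩ <;> rw [t.w_dot m hyy hne h0 hs, Finset.sum_pair (by decide)] <;>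
    simp only [Fin.sum_univ_three, m.pos, h1, h2, h3, h4, h5, h6]
  · rw [hw0]; norm_num
  · ring
  · ring

end

section
variable {Γ : PlumbingGraph.{u}} {ι : Type w} [Fintype ι] {c : Γ.V → ι → ℤ} {h : Γ.V → ι}
    {r : Γ.V} {par : Γ.V → Γ.V} {dep : Γ.V → ℕ} {e₀ : ι} {w : Fin 3 → Γ.V} {yy : Fin 3 → Γ.V}

theorem core_dep (t : Tri Γ.graph c h r par dep e₀ w) (h0 : dep r = 0) {x : Γ.V}
    (hx : x ∈ core par w) {a : Fin 3} (hxr : x ≠ r) (ha : Anc par x (w a)) :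
    1 ≤ dep x ∧ dep x < dep (w a) := by
  have e1 : dep x ≠ 0 := fun e => hxr ((t.rooted.dep_eq_zero h0).1 e)
  have e2 := t.rooted.anc_dep_lt ha fun e => w_not_mem (par := par) a (e ▸ hx)
  omega

/-- With leg 0 trivial and both marks on their own legs, this is the degenerate member of 𝒩 with
first parameter 0. -/
theorem starB_own (t : Tri Γ.graph c h r par dep e₀ w) (m : Marked c h par w {1, 2})
    (hB : StarB c h par w)
    (hyy : ∀ j ∈ ({1, 2} : Finset (Fin 3)), yy j ∈ core par w ∧ c (yy j) (h (w j)) = -1)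
    (hne : ¬ ∀ i ∈ ({1, 2} : Finset (Fin 3)), ∀ j ∈ ({1, 2} : Finset (Fin 3)), yy i = yy j)
    (h0 : dep r = 0) (hs : ∀ x, x ≠ r → dep (par x) + 1 = dep x)
    (hd : ∀ v, Γ.dec v = -(c v ⬝ᵥ c v)) (own1 : Anc par (yy 1) (w 1))
    (own2 : Anc par (yy 2) (w 2)) : Γ ∈ familyN := by
  have hP : ∀ a ∈ ({1, 2} : Finset (Fin 3)), ∀ x ∈ core par w, x ≠ r → Anc par x (w a) →
      Anc par x (yy a) := fun a ha x hx hxr hxa =>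
    (t.starB_anc m hB hyy hne a hx hxr hxa).2 (by rintro rfl; simp at ha)
  obtain ⟨d0, w0, w1, w2⟩ := t.starB_w_dot m hB hyy hne h0 hs
  have d1 := t.own_dep hyy h0 hs hP (a := 1) (by decide) own1
  have d2 := t.own_dep hyy h0 hs hP (a := 2) (by decide) own2
  have hb : ∀ j ∈ ({1, 2} : Finset (Fin 3)), Anc par (yy j) (w (id j)) := by
    intro j hj
    fin_cases j
    · simp at hj
    · exact own1
    · exact own2
  have hleg := fun x hx hxr a ha => t.leg_dot_of_legs m hyy hne h0 hs hb (x := x) hx hxr (a := a) ha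
  refine ⟨0, dep (yy 1), dep (yy 2), ?_⟩
  refine t.to_star m hyy hne h0 hs hd ![1, 2, 0] (by decide) ?_ ?_ ?_ ?_
  · intro i
    fin_cases i <;> simp [twos] <;> omega
  · rw [t.root_dot m hyy hne h0 hs, Finset.sum_pair (by decide)]
    simp only [Fin.sum_univ_three]
    split_ifs <;> omega
  · intro i x hx hxr ha
    fin_cases i
    · replace ha : Anc par x (w 1) := ha
      have e3 := t.core_dep h0 hx hxr ha
      rw [hleg x hx hxr 1 ha, Finset.sum_pair (by decide)]
      simp
      rw [getElem?_leg₁ (by omega)]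
      congr 1
      split_ifs <;> omega
    · replace ha : Anc par x (w 2) := ha
      have e3 := t.core_dep h0 hx hxr ha
      rw [hleg x hx hxr 2 ha, Finset.sum_pair (by decide)]
      simp
      rw [getElem?_leg₁ (by omega)]
      congr 1
      split_ifs <;> omega
    · replace ha : Anc par x (w 0) := ha
      have e3 := t.core_dep h0 hx hxr ha
      omega
  · intro i
    fin_cases i
    · simp
      rw [getElem?_leg₁ (by omega), if_pos (by omega), w1]
      congr 1; omega
    · simp
      rw [getElem?_leg₁ (by omega), if_pos (by omega), w2]
      congr 1; omega
    · simp
      rw [d0, w0]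
      simp

/-- Mark 2 moves to leg 1 and gives the entry 3 there; this is the member of ℳ with first parameter
0. -/
theorem starB_one (t : Tri Γ.graph c h r par dep e₀ w) (m : Marked c h par w {1, 2})
    (hB : StarB c h par w)
    (hyy : ∀ j ∈ ({1, 2} : Finset (Fin 3)), yy j ∈ core par w ∧ c (yy j) (h (w j)) = -1)
    (hne : ¬ ∀ i ∈ ({1, 2} : Finset (Fin 3)), ∀ j ∈ ({1, 2} : Finset (Fin 3)), yy i = yy j)
    (h0 : dep r = 0) (hs : ∀ x, x ≠ r → dep (par x) + 1 = dep x)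
    (hd : ∀ v, Γ.dec v = -(c v ⬝ᵥ c v)) (own2 : ¬ Anc par (yy 2) (w 2)) : Γ ∈ familyM := by
  have hP : ∀ a ∈ ({1, 2} : Finset (Fin 3)), ∀ x ∈ core par w, x ≠ r → Anc par x (w a) →
      Anc par x (yy a) := fun a ha x hx hxr hxa =>
    (t.starB_anc m hB hyy hne a hx hxr hxa).2 (by rintro rfl; simp at ha)
  obtain ⟨d0, w0, w1, w2⟩ := t.starB_w_dot m hB hyy hne h0 hs
  obtain ⟨d2, h2r, b, hbM, hb2, h2b, hbb, h2yb⟩ := t.not_own m hyy hne h0 hs hP (by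
    intro a ha
    fin_cases a
    · exact d0
    · simp at ha
    · simp at ha) (a := 2) (by decide) own2
  have hb1 : b = 1 := by
    fin_cases b
    · simp at hbM
    · rfl
    · exact absurd rfl hb2
  subst hb1
  have d1 := t.own_dep hyy h0 hs hP (a := 1) (by decide) hbb
  have e1 := t.rooted.anc_dep_le h2yb
  have e2 : dep (yy 2) ≠ 0 := fun e => h2r ((t.rooted.dep_eq_zero h0).1 e)
  have hb : ∀ j ∈ ({1, 2} : Finset (Fin 3)), Anc par (yy j) (w ((![0, 1, 1] : Fin 3 → Fin 3) j)) := by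
    intro j hj
    fin_cases j
    · simp at hj
    · exact hbb
    · exact h2b
  have hleg := fun x hx hxr a ha => t.leg_dot_of_legs m hyy hne h0 hs hb (x := x) hx hxr (a := a) ha
  refine ⟨0, dep (yy 2) - 1, dep (yy 1) - dep (yy 2) + 1, by simp, ?_⟩
  refine t.to_star m hyy hne h0 hs hd ![1, 0, 2] (by decide) ?_ ?_ ?_ ?_
  · intro i
    fin_cases i <;> simp [twos] <;> omega
  · rw [t.root_dot m hyy hne h0 hs, Finset.sum_pair (by decide)]
    simp only [Fin.sum_univ_three]
    split_ifs <;> omega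
  · intro i x hx hxr ha
    fin_cases i
    · replace ha : Anc par x (w 1) := ha
      have e3 := t.core_dep h0 hx hxr ha
      rw [hleg x hx hxr 1 ha, Finset.sum_pair (by decide)]
      change (twos _ ++ [3] ++ twos _ ++ [_])[_]? = _
      rw [getElem?_leg₂ (by omega)]
      congr 1
      simp
      split_ifs <;> omega
    · replace ha : Anc par x (w 0) := ha
      have e3 := t.core_dep h0 hx hxr ha
      omega
    · replace ha : Anc par x (w 2) := ha
      have e3 := t.core_dep h0 hx hxr ha
      omega
  · intro i
    fin_cases i
    · change (twos _ ++ [3] ++ twos _ ++ [_])[dep (w 1) - 1]? = some (c (w 1) ⬝ᵥ c (w 1))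
      rw [getElem?_leg₂ (by omega), if_neg (by omega), if_pos (by omega), w1]
      congr 1; omega
    · simp
      rw [d0, w0]
      simp
    · simp
      rw [d2, w2]
      simp
      omega

theorem StarA.rotate {w : Fin 3 → Γ.V} (hA : StarA c h par w) (a : Fin 3) :
    StarA c h par (w ∘ Equiv.addRight a) := by
  intro i
  rw [core_comp]
  simp only [Function.comp_apply, Equiv.coe_addRight]
  have := hA (i + a)
  rw [add_right_comm i 2 a, add_right_comm i 1 a]
  exact this

/-- The pattern is invariant under cyclic relabelling, so only the number of marks off their own
legs matters up to rotation. -/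
theorem starA_families (t : Tri Γ.graph c h r par dep e₀ w) (hpos : ∀ i, c (w i) (h (w i)) = 1)
    (hA : StarA c h par w)
    (hyy : ∀ j ∈ Finset.univ, yy j ∈ core par w ∧ c (yy j) (h (w j)) = -1)
    (hne : ¬ ∀ i ∈ Finset.univ, ∀ j ∈ Finset.univ, yy i = yy j) (h0 : dep r = 0)
    (hs : ∀ x, x ≠ r → dep (par x) + 1 = dep x) (hd : ∀ v, Γ.dec v = -(c v ⬝ᵥ c v)) :
    Γ ∈ familyW ∨ Γ ∈ familyN ∨ Γ ∈ familyM := by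
  have m := t.marked_of_starA hpos hA
  by_cases hall : ∀ a, Anc par (yy a) (w a)
  · exact Or.inl (t.starA_own m hA hyy hne h0 hs hd hall)
  right
  have hrot : ∀ a, Tri Γ.graph c h r par dep e₀ (w ∘ Equiv.addRight a) := fun a => t.comp _
  have hyyr : ∀ a, ∀ j ∈ Finset.univ, (yy ∘ Equiv.addRight a) j ∈ core par (w ∘ Equiv.addRight a) ∧
      c ((yy ∘ Equiv.addRight a) j) (h ((w ∘ Equiv.addRight a) j)) = -1 := by
    intro a j _
    rw [core_comp]
    exact hyy _ (Finset.mem_univ _)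
  have hner : ∀ a, ¬ ∀ i ∈ Finset.univ, ∀ j ∈ Finset.univ, (yy ∘ Equiv.addRight a) i =
      (yy ∘ Equiv.addRight a) j := by
    intro a hcon
    refine hne fun i _ j _ => ?_
    simpa using hcon (i - a) (Finset.mem_univ _) (j - a) (Finset.mem_univ _)
  have hmr : ∀ a, Marked c h par (w ∘ Equiv.addRight a) Finset.univ := fun a =>
    (hrot a).marked_of_starA (fun i => hpos _) (hA.rotate a)
  have hP := fun a (_ : a ∈ Finset.univ) x hx hxr ha => (t.starA_anc m hA hyy hne a (x := x) hx hxr ha).1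
  by_cases hone : ∃ a, Anc par (yy (0 + a)) (w (0 + a)) ∧ ¬ Anc par (yy (1 + a)) (w (1 + a)) ∧
      Anc par (yy (2 + a)) (w (2 + a))
  · obtain ⟨a, o0, o1, o2⟩ := hone
    exact Or.inl ((hrot a).starA_one (hmr a) (hA.rotate a) (hyyr a) (hner a) h0 hs hd o0 o1 o2)
  · by_cases htwo : ∃ a, ¬ Anc par (yy (1 + a)) (w (1 + a)) ∧ ¬ Anc par (yy (2 + a)) (w (2 + a))
    · obtain ⟨a, o1, o2⟩ := htwo
      exact Or.inr ((hrot a).starA_two (hmr a) (hA.rotate a) (hyyr a) (hner a) h0 hs hd o1 o2)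
    · exfalso
      push Not at hall hone htwo
      -- If b is off its leg and no two such indices occur, both other indices are on theirs, and
      -- rotating b to 1 is the case treated before.
      obtain ⟨b, hb⟩ := hall
      have h1 := hone (b - 1)
      have h2 := htwo (b - 1)
      have h3 := htwo (b - 2)
      fin_cases b
      · exact absurd (h1 (by by_contra h4; exact absurd (h3 h4) hb) hb) (by simpa using h2 hb)
      · exact absurd (h1 (by by_contra h4; exact absurd (h3 h4) hb) hb) (by simpa using h2 hb)
      · exact absurd (h1 (by by_contra h4; exact absurd (h3 h4) hb) hb) (by simpa using h2 hb)

theorem StarB.swap {w : Fin 3 → Γ.V} (hB : StarB c h par w) :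
    StarB c h par (w ∘ Equiv.swap 1 2) := by
  obtain ⟨h1, h2, h3, h4, h5, h6, h7, h8, h9⟩ := hB
  unfold StarB
  rw [core_comp]
  have e0 : (w ∘ Equiv.swap 1 2) 0 = w 0 := rfl
  have e1 : (w ∘ Equiv.swap 1 2) 1 = w 2 := rfl
  have e2 : (w ∘ Equiv.swap 1 2) 2 = w 1 := rfl
  rw [e0, e1, e2]
  exact ⟨h1, h3, h2, h5, h4, h8, h9, h6, h7⟩

theorem starB_families (t : Tri Γ.graph c h r par dep e₀ w) (hpos : ∀ i, c (w i) (h (w i)) = 1)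
    (hB : StarB c h par w)
    (hyy : ∀ j ∈ ({1, 2} : Finset (Fin 3)), yy j ∈ core par w ∧ c (yy j) (h (w j)) = -1)
    (hne : ¬ ∀ i ∈ ({1, 2} : Finset (Fin 3)), ∀ j ∈ ({1, 2} : Finset (Fin 3)), yy i = yy j)
    (h0 : dep r = 0) (hs : ∀ x, x ≠ r → dep (par x) + 1 = dep x)
    (hd : ∀ v, Γ.dec v = -(c v ⬝ᵥ c v)) : Γ ∈ familyN ∨ Γ ∈ familyM := by
  have m := t.marked_of_starB hpos hB
  by_cases own2 : Anc par (yy 2) (w 2)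
  · by_cases own1 : Anc par (yy 1) (w 1)
    · exact Or.inl (t.starB_own m hB hyy hne h0 hs hd own1 own2)
    · right
      have ts := t.comp (Equiv.swap 1 2)
      have e : ∀ j ∈ ({1, 2} : Finset (Fin 3)), Equiv.swap 1 2 j ∈ ({1, 2} : Finset (Fin 3)) := by
        decide
      refine ts.starB_one (ts.marked_of_starB (fun i => hpos _) hB.swap) hB.swap
        (yy := yy ∘ Equiv.swap 1 2) (fun j hj => ?_) (fun hcon => hne fun i hi j hj => ?_) h0 hs hd
        own1
      · rw [core_comp]
        exact hyy _ (e j hj)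
      · simpa using hcon _ (e i hi) _ (e j hj)
  · exact Or.inr (t.starB_one m hB hyy hne h0 hs hd own2)

/-- The classification when three vertices hold the head of the root. -/
theorem families (t : Tri Γ.graph c h r par dep e₀ w) (h0 : dep r = 0)
    (hs : ∀ x, x ≠ r → dep (par x) + 1 = dep x) (hd : ∀ v, Γ.dec v = -(c v ⬝ᵥ c v)) :
    Γ ∈ familyW ∨ Γ ∈ familyN ∨ Γ ∈ familyM ∨ HasFreeVertex c := by
  by_cases hpos : ∀ i, c (w i) (h (w i)) = 1
  · rcases t.star_types hpos with h1 | ⟨σ, hA | hB⟩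
    · exact (t.not_all_zero hpos h1).elim
    · have ts := t.comp σ
      have m := ts.marked_of_starA (fun i => hpos _) hA
      obtain ⟨yy, hyy⟩ := ts.exists_mark_holders m
      by_cases hsame : ∀ i ∈ Finset.univ, ∀ j ∈ Finset.univ, yy i = yy j
      · exact Or.inr (Or.inr (Or.inr (ts.free_of_marked m hyy hsame)))
      · rcases ts.starA_families (fun i => hpos _) hA hyy hsame h0 hs hd with h1 | h1 | h1
        · exact Or.inl h1
        · exact Or.inr (Or.inl h1)
        · exact Or.inr (Or.inr (Or.inl h1))
    · have ts := t.comp σ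
      have m := ts.marked_of_starB (fun i => hpos _) hB
      obtain ⟨yy, hyy⟩ := ts.exists_mark_holders m
      by_cases hsame : ∀ i ∈ ({1, 2} : Finset (Fin 3)), ∀ j ∈ ({1, 2} : Finset (Fin 3)), yy i = yy j
      · exact Or.inr (Or.inr (Or.inr (ts.free_of_marked m hyy hsame)))
      · rcases ts.starB_families (fun i => hpos _) hB hyy hsame h0 hs hd with h1 | h1
        · exact Or.inr (Or.inl h1)
        · exact Or.inr (Or.inr (Or.inl h1))
  · push Not at hpos
    obtain ⟨i, hi⟩ := hpos
    have hneg := (t.heads (w i)).1.resolve_left hi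
    refine Or.inr (Or.inr (Or.inr ((t.comp (Equiv.swap 2 i)).free_of_neg ?_)))
    simpa using hneg

end

end Tri

end PlumbingGraph

/-! ### Splitting by the head column of the sum of all vertices -/

namespace PlumbingGraph

open Matrix

section
variable {V ι : Type*} [Fintype V] [Fintype ι] {G : SimpleGraph V} {c : V → ι → ℤ}

/-- A column of a minimal configuration is not concentrated in a single positive entry. -/
theorem IsConf.not_single (hC : IsConf G c) (hG : G.IsTree) (h2 : ∀ v, 2 ≤ c v ⬝ᵥ c v)
    (hcard : Fintype.card ι = Fintype.card V) {r : V} {e₀ : ι} (hr : c r e₀ = 1)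
    (h0 : ∀ v, v ≠ r → c v e₀ = 0) : False := by
  classical
  obtain ⟨h, hh⟩ := hC.exists_heads
  obtain ⟨par, hR, -⟩ := exists_isRooted hG r
  have hhr : h r = e₀ := ((hh r).eq (Or.inl hr)).symm
  have hsum : ∀ L : Finset V, r ∈ L → ∑ v ∈ L, c v e₀ = 1 := by
    intro L hL
    rw [Finset.sum_eq_single_of_mem r hL fun v _ hv => h0 v hv, hr]
  -- Here the arrow system covers the whole tree, so all heads are positive and every column has
  -- one. The root holds some column, whose head is an arrow child, and `exists_mark` then produces
  -- a headless column.
  have hA : ArrowSys c r par Finset.univ {r} e₀ := by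
    refine ⟨Lower.univ, hR.lower_singleton, Finset.subset_univ _, ?_, ?_⟩
    · intro L hL _ _
      exact hC.off_of_head hR hL.connTop (Or.inl (hsum L hL.1))
    · intro x _ hx
      exact h0 x (by simpa using hx)
  have hpos : ∀ v, c v (h v) = 1 := by
    intro v
    by_cases hv : v = r
    · rw [hv, hhr, hr]
    · exact (hA.core_pre hC hh hR (Finset.mem_univ v) (by simpa using hv)).1
  have hall := hC.forall_exists_head hh hcard hpos
  obtain ⟨y, hy⟩ := hA.exists_arrow hC hh hR
  obtain ⟨k, hk⟩ := exists_neg_one (hh r) (hpos r) (h2 r)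
  obtain ⟨x, hx⟩ := hall k
  have hxr : x ∉ ({r} : Finset V) := by
    rw [Finset.mem_singleton]
    rintro rfl
    omega
  have hkx : h x = k := ((hh x).eq (Or.inl hx)).symm
  have hyx : y x = r := hy.eq_of_holder (Finset.mem_univ x) hxr
    (subset_pre x (Finset.mem_singleton_self r)) (hkx ▸ hk)
  obtain ⟨z, -, -, k', -, h4⟩ := hA.exists_mark hC hh hR hy
    (fun x hx _ hs => by
      rw [Finset.mem_singleton] at hx
      rw [hx, hhr, Finset.sum_singleton, hr] at hs
      omega)
    (fun x _ _ => h2 x)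
    (fun _ b hb hs => by
      rw [Finset.mem_singleton] at hb
      rw [hb, hhr, Finset.sum_singleton, hr] at hs
      omega) (Finset.mem_univ x) hxr hyx
  obtain ⟨x', hx'⟩ := hall k'
  exact h4 x' (Finset.mem_univ _) hx'

end

theorem IsConf.families {Γ : PlumbingGraph.{u}} {ι : Type w} [Fintype ι] {c : Γ.V → ι → ℤ}
    (hC : IsConf Γ.graph c) (hG : Γ.graph.IsTree) (h2 : ∀ v, 2 ≤ c v ⬝ᵥ c v)
    (hcard : Fintype.card ι = Fintype.card Γ.V) (hd : ∀ v, Γ.dec v = -(c v ⬝ᵥ c v)) :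
    (∃ l, GList l ∧ Γ.Isomorphic (chain l)) ∨ Γ ∈ familyW ∨ Γ ∈ familyN ∨ Γ ∈ familyM ∨
      HasFreeVertex c := by
  classical
  obtain ⟨h, hh⟩ := hC.exists_heads
  obtain ⟨r₀⟩ := hG.connected.nonempty
  obtain ⟨par₀, hR₀, -⟩ := exists_isRooted hG r₀
  obtain ⟨e₀, he₀⟩ := (hC.sph_sum hR₀ (Lower.univ (r := r₀) (par := par₀)).connTop).exists_head
  have he := he₀.1
  simp only [Finset.sum_apply] at he
  by_cases hp : ∃ r, c r e₀ = 1
  · obtain ⟨r, hr⟩ := hp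
    have hhr : h r = e₀ := ((hh r).eq (Or.inl hr)).symm
    have hneg : ∀ v, v ≠ r → c v e₀ ≤ 0 := fun v hv => by
      have := hC.nonpos_of_pos hh (x := r) (y := v) (k := e₀) hr hv
      exact this
    have hsplit := Finset.add_sum_erase Finset.univ (fun v => c v e₀) (Finset.mem_univ r)
    simp only [hr] at hsplit
    rcases he with he | he
    · exfalso
      refine hC.not_single hG h2 hcard hr fun v hv => ?_
      have h3 : ∑ v ∈ Finset.univ.erase r, c v e₀ = 0 := by omega
      rw [Finset.sum_eq_zero_iff_of_nonpos fun v hv => hneg v (Finset.ne_of_mem_erase hv)] at h3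
      exact h3 v (Finset.mem_erase.2 ⟨hv, Finset.mem_univ v⟩)
    -- An entry -2 excludes other negative entries, so with the 1 at r the sum would be at least -1.
    · have hno : ∀ v, c v e₀ ≠ -2 := by
        intro v hv
        have hvr : v ≠ r := by rintro rfl; omega
        have h3 := Finset.add_sum_erase _ (fun v => c v e₀)
          (Finset.mem_erase.2 ⟨hvr, Finset.mem_univ v⟩)
        have h4 : 0 ≤ ∑ x ∈ (Finset.univ.erase r).erase v, c x e₀ :=
          Finset.sum_nonneg fun x hx => hC.neg_two hh hv (Finset.ne_of_mem_erase hx).symm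
        omega
      have hval : ∀ v, v ≠ r → c v e₀ = if c v e₀ = -1 then -1 else 0 := by
        intro v hv
        have := (hh v).eq_zero_or e₀
        have := hneg v hv
        have := hno v
        split_ifs <;> omega
      -- The total is -2 = 1 - 3.
      have h3 : ((Finset.univ.erase r).filter fun v => c v e₀ = -1).card = 3 := by
        rw [Finset.sum_congr rfl fun v hv => hval v (Finset.ne_of_mem_erase hv),
          ← Finset.sum_filter] at hsplit
        simp only [Finset.sum_const, smul_eq_mul] at hsplit
        rw [nsmul_eq_mul] at hsplit
        omega
      let w : Fin 3 → Γ.V := fun i => ((Finset.equivFinOfCardEq h3).symm i).1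
      have hw : ∀ i, c (w i) e₀ = -1 := fun i =>
        (Finset.mem_filter.1 ((Finset.equivFinOfCardEq h3).symm i).2).2
      obtain ⟨par, hR, hs⟩ := exists_isRooted hG r
      have t : Tri Γ.graph c h r par (Γ.graph.dist r) e₀ w := by
        refine ⟨hC, hh, hR, h2, hcard, hr, hw, ?_, ?_⟩
        · intro v hv hvw
          rw [hval v hv, if_neg]
          intro h5
          have h6 : v ∈ (Finset.univ.erase r).filter fun v => c v e₀ = -1 :=
            Finset.mem_filter.2 ⟨Finset.mem_erase.2 ⟨hv, Finset.mem_univ v⟩, h5⟩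
          refine hvw ((Finset.equivFinOfCardEq h3) ⟨v, h6⟩) ?_
          simp [w]
        · exact Subtype.val_injective.comp (Finset.equivFinOfCardEq h3).symm.injective
      exact Or.inr (t.families SimpleGraph.dist_self hs hd)
  · push Not at hp
    have hneg : ∀ v, c v e₀ ≤ 0 := fun v => nonpos_of_ne_one hh (hp v)
    have hsum : ∑ v, c v e₀ = -2 := by
      have : ∑ v, c v e₀ ≤ 0 := Finset.sum_nonpos fun v _ => hneg v
      omega
    obtain ⟨vs, h3, h4, -⟩ := hC.headless_chain _ hG h2 hcard rfl hneg hsum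
    exact Or.inl ⟨_, h4, h3.isomorphic hd⟩

/-- A symplectic plumbing graph is a configuration of spheres. -/
theorem IsSymplectic.exists_isConf {Γ : PlumbingGraph.{u}} (h : Γ.IsSymplectic) :
    ∃ c : Γ.V → Fin (Fintype.card Γ.V) → ℤ, IsConf Γ.graph c ∧ ∀ v, Γ.dec v = -(c v ⬝ᵥ c v) := by
  obtain ⟨φ, h1, h2, h3, h4⟩ := h
  refine ⟨φ, ⟨fun v => ?_, fun a b hab => ?_, fun a b hab hn => ?_⟩, fun v => ?_⟩
  · have := h4 v
    simp only [Q, K, mul_one] at this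
    simp only [Sph, mul_add, mul_one, Finset.sum_add_distrib]
    omega
  · have := h1 a b hab
    simp only [Q] at this
    simp only [dotProduct]
    omega
  · have := h2 a b hab hn
    simp only [Q] at this
    simp only [dotProduct]
    omega
  · rw [← h3 v]; rfl

theorem IsConf.dot_self_pos {V ι : Type*} [Fintype ι] {G : SimpleGraph V} {c : V → ι → ℤ}
    (hC : IsConf G c) (a : V) : 0 < c a ⬝ᵥ c a := by
  classical
  obtain ⟨k, hk⟩ := (hC.sph a).exists_head
  have h1 := le_sum_of_forall (f := fun j => c a j * c a j) k fun j _ => mul_self_nonneg _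
  unfold dotProduct
  rcases hk.1 with h2 | h2 <;> rw [h2] at h1 <;> omega

/-- The vectors are automatically distinct: squares are positive, products of different rows are
not. -/
theorem IsConf.isSymplectic {Γ : PlumbingGraph.{u}} {ι : Type w} [Fintype ι] {c : Γ.V → ι → ℤ}
    (hC : IsConf Γ.graph c) (hcard : Fintype.card ι = Fintype.card Γ.V)
    (hd : ∀ v, Γ.dec v = -(c v ⬝ᵥ c v)) : Γ.IsSymplectic := by
  classical
  let e : Fin (Fintype.card Γ.V) ≃ ι := (finCongr hcard.symm).trans (Fintype.equivFin ι).symm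
  have hdot : ∀ a b, Q (c a ∘ e) (c b ∘ e) = -(c a ⬝ᵥ c b) := fun a b => by
    simp only [Q, dotProduct, Function.comp_apply]
    rw [e.sum_comp fun i => c a i * c b i]
  have hone : ∀ a, Q (c a ∘ e) (K _) = -∑ i, c a i := fun a => by
    simp only [Q, K, mul_one, Function.comp_apply]
    rw [e.sum_comp fun i => c a i]
  have hinj : Function.Injective fun a => c a ∘ e := by
    intro a b hab
    by_contra hne
    have h1 := hdot a b
    simp only at hab
    rw [← hab, hdot] at h1
    have h2 := hC.dot_self_pos a
    have h3 := hC.dot_nonpos hne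
    omega
  refine ⟨⟨_, hinj⟩, fun a b hab => ?_, fun a b hab hn => ?_, fun v => ?_, fun v => ?_⟩
  · change Q (c a ∘ e) (c b ∘ e) = 1
    rw [hdot, hC.adj a b hab]; norm_num
  · change Q (c a ∘ e) (c b ∘ e) = 0
    rw [hdot, hC.nadj a b hab hn]; norm_num
  · change Q (c v ∘ e) (c v ∘ e) = _
    rw [hdot, hd]
  · change Q (c v ∘ e) (K _) + Q (c v ∘ e) (c v ∘ e) = -2
    rw [hdot, hone, (hC.sph v).sum_eq]
    ring

theorem Isomorphic.mem_familyS {Γ : PlumbingGraph.{u}} {Γ' : PlumbingGraph.{w}}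
    (h : Γ.Isomorphic Γ') (h' : Γ' ∈ familyS.{w}) : Γ ∈ familyS.{u} := by
  obtain ⟨e, he⟩ := h
  obtain ⟨h1, h2, h3⟩ := h'
  obtain ⟨c, hC, hd⟩ := h2.exists_isConf
  refine ⟨e.isTree_iff.2 h1, ?_, fun v => he v ▸ h3 (e v)⟩
  refine IsConf.isSymplectic (c := fun v => c (e v)) ⟨fun v => hC.sph _,
    fun a b hab => hC.adj _ _ (e.map_adj_iff.2 hab), fun a b hab hn =>
      hC.nadj _ _ (fun h => hab (e.injective h)) fun h => hn (e.map_adj_iff.1 h)⟩ ?_ ?_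
  · rw [Fintype.card_fin]
    exact (Fintype.card_congr e.toEquiv).symm
  · intro v
    rw [← he, hd]

end PlumbingGraph

namespace PlumbingGraph

open Matrix

/-! ### Blowing down -/

/-- The graph `G` with decorations `d` is isomorphic to an iterated blow-up of `Γ₀` with
`(-1)`-vertex `v`. -/
def Reaches {V : Type*} (Γ₀ : PlumbingGraph.{0}) (G : SimpleGraph V) (d : V → ℤ) (v : V) : Prop :=
  ∃ (Γ' : PlumbingGraph.{0}) (φ : G ≃g Γ'.graph),
    (∀ x, Γ'.dec (φ x) = d x) ∧ IteratedBlowUp Γ₀ Γ' (φ v)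

/-- Delete `v` and join its neighbours. -/
def blowDown {V : Type*} (G : SimpleGraph V) (v : V) : SimpleGraph {x : V // x ≠ v} where
  Adj := fun a b => a ≠ b ∧ (G.Adj a b ∨ G.Adj v a ∧ G.Adj v b)
  symm := ⟨fun _ _ h => ⟨h.1.symm, h.2.imp (fun h => h.symm) (fun h => ⟨h.2, h.1⟩)⟩⟩
  loopless := ⟨fun _ h => h.1 rfl⟩

section BlowDown
variable {V : Type*} {G : SimpleGraph V} {v w : V}

theorem blowDown_adj {a b : {x : V // x ≠ v}} :
    (blowDown G v).Adj a b ↔ a ≠ b ∧ (G.Adj a b ∨ G.Adj v a ∧ G.Adj v b) := Iff.rfl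

-- With a second neighbour w₂ the vertex v arises by blowing up the edge from w to w₂, otherwise by
-- blowing up w. In either case w becomes the distinguished vertex of the smaller graph.
open Classical in
theorem Reaches.of_blowDown {Γ₀ : PlumbingGraph.{0}} {d : V → ℤ}
    (hvw : G.Adj v w) (huniq : ∀ a b, G.Adj v a → G.Adj v b → a ≠ w → b ≠ w → a = b)
    (htri : ∀ a b, G.Adj v a → G.Adj v b → ¬ G.Adj a b) (hv : d v = -1)
    (h : Reaches Γ₀ (blowDown G v) (fun a => if G.Adj v a then d a + 1 else d a) ⟨w, hvw.ne'⟩) :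
    Reaches Γ₀ G d v := by
  classical
  obtain ⟨Γ', φ, hφ, hI⟩ := h
  let ψ : V ≃ Option Γ'.V := (Equiv.optionSubtypeNe v).symm.trans (Equiv.optionCongr φ.toEquiv)
  have hψv : ψ v = none := by simp [ψ]
  have hψ : ∀ x (hx : x ≠ v), ψ x = some (φ ⟨x, hx⟩) := by
    intro x hx
    simp [ψ, Equiv.optionSubtypeNe_symm_of_ne hx]
  have hadj : ∀ a b (ha : a ≠ v) (hb : b ≠ v), Γ'.graph.Adj (φ ⟨a, ha⟩) (φ ⟨b, hb⟩) ↔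
      a ≠ b ∧ (G.Adj a b ∨ G.Adj v a ∧ G.Adj v b) := by
    intro a b ha hb
    rw [φ.map_adj_iff, blowDown_adj]
    simp
  have hdec : ∀ a (ha : a ≠ v), Γ'.dec (φ ⟨a, ha⟩) =
      if G.Adj v a then d a + 1 else d a := fun a ha => hφ _
  by_cases hw : ∃ w₂, G.Adj v w₂ ∧ w₂ ≠ w
  · obtain ⟨w₂, h1, h2⟩ := hw
    have hnb : ∀ a, G.Adj v a ↔ a = w ∨ a = w₂ := by
      intro a
      constructor
      · intro ha
        by_cases haw : a = w
        · exact Or.inl haw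
        · exact Or.inr (huniq a w₂ ha h1 haw h2)
      · rintro (rfl | rfl)
        · exact hvw
        · exact h1
    have hww := htri _ _ hvw h1
    refine ⟨Γ'.blowUpEdge (φ ⟨w, hvw.ne'⟩) (φ ⟨w₂, h1.ne'⟩), ⟨ψ, ?_⟩, ?_, ?_⟩
    · intro a b
      change Γ'.blowUpEdgeAdj _ _ (ψ a) (ψ b) ↔ _
      by_cases ha : a = v <;> by_cases hb : b = v
      · rw [ha, hb, hψv]
        simp [blowUpEdgeAdj]
      · rw [ha, hψv, hψ b hb, hnb]
        simp [blowUpEdgeAdj]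
      · rw [hb, hψv, hψ a ha, G.adj_comm, hnb]
        simp [blowUpEdgeAdj]
      · rw [hψ a ha, hψ b hb]
        simp only [blowUpEdgeAdj, hadj, hnb, Sym2.eq_iff, ne_eq, φ.injective.eq_iff, Subtype.mk.injEq]
        constructor
        · rintro ⟨⟨h3, h4⟩, h5⟩
          rcases h4 with h4 | h4
          · exact h4
          · exfalso
            rcases h4 with ⟨rfl | rfl, rfl | rfl⟩ <;> simp_all
        · intro h3
          refine ⟨⟨h3.ne, Or.inl h3⟩, ?_⟩
          rintro (⟨rfl, rfl⟩ | ⟨rfl, rfl⟩)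
          · exact hww h3
          · exact hww h3.symm
    · intro x
      change (Γ'.blowUpEdge _ _).dec (ψ x) = _
      by_cases hx : x = v
      · rw [hx, hψv, hv]
        rfl
      · rw [hψ x hx]
        simp only [blowUpEdge, hdec, hnb, φ.injective.eq_iff, Subtype.mk.injEq]
        split_ifs <;> ring
    · change IteratedBlowUp Γ₀ (Γ'.blowUpEdge (φ ⟨w, hvw.ne'⟩) (φ ⟨w₂, h1.ne'⟩)) (ψ v)
      rw [hψv]
      refine IteratedBlowUp.edge Γ' _ _ hI ?_
      rw [hadj]
      exact ⟨h2.symm, Or.inr ⟨hvw, h1⟩⟩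
  · push Not at hw
    have hnb : ∀ a, G.Adj v a ↔ a = w := fun a => ⟨hw a, fun h => h ▸ hvw⟩
    refine ⟨Γ'.blowUpVertex (φ ⟨w, hvw.ne'⟩), ⟨ψ, ?_⟩, ?_, ?_⟩
    · intro a b
      change Γ'.blowUpVertexAdj _ (ψ a) (ψ b) ↔ _
      by_cases ha : a = v <;> by_cases hb : b = v
      · rw [ha, hb, hψv]
        simp [blowUpVertexAdj]
      · rw [ha, hψv, hψ b hb, hnb]
        simp [blowUpVertexAdj]
      · rw [hb, hψv, hψ a ha, G.adj_comm, hnb]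
        simp [blowUpVertexAdj]
      · rw [hψ a ha, hψ b hb]
        simp only [blowUpVertexAdj, hadj, hnb]
        constructor
        · rintro ⟨h3, h4 | ⟨h4, h5⟩⟩
          · exact h4
          · exact absurd (h4.trans h5.symm) h3
        · exact fun h3 => ⟨h3.ne, Or.inl h3⟩
    · intro x
      change (Γ'.blowUpVertex _).dec (ψ x) = _
      by_cases hx : x = v
      · rw [hx, hψv, hv]
        rfl
      · rw [hψ x hx]
        simp only [blowUpVertex, hdec, hnb, φ.injective.eq_iff, Subtype.mk.injEq]
        split_ifs <;> ring
    · change IteratedBlowUp Γ₀ (Γ'.blowUpVertex (φ ⟨w, hvw.ne'⟩)) (ψ v)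
      rw [hψv]
      exact IteratedBlowUp.vertex Γ' _ hI

/-- Root the tree at w and hang the possible child of v on w. -/
theorem isTree_blowDown [Finite V] (hG : G.IsTree) (hvw : G.Adj v w)
    (huniq : ∀ a b, G.Adj v a → G.Adj v b → a ≠ w → b ≠ w → a = b) :
    (blowDown G v).IsTree := by
  classical
  obtain ⟨par, hR, -⟩ := exists_isRooted hG w
  have hpv : par v = w := by
    rcases (hR.adj_iff v w).1 hvw with h | h
    · exact h.2
    · exact absurd rfl h.1
  have hv0 := hR.dep_par v hvw.ne
  rw [hpv] at hv0
  have hne : ∀ x, (if par x = v then w else par x) ≠ v := by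
    intro x
    split_ifs with h
    · exact hvw.ne'
    · exact h
  refine IsRooted.isTree (r := (⟨w, hvw.ne'⟩ : {x : V // x ≠ v}))
    (par := fun x : {x : V // x ≠ v} => ⟨if par x = v then w else par x, hne x⟩)
    (dep := fun x : {x : V // x ≠ v} => G.dist w x) ⟨?_, ?_, ?_⟩
  · simp [hR.par_root]
  · rintro ⟨x, hx⟩ hxw
    have hxw' : x ≠ w := fun e => hxw (Subtype.ext e)
    have h1 := hR.dep_par x hxw'
    by_cases h2 : par x = v
    · simp only [h2, if_true]
      rw [h2] at h1
      omega
    · simpa only [h2, if_false] using h1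
  · rintro ⟨a, ha⟩ ⟨b, hb⟩
    rw [blowDown_adj]
    simp only [ne_eq, Subtype.mk.injEq]
    have key : ∀ a b, a ≠ v → b ≠ v → a ≠ w → (if par a = v then w else par a) = b →
        ¬ a = b ∧ (G.Adj a b ∨ G.Adj v a ∧ G.Adj v b) := by
      intro a b ha hb haw h1
      have h2 := hR.adj_par haw
      split_ifs at h1 with h3
      · subst h1
        exact ⟨haw, Or.inr ⟨(h3 ▸ h2).symm, hvw⟩⟩
      · subst h1
        exact ⟨h2.ne, Or.inl h2⟩
    have hnb : ∀ a, G.Adj v a → a ≠ w → par a = v := by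
      intro a h1 h2
      rcases (hR.adj_iff v a).1 h1 with h3 | h3
      · exact absurd (h3.2.symm.trans hpv) h2
      · exact h3.2
    constructor
    · rintro ⟨h1, h2 | ⟨h2, h3⟩⟩
      · rcases (hR.adj_iff a b).1 h2 with h3 | h3
        · exact Or.inl ⟨h3.1, by rw [h3.2, if_neg hb]⟩
        · exact Or.inr ⟨h3.1, by rw [h3.2, if_neg ha]⟩
      · by_cases haw : a = w
        · have hbw : b ≠ w := fun e => h1 (haw.trans e.symm)
          exact Or.inr ⟨hbw, by rw [if_pos (hnb b h3 hbw), haw]⟩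
        · by_cases hbw : b = w
          · exact Or.inl ⟨haw, by rw [if_pos (hnb a h2 haw), hbw]⟩
          · exact absurd (huniq a b h2 h3 haw hbw) h1
    · rintro (⟨h1, h2⟩ | ⟨h1, h2⟩)
      · exact key a b ha hb h1 h2
      · obtain ⟨h3, h4⟩ := key b a hb ha h1 h2
        exact ⟨fun e => h3 e.symm, h4.imp (fun h => h.symm) fun h => ⟨h.2, h.1⟩⟩

end BlowDown

end PlumbingGraph

namespace PlumbingGraph

open Matrix

/-! ### Configurations with a single exceptional sphere orthogonal to a vector -/

/-- All vertices but `v` are spheres of square at most `-2`, the vertex `v` is the basis vector `e`,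
and all vertices are orthogonal to the nonzero `0`-`1`-vector `f`. -/
structure FreeAt {V ι : Type*} [Fintype V] [Fintype ι] (G : SimpleGraph V) (c : V → ι → ℤ) (v : V)
    (e : ι) (f : ι → ℤ) : Prop where
  conf : IsConf G c
  tree : G.IsTree
  card : Fintype.card ι = Fintype.card V
  two_le : ∀ x, x ≠ v → 2 ≤ c x ⬝ᵥ c x
  one : c v e = 1
  zero : ∀ k, k ≠ e → c v k = 0
  orth : ∀ x, f ⬝ᵥ c x = 0
  ne : f ≠ 0
  bool : ∀ k, f k = 0 ∨ f k = 1

namespace FreeAt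

section
variable {V ι : Type*} [Fintype V] [Fintype ι] {G : SimpleGraph V} {c : V → ι → ℤ} {v : V}
  {e : ι} {f : ι → ℤ}

theorem dot_v (F : FreeAt G c v e f) (x : ι → ℤ) : c v ⬝ᵥ x = x e := by
  unfold dotProduct
  rw [sum_eq_add_of_forall e fun j hj => by rw [F.zero j hj, zero_mul], F.one, one_mul]

theorem f_e (F : FreeAt G c v e f) : f e = 0 := by
  rw [← F.dot_v f, dotProduct_comm, F.orth]

theorem col_adj (F : FreeAt G c v e f) {x : V} (h : G.Adj v x) : c x e = -1 := by
  rw [← F.dot_v (c x), F.conf.adj _ _ h]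

theorem col_nadj (F : FreeAt G c v e f) {x : V} (hx : x ≠ v) (h : ¬ G.Adj v x) : c x e = 0 := by
  rw [← F.dot_v (c x), F.conf.nadj _ _ hx.symm h]

theorem not_adj (F : FreeAt G c v e f) {a b : V} (ha : G.Adj v a) (hb : G.Adj v b) :
    ¬ G.Adj a b := by
  obtain ⟨par, hR, -⟩ := exists_isRooted F.tree v
  intro hab
  have key : ∀ x, G.Adj v x → par x = v := by
    intro x hx
    rcases (hR.adj_iff v x).1 hx with h | h
    · exact absurd rfl h.1
    · exact h.2
  rcases (hR.adj_iff a b).1 hab with h | h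
  · rw [key a ha] at h; exact hb.ne h.2
  · rw [key b hb] at h; exact ha.ne h.2

theorem exists_relation (F : FreeAt G c v e f) :
    ∃ m : V → ℤ, (∀ a, 0 < m a) ∧ ∑ a, m a • c a = 0 :=
  exists_pos_relation_of_orth (fun _ _ h => F.conf.dot_nonpos h) (F.conf.dotConn F.tree.connected)
    F.card F.ne F.orth

theorem exists_adj (F : FreeAt G c v e f) : ∃ w, G.Adj v w := by
  by_contra hcon
  push Not at hcon
  obtain ⟨m, hm, hz⟩ := F.exists_relation
  have h1 := dot_relation hz (c v)
  simp only [F.dot_v] at h1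
  rw [sum_eq_add_of_forall v fun x hx => by rw [F.col_nadj hx (hcon x), mul_zero], F.one] at h1
  have := hm v
  omega

/-- The configuration obtained by deleting `v` and its column. -/
theorem conf_blowDown [DecidableEq ι] (F : FreeAt G c v e f) :
    IsConf (blowDown G v) (fun x : {x // x ≠ v} => fun k : {k // k ≠ e} => c x k) := by
  refine ⟨?_, ?_, ?_⟩
  · rintro ⟨x, hx⟩
    refine sph_subtype_ne (F.conf.sph x) ?_
    by_cases h : G.Adj v x
    · exact Or.inr (F.col_adj h)
    · exact Or.inl (F.col_nadj hx h)
  · rintro ⟨a, ha⟩ ⟨b, hb⟩ ⟨h1, h2⟩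
    have h3 : a ≠ b := fun e => h1 (Subtype.ext e)
    rw [dot_subtype_ne]
    rcases h2 with h2 | ⟨h2, h4⟩
    · rw [F.conf.adj _ _ h2]
      by_cases h5 : G.Adj v a
      · by_cases h6 : G.Adj v b
        · exact absurd h2 (F.not_adj h5 h6)
        · simp [F.col_nadj hb h6]
      · simp [F.col_nadj ha h5]
    · rw [F.conf.nadj _ _ h3 (F.not_adj h2 h4), F.col_adj h2, F.col_adj h4]
      norm_num
  · rintro ⟨a, ha⟩ ⟨b, hb⟩ h1 h2
    have h3 : a ≠ b := fun e => h1 (Subtype.ext e)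
    rw [blowDown_adj] at h2
    push Not at h2
    obtain ⟨h4, h5⟩ := h2 h1
    rw [dot_subtype_ne, F.conf.nadj _ _ h3 h4]
    by_cases h6 : G.Adj v a
    · simp [F.col_nadj hb (h5 h6)]
    · simp [F.col_nadj ha h6]

theorem dot_blowDown [DecidableEq ι] [DecidableRel G.Adj] (F : FreeAt G c v e f)
    (x : {x // x ≠ v}) :
    (fun k : {k // k ≠ e} => c x k) ⬝ᵥ (fun k : {k // k ≠ e} => c x k) =
      c x ⬝ᵥ c x - if G.Adj v x then 1 else 0 := by
  rw [dot_subtype_ne]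
  split_ifs with h
  · rw [F.col_adj h]; ring
  · rw [F.col_nadj x.2 h]; ring

/-- If no neighbour had square 2, the blown down tree would be minimal, and the nonzero f would give
it a forbidden positive relation. Two such neighbours would become nonnegative vectors after the
blow-down, yet have product -1. -/
theorem exists_two (F : FreeAt G c v e f) {w : V} (hvw : G.Adj v w)
    (huniq : ∀ a b, G.Adj v a → G.Adj v b → a ≠ w → b ≠ w → a = b) :
    ∃ w, G.Adj v w ∧ c w ⬝ᵥ c w = 2 ∧
      (∀ a b, G.Adj v a → G.Adj v b → a ≠ w → b ≠ w → a = b) ∧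
      ∀ a, G.Adj v a → a ≠ w → c a ⬝ᵥ c a ≠ 2 := by
  classical
  have hC := F.conf_blowDown
  have hT := isTree_blowDown F.tree hvw huniq
  have hcard : Fintype.card {k // k ≠ e} = Fintype.card {x // x ≠ v} := by
    rw [Fintype.card_subtype_compl, Fintype.card_subtype_compl, F.card]
    simp
  have horth : ∀ x : {x // x ≠ v}, (fun k : {k // k ≠ e} => f k) ⬝ᵥ (fun k => c x k) = 0 := by
    intro x
    rw [dot_subtype_ne, F.orth, F.f_e]
    ring
  have hne : (fun k : {k // k ≠ e} => f k) ≠ 0 := by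
    intro h
    refine F.ne (funext fun k => ?_)
    by_cases hk : k = e
    · rw [hk, F.f_e]; rfl
    · exact congrFun h ⟨k, hk⟩
  have h1 : ∃ w, G.Adj v w ∧ c w ⬝ᵥ c w = 2 := by
    by_contra hcon
    push Not at hcon
    obtain ⟨m, hm, hz⟩ := exists_pos_relation_of_orth (fun _ _ h => hC.dot_nonpos h)
      (hC.dotConn hT.connected) hcard hne horth
    obtain ⟨par, hR, -⟩ := exists_isRooted hT ⟨w, hvw.ne'⟩
    refine hC.no_pos_relation hR ?_ hm hz
    intro x
    rw [F.dot_blowDown]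
    have h2 := F.two_le x x.2
    split_ifs with h3
    · have := hcon x h3
      omega
    · omega
  obtain ⟨w', hw', hd⟩ := h1
  refine ⟨w', hw', hd, ?_, ?_⟩
  · intro a b ha hb h2 h3
    by_contra hab
    rcases eq_or_ne w' w with rfl | h4
    · exact hab (huniq a b ha hb h2 h3)
    · rcases eq_or_ne a w with rfl | h5
      · exact h3 (huniq b w' hb hw' (Ne.symm hab) h4)
      · exact h2 (huniq a w' ha hw' h5 h4)
  · intro a ha haw hda
    have h2 : (blowDown G v).Adj ⟨a, ha.ne'⟩ ⟨w', hw'.ne'⟩ :=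
      ⟨fun e => haw (congrArg Subtype.val e), Or.inr ⟨ha, hw'⟩⟩
    have h3 := hC.adj _ _ h2
    have h4 : ∀ x (hx : G.Adj v x), c x ⬝ᵥ c x = 2 → ∀ k, k ≠ e → 0 ≤ c x k := by
      intro x hx hdx k hk
      obtain ⟨j, hj⟩ := (F.conf.sph x).exists_head
      have h5 := F.col_adj hx
      have hje : j ≠ e := by
        rintro rfl
        rcases hj.1 with h | h <;> omega
      by_contra hneg
      rcases eq_or_ne k j with rfl | hkj
      · have h6 := hj.1.resolve_left (by omega)
        have := le_sum_of_forall (f := fun i => c x i * c x i) k fun i _ => mul_self_nonneg _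
        simp only [h6] at this
        unfold dotProduct at hdx
        omega
      · have h6 := (hj.2 k hkj).resolve_left (by omega)
        have h7 := (F.conf.sph x).sum_eq
        have h8 := add_le_sum_of_forall (f := fun i => c x i * c x i) e k hk.symm
          fun i _ _ => mul_self_nonneg _
        have h9 : ∑ i, c x i ≤ c x j + c x e + c x k := by
          have := add_le_sum_of_forall (f := fun i => - c x i - if i = j then -c x j else 0) e k
            hk.symm fun i _ _ => by
              split_ifs with h
              · rw [h]; simp
              · have := hj.2 i h
                omega
          simp only [Finset.sum_sub_distrib, Finset.sum_neg_distrib, if_neg hje.symm, if_neg hkj,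
            Finset.sum_ite_eq', Finset.mem_univ, if_true] at this
          omega
        have := hj.1
        omega
    have h5 : 0 ≤ (fun k : {k // k ≠ e} => c a k) ⬝ᵥ (fun k : {k // k ≠ e} => c w' k) :=
      Finset.sum_nonneg fun k _ => mul_nonneg (h4 a ha hda k k.2) (h4 w' hw' hd k k.2)
    simp only at h3
    omega

/-- A vertex of square 2 holding e is a basis vector minus that of e, so deleting the column turns
it into the new exceptional basis vector. -/
theorem blowDown [DecidableEq V] [DecidableEq ι] (F : FreeAt G c v e f) {w : V} (hvw : G.Adj v w)
    (huniq : ∀ a b, G.Adj v a → G.Adj v b → a ≠ w → b ≠ w → a = b) (hd : c w ⬝ᵥ c w = 2)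
    (hother : ∀ a, G.Adj v a → a ≠ w → c a ⬝ᵥ c a ≠ 2) :
    ∃ e', FreeAt (PlumbingGraph.blowDown G v) (fun (x : {x // x ≠ v}) (k : {k // k ≠ e}) => c x k)
      ⟨w, hvw.ne'⟩ e' (fun k => f k) := by
  classical
  obtain ⟨j, hj⟩ := (F.conf.sph w).exists_head
  have h5 := F.col_adj hvw
  have hje : j ≠ e := by
    rintro rfl
    rcases hj.1 with h | h <;> omega
  have hj1 : c w j = 1 := by
    refine hj.1.resolve_right fun h6 => ?_
    have := le_sum_of_forall (f := fun i => c w i * c w i) j fun i _ => mul_self_nonneg _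
    simp only [h6] at this
    unfold dotProduct at hd
    omega
  have hj0 : ∀ k, k ≠ e → k ≠ j → c w k = 0 := by
    intro k hk hkj
    have h7 : ∑ i, c w i * c w i = 2 := hd
    have h8 := Finset.add_sum_erase Finset.univ (fun i => c w i * c w i) (Finset.mem_univ j)
    have h9 := Finset.add_sum_erase (Finset.univ.erase j) (fun i => c w i * c w i)
      (Finset.mem_erase.2 ⟨hje.symm, Finset.mem_univ e⟩)
    simp only [hj1, h5] at h8 h9
    have h10 : ∑ i ∈ (Finset.univ.erase j).erase e, c w i * c w i = 0 := by omega
    rw [Finset.sum_eq_zero_iff_of_nonneg fun i _ => mul_self_nonneg _] at h10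
    simpa using h10 k (by simp [hk, hkj])
  refine ⟨⟨j, hje⟩, F.conf_blowDown, isTree_blowDown F.tree hvw huniq, ?_, ?_, hj1, ?_, ?_, ?_,
    fun k => F.bool k⟩
  · rw [Fintype.card_subtype_compl, Fintype.card_subtype_compl, F.card]
    simp
  · rintro ⟨x, hx⟩ hxw
    have hxw' : x ≠ w := fun e => hxw (Subtype.ext e)
    rw [F.dot_blowDown]
    simp only
    have h2 := F.two_le x hx
    split_ifs with h3
    · have := hother x h3 hxw'
      omega
    · omega
  · rintro ⟨k, hk⟩ hkj
    exact hj0 k hk fun e => hkj (Subtype.ext e)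
  · intro x
    rw [dot_subtype_ne, F.orth, F.f_e]
    ring
  · intro h
    refine F.ne (funext fun k => ?_)
    by_cases hk : k = e
    · rw [hk, F.f_e]; rfl
    · exact congrFun h ⟨k, hk⟩

end

end FreeAt

end PlumbingGraph

/-! ### Three neighbours of the exceptional sphere -/

namespace PlumbingGraph

open Matrix

/-- After sorting, 1/a + 1/b + 1/c = 1 with all terms at most 1/2 leaves a ≤ 3 and b ≤ 4. -/
theorem exists_perm_of_egyptian {d : Fin 3 → ℤ} (hd : ∀ i, 2 ≤ d i)
    (h : d 0 * d 1 * d 2 = d 1 * d 2 + d 0 * d 2 + d 0 * d 1) :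
    ∃ σ : Equiv.Perm (Fin 3), d ∘ σ = ![3, 3, 3] ∨ d ∘ σ = ![4, 4, 2] ∨ d ∘ σ = ![2, 6, 3] := by
  have hsort : ∀ d : Fin 3 → ℤ, (∀ i, 2 ≤ d i) →
      d 0 * d 1 * d 2 = d 1 * d 2 + d 0 * d 2 + d 0 * d 1 → d 0 ≤ d 1 → d 1 ≤ d 2 →
      ∃ σ : Equiv.Perm (Fin 3), d ∘ σ = ![3, 3, 3] ∨ d ∘ σ = ![4, 4, 2] ∨ d ∘ σ = ![2, 6, 3] := by
    intro d hd h h01 h12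
    have h0 := hd 0
    have h1 := hd 1
    have h2 := hd 2
    have h3 : d 0 ≤ 3 := by
      by_contra hcon
      have : d 0 * (d 1 * d 2) ≥ 4 * (d 1 * d 2) :=
        mul_le_mul_of_nonneg_right (by omega) (by positivity)
      nlinarith [mul_le_mul_of_nonneg_right h01 (by omega : (0 : ℤ) ≤ d 2),
        mul_le_mul_of_nonneg_right h12 (by omega : (0 : ℤ) ≤ d 0),
        mul_le_mul_of_nonneg_right h12 (by omega : (0 : ℤ) ≤ d 1),
        mul_pos (by omega : (0 : ℤ) < d 1) (by omega : (0 : ℤ) < d 2)]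
    have h4 : d 1 ≤ 4 := by
      by_contra hcon
      nlinarith [mul_nonneg (by omega : (0 : ℤ) ≤ d 0 - 2)
          (mul_nonneg (by omega : (0 : ℤ) ≤ d 1) (by omega : (0 : ℤ) ≤ d 2)),
        mul_nonneg (by omega : (0 : ℤ) ≤ d 1 - 5) (by omega : (0 : ℤ) ≤ d 2),
        mul_nonneg (by omega : (0 : ℤ) ≤ 3 - d 0) (by omega : (0 : ℤ) ≤ d 2),
        mul_nonneg (by omega : (0 : ℤ) ≤ 3 - d 0) (by omega : (0 : ℤ) ≤ d 1)]
    obtain h5 | h5 : d 0 = 2 ∨ d 0 = 3 := by omega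
    · obtain h6 | h6 | h6 : d 1 = 2 ∨ d 1 = 3 ∨ d 1 = 4 := by omega
      · rw [h5, h6] at h; omega
      · rw [h5, h6] at h
        refine ⟨Equiv.swap 1 2, Or.inr (Or.inr (funext fun i => ?_))⟩
        have h7 : d 2 = 6 := by omega
        fin_cases i
        · exact h5
        · simpa using h7
        · simpa using h6
      · rw [h5, h6] at h
        refine ⟨Equiv.swap 0 2, Or.inr (Or.inl (funext fun i => ?_))⟩
        have h7 : d 2 = 4 := by omega
        fin_cases i
        · simpa using h7
        · exact h6
        · simpa using h5
    · obtain h6 | h6 | h6 : d 1 = 2 ∨ d 1 = 3 ∨ d 1 = 4 := by omega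
      · omega
      · rw [h5, h6] at h
        refine ⟨1, Or.inl (funext fun i => ?_)⟩
        have h7 : d 2 = 3 := by omega
        fin_cases i
        · simpa using h5
        · simpa using h6
        · simpa using h7
      · rw [h5, h6] at h; omega
  have hm := Tuple.monotone_sort d
  have hprod : ∀ σ : Equiv.Perm (Fin 3), (d ∘ σ) 0 * (d ∘ σ) 1 * (d ∘ σ) 2 =
      (d ∘ σ) 1 * (d ∘ σ) 2 + (d ∘ σ) 0 * (d ∘ σ) 2 + (d ∘ σ) 0 * (d ∘ σ) 1 := by
    intro σ
    have h1 : (d ∘ σ) 0 * (d ∘ σ) 1 * (d ∘ σ) 2 = d 0 * d 1 * d 2 := by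
      rw [← Fin.prod_univ_three, ← Fin.prod_univ_three]
      exact Equiv.prod_comp σ d
    have h2 : (d ∘ σ) 0 + (d ∘ σ) 1 + (d ∘ σ) 2 = d 0 + d 1 + d 2 := by
      rw [← Fin.sum_univ_three, ← Fin.sum_univ_three]
      exact Equiv.sum_comp σ d
    have h3 : (d ∘ σ) 0 * (d ∘ σ) 0 + (d ∘ σ) 1 * (d ∘ σ) 1 + (d ∘ σ) 2 * (d ∘ σ) 2 =
        d 0 * d 0 + d 1 * d 1 + d 2 * d 2 := by
      rw [← Fin.sum_univ_three fun i => (d ∘ σ) i * (d ∘ σ) i,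
        ← Fin.sum_univ_three fun i => d i * d i]
      exact Equiv.sum_comp σ fun i => d i * d i
    rw [h1, h]
    have h4 := congrArg (fun x => x * x) h2
    nlinarith
  obtain ⟨τ, hτ⟩ := hsort (d ∘ Tuple.sort d) (fun i => hd _) (hprod _) (hm (by decide))
    (hm (by decide))
  exact ⟨τ.trans (Tuple.sort d), hτ⟩

theorem exists_four {ι : Type*} [Fintype ι] (hcard : Fintype.card ι = 4) {e p : ι} (hep : e ≠ p) :
    ∃ q s : ι, q ≠ p ∧ s ≠ p ∧ ∀ g : ι → ℤ, ∑ k, g k = g e + g p + g q + g s := by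
  classical
  have h1 : ((Finset.univ.erase e).erase p).card = 2 := by
    rw [Finset.card_erase_of_mem (Finset.mem_erase.2 ⟨hep.symm, Finset.mem_univ p⟩),
      Finset.card_erase_of_mem (Finset.mem_univ e), Finset.card_univ, hcard]
  obtain ⟨q, s, hqs, h2⟩ := Finset.card_eq_two.1 h1
  have hq : q ∈ (Finset.univ.erase e).erase p := by rw [h2]; simp
  have hs : s ∈ (Finset.univ.erase e).erase p := by rw [h2]; simp
  refine ⟨q, s, Finset.ne_of_mem_erase hq, Finset.ne_of_mem_erase hs, fun g => ?_⟩
  rw [← Finset.add_sum_erase _ g (Finset.mem_univ e),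
    ← Finset.add_sum_erase _ g (Finset.mem_erase.2 ⟨hep.symm, Finset.mem_univ p⟩), h2,
    Finset.sum_pair hqs]
  ring

namespace FreeAt

section
variable {V ι : Type*} [Fintype V] [Fintype ι] {G : SimpleGraph V} {c : V → ι → ℤ} {v : V}
  {e : ι} {f : ι → ℤ} {w : Fin 3 → V}

theorem dot_w (F : FreeAt G c v e f) (hw : Function.Injective w) (hvw : ∀ i, G.Adj v (w i))
    {i j : Fin 3} (hij : i ≠ j) : c (w i) ⬝ᵥ c (w j) = 0 :=
  F.conf.nadj _ _ (fun h => hij (hw h)) (F.not_adj (hvw i) (hvw j))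

/-- The vector g = -1 - 2 c v - ∑ c (w i) is zero on v and on the w i and nonnegative on all other
rows, so the positive relation makes it vanish everywhere. It is positive on any further vertex
adjacent to one of these four. -/
theorem forall_eq (F : FreeAt G c v e f) (hw : Function.Injective w) (hvw : ∀ i, G.Adj v (w i))
    (x : V) : x = v ∨ ∃ i, x = w i := by
  classical
  obtain ⟨m, hm, hz⟩ := F.exists_relation
  let g : ι → ℤ := -1 - 2 • c v - ∑ i, c (w i)
  have hg : ∀ x, g ⬝ᵥ c x = c x ⬝ᵥ c x - 2 - 2 * c x e - ∑ i, c (w i) ⬝ᵥ c x := by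
    intro x
    simp only [g, sub_dotProduct, neg_dotProduct, one_dotProduct_of_sph (F.conf.sph x),
      smul_dotProduct, F.dot_v, sum_dotProduct]
    simp
  have hoth : ∀ x, x ≠ v → (∀ i, x ≠ w i) → 0 ≤ c x ⬝ᵥ c x - 2 ∧ 0 ≤ - c x e ∧
      ∀ i, 0 ≤ - (c (w i) ⬝ᵥ c x) := by
    intro x hx hxw
    refine ⟨by have := F.two_le x hx; omega, ?_, fun i => ?_⟩
    · rw [← F.dot_v (c x)]
      have := F.conf.dot_nonpos hx.symm
      omega
    · have := F.conf.dot_nonpos (hxw i).symm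
      omega
  have hnn : ∀ x, 0 ≤ g ⬝ᵥ c x := by
    intro x
    rw [hg]
    by_cases hx : x = v
    · subst hx
      simp only [dotProduct_comm _ (c x), F.dot_v, F.one, F.col_adj (hvw _)]
      simp
    · by_cases hxw : ∃ i, x = w i
      · obtain ⟨i, rfl⟩ := hxw
        rw [Finset.sum_eq_single i (fun j _ hj => F.dot_w hw hvw hj) (by simp), F.col_adj (hvw i)]
        omega
      · push Not at hxw
        obtain ⟨h1, h2, h3⟩ := hoth x hx hxw
        have := Finset.sum_nonneg fun i (_ : i ∈ Finset.univ) => h3 i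
        rw [Finset.sum_neg_distrib] at this
        omega
  refine F.conf.dotConn F.tree.connected (fun x => x = v ∨ ∃ i, x = w i) ⟨v, Or.inl rfl⟩ ?_ x
  intro a b ha hab
  by_contra hb
  push Not at hb
  obtain ⟨h1, h2, h3⟩ := hoth b hb.1 hb.2
  have h4 := eq_zero_of_pos_relation hm hz hnn b
  rw [hg] at h4
  have h5 := Finset.sum_nonneg fun i (_ : i ∈ Finset.univ) => h3 i
  rw [Finset.sum_neg_distrib] at h5
  rcases ha with rfl | ⟨i, rfl⟩
  · rw [F.dot_v] at hab
    omega
  · have h6 := Finset.single_le_sum (fun i _ => h3 i) (Finset.mem_univ i)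
    rw [Finset.sum_neg_distrib] at h6
    omega

/-- Paired with the rows, the positive relation m gives m(v) = ∑ m(w i) and m(w i) d i = m(v), hence
∑ 1/d i = 1. -/
theorem egyptian (F : FreeAt G c v e f) (hw : Function.Injective w) (hvw : ∀ i, G.Adj v (w i)) :
    (c (w 0) ⬝ᵥ c (w 0)) * (c (w 1) ⬝ᵥ c (w 1)) * (c (w 2) ⬝ᵥ c (w 2)) =
      (c (w 1) ⬝ᵥ c (w 1)) * (c (w 2) ⬝ᵥ c (w 2)) + (c (w 0) ⬝ᵥ c (w 0)) * (c (w 2) ⬝ᵥ c (w 2)) +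
        (c (w 0) ⬝ᵥ c (w 0)) * (c (w 1) ⬝ᵥ c (w 1)) := by
  classical
  obtain ⟨m, hm, hz⟩ := F.exists_relation
  have hsum : ∀ g : ι → ℤ, m v * (g ⬝ᵥ c v) + ∑ i, m (w i) * (g ⬝ᵥ c (w i)) = 0 := by
    intro g
    rw [← dot_relation hz g]
    refine (sum_eq_add_sum_range (F := fun a => m a * (g ⬝ᵥ c a)) hw (fun i => (hvw i).ne') fun k hk hkw => ?_).symm
    exact absurd (F.forall_eq hw hvw k) (by push Not; exact ⟨hk, hkw⟩)
  have h1 := hsum (c v)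
  simp only [F.dot_v, F.one, F.col_adj (hvw _), Fin.sum_univ_three] at h1
  have h2 : ∀ i, m (w i) * (c (w i) ⬝ᵥ c (w i)) = m v := by
    intro i
    have := hsum (c (w i))
    rw [Finset.sum_eq_single i (fun j _ hj => by rw [F.dot_w hw hvw hj.symm, mul_zero]) (by simp),
      dotProduct_comm _ (c v), F.dot_v, F.col_adj (hvw i)] at this
    omega
  have h3 := h2 0
  have h4 := h2 1
  have h5 := h2 2
  generalize c (w 0) ⬝ᵥ c (w 0) = a at *
  generalize c (w 1) ⬝ᵥ c (w 1) = b at *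
  generalize c (w 2) ⬝ᵥ c (w 2) = d at *
  have h6 : m v * (a * b * d) = m v * (b * d + a * d + a * b) := by
    have : m v = m (w 0) + m (w 1) + m (w 2) := by omega
    calc m v * (a * b * d) = (m (w 0) * a) * (b * d) + (m (w 1) * b) * (a * d) +
        (m (w 2) * d) * (a * b) := by rw [this]; ring
      _ = _ := by rw [h3, h4, h5]; ring
  exact mul_left_cancel₀ (hm v).ne' h6

theorem card_eq_four (F : FreeAt G c v e f) (hw : Function.Injective w)
    (hvw : ∀ i, G.Adj v (w i)) : Fintype.card ι = 4 := by
  classical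
  rw [F.card]
  let o : Option (Fin 3) → V := fun o => o.elim v w
  have ho : Function.Bijective o := by
    constructor
    · rintro (_ | i) (_ | j) h
      · rfl
      · exact absurd h (hvw j).ne
      · exact absurd h.symm (hvw i).ne
      · exact congrArg some (hw h)
    · intro x
      rcases F.forall_eq hw hvw x with rfl | ⟨i, rfl⟩
      · exact ⟨none, rfl⟩
      · exact ⟨some i, rfl⟩
  rw [← Fintype.card_of_bijective ho]
  simp

theorem sum_f_pos (F : FreeAt G c v e f) : 0 < ∑ k, f k := by
  obtain ⟨k, hk⟩ : ∃ k, f k ≠ 0 := by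
    by_contra hcon
    push Not at hcon
    exact F.ne (funext hcon)
  refine Finset.sum_pos' (fun k _ => ?_) ⟨k, Finset.mem_univ k, ?_⟩
  · have := F.bool k; omega
  · have := F.bool k; omega

theorem exists_head_ne (F : FreeAt G c v e f) {x : V} (h : G.Adj v x) : ∃ p, IsHead (c x) p ∧ e ≠ p := by
  obtain ⟨p, hp⟩ := (F.conf.sph x).exists_head
  refine ⟨p, hp, ?_⟩
  rintro rfl
  have := F.col_adj h
  have := hp.1
  omega

/-- In dimension four few vectors have these squares, and orthogonality to two of them determines
the size of f. -/
theorem sum_f_cases (F : FreeAt G c v e f) (hcard : Fintype.card ι = 4) {x y : V}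
    (hx : G.Adj v x) (hy : G.Adj v y) (hxy : c x ⬝ᵥ c y = 0) :
    (c x ⬝ᵥ c x = 3 → c y ⬝ᵥ c y = 3 → ∑ k, f k = 3) ∧
    (c x ⬝ᵥ c x = 2 → c y ⬝ᵥ c y = 4 → ∑ k, f k = 2) ∧
    (c x ⬝ᵥ c x = 2 → c y ⬝ᵥ c y = 3 → ∑ k, f k = 1) := by
  have hS := F.sum_f_pos
  have hfe := F.f_e
  have val : ∀ k, c y k = 0 ∨ c y k = -1 ∨ c y k = 1 ∨ c y k = -2 := by
    intro k
    obtain ⟨p, hp⟩ := (F.conf.sph y).exists_head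
    have := hp.eq_zero_or k
    omega
  obtain ⟨p, hp, hep⟩ := F.exists_head_ne hx
  obtain ⟨q, s, hq, hs, hsum⟩ := exists_four hcard hep
  have a4 := F.orth x
  have a5 := F.orth y
  have a6 := (F.conf.sph y).sum_eq
  have b4 := F.bool p
  have b5 := F.bool q
  have b6 := F.bool s
  simp only [dotProduct, hsum, F.col_adj hx, F.col_adj hy, hfe] at a4 a5 a6 hS hxy ⊢
  rcases hp.1 with b1 | b1 <;> rcases hp.2 q hq with b2 | b2 <;> rcases hp.2 s hs with b3 | b3 <;>
    simp only [b1, b2, b3] at hxy a4 ⊢ <;> try omega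
  all_goals
    rcases val p with b7 | b7 | b7 | b7 <;> rcases val q with b8 | b8 | b8 | b8 <;>
    simp only [b7, b8] at hxy a5 a6 ⊢ <;> try omega
  all_goals
    rcases val s with b9 | b9 | b9 | b9 <;> simp only [b9] at hxy a5 a6 ⊢ <;> omega

/-- The graphs with three legs of length one. -/
theorem reaches_star (F : FreeAt G c v e f) (hw : Function.Injective w) (hvw : ∀ i, G.Adj v (w i))
    {L : Fin 3 → List ℤ} (hL : ∀ i, L i = [c (w i) ⬝ᵥ c (w i)]) :
    Reaches (starGraph 1 L) G (fun x => -(c x ⬝ᵥ c x)) v := by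
  classical
  let Γ : PlumbingGraph := ⟨V, G, fun x => -(c x ⬝ᵥ c x)⟩
  have hv : c v ⬝ᵥ c v = 1 := by rw [F.dot_v, F.one]
  have hR : IsRooted Γ.graph v (fun _ => v) (fun x => if x = v then 0 else 1) := by
    refine ⟨rfl, fun x hx => by simp [hx], fun a b => ?_⟩
    change G.Adj a b ↔ _
    rcases F.forall_eq hw hvw a with rfl | ⟨i, rfl⟩
    · rcases F.forall_eq hw hvw b with rfl | ⟨j, rfl⟩
      · simp
      · simpa [(hvw j).ne'] using hvw j
    · rcases F.forall_eq hw hvw b with rfl | ⟨j, rfl⟩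
      · simpa [(hvw i).ne'] using (hvw i).symm
      · simpa [(hvw i).ne, (hvw j).ne] using F.not_adj (hvw i) (hvw j)
  have hanc : ∀ x, x ≠ v → ∀ i, Anc (fun _ => v) x (w i) → x = w i := by
    rintro x hx i ⟨n, hn⟩
    cases n with
    | zero => exact hn.symm
    | succ n => rw [Function.iterate_succ_apply'] at hn; exact absurd hn.symm hx
  obtain ⟨φ, hφ⟩ := isomorphic_starGraph (Γ := Γ) hR (if_pos rfl) (fun x hx => by simp [hx])
    (w := w) (fun x hx => by
      rcases F.forall_eq hw hvw x with rfl | ⟨i, rfl⟩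
      · exact absurd rfl hx
      · exact ⟨i, Anc.refl _, fun j hj => (hw (hanc _ hx j hj)).symm⟩) (cc := 1) (L := L)
    (fun i => by simp [hL, (hvw i).ne']) (by simp [Γ, hv])
    (fun i x hx hi => by
      obtain rfl := hanc x hx i hi
      simp [hL, Γ, hx])
  exact ⟨_, φ, hφ, IteratedBlowUp.start _ (by rw [hφ]; simp [Γ, hv])⟩

end

end FreeAt

/-- The three families of iterated blow-ups, together with the size of the orthogonal vector. -/
def InBlowUps {V : Type*} (G : SimpleGraph V) (d : V → ℤ) (v : V) (s : ℤ) : Prop :=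
  (Reaches (starGraph 1 ![[3], [3], [3]]) G d v ∧ s = 3) ∨
    (Reaches (starGraph 1 ![[4], [4], [2]]) G d v ∧ s = 2) ∨
    (Reaches (starGraph 1 ![[2], [6], [3]]) G d v ∧ s = 1)

namespace FreeAt

theorem inBlowUps_of_star {V ι : Type*} [Fintype V] [Fintype ι] {G : SimpleGraph V}
    {c : V → ι → ℤ} {v : V} {e : ι} {f : ι → ℤ} {w : Fin 3 → V} (F : FreeAt G c v e f)
    (hw : Function.Injective w) (hvw : ∀ i, G.Adj v (w i)) :
    InBlowUps G (fun x => -(c x ⬝ᵥ c x)) v (∑ k, f k) := by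
  obtain ⟨σ, hσ⟩ := exists_perm_of_egyptian (d := fun i => c (w i) ⬝ᵥ c (w i))
    (fun i => F.two_le _ (hvw i).ne') (F.egyptian hw hvw)
  have hw' : Function.Injective (w ∘ σ) := hw.comp σ.injective
  have hvw' : ∀ i, G.Adj v ((w ∘ σ) i) := fun i => hvw _
  have h4 := F.card_eq_four hw hvw
  rcases hσ with h | h | h
  · have hd : ∀ i, c (w (σ i)) ⬝ᵥ c (w (σ i)) = ![3, 3, 3] i := fun i => congrFun h i
    refine Or.inl ⟨F.reaches_star hw' hvw' fun i => ?_, ?_⟩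
    · rw [Function.comp_apply, hd]
      fin_cases i <;> rfl
    · exact (F.sum_f_cases h4 (hvw (σ 0)) (hvw (σ 1)) (F.dot_w hw' hvw' (by decide))).1 (hd 0) (hd 1)
  · have hd : ∀ i, c (w (σ i)) ⬝ᵥ c (w (σ i)) = ![4, 4, 2] i := fun i => congrFun h i
    refine Or.inr (Or.inl ⟨F.reaches_star hw' hvw' fun i => ?_, ?_⟩)
    · rw [Function.comp_apply, hd]
      fin_cases i <;> rfl
    · exact (F.sum_f_cases h4 (hvw (σ 2)) (hvw (σ 1))
        (F.dot_w hw' hvw' (i := 2) (j := 1) (by decide))).2.1 (hd 2) (hd 1)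
  · have hd : ∀ i, c (w (σ i)) ⬝ᵥ c (w (σ i)) = ![2, 6, 3] i := fun i => congrFun h i
    refine Or.inr (Or.inr ⟨F.reaches_star hw' hvw' fun i => ?_, ?_⟩)
    · rw [Function.comp_apply, hd]
      fin_cases i <;> rfl
    · exact (F.sum_f_cases h4 (hvw (σ 0)) (hvw (σ 2))
        (F.dot_w hw' hvw' (i := 0) (j := 2) (by decide))).2.2 (hd 0) (hd 2)

/-- Blow down as long as there are at most two neighbours. The vector f vanishes in every deleted
column, so its size is unchanged. -/
theorem inBlowUps (n : ℕ) : ∀ {V : Type u} {ι : Type w} [Fintype V] [Fintype ι]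
    {G : SimpleGraph V} {c : V → ι → ℤ} {v : V} {e : ι} {f : ι → ℤ} (_ : FreeAt G c v e f)
    (_ : Fintype.card V = n), InBlowUps G (fun x => -(c x ⬝ᵥ c x)) v (∑ k, f k) := by
  induction n with
  | zero =>
    intro V ι _ _ G c v e f F hn
    rw [Fintype.card_eq_zero_iff] at hn
    exact isEmptyElim v
  | succ n ih =>
    intro V ι _ _ G c v e f F hn
    classical
    obtain ⟨w, hvw⟩ := F.exists_adj
    by_cases huniq : ∀ a b, G.Adj v a → G.Adj v b → a ≠ w → b ≠ w → a = b
    · obtain ⟨w', hvw', hd, huniq', hother⟩ := F.exists_two hvw huniq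
      obtain ⟨e', F'⟩ := F.blowDown hvw' huniq' hd hother
      have hn' : Fintype.card {x // x ≠ v} = n := by
        rw [Fintype.card_subtype_compl, hn]
        simp
      have key := ih F' hn'
      have hf : ∑ k : {k // k ≠ e}, f k = ∑ k, f k := by
        rw [Fintype.sum_eq_add_sum_subtype_ne f e, F.f_e, zero_add]
      have hv : c v ⬝ᵥ c v = 1 := by rw [F.dot_v, F.one]
      have hdec : (fun x : {x // x ≠ v} => -((fun k : {k // k ≠ e} => c x k) ⬝ᵥ
          (fun k : {k // k ≠ e} => c x k))) =
          fun a : {x // x ≠ v} => if G.Adj v a then -(c a ⬝ᵥ c a) + 1 else -(c a ⬝ᵥ c a) := by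
        funext x
        rw [F.dot_blowDown]
        split_ifs <;> ring
      rw [hdec, hf] at key
      have lift : ∀ {Γ₀}, Reaches Γ₀ (PlumbingGraph.blowDown G v)
          (fun a : {x // x ≠ v} => if G.Adj v a then -(c a ⬝ᵥ c a) + 1 else -(c a ⬝ᵥ c a)) ⟨w', hvw'.ne'⟩ →
          Reaches Γ₀ G (fun x => -(c x ⬝ᵥ c x)) v := fun {Γ₀} h =>
        Reaches.of_blowDown hvw' huniq' (fun a b => F.not_adj) (by simp [hv]) (by convert h)
      rcases key with ⟨h1, h2⟩ | ⟨h1, h2⟩ | ⟨h1, h2⟩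
      · exact Or.inl ⟨lift h1, h2⟩
      · exact Or.inr (Or.inl ⟨lift h1, h2⟩)
      · exact Or.inr (Or.inr ⟨lift h1, h2⟩)
    · push Not at huniq
      obtain ⟨a, b, ha, hb, haw, hbw, hab⟩ := huniq
      refine F.inBlowUps_of_star (w := ![w, a, b]) ?_ ?_
      · intro i j hij
        fin_cases i <;> fin_cases j <;> simp_all
      · intro i
        fin_cases i
        · exact hvw
        · exact ha
        · exact hb

end FreeAt

theorem Reaches.mem_blowUpFamily {Γ₀ : PlumbingGraph.{0}} {Γ : PlumbingGraph.{u}} {d : Γ.V → ℤ}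
    {v : Γ.V} (h : Reaches Γ₀ Γ.graph d v) (hd : ∀ x, x ≠ v → Γ.dec x = d x) :
    Γ ∈ blowUpFamily Γ₀ (Γ.dec v) := by
  classical
  obtain ⟨Γ', φ, hφ, hI⟩ := h
  refine ⟨Γ', φ v, hI, φ, fun x => ?_⟩
  change Function.update Γ'.dec (φ v) (Γ.dec v) (φ x) = _
  by_cases hx : x = v
  · rw [hx, Function.update_self]
  · rw [Function.update_of_ne (fun h => hx (φ.injective h)), hφ, hd x hx]

/-- Replacing the row e - f by e does not change products with the other rows, as f is orthogonal to
them. The original decoration of v is -1 minus the size of f, that is -4, -3 or -2. -/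
theorem HasFreeVertex.families {Γ : PlumbingGraph.{u}} {ι : Type w} [Fintype ι] {c : Γ.V → ι → ℤ}
    (hF : HasFreeVertex c) (hC : IsConf Γ.graph c) (hG : Γ.graph.IsTree)
    (h2 : ∀ v, 2 ≤ c v ⬝ᵥ c v) (hcard : Fintype.card ι = Fintype.card Γ.V)
    (hd : ∀ v, Γ.dec v = -(c v ⬝ᵥ c v)) : Γ ∈ familyA ∨ Γ ∈ familyB ∨ Γ ∈ familyC := by
  classical
  obtain ⟨v, e, f, h3, h4, h5, h6, h7, h8⟩ := hF
  let c' : Γ.V → ι → ℤ := Function.update c v (Pi.single e 1)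
  have hv : c' v = Pi.single e 1 := Function.update_self ..
  have hx : ∀ x, x ≠ v → c' x = c x := fun x hx => Function.update_of_ne hx ..
  have hcv : c v = Pi.single e 1 - f := by
    funext k
    by_cases hk : k = e
    · rw [hk, h3]; simp [h5]
    · rw [h4 k hk]; simp [hk]
  have hdot : ∀ x, x ≠ v → c' v ⬝ᵥ c' x = c v ⬝ᵥ c x := by
    intro x hxv
    rw [hv, hx x hxv, hcv, sub_dotProduct, h8 x hxv, sub_zero]
  have hdots : ∀ a b, a ≠ b → c' a ⬝ᵥ c' b = c a ⬝ᵥ c b := by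
    intro a b hab
    by_cases ha : a = v
    · rw [ha]; exact hdot b fun h => hab (ha.trans h.symm)
    · by_cases hb : b = v
      · rw [hb, dotProduct_comm, hdot a ha, dotProduct_comm]
      · rw [hx a ha, hx b hb]
  have F : FreeAt Γ.graph c' v e f := by
    refine ⟨⟨fun x => ?_, fun a b hab => ?_, fun a b hab hn => ?_⟩, hG, hcard, fun x hxv => ?_, ?_,
      fun k hk => ?_, fun x => ?_, h7, h6⟩
    · by_cases hxv : x = v
      · rw [hxv, hv]
        unfold Sph
        rw [sum_eq_add_of_forall e fun j hj => by simp [hj]]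
        simp
      · rw [hx x hxv]; exact hC.sph x
    · rw [hdots a b hab.ne, hC.adj a b hab]
    · rw [hdots a b hab, hC.nadj a b hab hn]
    · rw [hx x hxv]; exact h2 x
    · rw [hv]; simp
    · rw [hv]; simp [hk]
    · by_cases hxv : x = v
      · rw [hxv, hv]; simp [h5]
      · rw [hx x hxv]; exact h8 x hxv
  have hdv : Γ.dec v = -1 - ∑ k, f k := by
    have h9 : f ⬝ᵥ f = ∑ k, f k := Finset.sum_congr rfl fun k _ => by
      rcases h6 k with h | h <;> simp [h]
    rw [hd, hcv]
    simp only [sub_dotProduct, dotProduct_sub, h9]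
    simp [h5]
    ring
  have hdx : ∀ x, x ≠ v → Γ.dec x = -(c' x ⬝ᵥ c' x) := fun x hxv => by rw [hx x hxv, hd]
  rcases F.inBlowUps _ rfl with ⟨h9, h10⟩ | ⟨h9, h10⟩ | ⟨h9, h10⟩
  · have := h9.mem_blowUpFamily hdx
    rw [hdv, h10] at this
    exact Or.inl this
  · have := h9.mem_blowUpFamily hdx
    rw [hdv, h10] at this
    exact Or.inr (Or.inl this)
  · have := h9.mem_blowUpFamily hdx
    rw [hdv, h10] at this
    exact Or.inr (Or.inr this)

end PlumbingGraph

namespace PlumbingGraph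

open Matrix

/-! ### Adding a vertex and a column -/

/-- The vector `x` with a new coordinate `a`. -/
def extend {ι : Type*} (a : ℤ) (x : ι → ℤ) : Option ι → ℤ := fun o => o.elim a x

section Extend
variable {ι : Type*}

@[simp] theorem extend_none (a : ℤ) (x : ι → ℤ) : extend a x none = a := rfl

@[simp] theorem extend_some (a : ℤ) (x : ι → ℤ) (k : ι) : extend a x (some k) = x k := rfl

theorem extend_dot [Fintype ι] (a b : ℤ) (x y : ι → ℤ) :
    extend a x ⬝ᵥ extend b y = a * b + x ⬝ᵥ y := by
  simp [dotProduct, Fintype.sum_option]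

theorem sph_extend [Fintype ι] {a : ℤ} {x : ι → ℤ} (hx : Sph x) (ha : a = 0 ∨ a = -1) :
    Sph (extend a x) := by
  unfold Sph at *
  rw [Fintype.sum_option]
  rcases ha with rfl | rfl <;> simpa using hx

end Extend

theorem isTree_addLeaf {V : Type*} [Finite V] {G : SimpleGraph V} (hG : G.IsTree) {v : V}
    {G' : SimpleGraph (Option V)} (h1 : ∀ b, G'.Adj none (some b) ↔ b = v)
    (h2 : ∀ a b, G'.Adj (some a) (some b) ↔ G.Adj a b) : G'.IsTree := by
  obtain ⟨par, hR, -⟩ := exists_isRooted hG v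
  refine IsRooted.isTree (r := some v) (par := fun o => o.elim (some v) fun x => some (par x))
    (dep := fun o => o.elim (G.dist v v + 1) (G.dist v)) ⟨by simp [hR.par_root], ?_, ?_⟩
  · rintro (_ | x) hx
    · simp
    · exact hR.dep_par x fun e => hx (congrArg some e)
  · rintro (_ | a) (_ | b)
    · simp
    · rw [h1]
      simp [eq_comm]
    · rw [G'.adj_comm, h1]
      simp [eq_comm]
    · rw [h2, hR.adj_iff]
      simp

/-- Root the tree at v and double the depths to make room for the new vertex between v and w. -/
theorem isTree_subdivide {V : Type*} [Finite V] {G : SimpleGraph V} (hG : G.IsTree) {v w : V}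
    (hvw : G.Adj v w) {G' : SimpleGraph (Option V)}
    (h1 : ∀ b, G'.Adj none (some b) ↔ b = v ∨ b = w)
    (h2 : ∀ a b, G'.Adj (some a) (some b) ↔ G.Adj a b ∧ s(a, b) ≠ s(v, w)) : G'.IsTree := by
  classical
  obtain ⟨par, hR, -⟩ := exists_isRooted hG v
  have hpw : par w = v := by
    rcases (hR.adj_iff v w).1 hvw with h | h
    · exact absurd rfl h.1
    · exact h.2
  have hw0 : 0 < G.dist v w := (Nat.zero_le _).trans_lt (hR.dep_par w hvw.ne')
  have hs : ∀ a b, s(a, b) = s(v, w) ↔ (a = v ∧ b = w) ∨ (a = w ∧ b = v) := fun a b => by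
    rw [Sym2.eq_iff]
  refine IsRooted.isTree (r := some v)
    (par := fun o => o.elim (some v) fun x => if x = w then none else some (par x))
    (dep := fun o => o.elim 1 fun x => 2 * G.dist v x) ⟨?_, ?_, ?_⟩
  · simp [hR.par_root, hvw.ne]
  · rintro (_ | x) hx
    · simp
    · have hxv : x ≠ v := fun e => hx (congrArg some e)
      have := hR.dep_par x hxv
      by_cases hxw : x = w
      · subst hxw
        simp
        omega
      · simp [hxw]
        omega
  · rintro (_ | a) (_ | b)
    · simp
    · rw [h1]
      by_cases hb : b = w
      · simp [hb, hvw.ne']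
      · simp [hb, eq_comm (a := v)]
    · rw [G'.adj_comm, h1]
      by_cases ha : a = w
      · simp [ha, hvw.ne']
      · simp [ha, eq_comm (a := v)]
    · rw [h2, hR.adj_iff, ne_eq (s(a, b)), hs]
      have hne := hvw.ne
      simp only [Option.elim_some, ne_eq, Option.some.injEq]
      by_cases ha : a = w <;> by_cases hb : b = w <;> simp only [ha, hb, if_true, if_false] <;> grind

namespace FreeAt

section
variable {V ι : Type*} [Fintype V] [Fintype ι] {G : SimpleGraph V} {c : V → ι → ℤ} {v : V}
  {e : ι} {f : ι → ℤ}

/-- Blowing up: the new vertex is the new basis vector, and `a` marks with -1 the vertices from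
which it is subtracted. Padding f with 0 keeps it orthogonal. -/
theorem extend (F : FreeAt G c v e f) {G' : SimpleGraph (Option V)} (hT : G'.IsTree)
    {a : V → ℤ} (ha : ∀ x, a x = 0 ∨ a x = -1) (hav : a v = -1)
    (h1 : ∀ b, G'.Adj none (some b) ↔ a b = -1)
    (h2 : ∀ x y, G'.Adj (some x) (some y) → a x * a y + c x ⬝ᵥ c y = -1)
    (h3 : ∀ x y, x ≠ y → ¬ G'.Adj (some x) (some y) → a x * a y + c x ⬝ᵥ c y = 0) :
    FreeAt G' (fun o => o.elim (PlumbingGraph.extend 1 0) fun x => PlumbingGraph.extend (a x) (c x))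
      none none (PlumbingGraph.extend 0 f) := by
  have hd : ∀ x, PlumbingGraph.extend 1 0 ⬝ᵥ PlumbingGraph.extend (a x) (c x) = a x := fun x => by
    rw [extend_dot]; simp
  have hd' : ∀ x, PlumbingGraph.extend (a x) (c x) ⬝ᵥ PlumbingGraph.extend 1 0 = a x := fun x => by
    rw [extend_dot]; simp
  refine ⟨⟨?_, ?_, ?_⟩, hT, ?_, ?_, rfl, ?_, ?_, ?_, ?_⟩
  · rintro (_ | x)
    · simp [Sph, Fintype.sum_option]
    · exact sph_extend (F.conf.sph x) (ha x)
  · rintro (_ | x) (_ | y) h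
    · exact absurd h (G'.loopless.irrefl _)
    · simp only [Option.elim_none, Option.elim_some, hd]
      exact (h1 y).1 h
    · simp only [Option.elim_none, Option.elim_some, hd']
      exact (h1 x).1 h.symm
    · simp only [Option.elim_some, extend_dot]
      exact h2 x y h
  · rintro (_ | x) (_ | y) hne h
    · exact absurd rfl hne
    · simp only [Option.elim_none, Option.elim_some, hd]
      exact (ha y).resolve_right fun h4 => h ((h1 y).2 h4)
    · simp only [Option.elim_none, Option.elim_some, hd']
      exact (ha x).resolve_right fun h4 => h ((h1 x).2 h4).symm
    · simp only [Option.elim_some, extend_dot]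
      exact h3 x y (fun e => hne (congrArg some e)) h
  · rw [Fintype.card_option, Fintype.card_option, F.card]
  · rintro (_ | x) hx
    · exact absurd rfl hx
    · simp only [Option.elim_some, extend_dot]
      by_cases hxv : x = v
      · rw [hxv, hav, F.dot_v, F.one]; norm_num
      · have := F.two_le x hxv
        have := mul_self_nonneg (a x)
        omega
  · rintro (_ | k) hk
    · exact absurd rfl hk
    · rfl
  · rintro (_ | x)
    · simp [extend_dot]
    · simp [extend_dot, F.orth]
  · intro h
    exact F.ne (funext fun k => congrFun h (some k))
  · rintro (_ | k)
    · exact Or.inl rfl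
    · exact F.bool k

end

/-- The three rows all hold the last column, whose basis vector is the centre. -/
theorem star {u : Fin 3 → Fin 4 → ℤ} {f : Fin 4 → ℤ} {L : Fin 3 → List ℤ}
    (hL : ∀ i, (L i).length = 1) (hs : ∀ i, Sph (u i)) (hu : ∀ i j, i ≠ j → u i ⬝ᵥ u j = 0)
    (hl : ∀ i, u i 3 = -1) (h2 : ∀ i, 2 ≤ u i ⬝ᵥ u i) (hf : ∀ i, f ⬝ᵥ u i = 0) (hf3 : f 3 = 0)
    (hne : f ≠ 0) (hb : ∀ k, f k = 0 ∨ f k = 1) :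
    FreeAt (starGraph 1 L).graph
      (fun o : Option (Σ i : Fin 3, Fin (L i).length) => o.elim (Pi.single 3 1) fun x => u x.1)
      none 3 f := by
  have h0 : ∀ x : Σ i : Fin 3, Fin (L i).length, x.2.val = 0 := fun x => by
    have := x.2.2
    have := hL x.1
    omega
  have hx : ∀ x y : Σ i : Fin 3, Fin (L i).length, x.1 = y.1 → x = y := by
    rintro ⟨i, s⟩ ⟨j, t⟩ hij
    obtain rfl : i = j := hij
    have h3 := h0 ⟨i, s⟩
    have h4 := h0 ⟨i, t⟩
    exact congrArg (Sigma.mk i) (Fin.ext (h3.trans h4.symm))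
  have hadj : ∀ x y : Σ i : Fin 3, Fin (L i).length,
      ¬ (starGraph 1 L).graph.Adj (some x) (some y) := by
    rintro x y ⟨-, h⟩
    have := h0 x
    have := h0 y
    omega
  have hadj' : ∀ x : Σ i : Fin 3, Fin (L i).length, (starGraph 1 L).graph.Adj none (some x) := h0
  refine ⟨⟨?_, ?_, ?_⟩, ?_, ?_, ?_, ?_, ?_, ?_, hne, hb⟩
  · rintro (_ | x)
    · simp only [Option.elim_none, Sph]
      decide
    · exact hs _
  · rintro (_ | x) (_ | y) h
    · exact absurd h ((starGraph 1 L).graph.loopless.irrefl _)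
    · simp [hl]
    · simp [hl]
    · exact absurd h (hadj x y)
  · rintro (_ | x) (_ | y) h h'
    · exact absurd rfl h
    · exact absurd (hadj' y) h'
    · exact absurd (hadj' x).symm h'
    · exact hu _ _ fun e => h (congrArg some (hx x y e))
  · have : Finite (starGraph 1 L).V := inferInstance
    refine IsRooted.isTree (r := (none : Option (Σ i : Fin 3, Fin (L i).length)))
      (par := fun _ => none) (dep := fun o : Option (Σ i : Fin 3, Fin (L i).length) => o.elim 0 1)
      ⟨rfl, ?_, ?_⟩
    · rintro (_ | x) h
      · exact absurd rfl h
      · exact Nat.zero_lt_one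
    · rintro (_ | x) (_ | y)
      · exact ⟨fun h => absurd h ((starGraph 1 L).graph.loopless.irrefl _), by simp⟩
      · exact ⟨fun _ => Or.inr ⟨Option.some_ne_none _, rfl⟩, fun _ => hadj' y⟩
      · exact ⟨fun _ => Or.inl ⟨Option.some_ne_none _, rfl⟩, fun _ => (hadj' x).symm⟩
      · refine ⟨fun h => absurd h (hadj x y), ?_⟩
        rintro (h | h)
        · exact absurd h.2.symm (Option.some_ne_none _)
        · exact absurd h.2.symm (Option.some_ne_none _)
  · change _ = Fintype.card (Option (Σ i : Fin 3, Fin (L i).length))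
    simp [hL]
  · rintro (_ | x) h
    · exact absurd rfl h
    · exact h2 _
  · simp
  · intro k hk
    simp [hk]
  · rintro (_ | x)
    · simp [hf3]
    · exact hf _

/-- Replacing the exceptional sphere by its difference with the orthogonal vector yields a minimal
symplectic tree. -/
theorem mem_familyS {Γ : PlumbingGraph.{u}} {ι : Type w} [Fintype ι] {c : Γ.V → ι → ℤ} {v : Γ.V}
    {e : ι} {f : ι → ℤ} (F : FreeAt Γ.graph c v e f) (hd : ∀ x, x ≠ v → Γ.dec x = -(c x ⬝ᵥ c x)) :
    Γ.setDec v (-1 - ∑ k, f k) ∈ familyS := by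
  classical
  have hpos := F.sum_f_pos
  have hdec : ∀ x, x ≠ v → (Γ.setDec v (-1 - ∑ k, f k)).dec x = -(c x ⬝ᵥ c x) := fun x hx =>
    (Function.update_of_ne hx _ _).trans (hd x hx)
  have hdecv : (Γ.setDec v (-1 - ∑ k, f k)).dec v = -1 - ∑ k, f k :=
    Function.update_self (f := Γ.dec) v _
  let c' : Γ.V → ι → ℤ := Function.update c v (c v - f)
  have hv : c' v = c v - f := Function.update_self ..
  have hx : ∀ x, x ≠ v → c' x = c x := fun x hx => Function.update_of_ne hx ..
  have hdots : ∀ a b, a ≠ b → c' a ⬝ᵥ c' b = c a ⬝ᵥ c b := by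
    intro a b hab
    by_cases ha : a = v
    · rw [ha, hv, hx b fun h => hab (ha.trans h.symm), sub_dotProduct, F.orth, sub_zero]
    · by_cases hb : b = v
      · rw [hb, hv, hx a ha, dotProduct_sub, dotProduct_comm _ f, F.orth, sub_zero]
      · rw [hx a ha, hx b hb]
  refine ⟨F.tree, ?_, fun x => ?_⟩
  · refine IsConf.isSymplectic (Γ := Γ.setDec v (-1 - ∑ k, f k)) (c := c')
      ⟨fun x => ?_, fun a b hab => ?_, fun a b hab hn => ?_⟩ F.card fun x => ?_
    · by_cases hxv : x = v
      · rw [hxv, hv]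
        refine IsHead.sph (h := e) ⟨Or.inl ?_, fun k hk => ?_⟩
        · simp [F.one, F.f_e]
        · have := F.bool k
          simp only [Pi.sub_apply, F.zero k hk]
          omega
      · rw [hx x hxv]; exact F.conf.sph x
    · rw [hdots a b hab.ne, F.conf.adj a b hab]
    · rw [hdots a b hab, F.conf.nadj a b hab hn]
    · by_cases hxv : x = v
      · rw [hxv, hdecv, hv]
        have h9 : f ⬝ᵥ f = ∑ k, f k := Finset.sum_congr rfl fun k _ => by
          rcases F.bool k with h | h <;> simp [h]
        simp only [sub_dotProduct, dotProduct_sub, h9, F.orth, F.dot_v, F.one, F.f_e]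
        ring
      · rw [hdec x hxv, hx x hxv]
  · by_cases hxv : x = v
    · rw [hxv, hdecv]; omega
    · rw [hdec x hxv]
      have := F.two_le x hxv
      omega

end FreeAt

/-- Both kinds of blow-up are instances of `FreeAt.extend`. At a subdivided edge the two marked ends
gain 1 in their product, which removes the edge. -/
theorem IteratedBlowUp.exists_freeAt {Γ₀ Γ : PlumbingGraph.{0}} {v : Γ.V}
    (h : IteratedBlowUp Γ₀ Γ v) {s : ℤ}
    (h0 : ∀ v₀, Γ₀.dec v₀ = -1 → ∃ (ι : Type) (_ : Fintype ι) (c : Γ₀.V → ι → ℤ) (e : ι)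
      (f : ι → ℤ), FreeAt Γ₀.graph c v₀ e f ∧ ∑ k, f k = s ∧ ∀ x, Γ₀.dec x = -(c x ⬝ᵥ c x)) :
    ∃ (ι : Type) (_ : Fintype ι) (c : Γ.V → ι → ℤ) (e : ι) (f : ι → ℤ),
      FreeAt Γ.graph c v e f ∧ ∑ k, f k = s ∧ ∀ x, Γ.dec x = -(c x ⬝ᵥ c x) := by
  classical
  induction h with
  | start v hv => exact h0 v hv
  | vertex Γ v h ih =>
    obtain ⟨ι, _, c, e, f, F, hs, hd⟩ := ih
    have F' := F.extend (G' := (Γ.blowUpVertex v).graph) (a := fun x => if x = v then -1 else 0)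
      (isTree_addLeaf F.tree (fun b => Iff.rfl) fun a b => Iff.rfl)
      (fun x => by by_cases h : x = v <;> simp [h]) (by simp)
      (fun b => by
        change b = v ↔ _
        by_cases h : b = v <;> simp [h])
      (fun x y hxy => by
        have hxy' : Γ.graph.Adj x y := hxy
        rw [F.conf.adj x y hxy']
        by_cases hx : x = v <;> by_cases hy : y = v <;> simp [hx, hy]
        exact hxy'.ne (hx.trans hy.symm))
      (fun x y hne hxy => by
        have hxy' : ¬ Γ.graph.Adj x y := hxy
        rw [F.conf.nadj x y hne hxy']
        by_cases hx : x = v <;> by_cases hy : y = v <;> simp [hx, hy]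
        exact hne (hx.trans hy.symm))
    refine ⟨_, inferInstance, _, _, _, F', ?_, ?_⟩
    · rw [Fintype.sum_option]
      simpa using hs
    · rintro (_ | x)
      · change (-1 : ℤ) = _
        simp [extend_dot]
      · change (if x = v then Γ.dec x - 1 else Γ.dec x) = _
        simp only [Option.elim_some, extend_dot, hd]
        split_ifs <;> ring
  | edge Γ v w h hvw ih =>
    obtain ⟨ι, _, c, e, f, F, hs, hd⟩ := ih
    have hc : ∀ x y, s(x, y) = s(v, w) → c x ⬝ᵥ c y = -1 := by
      intro x y h
      rcases Sym2.eq_iff.1 h with ⟨rfl, rfl⟩ | ⟨rfl, rfl⟩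
      · exact F.conf.adj _ _ hvw
      · exact F.conf.adj _ _ hvw.symm
    have hn : ∀ x y, x ≠ y → s(x, y) ≠ s(v, w) →
        (if x = v ∨ x = w then (-1 : ℤ) else 0) * (if y = v ∨ y = w then (-1 : ℤ) else 0) = 0 := by
      intro x y hxy hs
      by_contra hcon
      refine hs (Sym2.eq_iff.2 ?_)
      have h1 : x = v ∨ x = w := by
        by_contra h; simp [h] at hcon
      have h2 : y = v ∨ y = w := by
        by_contra h; simp [h] at hcon
      rcases h1 with rfl | rfl <;> rcases h2 with rfl | rfl <;> simp_all
    have F' := F.extend (G' := (Γ.blowUpEdge v w).graph)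
      (a := fun x => if x = v ∨ x = w then -1 else 0)
      (isTree_subdivide F.tree hvw (fun b => Iff.rfl) fun a b => Iff.rfl)
      (fun x => by by_cases h : x = v ∨ x = w <;> simp [h]) (by simp)
      (fun b => by
        change b = v ∨ b = w ↔ _
        by_cases h : b = v ∨ b = w <;> simp [h])
      (fun x y hxy => by
        have hxy' : Γ.graph.Adj x y ∧ s(x, y) ≠ s(v, w) := hxy
        rw [F.conf.adj x y hxy'.1, hn x y hxy'.1.ne hxy'.2, zero_add])
      (fun x y hne hxy => by
        have hxy' : ¬ (Γ.graph.Adj x y ∧ s(x, y) ≠ s(v, w)) := hxy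
        by_cases hs : s(x, y) = s(v, w)
        · rw [hc x y hs]
          rcases Sym2.eq_iff.1 hs with ⟨rfl, rfl⟩ | ⟨rfl, rfl⟩ <;> simp
        · rw [hn x y hne hs, F.conf.nadj x y hne fun h => hxy' ⟨h, hs⟩, zero_add])
    refine ⟨_, inferInstance, _, _, _, F', ?_, ?_⟩
    · rw [Fintype.sum_option]
      simpa using hs
    · rintro (_ | x)
      · change (-1 : ℤ) = _
        simp [extend_dot]
      · change (if x = v ∨ x = w then Γ.dec x - 1 else Γ.dec x) = _
        simp only [Option.elim_some, extend_dot, hd]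
        split_ifs <;> ring

theorem blowUpFamily_subset {u : Fin 3 → Fin 4 → ℤ} {f : Fin 4 → ℤ} {L : Fin 3 → List ℤ}
    (hL : ∀ i, L i = [u i ⬝ᵥ u i]) (hs : ∀ i, Sph (u i)) (hu : ∀ i j, i ≠ j → u i ⬝ᵥ u j = 0)
    (hl : ∀ i, u i 3 = -1) (h2 : ∀ i, 2 ≤ u i ⬝ᵥ u i) (hf : ∀ i, f ⬝ᵥ u i = 0) (hf3 : f 3 = 0)
    (hne : f ≠ 0) (hb : ∀ k, f k = 0 ∨ f k = 1) :
    blowUpFamily.{u} (starGraph 1 L) (-1 - ∑ k, f k) ⊆ familyS := by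
  rintro Γ ⟨Γ', v, hI, hiso⟩
  have hget : ∀ x : Σ i : Fin 3, Fin (L i).length, (L x.1).get x.2 = u x.1 ⬝ᵥ u x.1 := by
    rintro ⟨i, s⟩
    have h3 := List.get_mem (L i) s
    simp only [hL i] at h3
    exact List.mem_singleton.1 h3
  obtain ⟨ι, _, c, e, f', F, hs', hd⟩ := hI.exists_freeAt (s := ∑ k, f k) (by
    intro v₀ hv₀
    have F := FreeAt.star (L := L) (fun i => by rw [hL]; rfl) hs hu hl h2 hf hf3 hne hb
    have hv : v₀ = (none : Option (Σ i : Fin 3, Fin (L i).length)) := by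
      rcases v₀ with _ | x
      · rfl
      · have h3 : -(L x.1).get x.2 = -1 := hv₀
        rw [hget] at h3
        have := h2 x.1
        omega
    subst hv
    refine ⟨_, _, _, _, _, F, rfl, ?_⟩
    rintro (_ | x)
    · change (-1 : ℤ) = _
      simp
    · change -(L x.1).get x.2 = _
      rw [hget]
      rfl)
  refine hiso.mem_familyS ?_
  rw [← hs']
  exact F.mem_familyS fun x _ => hd x

theorem familyA_subset : familyA.{u} ⊆ familyS := by
  have := blowUpFamily_subset.{u} (u := ![![1, -1, 0, -1], ![0, 1, -1, -1], ![-1, 0, 1, -1]])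
    (f := ![1, 1, 1, 0]) (L := ![[3], [3], [3]]) (by decide) (by unfold Sph; decide) (by decide)
    (by decide) (by decide) (by decide) (by decide) (by decide) (by decide)
  exact this

theorem familyB_subset : familyB.{u} ⊆ familyS := by
  have := blowUpFamily_subset.{u} (u := ![![1, -1, -1, -1], ![-1, -1, 1, -1], ![0, 1, 0, -1]])
    (f := ![1, 0, 1, 0]) (L := ![[4], [4], [2]]) (by decide) (by unfold Sph; decide) (by decide)
    (by decide) (by decide) (by decide) (by decide) (by decide) (by decide)
  exact this

theorem familyC_subset : familyC.{u} ⊆ familyS := by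
  have := blowUpFamily_subset.{u} (u := ![![0, 1, 0, -1], ![0, -1, -2, -1], ![0, -1, 1, -1]])
    (f := ![1, 0, 0, 0]) (L := ![[2], [6], [3]]) (by decide) (by unfold Sph; decide) (by decide)
    (by decide) (by decide) (by decide) (by decide) (by decide) (by decide)
  exact this

end PlumbingGraph

namespace PlumbingGraph

open Matrix

/-! ### Realizing chains -/

theorem Isomorphic.symm {Γ : PlumbingGraph.{u}} {Γ' : PlumbingGraph.{w}} (h : Γ.Isomorphic Γ') :
    Γ'.Isomorphic Γ := by
  obtain ⟨e, he⟩ := h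
  exact ⟨e.symm, fun v => by rw [← he]; simp⟩

theorem ChainOf.option {V : Type*} {G : SimpleGraph V} {vs : List V} (hvs : ChainOf G vs)
    {G' : SimpleGraph (Option V)} (h1 : ∀ b, G'.Adj none (some b) ↔ vs.head? = some b)
    (h2 : ∀ a b, G'.Adj (some a) (some b) ↔ G.Adj a b) : ChainOf G' (none :: vs.map some) := by
  have h3 : ∀ i (hi : i < vs.length), vs.head? = some vs[i] ↔ i = 0 := by
    intro i hi
    rw [List.head?_eq_getElem?, List.getElem?_eq_getElem (by omega), Option.some_inj,
      hvs.1.getElem_inj_iff]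
    exact eq_comm
  refine ⟨?_, ?_, ?_⟩
  · rw [List.nodup_cons]
    exact ⟨by simp, hvs.1.map (Option.some_injective V)⟩
  · rintro (_ | v)
    · simp
    · simpa using hvs.2.1 v
  · rintro (_ | i) (_ | j) hi hj
    · simp
    · simp only [List.getElem_cons_zero, List.getElem_cons_succ, List.getElem_map, h1, h3]
      omega
    · rw [G'.adj_comm]
      simp only [List.getElem_cons_zero, List.getElem_cons_succ, List.getElem_map, h1, h3]
      omega
    · simp only [List.getElem_cons_succ, List.getElem_map, h2, hvs.2.2]
      omega

open Classical in
/-- The list `l` is realized by a linear configuration with a column that is `-1` at the first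
and at the last vertex. -/
def ChainReal (l : List ℤ) : Prop :=
  ∃ (V ι : Type) (_ : Fintype V) (_ : Fintype ι) (G : SimpleGraph V) (c : V → ι → ℤ) (e : ι)
    (vs : List V), IsConf G c ∧ G.IsTree ∧ Fintype.card ι = Fintype.card V ∧ ChainOf G vs ∧
      (vs.map fun v => c v ⬝ᵥ c v) = l ∧
      ∀ v, c v e = -(if vs.head? = some v then 1 else 0) - (if vs.getLast? = some v then 1 else 0)

/-- This reverses the peeling in `IsConf.headless_chain`: the new first vertex is the basis vector
of e minus a new one, and the new one is also subtracted from the last vertex. The new column then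
plays the role of e. -/
theorem GList.chainReal {l : List ℤ} (h : GList l) : ChainReal l := by
  classical
  induction h with
  | base =>
    refine ⟨Unit, Unit, inferInstance, inferInstance, ⊥, fun _ _ => -2, (), [()], ⟨?_, ?_, ?_⟩, ?_,
      rfl, ?_, ?_, ?_⟩
    · intro v; simp [Sph]
    · simp
    · intro a b hab; exact absurd rfl hab
    · refine IsRooted.isTree (r := ()) (par := id) (dep := fun _ => 0) ⟨rfl, ?_, ?_⟩ <;> simp
    · refine ⟨by simp, by simp, fun i j hi hj => ?_⟩
      simp at hi hj ⊢
      omega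
    · simp [dotProduct]
    · simp
  | step l a _ ih =>
    obtain ⟨V, ι, _, _, G, c, e, vs, hC, hT, hcard, hvs, hl, hcol⟩ := ih
    obtain ⟨us, y, rfl⟩ : ∃ us y, vs = us ++ [y] := by
      rcases List.eq_nil_or_concat' vs with rfl | ⟨us, y, rfl⟩
      · simp at hl
      · exact ⟨us, y, rfl⟩
    have hlast : ∀ v, (us ++ [y]).getLast? = some v ↔ v = y := by
      intro v
      simp [eq_comm]
    obtain ⟨x, hx⟩ : ∃ x, (us ++ [y]).head? = some x := by
      cases us <;> simp
    have hx' : ∀ v, (us ++ [y]).head? = some v ↔ v = x := by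
      intro v
      rw [hx, Option.some_inj, eq_comm]
    simp only [hlast, hx'] at hcol
    simp only [List.map_append, List.map_cons, List.map_nil] at hl
    obtain ⟨hl1, hl2⟩ := List.append_inj' hl (by simp)
    have hy : y ∉ us := by
      have := hvs.1
      rw [List.nodup_append] at this
      intro h
      exact this.2.2 y h y (by simp) rfl
    let G' : SimpleGraph (Option V) :=
      { Adj := fun a b => match a, b with
          | none, none => False
          | none, some b => b = x
          | some a, none => a = x
          | some a, some b => G.Adj a b
        symm := ⟨by
          rintro (_ | a) (_ | b) h
          · exact h
          · exact h
          · exact h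
          · exact SimpleGraph.Adj.symm h⟩
        loopless := ⟨by
          rintro (_ | a) h
          · exact h
          · exact G.loopless.irrefl a h⟩ }
    have hn : ∀ b, G'.Adj none (some b) ↔ b = x := fun b => Iff.rfl
    have hs : ∀ a b, G'.Adj (some a) (some b) ↔ G.Adj a b := fun a b => Iff.rfl
    let c' : Option V → Option ι → ℤ := fun o => o.elim (extend (-1) (Pi.single e 1))
      fun v => extend (if v = y then -1 else 0) (c v)
    have hdn : ∀ v, c' none ⬝ᵥ c' (some v) = -(if v = x then 1 else 0) := by
      intro v
      simp only [c', Option.elim_none, Option.elim_some, extend_dot, single_dotProduct, hcol]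
      split_ifs <;> simp
    have hds : ∀ a b, a ≠ b → c' (some a) ⬝ᵥ c' (some b) = c a ⬝ᵥ c b := by
      intro a b hab
      simp only [c', Option.elim_some, extend_dot]
      by_cases ha : a = y <;> by_cases hb : b = y <;> simp [ha, hb]
      exact absurd (ha.trans hb.symm) hab
    refine ⟨Option V, Option ι, inferInstance, inferInstance, G', c', none,
      none :: (us ++ [y]).map some, ⟨?_, ?_, ?_⟩, isTree_addLeaf hT hn hs, ?_, ?_, ?_, ?_⟩
    · rintro (_ | v)
      · refine sph_extend ?_ (Or.inr rfl)
        refine IsHead.sph (h := e) ⟨Or.inl (by simp), fun k hk => Or.inl (by simp [hk])⟩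
      · refine sph_extend (hC.sph v) ?_
        by_cases hv : v = y <;> simp [hv]
    · rintro (_ | a) (_ | b) h
      · exact absurd h (G'.loopless.irrefl _)
      · rw [hdn, if_pos ((hn b).1 h)]
      · rw [dotProduct_comm, hdn, if_pos ((hn a).1 h.symm)]
      · rw [hds a b (fun e => G'.loopless.irrefl (some a) (by rw [← e] at h; exact h)),
          hC.adj a b h]
    · rintro (_ | a) (_ | b) hne h
      · exact absurd rfl hne
      · rw [hdn, if_neg fun e => h ((hn b).2 e), neg_zero]
      · rw [dotProduct_comm, hdn, if_neg fun e => h ((hn a).2 e).symm, neg_zero]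
      · have hab : a ≠ b := fun e => hne (congrArg some e)
        rw [hds a b hab, hC.nadj a b hab h]
    · rw [Fintype.card_option, Fintype.card_option, hcard]
    · refine hvs.option (fun b => ?_) hs
      rw [hn, hx']
    · simp only [List.map_cons, List.map_append, List.map_map, List.map_nil]
      congr 1
      · simp [c', extend_dot]
      · congr 1
        · rw [← hl1]
          refine List.map_congr_left fun v hv => ?_
          have hvy : v ≠ y := fun e => hy (e ▸ hv)
          simp [c', extend_dot, hvy]
        · simp only [List.cons.injEq, and_true] at hl2
          simp [c', extend_dot, hl2]
          ring
    · have hgl : (none :: (us ++ [y]).map some).getLast? = some (some y) := by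
        have : none :: (us ++ [y]).map some = (none :: us.map some) ++ [some y] := by simp
        rw [this, List.getLast?_append]
        simp
      rw [hgl]
      rintro (_ | v)
      · simp [c']
      · by_cases hv : v = y
        · simp [c', hv]
        · simp [c', hv, Ne.symm hv]
  | rev l _ ih =>
    obtain ⟨V, ι, _, _, G, c, e, vs, hC, hT, hcard, hvs, hl, hcol⟩ := ih
    refine ⟨V, ι, _, _, G, c, e, vs.reverse, hC, hT, hcard, hvs.reverse, ?_, fun v => ?_⟩
    · rw [List.map_reverse, hl]
    · rw [hcol, List.head?_reverse, List.getLast?_reverse]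
      ring

theorem GList.chain_mem {l : List ℤ} (h : GList l) (h2 : ∀ a ∈ l, 2 ≤ a) :
    chain l ∈ familyS.{0} := by
  obtain ⟨V, ι, _, _, G, c, e, vs, hC, hT, hcard, hvs, hl, -⟩ := h.chainReal
  let Γ : PlumbingGraph.{0} := ⟨V, G, fun v => -(c v ⬝ᵥ c v)⟩
  have hiso := ChainOf.isomorphic (Γ := Γ) hvs (d := fun v => c v ⬝ᵥ c v) fun _ => rfl
  rw [hl] at hiso
  refine hiso.symm.mem_familyS ⟨hT, IsConf.isSymplectic (Γ := Γ) hC hcard fun _ => rfl, fun v => ?_⟩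
  have := h2 (c v ⬝ᵥ c v) (hl ▸ List.mem_map_of_mem (hvs.2.1 v))
  change -(c v ⬝ᵥ c v) ≠ -1
  omega

end PlumbingGraph

namespace PlumbingGraph

open Matrix

/-! ### Continued fractions -/

/-- The product of the matrices `!![a, -1; 1, 0]` for `a` in the list. -/
def cfMat (l : List ℤ) : Matrix (Fin 2) (Fin 2) ℤ := (l.map fun a => !![a, -1; 1, 0]).prod

theorem cfMat_cons (a : ℤ) (l : List ℤ) : cfMat (a :: l) = !![a, -1; 1, 0] * cfMat l := by
  simp [cfMat]

theorem cfMat_append (l l' : List ℤ) : cfMat (l ++ l') = cfMat l * cfMat l' := by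
  simp [cfMat]

theorem cfMat_singleton (a : ℤ) : cfMat [a] = !![a, -1; 1, 0] := by simp [cfMat]

/-- Each factor A satisfies A = D Aᵀ D with D = diag(1, -1), and transposition reverses products. -/
theorem cfMat_reverse (l : List ℤ) :
    cfMat l.reverse = !![1, 0; 0, -1] * (cfMat l)ᵀ * !![1, 0; 0, -1] := by
  induction l with
  | nil => ext i j; fin_cases i <;> fin_cases j <;> simp [cfMat, Matrix.mul_apply]
  | cons a l ih =>
    rw [List.reverse_cons, cfMat_append, ih, cfMat_singleton, cfMat_cons, Matrix.transpose_mul]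
    simp only [Matrix.mul_assoc]
    congr 2
    ext i j
    fin_cases i <;> fin_cases j <;> simp [Matrix.mul_apply, Fin.sum_univ_two]

theorem cfMat_pos {l : List ℤ} (hl : ∀ a ∈ l, 2 ≤ a) :
    0 ≤ cfMat l 1 0 ∧ cfMat l 1 0 < cfMat l 0 0 := by
  induction l with
  | nil => simp [cfMat]
  | cons a l ih =>
    obtain ⟨h1, h2⟩ := ih fun b hb => hl b (List.mem_cons_of_mem _ hb)
    have ha := hl a List.mem_cons_self
    simp only [cfMat_cons, Matrix.mul_apply, Fin.sum_univ_two]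
    simp
    constructor
    · omega
    · nlinarith

theorem contFrac_eq {l : List ℤ} (hl : ∀ a ∈ l, 2 ≤ a) (hne : l ≠ []) :
    contFrac l = (cfMat l 0 0 : ℚ) / cfMat l 1 0 := by
  induction l with
  | nil => exact absurd rfl hne
  | cons a l ih =>
    cases l with
    | nil => simp [contFrac, cfMat]
    | cons b l =>
      have hl' : ∀ x ∈ b :: l, 2 ≤ x := fun x hx => hl x (List.mem_cons_of_mem _ hx)
      obtain ⟨h1, h2⟩ := cfMat_pos hl'
      have h3 : (cfMat (b :: l) 0 0 : ℚ) ≠ 0 := by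
        have : cfMat (b :: l) 0 0 ≠ 0 := by omega
        exact_mod_cast this
      rw [contFrac, ih hl' (by simp), cfMat_cons a]
      simp only [Matrix.mul_apply, Fin.sum_univ_two]
      simp
      field_simp
      ring

theorem one_lt_contFrac {l : List ℤ} (hl : ∀ a ∈ l, 2 ≤ a) (hne : l ≠ []) : 1 < contFrac l := by
  cases l with
  | nil => exact absurd rfl hne
  | cons a l =>
    induction l generalizing a with
    | nil =>
      have := hl a (by simp)
      rw [contFrac]
      exact_mod_cast (by omega : (1 : ℤ) < a)
    | cons b l ih =>
      have h1 := ih b (fun x hx => hl x (List.mem_cons_of_mem _ hx)) (by simp)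
      have h2 : (2 : ℚ) ≤ a := by exact_mod_cast hl a (by simp)
      rw [contFrac]
      have h3 : 1 / contFrac (b :: l) < 1 := by
        rw [div_lt_one (by linarith)]
        exact h1
      linarith

/-- A tail has value greater than 1, so its reciprocal lies strictly between 0 and 1 and the first
entry is determined by the value. -/
theorem eq_of_contFrac_eq {l : List ℤ} : ∀ {l' : List ℤ}, (∀ a ∈ l, 2 ≤ a) → (∀ a ∈ l', 2 ≤ a) →
    l ≠ [] → l' ≠ [] → contFrac l = contFrac l' → l = l' := by
  have key : ∀ (a b : ℤ) (x y : ℚ), 0 ≤ x → x < 1 → 0 ≤ y → y < 1 → (a : ℚ) - x = b - y → a = b := by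
    intro a b x y h1 h2 h3 h4 h5
    have h6 : (a : ℚ) - b < 1 := by linarith
    have h7 : (b : ℚ) - a < 1 := by linarith
    have h8 : a - b < 1 := by exact_mod_cast h6
    have h9 : b - a < 1 := by exact_mod_cast h7
    omega
  have inv : ∀ t : List ℤ, (∀ a ∈ t, 2 ≤ a) → t ≠ [] → 0 < 1 / contFrac t ∧ 1 / contFrac t < 1 := by
    intro t ht hne
    have := one_lt_contFrac ht hne
    refine ⟨by positivity, ?_⟩
    rw [div_lt_one (by linarith)]
    exact this
  induction l with
  | nil => exact fun _ _ h => absurd rfl h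
  | cons a t ih =>
    rintro (_ | ⟨b, t'⟩) hl hl' _ hne' h
    · exact absurd rfl hne'
    have ht : ∀ x ∈ t, 2 ≤ x := fun x hx => hl x (List.mem_cons_of_mem _ hx)
    have ht' : ∀ x ∈ t', 2 ≤ x := fun x hx => hl' x (List.mem_cons_of_mem _ hx)
    rcases t with _ | ⟨x, t⟩ <;> rcases t' with _ | ⟨y, t'⟩
    · simp only [contFrac] at h
      rw [show a = b by exact_mod_cast h]
    · obtain ⟨h1, h2⟩ := inv _ ht' (by simp)
      rw [contFrac, contFrac] at h
      obtain rfl := key a b 0 _ le_rfl one_pos h1.le h2 (by linarith)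
      linarith
    · obtain ⟨h1, h2⟩ := inv _ ht (by simp)
      rw [contFrac, contFrac] at h
      obtain rfl := key a b _ 0 h1.le h2 le_rfl one_pos (by linarith)
      linarith
    · obtain ⟨h1, h2⟩ := inv _ ht (by simp)
      obtain ⟨h3, h4⟩ := inv _ ht' (by simp)
      rw [contFrac, contFrac] at h
      obtain rfl := key a b _ _ h1.le h2 h3.le h4 h
      have h5 : 1 / contFrac (x :: t) = 1 / contFrac (y :: t') := by linarith
      rw [one_div, one_div, _root_.inv_inj] at h5
      rw [ih ht ht' (by simp) (by simp) h5]

/-- The matrix of the expansion of `p² / (pq - 1)`. -/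
def pqMat (p q : ℤ) : Matrix (Fin 2) (Fin 2) ℤ :=
  !![p ^ 2, -(p * (p - q) - 1); p * q - 1, -(q * (p - q) - 1)]

theorem cfMat_rev_eq {l : List ℤ} {p q : ℤ} (h : cfMat l = pqMat p q) :
    cfMat l.reverse = pqMat p (p - q) := by
  rw [cfMat_reverse, h]
  ext i j
  simp only [Matrix.mul_apply, Fin.sum_univ_two, Matrix.transpose_apply]
  fin_cases i <;> fin_cases j <;> (simp [pqMat]; try ring)

/-- Raising the last entry multiplies from the right by an elementary matrix, a leading 2 multiplies
from the left. Thus the step acts by (p, q) ↦ (2p - q, p), and reversal acts by (p, q) ↦ (p, p - q).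
-/
theorem cfMat_step_eq {l : List ℤ} {a p q : ℤ} (h : cfMat (l ++ [a]) = pqMat p q) :
    cfMat (2 :: (l ++ [a + 1])) = pqMat (2 * p - q) p := by
  have h1 : cfMat [a + 1] = cfMat [a] * !![1, 0; -1, 1] := by
    rw [cfMat_singleton, cfMat_singleton]
    ext i j
    fin_cases i <;> fin_cases j <;> simp [Matrix.mul_apply, Fin.sum_univ_two]
  rw [cfMat_cons, cfMat_append, h1, ← Matrix.mul_assoc (cfMat l), ← cfMat_append, h]
  ext i j
  fin_cases i <;> fin_cases j <;> simp [pqMat, Matrix.mul_apply, Fin.sum_univ_two] <;>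
    first | ring1 | (ring_nf; simp)

theorem GList.two_le {l : List ℤ} (h : GList l) : ∀ a ∈ l, 2 ≤ a := by
  induction h with
  | base => simp
  | step l a _ ih =>
    intro b hb
    simp only [List.mem_cons, List.mem_append, List.not_mem_nil, or_false] at hb
    rcases hb with rfl | hb | rfl
    · exact le_rfl
    · exact ih b (by simp [hb])
    · have := ih a (by simp)
      omega
  | rev l _ ih => intro b hb; exact ih b (by simpa using hb)

theorem GList.exists_pqMat {l : List ℤ} (h : GList l) :
    ∃ p q : ℕ, 0 < q ∧ q < p ∧ p.Coprime q ∧ cfMat l = pqMat p q := by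
  induction h with
  | base => exact ⟨2, 1, by norm_num, by norm_num, by norm_num, by
      ext i j; fin_cases i <;> fin_cases j <;> simp [pqMat, cfMat]⟩
  | step l a _ ih =>
    obtain ⟨p, q, h1, h2, h3, h4⟩ := ih
    refine ⟨2 * p - q, p, by omega, by omega, ?_, ?_⟩
    · have h5 : 2 * p - q = p + (p - q) := by omega
      rw [h5, Nat.coprime_self_add_left, Nat.coprime_comm, Nat.coprime_self_sub_right h2.le]
      exact h3
    · rw [cfMat_step_eq h4, Nat.cast_sub (by omega)]
      push_cast
      rfl
  | rev l _ ih =>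
    obtain ⟨p, q, h1, h2, h3, h4⟩ := ih
    refine ⟨p, p - q, by omega, by omega, ?_, ?_⟩
    · rw [Nat.coprime_self_sub_right h2.le]
      exact h3
    · rw [cfMat_rev_eq h4, Nat.cast_sub h2.le]

/-- A subtractive Euclidean algorithm: for p < 2q the pair comes from (q, 2q - p) by a step, for p >
2q reversal leads back to that case, and p = 2q forces (2, 1), that is [4]. -/
theorem exists_gList (n : ℕ) : ∀ p q : ℕ, p ≤ n → 0 < q → q < p → p.Coprime q →
    ∃ l, GList l ∧ cfMat l = pqMat p q := by
  induction n with
  | zero => intro p q h1 h2 h3; omega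
  | succ n ih =>
    have key : ∀ p q : ℕ, p ≤ n + 1 → 0 < q → q < p → p.Coprime q → p < 2 * q →
        ∃ l, GList l ∧ cfMat l = pqMat p q := by
      intro p q h1 h2 h3 h4 h5
      have h6 : q.Coprime (2 * q - p) := by
        have h7 : 2 * q - p = q - (p - q) := by omega
        rw [h7, Nat.coprime_self_sub_right (by omega), Nat.coprime_sub_self_right h3.le]
        exact h4.symm
      obtain ⟨l, h7, h8⟩ := ih q (2 * q - p) (by omega) (by omega) (by omega) h6
      obtain ⟨l', a, rfl⟩ := List.eq_nil_or_concat' l |>.resolve_left h7.ne_nil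
      refine ⟨_, GList.step l' a h7, ?_⟩
      rw [cfMat_step_eq h8, Nat.cast_sub (by omega)]
      push_cast
      congr 1
      ring
    intro p q h1 h2 h3 h4
    rcases lt_trichotomy (2 * q) p with h5 | h5 | h5
    · obtain ⟨l, h6, h7⟩ := key p (p - q) h1 (by omega) (by omega)
        (by rw [Nat.coprime_self_sub_right h3.le]; exact h4) (by omega)
      refine ⟨_, GList.rev l h6, ?_⟩
      rw [cfMat_rev_eq h7, Nat.cast_sub h3.le]
      congr 1
      ring
    · subst h5
      obtain rfl : q = 1 := by
        have := Nat.Coprime.eq_one_of_dvd h4.symm (Dvd.intro_left 2 rfl)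
        exact this
      exact ⟨[4], GList.base, by ext i j; fin_cases i <;> fin_cases j <;> simp [pqMat, cfMat]⟩
    · exact key p q h1 h2 h3 h4 h5

theorem contFrac_of_cfMat {l : List ℤ} (hl : ∀ a ∈ l, 2 ≤ a) (hne : l ≠ []) {p q : ℕ}
    (h : cfMat l = pqMat p q) : contFrac l = (p : ℚ) ^ 2 / ((p : ℚ) * q - 1) := by
  rw [contFrac_eq hl hne, h]
  simp [pqMat]

/-- Expansions with entries at least 2 are unique, so a list with the right value must be the one
constructed. -/
theorem gList_iff {l : List ℤ} :
    GList l ↔ ∃ p q : ℕ, 0 < q ∧ q < p ∧ p.Coprime q ∧ (∀ a ∈ l, 2 ≤ a) ∧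
      contFrac l = (p : ℚ) ^ 2 / ((p : ℚ) * q - 1) := by
  constructor
  · intro h
    obtain ⟨p, q, h1, h2, h3, h4⟩ := h.exists_pqMat
    exact ⟨p, q, h1, h2, h3, h.two_le, contFrac_of_cfMat h.two_le h.ne_nil h4⟩
  · rintro ⟨p, q, h1, h2, h3, h4, h5⟩
    obtain ⟨l', h6, h7⟩ := exists_gList p p q le_rfl h1 h2 h3
    have h8 := contFrac_of_cfMat h6.two_le h6.ne_nil h7
    have hne : l ≠ [] := by
      rintro rfl
      rw [← h5, contFrac] at h8
      have := one_lt_contFrac h6.two_le h6.ne_nil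
      linarith
    rw [eq_of_contFrac_eq h4 h6.two_le hne h6.ne_nil (h5.trans h8.symm)]
    exact h6

theorem mem_familyG_iff {Γ : PlumbingGraph.{u}} :
    Γ ∈ familyG ↔ ∃ l, GList l ∧ Γ.Isomorphic (chain l) := by
  constructor
  · rintro ⟨p, q, h1, h2, h3, l, h4, h5, h6⟩
    exact ⟨l, gList_iff.2 ⟨p, q, h1, h2, h3, h4, h5⟩, h6⟩
  · rintro ⟨l, h1, h2⟩
    obtain ⟨p, q, h3, h4, h5, h6, h7⟩ := gList_iff.1 h1
    exact ⟨p, q, h3, h4, h5, l, h6, h7, h2⟩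

theorem familyG_subset : familyG.{u} ⊆ familyS := by
  intro Γ hΓ
  obtain ⟨l, h1, h2⟩ := mem_familyG_iff.1 hΓ
  exact h2.mem_familyS (h1.chain_mem h1.two_le)

end PlumbingGraph

namespace PlumbingGraph

open Matrix

/-! ### Subdividing an edge -/

section Subdiv
variable {V ι : Type*} [DecidableEq V] [DecidableEq ι] {c : V → ι → ℤ} {y z w : V} {k : ι}

/-- The new vertex is the new column minus `k`; at `y` the column `k` is replaced by the new one, and
at `w` the new column is subtracted. -/
def subdiv (c : V → ι → ℤ) (y w : V) (k : ι) : Option V → Option ι → ℤ := fun o =>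
  o.elim (extend 1 (-Pi.single k 1)) fun v =>
    extend (-(if v = y then 1 else 0) - (if v = w then 1 else 0))
      (c v + if v = y then Pi.single k 1 else 0)

variable [Fintype ι]

theorem subdiv_dot_none (hk : ∀ v, c v k = (if v = z then 1 else 0) - (if v = y then 1 else 0) -
    (if v = w then 1 else 0)) (v : V) :
    subdiv c y w k none ⬝ᵥ subdiv c y w k (some v) =
      -(if v = y then 1 else 0) - (if v = z then 1 else 0) := by
  simp only [subdiv, Option.elim_none, Option.elim_some, extend_dot, neg_dotProduct,
    single_dotProduct, Pi.add_apply, hk]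
  by_cases h : v = y <;> simp [h] <;> ring

theorem subdiv_none_self : subdiv c y w k none ⬝ᵥ subdiv c y w k none = 2 := by
  simp [subdiv, extend_dot]

/-- At y the old entry -1 in column k moves to the new column. This removes its product -1 with z,
while the product with w survives because w receives -1 in the new column too. -/
theorem subdiv_dot_some (hyz : y ≠ z) (hyw : y ≠ w) (hk : ∀ v, c v k = (if v = z then 1 else 0) -
    (if v = y then 1 else 0) - (if v = w then 1 else 0)) {u v : V} (huv : u ≠ v) :
    subdiv c y w k (some u) ⬝ᵥ subdiv c y w k (some v) =
      c u ⬝ᵥ c v + if (u = y ∧ v = z) ∨ (u = z ∧ v = y) then 1 else 0 := by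
  simp only [subdiv, Option.elim_some, extend_dot, add_dotProduct, dotProduct_add]
  by_cases hu : u = y
  · subst hu
    have hv : v ≠ u := huv.symm
    by_cases hvz : v = z
    · subst hvz
      rcases eq_or_ne v w with rfl | hvw <;> (simp_all; try ring)
    · rcases eq_or_ne v w with rfl | hvw <;> simp_all
  · by_cases hv : v = y
    · subst hv
      by_cases huz : u = z
      · subst huz
        rcases eq_or_ne u w with rfl | huw <;> (simp_all; try ring)
      · rcases eq_or_ne u w with rfl | huw <;> simp_all
    · by_cases huw : u = w
      · have hvw : v ≠ w := fun h => huv (huw.trans h.symm)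
        simp [hu, hv, hvw]
      · simp [hu, hv, huw]

theorem subdiv_some_self (hyz : y ≠ z) (hyw : y ≠ w) (hk : ∀ v, c v k = (if v = z then 1 else 0) -
    (if v = y then 1 else 0) - (if v = w then 1 else 0)) (v : V) :
    subdiv c y w k (some v) ⬝ᵥ subdiv c y w k (some v) = c v ⬝ᵥ c v + if v = w then 1 else 0 := by
  simp only [subdiv, Option.elim_some, extend_dot, add_dotProduct, dotProduct_add]
  by_cases hv : v = y
  · subst hv
    simp [hyw, hk, hyz]
  · by_cases hvw : v = w <;> simp [hv, hvw]
    · subst hvw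
      simp [hyw.symm]
      ring

theorem sph_subdiv (hyw : y ≠ w) (hs : ∀ v, Sph (c v)) (hy : c y k = -1) (o : Option V) :
    Sph (subdiv c y w k o) := by
  rcases o with _ | v
  · refine IsHead.sph (h := none) ⟨Or.inl rfl, ?_⟩
    rintro (_ | j) hj
    · exact absurd rfl hj
    · by_cases h : j = k
      · exact Or.inr (by simp [subdiv, h])
      · exact Or.inl (by simp [subdiv, h])
  · refine sph_extend ?_ ?_
    · by_cases hv : v = y
      · obtain ⟨j, hj⟩ := (hs v).exists_head
        have hjk : j ≠ k := by
          rintro rfl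
          have := hj.1
          rw [hv] at this
          omega
        refine IsHead.sph (h := j) ⟨by simpa [hv, hjk] using hj.1, fun i hi => ?_⟩
        by_cases hik : i = k
        · left
          simp [hv, hik, hy]
        · simpa [hv, hik] using hj.2 i hi
      · simpa [hv] using hs v
    · by_cases hv : v = y
      · right; simp [hv, hyw]
      · rcases eq_or_ne v w with rfl | hw
        · right; simp [hv]
        · left; simp [hv, hw]

end Subdiv

/-! ### Realizing stars -/

/-- `P i a` is the vertex at distance `a` from the centre on the `i`-th leg, of length `n i`. -/
structure StarPos {V : Type*} (P : Fin 3 → ℕ → V) (n : Fin 3 → ℕ) : Prop where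
  root : ∀ i j, P i 0 = P j 0
  inj : ∀ i j a b, a ≤ n i → b ≤ n j → P i a = P j b → a = b ∧ (i = j ∨ a = 0)
  surj : ∀ v, ∃ i a, a ≤ n i ∧ P i a = v

/-- The positions `a` on the `i`-th leg and `b` on the `j`-th leg are adjacent. -/
def PosAdj (i j : Fin 3) (a b : ℕ) : Prop := (i = j ∨ a = 0 ∨ b = 0) ∧ (a + 1 = b ∨ b + 1 = a)

instance (i j : Fin 3) (a b : ℕ) : Decidable (PosAdj i j a b) := by
  unfold PosAdj; infer_instance

open Classical in
/-- The star with centre `-cc` and legs `L` is realized by a configuration such that for every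
`(i, m, j)` in `S` some column is `1` at position `m + 1` of the `i`-th leg, `-1` at position `m` of
the `i`-th leg and at the end of the `j`-th leg, and `0` elsewhere. -/
def StarReal (cc : ℤ) (L : Fin 3 → List ℤ) (S : List (Fin 3 × ℕ × Fin 3)) : Prop :=
  ∃ (V ι : Type) (_ : Fintype V) (_ : Fintype ι) (c : V → ι → ℤ) (P : Fin 3 → ℕ → V),
    Fintype.card ι = Fintype.card V ∧ (∀ v, Sph (c v)) ∧ StarPos P (fun i => (L i).length) ∧
    (∀ i j a b, a ≤ (L i).length → b ≤ (L j).length → P i a ≠ P j b →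
      c (P i a) ⬝ᵥ c (P j b) = if PosAdj i j a b then -1 else 0) ∧
    c (P 0 0) ⬝ᵥ c (P 0 0) = cc ∧
    (∀ i a (h : a < (L i).length), (L i)[a] = c (P i (a + 1)) ⬝ᵥ c (P i (a + 1))) ∧
    ∀ s ∈ S, ∃ k, ∀ v, c v k = (if v = P s.1 (s.2.1 + 1) then 1 else 0) -
      (if v = P s.1 s.2.1 then 1 else 0) - (if v = P s.2.2 (L s.2.2).length then 1 else 0)

theorem StarReal.mono {cc : ℤ} {L : Fin 3 → List ℤ} {S S' : List (Fin 3 × ℕ × Fin 3)}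
    (h : StarReal cc L S) (hS : S' ⊆ S) : StarReal cc L S' := by
  obtain ⟨V, ι, _, _, c, P, h1, h2, h3, h4, h5, h6, h7⟩ := h
  exact ⟨V, ι, _, _, c, P, h1, h2, h3, h4, h5, h6, fun s hs => h7 s (hS hs)⟩

theorem StarReal.isomorphic {cc : ℤ} {L : Fin 3 → List ℤ} {S : List (Fin 3 × ℕ × Fin 3)}
    (h : StarReal cc L S) (hc : cc ≠ 1) (hL : ∀ i, ∀ a ∈ L i, a ≠ 1) :
    starGraph cc L ∈ familyS.{0} := by
  classical
  obtain ⟨V, ι, _, _, c, P, h1, h2, h3, h4, h5, h6, -⟩ := h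
  have hadj : ∀ i j a b, a ≤ (L i).length → b ≤ (L j).length → (P i a ≠ P j b ∧
      c (P i a) ⬝ᵥ c (P j b) = -1 ↔ PosAdj i j a b) := by
    intro i j a b ha hb
    constructor
    · rintro ⟨h8, h9⟩
      rw [h4 i j a b ha hb h8] at h9
      by_contra hn
      simp [hn] at h9
    · intro h8
      have h9 : P i a ≠ P j b := fun e => by
        have := (h3.inj i j a b ha hb e).1
        have := h8.2
        omega
      exact ⟨h9, by rw [h4 i j a b ha hb h9, if_pos h8]⟩
  let G : SimpleGraph V :=
    { Adj := fun a b => a ≠ b ∧ c a ⬝ᵥ c b = -1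
      symm := ⟨fun a b h => ⟨h.1.symm, by rw [dotProduct_comm]; exact h.2⟩⟩
      loopless := ⟨fun _ h => h.1 rfl⟩ }
  have hG : ∀ a b, G.Adj a b ↔ a ≠ b ∧ c a ⬝ᵥ c b = -1 := fun _ _ => Iff.rfl
  have hC : IsConf G c := by
    refine ⟨h2, fun a b h => h.2, fun a b hab hn => ?_⟩
    obtain ⟨i, s, hs, rfl⟩ := h3.surj a
    obtain ⟨j, t, ht, rfl⟩ := h3.surj b
    rw [h4 i j s t hs ht hab]
    rw [hG, hadj i j s t hs ht] at hn
    rw [if_neg hn]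
  have hT : G.IsTree := by
    -- Only the centre lies on several legs; the leg chosen for it does not matter, since all legs
    -- agree at position 0.
    choose li ht hle hP using h3.surj
    have hr : ∀ v, v = P 0 0 ↔ ht v = 0 := by
      intro v
      constructor
      · intro h
        rw [← hP v] at h
        exact (h3.inj _ _ _ _ (hle v) (Nat.zero_le _) h).1
      · intro h
        rw [← hP v, h, h3.root (li v) 0]
    refine IsRooted.isTree (r := P 0 0) (par := fun v => P (li v) (ht v - 1)) (dep := ht)
      ⟨?_, ?_, ?_⟩
    · rw [(hr _).1 rfl, h3.root _ 0]
    · intro x hx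
      have h8 : ht x ≠ 0 := fun h => hx ((hr x).2 h)
      have h9 := hle x
      have h10 := (h3.inj _ _ _ _ (hle _) (by omega) (hP (P (li x) (ht x - 1)))).1
      omega
    · intro a b
      have hpar : ∀ a b, ht a ≠ 0 → (P (li a) (ht a - 1) = b ↔
          ht b + 1 = ht a ∧ (li a = li b ∨ ht b = 0)) := by
        intro a b h8
        have h9 := hle a
        constructor
        · intro h
          rw [← hP b] at h
          have := h3.inj _ _ _ _ (by omega) (hle b) h
          refine ⟨by omega, this.2.imp id fun h => by omega⟩
        · rintro ⟨h10, h11⟩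
          rw [← hP b, show ht b = ht a - 1 by omega]
          rcases h11 with h11 | h11
          · rw [h11]
          · rw [show ht a - 1 = 0 by omega]
            exact h3.root _ _
      have := hadj (li a) (li b) (ht a) (ht b) (hle a) (hle b)
      rw [hP, hP] at this
      rw [hG, this, PosAdj, Ne, Ne, hr, hr]
      by_cases ha : ht a = 0
      · by_cases hb : ht b = 0
        · simp [ha, hb]
        · rw [hpar b a hb]
          simp [ha, hb]
      · by_cases hb : ht b = 0
        · rw [hpar a b ha]
          simp [ha, hb]
        · rw [hpar a b ha, hpar b a hb]
          simp only [ha, hb, not_false_eq_true, true_and, or_false]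
          constructor
          · rintro ⟨h8, h9 | h9⟩
            · exact Or.inr ⟨h9, h8.symm⟩
            · exact Or.inl ⟨h9, h8⟩
          · rintro (⟨h8, h9⟩ | ⟨h8, h9⟩)
            · exact ⟨h9, Or.inr h8⟩
            · exact ⟨h9.symm, Or.inl h8⟩
  let Γ : PlumbingGraph.{0} := ⟨V, G, fun v => -(c v ⬝ᵥ c v)⟩
  let F : Option (Σ i : Fin 3, Fin (L i).length) → V := fun o =>
    o.elim (P 0 0) fun x => P x.1 (x.2.val + 1)
  have hF : Function.Bijective F := by
    constructor
    · rintro (_ | ⟨i, s⟩) (_ | ⟨j, t⟩) h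
      · rfl
      · have := (h3.inj 0 j 0 (t.val + 1) (Nat.zero_le _) t.2 h).1
        omega
      · have := (h3.inj i 0 (s.val + 1) 0 s.2 (Nat.zero_le _) h).1
        omega
      · obtain ⟨h8, h9⟩ := h3.inj i j (s.val + 1) (t.val + 1) s.2 t.2 h
        obtain rfl := h9.resolve_right (by omega)
        rw [Fin.ext (show s.val = t.val by omega)]
    · intro v
      obtain ⟨i, a, ha, rfl⟩ := h3.surj v
      cases a with
      | zero => exact ⟨none, h3.root 0 i⟩
      | succ a => exact ⟨some ⟨i, a, ha⟩, rfl⟩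
  have hdec : ∀ o, -(c (F o) ⬝ᵥ c (F o)) = (starGraph cc L).dec o := by
    rintro (_ | ⟨i, s⟩)
    · exact congrArg Neg.neg h5
    · exact congrArg Neg.neg (h6 i s.val s.2).symm
  have hiso : (starGraph cc L).Isomorphic Γ := by
    refine ⟨⟨Equiv.ofBijective F hF, ?_⟩, fun o => hdec o⟩
    intro a b
    change G.Adj (F a) (F b) ↔ starAdj L a b
    rw [hG]
    rcases a with _ | ⟨i, s⟩ <;> rcases b with _ | ⟨j, t⟩
    · simp [starAdj]
    · exact (hadj 0 j 0 (t.val + 1) (Nat.zero_le _) t.2).trans (by simp [PosAdj, starAdj, eq_comm])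
    · exact (hadj i 0 (s.val + 1) 0 s.2 (Nat.zero_le _)).trans (by simp [PosAdj, starAdj, eq_comm])
    · exact (hadj i j (s.val + 1) (t.val + 1) s.2 t.2).trans (by simp [PosAdj, starAdj])
  refine hiso.mem_familyS ⟨hT, IsConf.isSymplectic (Γ := Γ) hC h1 fun _ => rfl, fun v => ?_⟩
  obtain ⟨o, rfl⟩ := hF.2 v
  change -(c (F o) ⬝ᵥ c (F o)) ≠ -1
  rw [hdec]
  rcases o with _ | ⟨i, s⟩
  · exact fun h => hc (neg_inj.1 h)
  · exact fun h => hL i _ (List.get_mem _ _) (neg_inj.1 h)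

end PlumbingGraph

/-! ### Inserting a 2 into a leg and raising an end -/

namespace PlumbingGraph

open Matrix

/-- Insert a `2` at position `m`. -/
def insTwo (m : ℕ) (l : List ℤ) : List ℤ := l.take m ++ 2 :: l.drop m

/-- Raise the last entry by `1`. -/
def bump (l : List ℤ) : List ℤ := l.modify (l.length - 1) (· + 1)

theorem length_insTwo (m : ℕ) (l : List ℤ) : (insTwo m l).length = l.length + 1 := by
  simp [insTwo]
  omega

theorem length_bump (l : List ℤ) : (bump l).length = l.length := by simp [bump]

theorem getElem?_insTwo {m a : ℕ} {l : List ℤ} (hm : m ≤ l.length) :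
    (insTwo m l)[a]? = if a < m then l[a]? else if a = m then some 2 else l[a - 1]? := by
  unfold insTwo
  rw [List.getElem?_append, List.length_take, min_eq_left hm]
  split_ifs with h1 h2
  · rw [List.getElem?_take_of_lt h1]
  · simp [h2]
  · obtain ⟨b, rfl⟩ : ∃ b, a = m + 1 + b := ⟨a - m - 1, by omega⟩
    rw [show m + 1 + b - m = b + 1 by omega, List.getElem?_cons_succ, List.getElem?_drop]
    congr 1
    omega

theorem getElem?_bump {a : ℕ} {l : List ℤ} :
    (bump l)[a]? = if l.length - 1 = a then l[a]?.map (· + 1) else l[a]? := by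
  unfold bump
  rw [List.getElem?_modify]
  split_ifs <;> simp

theorem posAdj_subdivide {i a a' : Fin 3} {m b b' s s' : ℕ}
    (h : (a = i ∧ m < b ∧ s = b + 1) ∨ ((a ≠ i ∨ b ≤ m) ∧ s = b))
    (h' : (a' = i ∧ m < b' ∧ s' = b' + 1) ∨ ((a' ≠ i ∨ b' ≤ m) ∧ s' = b')) :
    ((if PosAdj a a' b b' then -1 else 0) +
      if ((b = m ∧ (a = i ∨ b = 0)) ∧ (b' = m + 1 ∧ a' = i)) ∨
        ((b = m + 1 ∧ a = i) ∧ (b' = m ∧ (a' = i ∨ b' = 0))) then 1 else 0 : ℤ) =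
      if PosAdj a a' s s' then -1 else 0 := by
  unfold PosAdj
  by_cases e1 : a = i
  · subst e1
    by_cases e2 : a' = a
    · subst e2
      simp only [true_and, true_or, not_true_eq_false, false_or, and_true, ne_eq] at h h' ⊢
      rcases h with ⟨h1, rfl⟩ | ⟨h1, rfl⟩ <;> rcases h' with ⟨h2, rfl⟩ | ⟨h2, rfl⟩ <;>
        split_ifs <;> omega
    · have e3 : ¬ a = a' := fun h => e2 h.symm
      simp only [e2, e3, true_and, true_or, not_true_eq_false, false_or, and_true, ne_eq,
        not_false_eq_true, false_and, and_false, or_false] at h h' ⊢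
      subst h'
      clear e2 e3
      rcases h with ⟨h1, rfl⟩ | ⟨h1, rfl⟩ <;> split_ifs <;>
        first | omega | (simp only [false_or, or_false, Nat.add_eq_zero_iff, one_ne_zero, and_false] at *; omega)
  · by_cases e2 : a' = i
    · subst e2
      simp only [e1, true_and, true_or, not_true_eq_false, false_or, and_true, ne_eq,
        not_false_eq_true, false_and, and_false, or_false] at h h' ⊢
      subst h
      clear e1
      rcases h' with ⟨h1, rfl⟩ | ⟨h1, rfl⟩ <;> split_ifs <;>
        first | omega | (simp only [false_or, or_false, Nat.add_eq_zero_iff, one_ne_zero, and_false] at *; omega)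
    · simp only [e1, e2, true_and, true_or, not_true_eq_false, false_or, and_true, ne_eq,
        not_false_eq_true, false_and, and_false, or_false] at h h' ⊢
      subst h h'
      simp

/-- Apply `subdiv` to the edge between positions m and m + 1 of leg i, with w the end of leg j. The
new column has the same shape with the new vertex in place of z, so the move can be repeated. The
other triples of S survive because they sit on other legs or below position m, where nothing is
shifted. -/
theorem StarReal.subdivide {cc : ℤ} {L L' : Fin 3 → List ℤ} {S : List (Fin 3 × ℕ × Fin 3)}
    {i j : Fin 3} {m : ℕ} (h : StarReal cc L ((i, m, j) :: S)) (hm : m < (L i).length)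
    (hij : i = j → m + 1 < (L i).length) (hj : 0 < (L j).length)
    (hS : ∀ s ∈ S, (s.1 ≠ i ∨ s.2.1 < m) ∧ s.2.1 < (L s.1).length)
    (hL' : ∀ a, L' a = (if a = j then bump else id) ((if a = i then insTwo m else id) (L a))) :
    StarReal cc L' ((i, m, j) :: S) := by
  classical
  obtain ⟨V, ι, _, _, c, P, h1, h2, h3, h4, h5, h6, h7⟩ := h
  obtain ⟨k, hk⟩ := h7 (i, m, j) List.mem_cons_self
  simp only at hk
  have hlen : ∀ a, (L' a).length = (L a).length + if a = i then 1 else 0 := by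
    intro a
    rw [hL']
    by_cases hai : a = i <;> by_cases haj : a = j <;>
      simp [hai, haj, length_bump, length_insTwo] <;> split_ifs <;> simp [length_bump, length_insTwo]
  have hroot : ∀ a b, P a 0 = P b 0 := h3.root
  have heq : ∀ i₁ i₂ a b, a ≤ (L i₁).length → b ≤ (L i₂).length →
      (P i₁ a = P i₂ b ↔ a = b ∧ (i₁ = i₂ ∨ a = 0)) := by
    intro i₁ i₂ a b ha hb
    refine ⟨h3.inj i₁ i₂ a b ha hb, ?_⟩
    rintro ⟨rfl, rfl | rfl⟩
    · rfl
    · exact hroot _ _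
  have hyz : P i m ≠ P i (m + 1) := by
    rw [Ne, heq i i m (m + 1) (by omega) (by omega)]
    omega
  have hyw : P i m ≠ P j (L j).length := by
    rw [Ne, heq i j m _ (by omega) le_rfl]
    rintro ⟨h8, rfl | h8⟩
    · omega
    · omega
  have hzw : P i (m + 1) ≠ P j (L j).length := by
    rw [Ne, heq i j (m + 1) _ (by omega) le_rfl]
    rintro ⟨h8, rfl | h8⟩
    · have := hij rfl
      omega
    · omega
  -- The new vertex takes position m + 1 of leg i, and the later vertices of that leg move outwards
  -- by one.
  let P' : Fin 3 → ℕ → Option V := fun a s =>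
    if a = i ∧ m < s then (if s = m + 1 then none else some (P i (s - 1))) else some (P a s)
  have hP1 : P' i (m + 1) = none := by simp [P']
  have hP2 : ∀ s, m < s → P' i (s + 1) = some (P i s) := by
    intro s hs
    have : s ≠ m := by omega
    simp [P', this]
    omega
  have hP3 : ∀ a s, a ≠ i ∨ s ≤ m → P' a s = some (P a s) := by
    intro a s hs
    have : ¬ (a = i ∧ m < s) := by
      rintro ⟨h8, h9⟩
      rcases hs with hs | hs
      · exact hs h8
      · omega
    simp [P', this]
  have hcases : ∀ a s, s ≤ (L' a).length → (a = i ∧ s = m + 1) ∨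
      (a = i ∧ ∃ b, m < b ∧ b ≤ (L a).length ∧ s = b + 1) ∨
      ((a ≠ i ∨ s ≤ m) ∧ s ≤ (L a).length) := by
    intro a s hs
    rw [hlen] at hs
    by_cases ha : a = i
    · subst ha
      rw [if_pos rfl] at hs
      rcases lt_trichotomy s (m + 1) with h8 | h8 | h8
      · exact Or.inr (Or.inr ⟨Or.inr (by omega), by omega⟩)
      · exact Or.inl ⟨rfl, h8⟩
      · exact Or.inr (Or.inl ⟨rfl, s - 1, by omega, by omega, by omega⟩)
    · rw [if_neg ha] at hs
      exact Or.inr (Or.inr ⟨Or.inl ha, hs⟩)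
  have hold : ∀ a s, s ≤ (L' a).length → (a = i ∧ s = m + 1 ∧ P' a s = none) ∨
      ∃ b, b ≤ (L a).length ∧ P' a s = some (P a b) ∧
        ((a = i ∧ m < b ∧ s = b + 1) ∨ ((a ≠ i ∨ b ≤ m) ∧ s = b)) := by
    intro a s hs
    rcases hcases a s hs with ⟨rfl, rfl⟩ | ⟨rfl, b, hb, hb', rfl⟩ | ⟨h8, h9⟩
    · exact Or.inl ⟨rfl, rfl, hP1⟩
    · exact Or.inr ⟨b, hb', hP2 b hb, Or.inl ⟨rfl, hb, rfl⟩⟩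
    · exact Or.inr ⟨s, h9, hP3 a s h8, Or.inr ⟨h8, rfl⟩⟩
  have hend : ∀ a, P' a (L' a).length = some (P a (L a).length) := by
    intro a
    rw [hlen]
    by_cases ha : a = i
    · subst ha
      rw [if_pos rfl, hP2 _ hm]
    · rw [if_neg ha, add_zero, hP3 a _ (Or.inl ha)]
  have hy : ∀ a b, b ≤ (L a).length → (P a b = P i m ↔ b = m ∧ (a = i ∨ b = 0)) :=
    fun a b hb => heq a i b m hb (by omega)
  have hz : ∀ a b, b ≤ (L a).length → (P a b = P i (m + 1) ↔ b = m + 1 ∧ a = i) := by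
    intro a b hb
    rw [heq a i b (m + 1) hb (by omega)]
    constructor
    · rintro ⟨h8, h9 | h9⟩
      · exact ⟨h8, h9⟩
      · omega
    · exact fun h => ⟨h.1, Or.inl h.2⟩
  have hw : ∀ a b, b ≤ (L a).length → (P a b = P j (L j).length ↔ b = (L j).length ∧ a = j) := by
    intro a b hb
    rw [heq a j b _ hb le_rfl]
    constructor
    · rintro ⟨h8, h9 | h9⟩
      · exact ⟨h8, h9⟩
      · omega
    · exact fun h => ⟨h.1, Or.inl h.2⟩
  have hcy : c (P i m) k = -1 := by
    rw [hk]
    simp [hyz, hyw]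
  have hdn : ∀ a b s, b ≤ (L a).length →
      ((a = i ∧ m < b ∧ s = b + 1) ∨ ((a ≠ i ∨ b ≤ m) ∧ s = b)) →
      subdiv c (P i m) (P j (L j).length) k none ⬝ᵥ
        subdiv c (P i m) (P j (L j).length) k (some (P a b)) =
        if PosAdj i a (m + 1) s then -1 else 0 := by
    intro a b s hb hs
    rw [subdiv_dot_none hk]
    simp only [hy a b hb, hz a b hb, PosAdj]
    grind
  refine ⟨Option V, Option ι, inferInstance, inferInstance,
    subdiv c (P i m) (P j (L j).length) k, P', ?_, ?_, ⟨?_, ?_, ?_⟩, ?_, ?_, ?_, ?_⟩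
  · rw [Fintype.card_option, Fintype.card_option, h1]
  · exact sph_subdiv hyw h2 hcy
  · intro a b
    rw [hP3 a 0 (Or.inr (Nat.zero_le _)), hP3 b 0 (Or.inr (Nat.zero_le _)), hroot a b]
  · intro a a' s s' hs hs' heq'
    rcases hold a s hs with ⟨e1, e2, h8⟩ | ⟨b, hb, h8, h9⟩ <;>
      rcases hold a' s' hs' with ⟨e3, e4, h10⟩ | ⟨b', hb', h10, h11⟩ <;> rw [h8, h10] at heq'
    · exact ⟨e2.trans e4.symm, Or.inl (e1.trans e3.symm)⟩
    · simp at heq'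
    · simp at heq'
    · obtain ⟨rfl, h12⟩ := (heq a a' b b' hb hb').1 (Option.some_injective _ heq')
      grind
  · rintro (_ | v)
    · exact ⟨i, m + 1, by rw [hlen, if_pos rfl]; omega, hP1⟩
    · obtain ⟨a, b, hb, rfl⟩ := h3.surj v
      by_cases hab : a = i ∧ m < b
      · obtain ⟨rfl, hb'⟩ := hab
        exact ⟨a, b + 1, by rw [hlen, if_pos rfl]; omega, hP2 b hb'⟩
      · refine ⟨a, b, by rw [hlen]; omega, hP3 a b ?_⟩
        by_cases ha : a = i
        · exact Or.inr (by by_contra h8; exact hab ⟨ha, by omega⟩)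
        · exact Or.inl ha
  · intro a a' s s' hs hs' hne
    rcases hold a s hs with ⟨e1, e2, h8⟩ | ⟨b, hb, h8, h9⟩ <;>
      rcases hold a' s' hs' with ⟨e3, e4, h10⟩ | ⟨b', hb', h10, h11⟩ <;> rw [h8, h10] at hne ⊢
    · exact absurd rfl hne
    · rw [hdn a' b' s' hb' h11, e1, e2]
    · rw [dotProduct_comm, hdn a b s hb h9, e3, e4]
      simp only [PosAdj]
      grind
    · have hne' : P a b ≠ P a' b' := fun e => hne (congrArg some e)
      rw [subdiv_dot_some hyz hyw hk hne', h4 a a' b b' hb hb' hne']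
      simp only [hy a b hb, hz a b hb, hy a' b' hb', hz a' b' hb']
      exact posAdj_subdivide h9 h11
  · rw [hP3 0 0 (Or.inr (Nat.zero_le _)), subdiv_some_self hyz hyw hk, h5, if_neg, add_zero]
    rw [hw 0 0 (Nat.zero_le _)]
    omega
  · intro a s hs
    have key : (L' a)[s]? = some (subdiv c (P i m) (P j (L j).length) k (P' a (s + 1)) ⬝ᵥ
        subdiv c (P i m) (P j (L j).length) k (P' a (s + 1))) := by
      rcases hold a (s + 1) hs with ⟨rfl, h8, h9⟩ | ⟨b, hb, h8, h9⟩
      · obtain rfl : s = m := by omega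
        rw [h9, subdiv_none_self, hL', if_pos rfl]
        by_cases haj : a = j
        · subst haj
          rw [if_pos rfl, getElem?_bump, length_insTwo, if_neg (by omega),
            getElem?_insTwo hm.le, if_neg (lt_irrefl _), if_pos rfl]
        · rw [if_neg haj, id, getElem?_insTwo hm.le, if_neg (lt_irrefl _), if_pos rfl]
      · rw [h8, subdiv_some_self hyz hyw hk, hL']
        simp only [hw a b hb]
        obtain ⟨b, rfl⟩ : ∃ b', b = b' + 1 := ⟨b - 1, by omega⟩
        have h10 := h6 a b hb
        have h11 : (L a)[b]? = some (c (P a (b + 1)) ⬝ᵥ c (P a (b + 1))) := by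
          rw [← h10, List.getElem?_eq_getElem]
        have h12 : ((if a = i then insTwo m else id) (L a))[s]? = (L a)[b]? := by
          rcases h9 with ⟨rfl, h13, h14⟩ | ⟨h13, h14⟩
          · rw [if_pos rfl, getElem?_insTwo hm.le, if_neg (by omega), if_neg (by omega)]
            congr 1
            omega
          · obtain rfl : s = b := by omega
            by_cases ha : a = i
            · subst ha
              have h15 := h13.resolve_left (fun h => h rfl)
              rw [if_pos rfl, getElem?_insTwo hm.le, if_pos (by omega)]
            · rw [if_neg ha, id]
        have h13 : ((if a = i then insTwo m else id) (L a)).length = (L' a).length := by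
          rw [hL']
          by_cases haj : a = j <;> simp [haj, length_bump]
        by_cases haj : a = j
        · rw [if_pos haj, getElem?_bump, h12, h13, h11, hlen]
          have h14 : (L a).length + (if a = i then 1 else 0) - 1 = s ↔ b + 1 = (L a).length := by
            have h15 := hlen a
            rcases h9 with ⟨rfl, h13, h14⟩ | ⟨h13, h14⟩
            · rw [if_pos rfl]
              omega
            · by_cases ha : a = i
              · subst ha
                have h16 := h13.resolve_left (fun h => h rfl)
                rw [if_pos rfl]
                omega
              · rw [if_neg ha]
                omega
          subst haj
          by_cases h15 : b + 1 = (L a).length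
          · rw [if_pos (h14.2 h15), if_pos ⟨h15, rfl⟩, Option.map_some]
          · rw [if_neg (fun h => h15 (h14.1 h)), if_neg (fun h => h15 h.1), add_zero]
        · rw [if_neg haj, id, h12, h11]
          simp [haj]
    rw [List.getElem?_eq_getElem hs] at key
    exact Option.some_injective _ key
  · intro s hs
    rcases List.mem_cons.1 hs with rfl | hs
    · refine ⟨none, ?_⟩
      simp only [hend, hP1, hP3 i m (Or.inr le_rfl)]
      rintro (_ | v)
      · simp [subdiv]
      · simp [subdiv]
    · obtain ⟨k', hk'⟩ := h7 s (List.mem_cons_of_mem _ hs)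
      obtain ⟨h8, h9⟩ := hS s hs
      have hkk : k' ≠ k := by
        rintro rfl
        have h10 := hk (P i (m + 1))
        rw [hk'] at h10
        have h11 : P i (m + 1) ≠ P s.1 (s.2.1 + 1) := by
          rw [Ne, heq i s.1 (m + 1) (s.2.1 + 1) (by omega) (by omega)]
          rintro ⟨h12, h13 | h13⟩
          · rcases h8 with h8 | h8
            · exact h8 h13.symm
            · omega
          · omega
        rw [if_neg h11, if_pos rfl, if_neg hyz.symm, if_neg hzw] at h10
        split_ifs at h10 <;> omega
      refine ⟨some k', ?_⟩
      rw [hend, hP3 s.1 (s.2.1 + 1) (h8.imp id fun h => h), hP3 s.1 s.2.1 (h8.imp id fun h => h.le)]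
      rintro (_ | v)
      · simp [subdiv, hkk]
      · have := hk' v
        by_cases hv : v = P i m <;> simp [subdiv, hv, hkk] at this ⊢ <;> exact this

end PlumbingGraph

/-! ### The six smallest stars -/

namespace PlumbingGraph

open Matrix

/-- The positions on the star with centre `0` whose `i`-th leg consists of the vertices `pos i`. -/
def legPos {n : ℕ} (pos : Fin 3 → List (Fin (n + 1))) (i : Fin 3) (a : ℕ) : Fin (n + 1) :=
  (0 :: pos i).getD a 0

/-- Vertex 0 is the centre. All conditions are finite with bounded quantifiers, so they can be
decided. -/
theorem starReal_of_matrix {n : ℕ} {cc : ℤ} {L : Fin 3 → List ℤ} {S : List (Fin 3 × ℕ × Fin 3)}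
    (c : Matrix (Fin (n + 1)) (Fin (n + 1)) ℤ) (pos : Fin 3 → List (Fin (n + 1)))
    (h1 : ∀ v, ∑ i, c v i * (c v i + 1) = 2)
    (h2 : ∀ i j, ∀ a < (L i).length + 1, ∀ b < (L j).length + 1,
      legPos pos i a = legPos pos j b → a = b ∧ (i = j ∨ a = 0))
    (h3 : ∀ v, ∃ i, ∃ a < (L i).length + 1, legPos pos i a = v)
    (h4 : ∀ i j, ∀ a < (L i).length + 1, ∀ b < (L j).length + 1,
      legPos pos i a ≠ legPos pos j b →
      c (legPos pos i a) ⬝ᵥ c (legPos pos j b) = if PosAdj i j a b then -1 else 0)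
    (h5 : c 0 ⬝ᵥ c 0 = cc)
    (h6 : ∀ i, L i = (pos i).map fun v => c v ⬝ᵥ c v)
    (h7 : ∀ s ∈ S, ∃ k, ∀ v, c v k = (if v = legPos pos s.1 (s.2.1 + 1) then 1 else 0) -
      (if v = legPos pos s.1 s.2.1 then 1 else 0) -
      (if v = legPos pos s.2.2 (L s.2.2).length then 1 else 0)) :
    StarReal cc L S := by
  refine ⟨Fin (n + 1), Fin (n + 1), inferInstance, inferInstance, c, legPos pos, rfl, h1,
    ⟨fun _ _ => rfl, ?_, ?_⟩, ?_, h5, ?_, ?_⟩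
  · intro i j a b ha hb
    exact h2 i j a (Nat.lt_succ_of_le ha) b (Nat.lt_succ_of_le hb)
  · intro v
    obtain ⟨i, a, ha, h⟩ := h3 v
    exact ⟨i, a, Nat.le_of_lt_succ ha, h⟩
  · intro i j a b ha hb
    exact h4 i j a (Nat.lt_succ_of_le ha) b (Nat.lt_succ_of_le hb)
  · intro i a ha
    have hlen : a < (pos i).length := by simpa [h6 i] using ha
    simp [h6 i, legPos, hlen]
  · intro s hs
    obtain ⟨k, hk⟩ := h7 s hs
    refine ⟨k, fun v => ?_⟩
    rw [hk v]
    congr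

/-- Each triple corresponds to one parameter: subdividing that edge increases it by 1. The order is
the one in which they are used, outer edges of a leg before inner ones. -/
theorem starReal_gam : StarReal 4 ![[3], [3], [3]] [(0, 0, 1), (1, 0, 2), (2, 0, 0)] :=
  starReal_of_matrix !![1, -1, -1, -1; -1, 1, 0, -1; -1, -1, 1, 0; -1, 0, -1, 1]
    ![[1], [2], [3]] (by decide) (by decide) (by decide) (by decide) (by decide) (by decide)
    (by decide)

theorem starReal_del_one : StarReal 3 ![[3, 3], [4], [3]] [(0, 1, 2), (0, 0, 1), (1, 0, 0)] :=
  starReal_of_matrix !![1, -1, 0, -1, 0; 0, 1, -1, 0, -1; -1, 0, 1, -1, 0; -1, -1, 0, 1, -1;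
      -1, 0, -1, 0, 1]
    ![[1, 2], [3], [4]] (by decide) (by decide) (by decide) (by decide) (by decide) (by decide)
    (by decide)

theorem starReal_del_zero : StarReal 3 ![[4], [4], [2]] [(0, 0, 1), (1, 0, 0)] :=
  starReal_of_matrix !![1, -1, -1, 0; -1, 1, -1, -1; -1, -1, 1, -1; -1, 0, 0, 1]
    ![[1], [2], [3]] (by decide) (by decide) (by decide) (by decide) (by decide) (by decide)
    (by decide)

theorem starReal_lam_one_one : StarReal 2 ![[3, 3, 4], [3], [4]]
    [(0, 2, 1), (0, 1, 2), (0, 0, 0)] :=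
  starReal_of_matrix !![1, -1, 0, 0, 0, 0; 0, 1, -1, 0, 0, -1; 0, 0, 1, -1, -1, 0;
      -1, -1, 0, 1, 0, -1; -1, 0, 0, -1, 1, 0; -1, 0, -1, 0, -1, 1]
    ![[1, 2, 3], [4], [5]] (by decide) (by decide) (by decide) (by decide) (by decide) (by decide)
    (by decide)

theorem starReal_lam_zero_one : StarReal 2 ![[3, 5], [2], [4]] [(0, 1, 2), (0, 0, 0)] :=
  starReal_of_matrix !![1, -1, 0, 0, 0; 0, 1, -1, 0, -1; -1, -1, 1, -1, -1; -1, 0, 0, 1, 0;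
      -1, 0, -1, -1, 1]
    ![[1, 2], [3], [4]] (by decide) (by decide) (by decide) (by decide) (by decide) (by decide)
    (by decide)

theorem starReal_lam_one_zero : StarReal 2 ![[4, 4], [3], [3]] [(0, 1, 1), (0, 0, 0)] :=
  starReal_of_matrix !![1, -1, 0, 0, 0; 0, 1, -1, -1, -1; -1, -1, 1, 0, -1; -1, 0, -1, 1, 0;
      -1, 0, 0, -1, 1]
    ![[1, 2], [3], [4]] (by decide) (by decide) (by decide) (by decide) (by decide) (by decide)
    (by decide)

end PlumbingGraph

/-! ### Growing the stars by subdivision -/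

namespace PlumbingGraph

open Matrix

theorem insTwo_zero (l : List ℤ) : insTwo 0 l = 2 :: l := rfl

theorem insTwo_one (x : ℤ) (l : List ℤ) : insTwo 1 (x :: l) = x :: 2 :: l := rfl

theorem insTwo_two (x y : ℤ) (l : List ℤ) : insTwo 2 (x :: y :: l) = x :: y :: 2 :: l := rfl

theorem bump_singleton (a : ℤ) : bump [a] = [a + 1] := rfl

theorem bump_cons (b : ℤ) {l : List ℤ} (h : l ≠ []) : bump (b :: l) = b :: bump l := by
  obtain ⟨a, l, rfl⟩ := List.exists_cons_of_ne_nil h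
  simp [bump]

theorem bump_append (l : List ℤ) {l' : List ℤ} (h : l' ≠ []) : bump (l ++ l') = l ++ bump l' := by
  induction l with
  | nil => rfl
  | cons b l ih => rw [List.cons_append, bump_cons b (by simp [h]), ih, List.cons_append]

theorem ne_one_of_mem_twos {k : ℕ} {a : ℤ} (h : a ∈ twos k) : a ≠ 1 := by
  rw [List.eq_of_mem_replicate h]
  decide

/-- The parameters are raised from 0 one after the other, and a triple is dropped once its parameter
has been reached. -/
theorem StarReal.gam (p q r : ℕ) : StarReal 4
    ![twos q ++ [(p : ℤ) + 3], twos r ++ [(q : ℤ) + 3], twos p ++ [(r : ℤ) + 3]] [(2, 0, 0)] := by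
  have hq : StarReal 4 ![twos q ++ [3], [(q : ℤ) + 3], [3]] [(0, 0, 1), (1, 0, 2), (2, 0, 0)] := by
    induction q with
    | zero => exact starReal_gam
    | succ q ih =>
      refine ih.subdivide (by simp) (by simp) (by simp) (by simp) fun a => ?_
      fin_cases a <;> simp [twos, List.replicate_succ, insTwo_zero, bump_singleton]
      ring
  have hr : StarReal 4 ![twos q ++ [3], twos r ++ [(q : ℤ) + 3], [(r : ℤ) + 3]]
      [(1, 0, 2), (2, 0, 0)] := by
    induction r with
    | zero => simpa [twos] using hq.mono (S' := [(1, 0, 2), (2, 0, 0)]) (by simp)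
    | succ r ih =>
      refine ih.subdivide (by simp) (by simp) (by simp) (by simp) fun a => ?_
      fin_cases a <;> simp [twos, List.replicate_succ, insTwo_zero, bump_singleton]
      ring
  induction p with
  | zero => simpa [twos] using hr.mono (S' := [(2, 0, 0)]) (by simp)
  | succ p ih =>
    refine ih.subdivide (by simp) (by simp) (by simp) (by simp) fun a => ?_
    fin_cases a <;> simp [twos, List.replicate_succ, insTwo_zero, bump_append, bump_singleton]
    ring

theorem familyW_subset : familyW.{u} ⊆ familyS := by
  rintro Γ ⟨p, q, r, h⟩
  refine h.mem_familyS ((StarReal.gam p q r).isomorphic (by decide) fun i a ha => ?_)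
  fin_cases i <;> simp at ha <;>
    rcases ha with ha | rfl <;> first | exact ne_one_of_mem_twos ha | omega

theorem StarReal.del_zero (q r : ℕ) : StarReal 3
    ![twos q ++ [(r : ℤ) + 4], twos r ++ [(q : ℤ) + 4], [2]] [(1, 0, 0)] := by
  have hq : StarReal 3 ![twos q ++ [4], [(q : ℤ) + 4], [2]] [(0, 0, 1), (1, 0, 0)] := by
    induction q with
    | zero => exact starReal_del_zero
    | succ q ih =>
      refine ih.subdivide (by simp) (by simp) (by simp) (by simp) fun a => ?_
      fin_cases a <;> simp [twos, List.replicate_succ, insTwo_zero, bump_singleton]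
      ring
  induction r with
  | zero => simpa [twos] using hq.mono (S' := [(1, 0, 0)]) (by simp)
  | succ r ih =>
    refine ih.subdivide (by simp) (by simp) (by simp) (by simp) fun a => ?_
    fin_cases a <;> simp [twos, List.replicate_succ, insTwo_zero, bump_append, bump_singleton]
    ring

theorem StarReal.del_succ (p q r : ℕ) : StarReal 3
    ![twos q ++ [3] ++ twos p ++ [(r : ℤ) + 3], twos r ++ [(q : ℤ) + 4],
      [((p + 1 : ℕ) : ℤ) + 2]] [(1, 0, 0)] := by
  have hp : StarReal 3 ![[3] ++ twos p ++ [3], [4], [((p + 1 : ℕ) : ℤ) + 2]]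
      [(0, 1, 2), (0, 0, 1), (1, 0, 0)] := by
    induction p with
    | zero => exact starReal_del_one
    | succ p ih =>
      refine ih.subdivide (by simp) (by simp) (by simp) (by simp) fun a => ?_
      fin_cases a <;> simp [twos, List.replicate_succ, insTwo_one, bump_singleton]
      ring
  have hq : StarReal 3 ![twos q ++ [3] ++ twos p ++ [3], [(q : ℤ) + 4], [((p + 1 : ℕ) : ℤ) + 2]]
      [(0, 0, 1), (1, 0, 0)] := by
    induction q with
    | zero => simpa [twos] using hp.mono (S' := [(0, 0, 1), (1, 0, 0)]) (by simp)
    | succ q ih =>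
      refine ih.subdivide (by simp) (by simp) (by simp) (by simp) fun a => ?_
      fin_cases a <;> simp [twos, List.replicate_succ, insTwo_zero, bump_singleton]
      ring
  induction r with
  | zero => simpa [twos] using hq.mono (S' := [(1, 0, 0)]) (by simp)
  | succ r ih =>
    refine ih.subdivide (by simp) (by simp) (by simp) (by simp) fun a => ?_
    fin_cases a <;> simp [twos, List.replicate_succ, insTwo_zero, bump_cons, bump_append, bump_singleton]
    ring

theorem familyN_subset : familyN.{u} ⊆ familyS := by
  rintro Γ ⟨p, q, r, h⟩
  refine h.mem_familyS ?_
  rcases p with _ | p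
  · refine (StarReal.del_zero q r).isomorphic (by decide) fun i a ha => ?_
    fin_cases i <;> simp at ha
    · rcases ha with ha | rfl <;> first | exact ne_one_of_mem_twos ha | omega
    · rcases ha with ha | rfl <;> first | exact ne_one_of_mem_twos ha | omega
    · omega
  · refine (StarReal.del_succ p q r).isomorphic (by decide) fun i a ha => ?_
    fin_cases i <;> simp at ha
    · rcases ha with ha | rfl | ha | rfl <;> first | exact ne_one_of_mem_twos ha | omega
    · rcases ha with ha | rfl <;> first | exact ne_one_of_mem_twos ha | omega
    · omega

theorem StarReal.lam_zero (q r : ℕ) : StarReal 2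
    ![twos q ++ [3] ++ twos r ++ [(q : ℤ) + 5], [2], [((r + 1 : ℕ) : ℤ) + 3]] [(0, 0, 0)] := by
  have hr : StarReal 2 ![[3] ++ twos r ++ [5], [2], [((r + 1 : ℕ) : ℤ) + 3]]
      [(0, 1, 2), (0, 0, 0)] := by
    induction r with
    | zero => exact starReal_lam_zero_one
    | succ r ih =>
      refine ih.subdivide (by simp) (by simp) (by simp) (by simp) fun a => ?_
      fin_cases a <;> simp [twos, List.replicate_succ, insTwo_one, bump_singleton]
      ring
  induction q with
  | zero => simpa [twos] using hr.mono (S' := [(0, 0, 0)]) (by simp)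
  | succ q ih =>
    -- The raised end is on the subdivided leg itself, so the edge must not be the last one of that
    -- leg.
    refine ih.subdivide (by simp) (by simp; omega) (by simp) (by simp) fun a => ?_
    fin_cases a <;> simp [twos, List.replicate_succ, insTwo_zero, bump_cons, bump_append, bump_singleton]
    ring

theorem StarReal.lam_succ_zero (p q : ℕ) : StarReal 2
    ![twos q ++ [4] ++ twos p ++ [(q : ℤ) + 4], [((p + 1 : ℕ) : ℤ) + 2], [3]] [(0, 0, 0)] := by
  have hp : StarReal 2 ![[4] ++ twos p ++ [4], [((p + 1 : ℕ) : ℤ) + 2], [3]]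
      [(0, 1, 1), (0, 0, 0)] := by
    induction p with
    | zero => exact starReal_lam_one_zero
    | succ p ih =>
      refine ih.subdivide (by simp) (by simp) (by simp) (by simp) fun a => ?_
      fin_cases a <;> simp [twos, List.replicate_succ, insTwo_one, bump_singleton]
      ring
  induction q with
  | zero => simpa [twos] using hp.mono (S' := [(0, 0, 0)]) (by simp)
  | succ q ih =>
    refine ih.subdivide (by simp) (by simp; omega) (by simp) (by simp) fun a => ?_
    fin_cases a <;> simp [twos, List.replicate_succ, insTwo_zero, bump_cons, bump_append, bump_singleton]
    ring

theorem StarReal.lam_succ_succ (p q r : ℕ) : StarReal 2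
    ![twos q ++ [3] ++ twos r ++ [3] ++ twos p ++ [(q : ℤ) + 4],
      [((p + 1 : ℕ) : ℤ) + 2], [((r + 1 : ℕ) : ℤ) + 3]] [(0, 0, 0)] := by
  have hp : StarReal 2 ![[3, 3] ++ twos p ++ [4], [((p + 1 : ℕ) : ℤ) + 2], [4]]
      [(0, 2, 1), (0, 1, 2), (0, 0, 0)] := by
    induction p with
    | zero => exact starReal_lam_one_one
    | succ p ih =>
      refine ih.subdivide (by simp) (by simp) (by simp) (by simp) fun a => ?_
      fin_cases a <;> simp [twos, List.replicate_succ, insTwo_two, bump_singleton]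
      ring
  have hr : StarReal 2 ![[3] ++ twos r ++ [3] ++ twos p ++ [4], [((p + 1 : ℕ) : ℤ) + 2],
      [((r + 1 : ℕ) : ℤ) + 3]] [(0, 1, 2), (0, 0, 0)] := by
    induction r with
    | zero => simpa [twos] using hp.mono (S' := [(0, 1, 2), (0, 0, 0)]) (by simp)
    | succ r ih =>
      refine ih.subdivide (by simp) (by simp) (by simp) (by simp) fun a => ?_
      fin_cases a <;> simp [twos, List.replicate_succ, insTwo_one, bump_singleton]
      ring
  induction q with
  | zero => simpa [twos] using hr.mono (S' := [(0, 0, 0)]) (by simp)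
  | succ q ih =>
    refine ih.subdivide (by simp) (by simp; omega) (by simp) (by simp) fun a => ?_
    fin_cases a <;> simp [twos, List.replicate_succ, insTwo_zero, bump_cons, bump_append, bump_singleton]
    ring

theorem familyM_subset : familyM.{u} ⊆ familyS := by
  rintro Γ ⟨p, q, r, hpr, h⟩
  refine h.mem_familyS ?_
  rcases p with _ | p <;> rcases r with _ | r
  · exact absurd rfl hpr
  · refine (StarReal.lam_zero q r).isomorphic (by decide) fun i a ha => ?_
    fin_cases i <;> simp at ha
    · rcases ha with ha | rfl | ha | rfl <;> first | exact ne_one_of_mem_twos ha | omega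
    · omega
    · omega
  · refine (StarReal.lam_succ_zero p q).isomorphic (by decide) fun i a ha => ?_
    fin_cases i <;> simp at ha
    · rcases ha with ha | rfl | ha | rfl <;> first | exact ne_one_of_mem_twos ha | omega
    · omega
    · omega
  · refine (StarReal.lam_succ_succ p q r).isomorphic (by decide) fun i a ha => ?_
    fin_cases i <;> simp at ha
    · rcases ha with ha | rfl | ha | rfl | ha | rfl <;>
        first | exact ne_one_of_mem_twos ha | omega
    · omega
    · omega

end PlumbingGraph

/-! ### The classification -/

theorem theorem1p5 :
    PlumbingGraph.familyS.{u} =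
      PlumbingGraph.familyG ∪ PlumbingGraph.familyW ∪ PlumbingGraph.familyN ∪
        PlumbingGraph.familyM ∪ PlumbingGraph.familyA ∪ PlumbingGraph.familyB ∪
        PlumbingGraph.familyC := by
  open PlumbingGraph in
  refine Set.Subset.antisymm ?_ ?_
  · rintro Γ ⟨hG, hS, hM⟩
    obtain ⟨c, hC, hd⟩ := hS.exists_isConf
    have h2 : ∀ v, 2 ≤ dotProduct (c v) (c v) := fun v => by
      have h1 := hC.dot_self_pos v
      have h2 := hM v
      rw [hd v] at h2
      omega
    rcases hC.families hG h2 (Fintype.card_fin _) hd with h | h | h | h | h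
    · exact .inl (.inl (.inl (.inl (.inl (.inl (mem_familyG_iff.2 h))))))
    · exact .inl (.inl (.inl (.inl (.inl (.inr h)))))
    · exact .inl (.inl (.inl (.inl (.inr h))))
    · exact .inl (.inl (.inl (.inr h)))
    · rcases h.families hC hG h2 (Fintype.card_fin _) hd with h | h | h
      · exact .inl (.inl (.inr h))
      · exact .inl (.inr h)
      · exact .inr h
  · exact Set.union_subset (Set.union_subset (Set.union_subset (Set.union_subset (Set.union_subset
      (Set.union_subset familyG_subset familyW_subset) familyN_subset) familyM_subset)
      familyA_subset) familyB_subset) familyC_subset
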